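/- Let $k>0$, $\xi\in(1/2,1/\sqrt2)$, and let $a_4>0$, $x_2<0$ be auxiliary constants (their choice does not affect the isometry class). Put $\nu=-2\xi^2$, $$x_1=-\frac{\xi(1-2\xi+2\xi^2)x_2}{1-2\xi},\qquad x_3=\frac{(1-2\xi+2\xi^2)x_2}{4\xi^2(1-\xi)},\qquad x_4=0,$$ so that $x_1<x_2<x_3<x_4$, and define $a_0,\dots,a_3$ by $\sum_{i=0}^4a_it^i=a_4\prod_{i=1}^4(t-x_i)$. Let $X=\sum_i a_ix^i$, $Y=\sum_i a_iy^i$, $F=Xy^2-x^2Y$, $$H=(\nu x+y)\bigl((\nu x-y)(a_1-a_3xy)-2(1-\nu)(a_0-a_4x^2y^2)\bigr),$$ $$G=X(a_0\nu^2+2a_3\nu y^3-a_4y^4+2a_4\nu y^4)+(a_0-2a_0\nu-2a_1\nu x-a_4\nu^2x^4)Y,$$ and consider, for $(x,y)\in\Omega=(x_2,x_3)\times(x_1,x_2)$, the Chen–Teo line element $$ds^2=\frac{kH}{(x-y)^3}\Bigl(\frac{dx^2}{X}-\frac{dy^2}{Y}-\frac{XY}{kF}\,d\phi^2\Bigr)+\frac{(F\,d\tau+G\,d\phi)^2}{FH(x-y)}.$$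 With $x_{ij}=x_i-x_j$, let $\ell_0,\ell_1$ be the vectors with $(\tau,\phi)$-components $$\ell_0=\Bigl(\tfrac{2\sqrt k\,(x_1x_3x_4-\nu^2x_2^3+2\nu x_2(x_3x_4+x_1x_3+x_1x_4))}{x_{12}x_{23}x_{24}},\ \tfrac{2\sqrt k\,x_2}{a_4x_{12}x_{23}x_{24}}\Bigr),$$ $$\ell_1=\Bigl(\tfrac{2\sqrt k\,(x_1^3-\nu^2x_2x_3x_4+2\nu x_1^2(x_2+x_3+x_4))}{x_{12}x_{13}x_{14}},\ \tfrac{2\sqrt k\,x_1}{a_4x_{12}x_{13}x_{14}}\Bigr).$$ Identify $(\tau,\phi)\sim(\tau,\phi)+2\pi\ell_0\sim(\tau,\phi)+2\pi\ell_1$, and let $M$ be the smooth four-manifold obtained from $(\overline\Omega\setminus\{(x_2,x_2)\})\times T^2$ by collapsing the orbits of $\ell_0$ over the sides $x=x_2$ and $y=x_2$, of $\ell_1$ over $y=x_1$, and of $\ell_0-\ell_1$ over $x=x_3$. Its smooth structure is given by three charts with values in $\mathbb C^2$, one around each of the corners $(x_2,x_1)$, $(x_3,x_1)$, $(x_3,x_2)$,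 in which the two complex coordinates are, up to order and conjugation, the square roots of the distances of $x$ and $y$ from the two sides that meet at the corner, times unit complex numbers formed from the two angles. Orient $M$ by $dx\wedge dy\wedge d\tau\wedge d\phi$. Then the line element extends in exactly one way to a smooth Riemannian metric $g$ on $M$ (the Chen–Teo instanton), and $g$ is Ricci flat. Its Weyl tensor is of type $D^+I^-$ in the following sense. At every point of $M$ the self-dual Weyl tensor $W^+$, as an endomorphism of the three-dimensional space of self-dual 2-forms, has exactly two distinct eigenvalues, that is, it is nonzero and has a repeated eigenvalue. At every point of a dense open subset of $M$ the anti-self-dual Weyl tensor $W^-$ is algebraically general, that is, it has three distinct eigenvalues. Moreover, $(M,g)$ is Hermitian and non-Kähler: $M$ carries a smooth integrable complex structure $J$ for which $g$ is $J$-invariant, but none for which in addition the fundamental form $g(J\cdot,\cdot)$ is closed. -/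

import Mathlib

open Set Filter Topology Manifold Bundle
open scoped ContDiff

noncomputable section

namespace ChenTeo

/-- The model space of the four-manifolds considered here. -/
abbrev E4 : Type := EuclideanSpace ℝ (Fin 4)

/-! ## Riemannian geometry of an oriented four-manifold in charts

`M` is a smooth four-manifold. The charts in `atlas E4 M` are taken to be positively oriented,
that is, the orientation of `M` is the one in which the coordinate frame
`∂₀, ∂₁, ∂₂, ∂₃` of each of these charts is positive. -/

section Local

/-- The partial derivative `∂ᵢ f` of a function of four variables. -/
def pd (i : Fin 4) (f : E4 → ℝ) (u : E4) : ℝ :=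
  fderiv ℝ f u (EuclideanSpace.single i 1)

/-- The Christoffel symbols `Γᵐᵢⱼ = ½ gᵐˡ (∂ᵢ gⱼₗ + ∂ⱼ gᵢₗ - ∂ₗ gᵢⱼ)` of the metric with
component matrix `h`. -/
def christoffel (h : E4 → Matrix (Fin 4) (Fin 4) ℝ) (m i j : Fin 4) (u : E4) : ℝ :=
  (1 / 2) * ∑ l, (h u)⁻¹ m l *
    (pd i (fun v => h v j l) u + pd j (fun v => h v i l) u - pd l (fun v => h v i j) u)

/-- The curvature components `Rˡₖᵢⱼ`, where `R(∂ᵢ, ∂ⱼ) ∂ₖ = Rˡₖᵢⱼ ∂ₗ` and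
`R(X, Y) = [∇_X, ∇_Y] - ∇_[X, Y]`. -/
def riemann (h : E4 → Matrix (Fin 4) (Fin 4) ℝ) (u : E4) (l k i j : Fin 4) : ℝ :=
  pd i (christoffel h l j k) u - pd j (christoffel h l i k) u
    + ∑ m, (christoffel h l i m u * christoffel h m j k u
      - christoffel h l j m u * christoffel h m i k u)

/-- The Ricci tensor `Rₖⱼ = Rˡₖₗⱼ`. -/
def ricci (h : E4 → Matrix (Fin 4) (Fin 4) ℝ) (u : E4) (k j : Fin 4) : ℝ :=
  ∑ l, riemann h u l k l j

/-- The scalar curvature. -/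
def scal (h : E4 → Matrix (Fin 4) (Fin 4) ℝ) (u : E4) : ℝ :=
  ∑ k, ∑ j, (h u)⁻¹ k j * ricci h u k j

/-- The Weyl tensor `Wₗₖᵢⱼ` of a metric in dimension four. -/
def weyl (h : E4 → Matrix (Fin 4) (Fin 4) ℝ) (u : E4) (l k i j : Fin 4) : ℝ :=
  (∑ m, h u l m * riemann h u m k i j)
    - (1 / 2) * (h u l i * ricci h u k j - h u l j * ricci h u k i
        - h u k i * ricci h u l j + h u k j * ricci h u l i)
    + (scal h u / 6) * (h u l i * h u k j - h u l j * h u k i)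

/-- The Levi-Civita symbol, with `leviCivita 0 1 2 3 = 1`. -/
def leviCivita (i j k l : Fin 4) : ℝ :=
  ((1 : Matrix (Fin 4) (Fin 4) ℝ).submatrix ![i, j, k, l] id).det

/-- Raising both indices of a 2-form. -/
def raise (h : E4 → Matrix (Fin 4) (Fin 4) ℝ) (u : E4) (η : Matrix (Fin 4) (Fin 4) ℝ) :
    Matrix (Fin 4) (Fin 4) ℝ :=
  (h u)⁻¹ * η * ((h u)⁻¹).transpose

/-- The Hodge star on 2-forms, `(⋆η)ᵢⱼ = ½ √(det g) εᵢⱼₖₗ ηᵏˡ`. -/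
def hodgeStar (h : E4 → Matrix (Fin 4) (Fin 4) ℝ) (u : E4) (η : Matrix (Fin 4) (Fin 4) ℝ) :
    Matrix (Fin 4) (Fin 4) ℝ :=
  fun i j => (1 / 2) * √(h u).det * ∑ k, ∑ l, leviCivita i j k l * raise h u η k l

/-- The action of the Weyl tensor on 2-forms, `(W η)ᵢⱼ = ½ Wᵢⱼₖₗ ηᵏˡ`. -/
def weylOp (h : E4 → Matrix (Fin 4) (Fin 4) ℝ) (u : E4) (η : Matrix (Fin 4) (Fin 4) ℝ) :
    Matrix (Fin 4) (Fin 4) ℝ :=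
  fun i j => (1 / 2) * ∑ k, ∑ l, weyl h u i j k l * raise h u η k l

/-- The eigenvalues of the endomorphism that the Weyl tensor induces on the three-dimensional
space of 2-forms `η` with `⋆η = σ η`: those of `W⁺` for `σ = 1`, those of `W⁻` for `σ = -1`. -/
def weylEigenvalues (h : E4 → Matrix (Fin 4) (Fin 4) ℝ) (u : E4) (σ : ℝ) : Set ℝ :=
  {c | ∃ η : Matrix (Fin 4) (Fin 4) ℝ, η ≠ 0 ∧ η.transpose = -η ∧
    hodgeStar h u η = σ • η ∧ weylOp h u η = c • η}

end Local

section Global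

variable (M : Type) [TopologicalSpace M] [ChartedSpace E4 M] [IsManifold (𝓡 4) ∞ M]

/-- Smooth Riemannian metrics on the four-manifold `M`. -/
abbrev Metric : Type :=
  ContMDiffRiemannianMetric (𝓡 4) ∞ E4 (fun p : M => TangentSpace (𝓡 4) p)

variable {M}

/-- The coordinate vector field `∂ᵢ` of the chart `e`, at the point with coordinates `u`. -/
def coordVec (e : OpenPartialHomeomorph M E4) (u : E4) (i : Fin 4) :
    TangentSpace (𝓡 4) (e.symm u) :=
  mfderiv (𝓡 4) (𝓡 4) e.symm u (EuclideanSpace.single i (1 : ℝ) : E4)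

/-- The components `gᵢⱼ` of the metric in the chart `e`, as functions of the coordinates. -/
def gram (g : Metric M) (e : OpenPartialHomeomorph M E4) (u : E4) : Matrix (Fin 4) (Fin 4) ℝ :=
  fun i j => g.inner (e.symm u) (coordVec e u i) (coordVec e u j)

/-- The Ricci tensor vanishes. -/
def IsRicciFlat (g : Metric M) : Prop :=
  ∀ e ∈ atlas E4 M, ∀ p ∈ e.source, ∀ i j, ricci (gram g e) (e p) i j = 0

/-- `W⁺` (for `σ = 1`) or `W⁻` (for `σ = -1`) is of type `D` at `p`: it has exactly two distinct
eigenvalues. Since it is trace-free and self-adjoint on a three-dimensional space, this says that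
it is nonzero and has a repeated eigenvalue. -/
def IsTypeD (g : Metric M) (σ : ℝ) (p : M) : Prop :=
  ∀ e ∈ atlas E4 M, p ∈ e.source → (weylEigenvalues (gram g e) (e p) σ).ncard = 2

/-- `W⁺` (for `σ = 1`) or `W⁻` (for `σ = -1`) is of type `I` (algebraically general) at `p`:
it has three distinct eigenvalues. -/
def IsTypeI (g : Metric M) (σ : ℝ) (p : M) : Prop :=
  ∀ e ∈ atlas E4 M, p ∈ e.source → (weylEigenvalues (gram g e) (e p) σ).ncard = 3

variable (M) in
/-- Fields of endomorphisms of the tangent spaces of `M`. -/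
abbrev EndField : Type :=
  ∀ p : M, TangentSpace (𝓡 4) p →L[ℝ] TangentSpace (𝓡 4) p

/-- The components `Jⁱⱼ` in the chart `e`, where `J ∂ⱼ = Jⁱⱼ ∂ᵢ`. -/
def endMatrix (J : EndField M) (e : OpenPartialHomeomorph M E4) (u : E4) :
    Matrix (Fin 4) (Fin 4) ℝ :=
  fun i j => (show E4 from
    mfderiv (𝓡 4) (𝓡 4) e (e.symm u) (J (e.symm u) (coordVec e u j))) i

/-- A smooth field of endomorphisms: a smooth section of the bundle `End(TM)`. -/
def IsSmoothEnd (J : EndField M) : Prop :=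
  ContMDiff (𝓡 4) ((𝓡 4).prod 𝓘(ℝ, E4 →L[ℝ] E4)) ∞
    (fun p => TotalSpace.mk' (E4 →L[ℝ] E4)
      (E := fun p : M => TangentSpace (𝓡 4) p →L[ℝ] TangentSpace (𝓡 4) p) p (J p))

/-- The Nijenhuis tensor vanishes:
`Jˡᵢ ∂ₗ Jᵏⱼ - Jˡⱼ ∂ₗ Jᵏᵢ - Jᵏₗ (∂ᵢ Jˡⱼ - ∂ⱼ Jˡᵢ) = 0` in every chart. -/
def IsIntegrable (J : EndField M) : Prop :=
  ∀ e ∈ atlas E4 M, ∀ p ∈ e.source, ∀ i j k,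
    ∑ l, (endMatrix J e (e p) l i * pd l (fun v => endMatrix J e v k j) (e p)
      - endMatrix J e (e p) l j * pd l (fun v => endMatrix J e v k i) (e p)
      - endMatrix J e (e p) k l *
        (pd i (fun v => endMatrix J e v l j) (e p) - pd j (fun v => endMatrix J e v l i) (e p))) = 0

/-- `(M, g, J)` is Hermitian: `J` is a smooth integrable almost complex structure and `g` is
`J`-invariant. -/
structure IsHermitian (g : Metric M) (J : EndField M) : Prop where
  smooth : IsSmoothEnd J
  sq : ∀ p (v : TangentSpace (𝓡 4) p), J p (J p v) = -v
  orthogonal : ∀ p (v w : TangentSpace (𝓡 4) p), g.inner p (J p v) (J p w) = g.inner p v w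
  integrable : IsIntegrable J

/-- The components `ηᵢⱼ = g(J ∂ᵢ, ∂ⱼ)` of the fundamental form in the chart `e`. -/
def fundForm (g : Metric M) (J : EndField M) (e : OpenPartialHomeomorph M E4) (u : E4)
    (i j : Fin 4) : ℝ :=
  g.inner (e.symm u) (J (e.symm u) (coordVec e u i)) (coordVec e u j)

/-- `(M, g, J)` is Kähler: it is Hermitian and its fundamental form is closed. -/
structure IsKahler (g : Metric M) (J : EndField M) : Prop extends IsHermitian g J where
  closed : ∀ e ∈ atlas E4 M, ∀ p ∈ e.source, ∀ i j k,
    pd i (fun v => fundForm g J e v j k) (e p) + pd j (fun v => fundForm g J e v k i) (e p)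
      + pd k (fun v => fundForm g J e v i j) (e p) = 0

end Global

/-! ## The Chen–Teo metric -/

/-- The parameters of the Chen–Teo instanton. The metric depends, up to isometry, on `k` and `ξ`
only; `a₄` and `x₂` are auxiliary. -/
structure Params where
  k : ℝ
  ξ : ℝ
  a₄ : ℝ
  x₂ : ℝ
  k_pos : 0 < k
  lt_ξ : 1 / 2 < ξ
  ξ_lt : ξ < 1 / √2
  a₄_pos : 0 < a₄
  x₂_neg : x₂ < 0

namespace Params

variable (P : Params)

def ν : ℝ := -2 * P.ξ ^ 2
def x₁ : ℝ := -(P.ξ * (1 - 2 * P.ξ + 2 * P.ξ ^ 2) * P.x₂) / (1 - 2 * P.ξ)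
def x₃ : ℝ := (1 - 2 * P.ξ + 2 * P.ξ ^ 2) * P.x₂ / (4 * P.ξ ^ 2 * (1 - P.ξ))
def x₄ (_ : Params) : ℝ := 0

def a₀ : ℝ := P.a₄ * (P.x₁ * P.x₂ * P.x₃ * P.x₄)
def a₁ : ℝ := -P.a₄ *
  (P.x₁ * P.x₂ * P.x₃ + P.x₁ * P.x₂ * P.x₄ + P.x₁ * P.x₃ * P.x₄ + P.x₂ * P.x₃ * P.x₄)
def a₂ : ℝ := P.a₄ * (P.x₁ * P.x₂ + P.x₁ * P.x₃ + P.x₂ * P.x₃ + P.x₁ * P.x₄ + P.x₂ * P.x₄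
  + P.x₃ * P.x₄)
def a₃ : ℝ := -P.a₄ * (P.x₁ + P.x₂ + P.x₃ + P.x₄)

/-- The quartic with roots `x₁, x₂, x₃, x₄`; `X = quartic x` and `Y = quartic y`. -/
def quartic (t : ℝ) : ℝ := P.a₀ + P.a₁ * t + P.a₂ * t ^ 2 + P.a₃ * t ^ 3 + P.a₄ * t ^ 4

def H (x y : ℝ) : ℝ :=
  (P.ν * x + y) * ((P.ν * x - y) * (P.a₁ - P.a₃ * x * y)
    - 2 * (1 - P.ν) * (P.a₀ - P.a₄ * x ^ 2 * y ^ 2))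

def F (x y : ℝ) : ℝ := P.quartic x * y ^ 2 - x ^ 2 * P.quartic y

def G (x y : ℝ) : ℝ :=
  P.quartic x * (P.a₀ * P.ν ^ 2 + 2 * P.a₃ * P.ν * y ^ 3 - P.a₄ * y ^ 4 + 2 * P.a₄ * P.ν * y ^ 4)
    + (P.a₀ - 2 * P.a₀ * P.ν - 2 * P.a₁ * P.ν * x - P.a₄ * P.ν ^ 2 * x ^ 4) * P.quartic y

/-- The Chen–Teo metric
`kH/(x-y)³ (dx²/X - dy²/Y - XY/(kF) dφ²) + (F dτ + G dφ)²/(FH(x-y))` at `(x, y)`, as a bilinear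
form evaluated on two vectors with components `(dx, dy, dτ, dφ)` equal to `v` and `w`. -/
def lineElement (x y : ℝ) (v w : Fin 4 → ℝ) : ℝ :=
  P.k * P.H x y / (x - y) ^ 3 *
      (v 0 * w 0 / P.quartic x - v 1 * w 1 / P.quartic y
        - P.quartic x * P.quartic y / (P.k * P.F x y) * (v 3 * w 3))
    + (P.F x y * v 2 + P.G x y * v 3) * (P.F x y * w 2 + P.G x y * w 3)
      / (P.F x y * P.H x y * (x - y))

/-- The `τ`-component of the normalized rod vector `ℓ₀`. -/
def ℓ₀τ : ℝ := 2 * √P.k * (P.x₁ * P.x₃ * P.x₄ - P.ν ^ 2 * P.x₂ ^ 3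
    + 2 * P.ν * P.x₂ * (P.x₃ * P.x₄ + P.x₁ * P.x₃ + P.x₁ * P.x₄))
  / ((P.x₁ - P.x₂) * (P.x₂ - P.x₃) * (P.x₂ - P.x₄))

/-- The `φ`-component of the normalized rod vector `ℓ₀`. -/
def ℓ₀φ : ℝ := 2 * √P.k * P.x₂ / (P.a₄ * (P.x₁ - P.x₂) * (P.x₂ - P.x₃) * (P.x₂ - P.x₄))

/-- The `τ`-component of the normalized rod vector `ℓ₁`. -/
def ℓ₁τ : ℝ := 2 * √P.k * (P.x₁ ^ 3 - P.ν ^ 2 * P.x₂ * P.x₃ * P.x₄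
    + 2 * P.ν * P.x₁ ^ 2 * (P.x₂ + P.x₃ + P.x₄))
  / ((P.x₁ - P.x₂) * (P.x₁ - P.x₃) * (P.x₁ - P.x₄))

/-- The `φ`-component of the normalized rod vector `ℓ₁`. -/
def ℓ₁φ : ℝ := 2 * √P.k * P.x₁ / (P.a₄ * (P.x₁ - P.x₂) * (P.x₁ - P.x₃) * (P.x₁ - P.x₄))

lemma one_sub_two_ξ_neg : 1 - 2 * P.ξ < 0 := by linarith [P.lt_ξ]

lemma two_ξ_sq_lt : 2 * P.ξ ^ 2 < 1 := by
  have h := P.ξ_lt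
  have h2 : (0 : ℝ) < √2 := by positivity
  rw [lt_div_iff₀ h2] at h
  have h3 : √2 ^ 2 = (2 : ℝ) := Real.sq_sqrt (by norm_num)
  have h4 : 0 < P.ξ := by linarith [P.lt_ξ]
  have h5 : 0 < P.ξ * √2 := by positivity
  nlinarith

lemma x₁_lt_x₂ : P.x₁ < P.x₂ := by
  have h := P.one_sub_two_ξ_neg
  have h1 := P.two_ξ_sq_lt
  have h2 := P.lt_ξ
  unfold x₁
  rw [div_lt_iff_of_neg h]
  have h3 : 0 < (1 - P.ξ) * (1 - 2 * P.ξ ^ 2) := by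
    apply mul_pos <;> nlinarith
  nlinarith [mul_pos_of_neg_of_neg P.x₂_neg (neg_neg_of_pos h3)]

lemma x₂_lt_x₃ : P.x₂ < P.x₃ := by
  have h1 := P.two_ξ_sq_lt
  have h2 := P.lt_ξ
  have h4 : 0 < 1 - P.ξ := by nlinarith
  have h5 : 0 < P.ξ := by linarith
  unfold x₃
  rw [lt_div_iff₀ (by positivity)]
  have h3 : 0 < (2 * P.ξ - 1) * (1 - 2 * P.ξ ^ 2) := by
    apply mul_pos <;> linarith
  nlinarith [mul_pos_of_neg_of_neg P.x₂_neg (neg_neg_of_pos h3)]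

/-! ## The manifold

The coordinates `(x, y)` range over the closed rectangle `[x₂, x₃] × [x₁, x₂]` without its corner
`(x₂, x₂)`. The Killing coordinates are written `(τ, φ) = α ℓ₁ + β ℓ₀`, so that the
identifications `(τ, φ) ∼ (τ, φ) + 2π ℓ₀ ∼ (τ, φ) + 2π ℓ₁` say that `α` and `β` are angles,
and `∂_α = ℓ₁`, `∂_β = ℓ₀`. The vector that is collapsed is `ℓ₀ = ∂_β` on the sides `x = x₂` and
`y = x₂`, `ℓ₁ = ∂_α` on `y = x₁`, and `ℓ₂ = ℓ₀ - ℓ₁ = ∂_β - ∂_α` on `x = x₃`: the rod structure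
`(0,1), (1,0), (-1,1), (0,1)`.

The quotient is realized as a subset of `ℝ² × ℂ³` by means of `x`, `y` and
* `A = √((y - x₁) (x₃ - x)) e^{iα}`,
* `B = √((x - x₂) (x₂ - y) (x₃ - x)) e^{iβ}`,
* `C = √((x - x₂) (x₂ - y) (y - x₁)) e^{i(α + β)}`,

which are well defined on it and separate its points. With
`|Z₀|² = (x - x₂) (x₂ - y)`, `|Z₁|² = y - x₁`, `|Z₂|² = x₃ - x`, `A = Z₁ Z̄₂`, `B = Z₂ Z̄₀`,
`C = Z₁ Z̄₀`, the equations below say that `A, B, C` are the off-diagonal entries of a Hermitian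
matrix `Z Z*` of rank one. Sending it to the line `[Z₀ : Z₁ : Z₂]` identifies the manifold with
the complement in the complex projective plane of the circle
`Z₀ = 0`, `(x₃ - x₂) |Z₁|² = (x₂ - x₁) |Z₂|²`. -/

/-- The ambient space, with coordinates `(x, y, A, B, C)`. -/
abbrev Ambient : Type := ℝ × ℝ × ℂ × ℂ × ℂ

/-- The subset of `ℝ² × ℂ³` that realizes the Chen–Teo manifold. -/
def carrier : Set Ambient :=
  {q | let x := q.1; let y := q.2.1; let A := q.2.2.1; let B := q.2.2.2.1; let C := q.2.2.2.2
    P.x₂ ≤ x ∧ x ≤ P.x₃ ∧ P.x₁ ≤ y ∧ y ≤ P.x₂ ∧ ¬(x = P.x₂ ∧ y = P.x₂) ∧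
    Complex.normSq A = (y - P.x₁) * (P.x₃ - x) ∧
    Complex.normSq B = (x - P.x₂) * (P.x₂ - y) * (P.x₃ - x) ∧
    Complex.normSq C = (x - P.x₂) * (P.x₂ - y) * (y - P.x₁) ∧
    A * B = ((P.x₃ - x : ℝ) : ℂ) * C ∧
    (starRingEnd ℂ) A * C = ((y - P.x₁ : ℝ) : ℂ) * B ∧
    C * (starRingEnd ℂ) B = (((x - P.x₂) * (P.x₂ - y) : ℝ) : ℂ) * A}

/-- The Chen–Teo manifold, with the topology induced from `ℝ² × ℂ³`. -/
abbrev Space : Type := P.carrier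

/-- The first complex coordinate of a point of `ℝ⁴ = ℂ²`. -/
def cz (u : E4) : ℂ := ⟨u 0, u 1⟩

/-- The second complex coordinate of a point of `ℝ⁴ = ℂ²`. -/
def cw (u : E4) : ℂ := ⟨u 2, u 3⟩

/-- The point of `ℝ⁴ = ℂ²` with complex coordinates `z, w`. -/
def mk4 (z w : ℂ) : E4 := !₂[z.re, z.im, w.re, w.im]

@[simp] lemma cz_mk4 (z w : ℂ) : cz (mk4 z w) = z := by simp [cz, mk4]

@[simp] lemma cw_mk4 (z w : ℂ) : cw (mk4 z w) = w := by simp [cw, mk4]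

@[simp] lemma mk4_cz_cw (u : E4) : mk4 (cz u) (cw u) = u := by
  ext i; fin_cases i <;> simp [cz, cw, mk4]

/-- The chart around the corner `(x₂, x₁)`:
`z = √(x - x₂) e^{iβ}`, `w = √(y - x₁) e^{iα}`. -/
def fwd₁ (q : Ambient) : E4 :=
  mk4 (q.2.2.2.1 / ((√(P.x₂ - q.2.1) * √(P.x₃ - q.1) : ℝ) : ℂ))
    (q.2.2.1 / ((√(P.x₃ - q.1) : ℝ) : ℂ))

def bwd₁ (u : E4) : Ambient :=
  let x := P.x₂ + Complex.normSq (cz u)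
  let y := P.x₁ + Complex.normSq (cw u)
  (x, y, cw u * ((√(P.x₃ - x) : ℝ) : ℂ), cz u * ((√(P.x₂ - y) * √(P.x₃ - x) : ℝ) : ℂ),
    cz u * cw u * ((√(P.x₂ - y) : ℝ) : ℂ))

/-- The chart around the corner `(x₃, x₁)`:
`z = √(y - x₁) e^{i(α + β)}`, `w = √(x₃ - x) e^{-iβ}`. -/
def fwd₂ (q : Ambient) : E4 :=
  mk4 (q.2.2.2.2 / ((√(q.1 - P.x₂) * √(P.x₂ - q.2.1) : ℝ) : ℂ))
    ((starRingEnd ℂ) q.2.2.2.1 / ((√(q.1 - P.x₂) * √(P.x₂ - q.2.1) : ℝ) : ℂ))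

def bwd₂ (u : E4) : Ambient :=
  let x := P.x₃ - Complex.normSq (cw u)
  let y := P.x₁ + Complex.normSq (cz u)
  (x, y, cz u * cw u, (starRingEnd ℂ) (cw u) * ((√(x - P.x₂) * √(P.x₂ - y) : ℝ) : ℂ),
    cz u * ((√(x - P.x₂) * √(P.x₂ - y) : ℝ) : ℂ))

/-- The chart around the corner `(x₃, x₂)`:
`z = √(x₃ - x) e^{-iα}`, `w = √(x₂ - y) e^{i(α + β)}`. -/
def fwd₃ (q : Ambient) : E4 :=
  mk4 ((starRingEnd ℂ) q.2.2.1 / ((√(q.2.1 - P.x₁) : ℝ) : ℂ))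
    (q.2.2.2.2 / ((√(q.1 - P.x₂) * √(q.2.1 - P.x₁) : ℝ) : ℂ))

def bwd₃ (u : E4) : Ambient :=
  let x := P.x₃ - Complex.normSq (cz u)
  let y := P.x₂ - Complex.normSq (cw u)
  (x, y, (starRingEnd ℂ) (cz u) * ((√(y - P.x₁) : ℝ) : ℂ),
    cz u * cw u * ((√(x - P.x₂) : ℝ) : ℂ),
    cw u * ((√(x - P.x₂) * √(y - P.x₁) : ℝ) : ℂ))

def dom₁ : Set Ambient := {q | q.1 < P.x₃ ∧ q.2.1 < P.x₂}
def dom₂ : Set Ambient := {q | P.x₂ < q.1 ∧ q.2.1 < P.x₂}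
def dom₃ : Set Ambient := {q | P.x₂ < q.1 ∧ P.x₁ < q.2.1}

def tgt₁ : Set E4 :=
  {u | Complex.normSq (cz u) < P.x₃ - P.x₂ ∧ Complex.normSq (cw u) < P.x₂ - P.x₁}
def tgt₂ : Set E4 :=
  {u | Complex.normSq (cz u) < P.x₂ - P.x₁ ∧ Complex.normSq (cw u) < P.x₃ - P.x₂}

lemma normSq_mul_re (z : ℂ) : Complex.normSq z = z.re * z.re + z.im * z.im := rfl

lemma contDiff_cz : ContDiff ℝ ∞ cz := by
  have : cz = fun u : E4 => ((u 0 : ℝ) : ℂ) + ((u 1 : ℝ) : ℂ) * Complex.I := by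
    ext1 u; apply Complex.ext <;> simp [cz]
  rw [this]
  have h0 : ContDiff ℝ ∞ (fun u : E4 => u 0) := contDiff_euclidean.1 contDiff_id 0
  have h1 : ContDiff ℝ ∞ (fun u : E4 => u 1) := contDiff_euclidean.1 contDiff_id 1
  exact (Complex.ofRealCLM.contDiff.comp h0).add
    ((Complex.ofRealCLM.contDiff.comp h1).mul contDiff_const)

lemma contDiff_cw : ContDiff ℝ ∞ cw := by
  have : cw = fun u : E4 => ((u 2 : ℝ) : ℂ) + ((u 3 : ℝ) : ℂ) * Complex.I := by
    ext1 u; apply Complex.ext <;> simp [cw]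
  rw [this]
  have h0 : ContDiff ℝ ∞ (fun u : E4 => u 2) := contDiff_euclidean.1 contDiff_id 2
  have h1 : ContDiff ℝ ∞ (fun u : E4 => u 3) := contDiff_euclidean.1 contDiff_id 3
  exact (Complex.ofRealCLM.contDiff.comp h0).add
    ((Complex.ofRealCLM.contDiff.comp h1).mul contDiff_const)

lemma contDiff_normSq : ContDiff ℝ ∞ (fun z : ℂ => Complex.normSq z) := by
  have h0 : ContDiff ℝ ∞ (fun z : ℂ => z.re) := Complex.reCLM.contDiff
  have h1 : ContDiff ℝ ∞ (fun z : ℂ => z.im) := Complex.imCLM.contDiff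
  exact (h0.mul h0).add (h1.mul h1)

lemma contDiff_conj : ContDiff ℝ ∞ (fun z : ℂ => (starRingEnd ℂ) z) :=
  Complex.conjCLE.contDiff

lemma contDiffOn_ofReal {E : Type} [NormedAddCommGroup E] [NormedSpace ℝ E] {s : Set E}
    {f : E → ℝ} (hf : ContDiffOn ℝ ∞ f s) : ContDiffOn ℝ ∞ (fun u => ((f u : ℝ) : ℂ)) s :=
  Complex.ofRealCLM.contDiff.comp_contDiffOn hf

lemma contDiffOn_div {E : Type} [NormedAddCommGroup E] [NormedSpace ℝ E] {s : Set E}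
    {f : E → ℂ} {t : E → ℝ} (hf : ContDiffOn ℝ ∞ f s) (ht : ContDiffOn ℝ ∞ t s)
    (h0 : ∀ u ∈ s, 0 < t u) : ContDiffOn ℝ ∞ (fun u => f u / ((t u : ℝ) : ℂ)) s := by
  have := hf.mul (contDiffOn_ofReal (ht.inv fun u hu => (h0 u hu).ne'))
  refine this.congr fun u _ => ?_
  simp [div_eq_mul_inv]

lemma contDiffOn_mk4 {E : Type} [NormedAddCommGroup E] [NormedSpace ℝ E] {s : Set E}
    {f g : E → ℂ} (hf : ContDiffOn ℝ ∞ f s) (hg : ContDiffOn ℝ ∞ g s) :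
    ContDiffOn ℝ ∞ (fun u => mk4 (f u) (g u)) s := by
  rw [contDiffOn_euclidean]
  intro i
  fin_cases i
  · exact Complex.reCLM.contDiff.comp_contDiffOn hf
  · exact Complex.imCLM.contDiff.comp_contDiffOn hf
  · exact Complex.reCLM.contDiff.comp_contDiffOn hg
  · exact Complex.imCLM.contDiff.comp_contDiffOn hg

lemma contDiffOn_fwd₁ : ContDiffOn ℝ ∞ P.fwd₁ P.dom₁ := by
  have h3 : ContDiffOn ℝ ∞ (fun q : Ambient => √(P.x₃ - q.1)) P.dom₁ :=
    ContDiffOn.sqrt (by fun_prop) (fun q hq => (sub_pos.2 hq.1).ne')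
  have h4 : ContDiffOn ℝ ∞ (fun q : Ambient => √(P.x₂ - q.2.1)) P.dom₁ :=
    ContDiffOn.sqrt (by fun_prop) (fun q hq => (sub_pos.2 hq.2).ne')
  have p3 : ∀ q ∈ P.dom₁, 0 < √(P.x₃ - q.1) := fun q hq => Real.sqrt_pos.2 (sub_pos.2 hq.1)
  have p4 : ∀ q ∈ P.dom₁, 0 < √(P.x₂ - q.2.1) := fun q hq => Real.sqrt_pos.2 (sub_pos.2 hq.2)
  have hA : ContDiffOn ℝ ∞ (fun q : Ambient => q.2.2.1) P.dom₁ := by fun_prop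
  have hB : ContDiffOn ℝ ∞ (fun q : Ambient => q.2.2.2.1) P.dom₁ := by fun_prop
  exact contDiffOn_mk4 (contDiffOn_div hB (h4.mul h3) fun q hq => mul_pos (p4 q hq) (p3 q hq))
    (contDiffOn_div hA h3 p3)

lemma contDiffOn_fwd₂ : ContDiffOn ℝ ∞ P.fwd₂ P.dom₂ := by
  have h1 : ContDiffOn ℝ ∞ (fun q : Ambient => √(q.1 - P.x₂)) P.dom₂ :=
    ContDiffOn.sqrt (by fun_prop) (fun q hq => (sub_pos.2 hq.1).ne')
  have h4 : ContDiffOn ℝ ∞ (fun q : Ambient => √(P.x₂ - q.2.1)) P.dom₂ :=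
    ContDiffOn.sqrt (by fun_prop) (fun q hq => (sub_pos.2 hq.2).ne')
  have p : ∀ q ∈ P.dom₂, 0 < √(q.1 - P.x₂) * √(P.x₂ - q.2.1) := fun q hq =>
    mul_pos (Real.sqrt_pos.2 (sub_pos.2 hq.1)) (Real.sqrt_pos.2 (sub_pos.2 hq.2))
  have hB : ContDiffOn ℝ ∞ (fun q : Ambient => q.2.2.2.1) P.dom₂ := by fun_prop
  have hC : ContDiffOn ℝ ∞ (fun q : Ambient => q.2.2.2.2) P.dom₂ := by fun_prop
  exact contDiffOn_mk4 (contDiffOn_div hC (h1.mul h4) p)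
    (contDiffOn_div (contDiff_conj.comp_contDiffOn hB) (h1.mul h4) p)

lemma contDiffOn_fwd₃ : ContDiffOn ℝ ∞ P.fwd₃ P.dom₃ := by
  have h1 : ContDiffOn ℝ ∞ (fun q : Ambient => √(q.1 - P.x₂)) P.dom₃ :=
    ContDiffOn.sqrt (by fun_prop) (fun q hq => (sub_pos.2 hq.1).ne')
  have h2 : ContDiffOn ℝ ∞ (fun q : Ambient => √(q.2.1 - P.x₁)) P.dom₃ :=
    ContDiffOn.sqrt (by fun_prop) (fun q hq => (sub_pos.2 hq.2).ne')
  have p1 : ∀ q ∈ P.dom₃, 0 < √(q.1 - P.x₂) := fun q hq => Real.sqrt_pos.2 (sub_pos.2 hq.1)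
  have p2 : ∀ q ∈ P.dom₃, 0 < √(q.2.1 - P.x₁) := fun q hq => Real.sqrt_pos.2 (sub_pos.2 hq.2)
  have hA : ContDiffOn ℝ ∞ (fun q : Ambient => q.2.2.1) P.dom₃ := by fun_prop
  have hC : ContDiffOn ℝ ∞ (fun q : Ambient => q.2.2.2.2) P.dom₃ := by fun_prop
  exact contDiffOn_mk4 (contDiffOn_div (contDiff_conj.comp_contDiffOn hA) h2 p2)
    (contDiffOn_div hC (h1.mul h2) fun q hq => mul_pos (p1 q hq) (p2 q hq))

lemma contDiff_nz : ContDiff ℝ ∞ (fun u : E4 => Complex.normSq (cz u)) :=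
  contDiff_normSq.comp contDiff_cz

lemma contDiff_nw : ContDiff ℝ ∞ (fun u : E4 => Complex.normSq (cw u)) :=
  contDiff_normSq.comp contDiff_cw

lemma contDiffOn_bwd₁ : ContDiffOn ℝ ∞ P.bwd₁ P.tgt₁ := by
  have hz := contDiff_cz.contDiffOn (s := P.tgt₁)
  have hw := contDiff_cw.contDiffOn (s := P.tgt₁)
  have hx : ContDiffOn ℝ ∞ (fun u : E4 => P.x₂ + Complex.normSq (cz u)) P.tgt₁ :=
    (contDiff_const.add contDiff_nz).contDiffOn
  have hy : ContDiffOn ℝ ∞ (fun u : E4 => P.x₁ + Complex.normSq (cw u)) P.tgt₁ :=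
    (contDiff_const.add contDiff_nw).contDiffOn
  have h3 : ContDiffOn ℝ ∞ (fun u : E4 => √(P.x₃ - (P.x₂ + Complex.normSq (cz u)))) P.tgt₁ :=
    ContDiffOn.sqrt (contDiffOn_const.sub hx) (fun u hu => by have := hu.1; exact (by linarith : (0 : ℝ) < _).ne')
  have h4 : ContDiffOn ℝ ∞ (fun u : E4 => √(P.x₂ - (P.x₁ + Complex.normSq (cw u)))) P.tgt₁ :=
    ContDiffOn.sqrt (contDiffOn_const.sub hy) (fun u hu => by have := hu.2; exact (by linarith : (0 : ℝ) < _).ne')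
  exact hx.prodMk (hy.prodMk ((hw.mul (contDiffOn_ofReal h3)).prodMk
    ((hz.mul (contDiffOn_ofReal (h4.mul h3))).prodMk ((hz.mul hw).mul (contDiffOn_ofReal h4)))))

lemma contDiffOn_bwd₂ : ContDiffOn ℝ ∞ P.bwd₂ P.tgt₂ := by
  have hz := contDiff_cz.contDiffOn (s := P.tgt₂)
  have hw := contDiff_cw.contDiffOn (s := P.tgt₂)
  have hx : ContDiffOn ℝ ∞ (fun u : E4 => P.x₃ - Complex.normSq (cw u)) P.tgt₂ :=
    (contDiff_const.sub contDiff_nw).contDiffOn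
  have hy : ContDiffOn ℝ ∞ (fun u : E4 => P.x₁ + Complex.normSq (cz u)) P.tgt₂ :=
    (contDiff_const.add contDiff_nz).contDiffOn
  have h1 : ContDiffOn ℝ ∞ (fun u : E4 => √(P.x₃ - Complex.normSq (cw u) - P.x₂)) P.tgt₂ :=
    ContDiffOn.sqrt (hx.sub contDiffOn_const) (fun u hu => by have := hu.2; exact (by linarith : (0 : ℝ) < _).ne')
  have h4 : ContDiffOn ℝ ∞ (fun u : E4 => √(P.x₂ - (P.x₁ + Complex.normSq (cz u)))) P.tgt₂ :=
    ContDiffOn.sqrt (contDiffOn_const.sub hy) (fun u hu => by have := hu.1; exact (by linarith : (0 : ℝ) < _).ne')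
  have h := contDiffOn_ofReal (h1.mul h4)
  exact hx.prodMk (hy.prodMk ((hz.mul hw).prodMk
    (((contDiff_conj.comp_contDiffOn hw).mul h).prodMk (hz.mul h))))

lemma contDiffOn_bwd₃ : ContDiffOn ℝ ∞ P.bwd₃ P.tgt₁ := by
  have hz := contDiff_cz.contDiffOn (s := P.tgt₁)
  have hw := contDiff_cw.contDiffOn (s := P.tgt₁)
  have hx : ContDiffOn ℝ ∞ (fun u : E4 => P.x₃ - Complex.normSq (cz u)) P.tgt₁ :=
    (contDiff_const.sub contDiff_nz).contDiffOn
  have hy : ContDiffOn ℝ ∞ (fun u : E4 => P.x₂ - Complex.normSq (cw u)) P.tgt₁ :=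
    (contDiff_const.sub contDiff_nw).contDiffOn
  have h1 : ContDiffOn ℝ ∞ (fun u : E4 => √(P.x₃ - Complex.normSq (cz u) - P.x₂)) P.tgt₁ :=
    ContDiffOn.sqrt (hx.sub contDiffOn_const) (fun u hu => by have := hu.1; exact (by linarith : (0 : ℝ) < _).ne')
  have h2 : ContDiffOn ℝ ∞ (fun u : E4 => √(P.x₂ - Complex.normSq (cw u) - P.x₁)) P.tgt₁ :=
    ContDiffOn.sqrt (hy.sub contDiffOn_const) (fun u hu => by have := hu.2; exact (by linarith : (0 : ℝ) < _).ne')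
  exact hx.prodMk (hy.prodMk (((contDiff_conj.comp_contDiffOn hz).mul (contDiffOn_ofReal h2)).prodMk
    (((hz.mul hw).mul (contDiffOn_ofReal h1)).prodMk (hw.mul (contDiffOn_ofReal (h1.mul h2))))))

lemma isOpen_tgt₁ : IsOpen P.tgt₁ :=
  (isOpen_lt contDiff_nz.continuous continuous_const).inter
    (isOpen_lt contDiff_nw.continuous continuous_const)

lemma isOpen_tgt₂ : IsOpen P.tgt₂ :=
  (isOpen_lt contDiff_nz.continuous continuous_const).inter
    (isOpen_lt contDiff_nw.continuous continuous_const)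

lemma isOpen_dom₁ : IsOpen P.dom₁ :=
  IsOpen.inter (isOpen_lt (f := fun q : Ambient => q.1) (g := fun q : Ambient => P.x₃)
    (by fun_prop) (by fun_prop))
    (isOpen_lt (f := fun q : Ambient => q.2.1) (g := fun q : Ambient => P.x₂)
    (by fun_prop) (by fun_prop))

lemma isOpen_dom₂ : IsOpen P.dom₂ :=
  IsOpen.inter (isOpen_lt (f := fun q : Ambient => P.x₂) (g := fun q : Ambient => q.1)
    (by fun_prop) (by fun_prop))
    (isOpen_lt (f := fun q : Ambient => q.2.1) (g := fun q : Ambient => P.x₂)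
    (by fun_prop) (by fun_prop))

lemma isOpen_dom₃ : IsOpen P.dom₃ :=
  IsOpen.inter (isOpen_lt (f := fun q : Ambient => P.x₂) (g := fun q : Ambient => q.1)
    (by fun_prop) (by fun_prop))
    (isOpen_lt (f := fun q : Ambient => P.x₁) (g := fun q : Ambient => q.2.1)
    (by fun_prop) (by fun_prop))

lemma ofReal_sqrt_mul_self {t : ℝ} (ht : 0 ≤ t) : ((√t : ℝ) : ℂ) * ((√t : ℝ) : ℂ) = (t : ℂ) := by
  exact_mod_cast Real.mul_self_sqrt ht

lemma bwd₁_mem {u : E4} (hu : u ∈ P.tgt₁) : P.bwd₁ u ∈ P.carrier := by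
  obtain ⟨h1, h2⟩ := hu
  have hz := Complex.normSq_nonneg (cz u)
  have hw := Complex.normSq_nonneg (cw u)
  have e3 : 0 ≤ P.x₃ - (P.x₂ + Complex.normSq (cz u)) := by linarith
  have e4 : 0 ≤ P.x₂ - (P.x₁ + Complex.normSq (cw u)) := by linarith
  have q3 := ofReal_sqrt_mul_self e3
  have q4 := ofReal_sqrt_mul_self e4
  refine ⟨by simp only [bwd₁]; linarith, by simp only [bwd₁]; linarith,
    by simp only [bwd₁]; linarith, by simp only [bwd₁]; linarith, ?_, ?_, ?_, ?_, ?_, ?_, ?_⟩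
  · rintro ⟨-, h⟩
    simp only [bwd₁] at h
    linarith
  · simp only [bwd₁, map_mul, Complex.normSq_ofReal, Real.mul_self_sqrt e3]; ring
  · simp only [bwd₁, map_mul, Complex.normSq_ofReal]
    rw [mul_mul_mul_comm, Real.mul_self_sqrt e3, Real.mul_self_sqrt e4]; ring
  · simp only [bwd₁, map_mul, Complex.normSq_ofReal, Real.mul_self_sqrt e4]; ring
  · simp only [bwd₁]
    rw [← q3]; push_cast; ring
  · simp only [bwd₁]
    have : ((P.x₁ + Complex.normSq (cw u) - P.x₁ : ℝ) : ℂ) = (starRingEnd ℂ) (cw u) * cw u := by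
      rw [← Complex.normSq_eq_conj_mul_self]; push_cast; ring
    rw [this]; simp only [map_mul, Complex.conj_ofReal]; push_cast; ring
  · simp only [bwd₁]
    have : (((P.x₂ + Complex.normSq (cz u) - P.x₂) * (P.x₂ - (P.x₁ + Complex.normSq (cw u))) : ℝ) : ℂ)
        = (starRingEnd ℂ) (cz u) * cz u *
          ((P.x₂ - (P.x₁ + Complex.normSq (cw u)) : ℝ) : ℂ) := by
      rw [← Complex.normSq_eq_conj_mul_self]; push_cast; ring
    rw [this, ← q4]; simp only [map_mul, Complex.conj_ofReal]; push_cast; ring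

lemma bwd₂_mem {u : E4} (hu : u ∈ P.tgt₂) : P.bwd₂ u ∈ P.carrier := by
  obtain ⟨h1, h2⟩ := hu
  have hz := Complex.normSq_nonneg (cz u)
  have hw := Complex.normSq_nonneg (cw u)
  have e1 : 0 ≤ P.x₃ - Complex.normSq (cw u) - P.x₂ := by linarith
  have e4 : 0 ≤ P.x₂ - (P.x₁ + Complex.normSq (cz u)) := by linarith
  have q1 := ofReal_sqrt_mul_self e1
  have q4 := ofReal_sqrt_mul_self e4
  have cz2 : ((Complex.normSq (cz u) : ℝ) : ℂ) = (starRingEnd ℂ) (cz u) * cz u :=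
    Complex.normSq_eq_conj_mul_self
  have cw2 : ((Complex.normSq (cw u) : ℝ) : ℂ) = (starRingEnd ℂ) (cw u) * cw u :=
    Complex.normSq_eq_conj_mul_self
  refine ⟨by simp only [bwd₂]; linarith, by simp only [bwd₂]; linarith,
    by simp only [bwd₂]; linarith, by simp only [bwd₂]; linarith, ?_, ?_, ?_, ?_, ?_, ?_, ?_⟩
  · rintro ⟨-, h⟩
    simp only [bwd₂] at h
    linarith
  · simp only [bwd₂, map_mul]; ring
  · simp only [bwd₂, map_mul, Complex.normSq_ofReal, Complex.normSq_conj]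
    rw [mul_mul_mul_comm, Real.mul_self_sqrt e1, Real.mul_self_sqrt e4]; ring
  · simp only [bwd₂, map_mul, Complex.normSq_ofReal]
    rw [mul_mul_mul_comm, Real.mul_self_sqrt e1, Real.mul_self_sqrt e4]; ring
  · simp only [bwd₂]
    have : ((P.x₃ - (P.x₃ - Complex.normSq (cw u)) : ℝ) : ℂ) = (starRingEnd ℂ) (cw u) * cw u := by
      rw [← cw2]; push_cast; ring
    rw [this]; ring
  · simp only [bwd₂]
    have : ((P.x₁ + Complex.normSq (cz u) - P.x₁ : ℝ) : ℂ) = (starRingEnd ℂ) (cz u) * cz u := by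
      rw [← cz2]; push_cast; ring
    rw [this]; simp only [map_mul]; ring
  · simp only [bwd₂]
    rw [Complex.ofReal_mul (P.x₃ - Complex.normSq (cw u) - P.x₂), ← q1, ← q4]
    simp only [map_mul, Complex.conj_ofReal, Complex.conj_conj, Complex.ofReal_mul]; ring

lemma bwd₃_mem {u : E4} (hu : u ∈ P.tgt₁) : P.bwd₃ u ∈ P.carrier := by
  obtain ⟨h1, h2⟩ := hu
  have hz := Complex.normSq_nonneg (cz u)
  have hw := Complex.normSq_nonneg (cw u)
  have e1 : 0 ≤ P.x₃ - Complex.normSq (cz u) - P.x₂ := by linarith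
  have e2 : 0 ≤ P.x₂ - Complex.normSq (cw u) - P.x₁ := by linarith
  have q1 := ofReal_sqrt_mul_self e1
  have q2 := ofReal_sqrt_mul_self e2
  have cz2 : ((Complex.normSq (cz u) : ℝ) : ℂ) = (starRingEnd ℂ) (cz u) * cz u :=
    Complex.normSq_eq_conj_mul_self
  have cw2 : ((Complex.normSq (cw u) : ℝ) : ℂ) = (starRingEnd ℂ) (cw u) * cw u :=
    Complex.normSq_eq_conj_mul_self
  refine ⟨by simp only [bwd₃]; linarith, by simp only [bwd₃]; linarith,
    by simp only [bwd₃]; linarith, by simp only [bwd₃]; linarith, ?_, ?_, ?_, ?_, ?_, ?_, ?_⟩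
  · rintro ⟨h, -⟩
    simp only [bwd₃] at h
    linarith
  · simp only [bwd₃, map_mul, Complex.normSq_ofReal, Complex.normSq_conj, Real.mul_self_sqrt e2]
    ring
  · simp only [bwd₃, map_mul, Complex.normSq_ofReal, Real.mul_self_sqrt e1]; ring
  · simp only [bwd₃, map_mul, Complex.normSq_ofReal]
    rw [mul_mul_mul_comm, Real.mul_self_sqrt e1, Real.mul_self_sqrt e2]; ring
  · simp only [bwd₃]
    have : ((P.x₃ - (P.x₃ - Complex.normSq (cz u)) : ℝ) : ℂ) = (starRingEnd ℂ) (cz u) * cz u := by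
      rw [← cz2]; push_cast; ring
    rw [this]; push_cast; ring
  · simp only [bwd₃]
    rw [← q2]; simp only [map_mul, Complex.conj_ofReal, Complex.conj_conj]; push_cast; ring
  · simp only [bwd₃]
    have : (((P.x₃ - Complex.normSq (cz u) - P.x₂) * (P.x₂ - (P.x₂ - Complex.normSq (cw u))) : ℝ) : ℂ)
        = ((P.x₃ - Complex.normSq (cz u) - P.x₂ : ℝ) : ℂ) * ((starRingEnd ℂ) (cw u) * cw u) := by
      rw [← cw2]; push_cast; ring
    rw [this, ← q1]; simp only [map_mul, Complex.conj_ofReal]; push_cast; ring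

lemma fwd₁_mem {q : Ambient} (hq : q ∈ P.carrier) (hd : q ∈ P.dom₁) : P.fwd₁ q ∈ P.tgt₁ := by
  obtain ⟨h1, h2, h3, h4, h5, hA, hB, hC, e1, e2, e3⟩ := hq
  obtain ⟨d1, d2⟩ := hd
  have p3 : 0 < P.x₃ - q.1 := sub_pos.2 d1
  have p4 : 0 < P.x₂ - q.2.1 := sub_pos.2 d2
  simp only [tgt₁, fwd₁, mem_ofPred_eq, cz_mk4, cw_mk4, map_div₀, Complex.normSq_ofReal]
  rw [hA, hB, mul_mul_mul_comm, Real.mul_self_sqrt p3.le, Real.mul_self_sqrt p4.le,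
    div_lt_iff₀ (by positivity), div_lt_iff₀ p3]
  constructor <;> nlinarith [mul_pos p3 p4]

lemma fwd₂_mem {q : Ambient} (hq : q ∈ P.carrier) (hd : q ∈ P.dom₂) : P.fwd₂ q ∈ P.tgt₂ := by
  obtain ⟨h1, h2, h3, h4, h5, hA, hB, hC, e1, e2, e3⟩ := hq
  obtain ⟨d1, d2⟩ := hd
  have p1 : 0 < q.1 - P.x₂ := sub_pos.2 d1
  have p4 : 0 < P.x₂ - q.2.1 := sub_pos.2 d2
  simp only [tgt₂, fwd₂, mem_ofPred_eq, cz_mk4, cw_mk4, map_div₀, Complex.normSq_ofReal,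
    Complex.normSq_conj]
  rw [hB, hC, mul_mul_mul_comm, Real.mul_self_sqrt p1.le, Real.mul_self_sqrt p4.le,
    div_lt_iff₀ (by positivity), div_lt_iff₀ (by positivity)]
  constructor <;> nlinarith [mul_pos p1 p4]

lemma fwd₃_mem {q : Ambient} (hq : q ∈ P.carrier) (hd : q ∈ P.dom₃) : P.fwd₃ q ∈ P.tgt₁ := by
  obtain ⟨h1, h2, h3, h4, h5, hA, hB, hC, e1, e2, e3⟩ := hq
  obtain ⟨d1, d2⟩ := hd
  have p1 : 0 < q.1 - P.x₂ := sub_pos.2 d1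
  have p2 : 0 < q.2.1 - P.x₁ := sub_pos.2 d2
  simp only [tgt₁, fwd₃, mem_ofPred_eq, cz_mk4, cw_mk4, map_div₀, Complex.normSq_ofReal,
    Complex.normSq_conj]
  rw [hA, hC, mul_mul_mul_comm, Real.mul_self_sqrt p1.le, Real.mul_self_sqrt p2.le,
    div_lt_iff₀ (by positivity), div_lt_iff₀ (by positivity)]
  constructor <;> nlinarith [mul_pos p1 p2]

lemma bwd₁_dom {u : E4} (hu : u ∈ P.tgt₁) : P.bwd₁ u ∈ P.dom₁ := by
  obtain ⟨h1, h2⟩ := hu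
  constructor <;> simp only [bwd₁] <;> linarith

lemma bwd₂_dom {u : E4} (hu : u ∈ P.tgt₂) : P.bwd₂ u ∈ P.dom₂ := by
  obtain ⟨h1, h2⟩ := hu
  constructor <;> simp only [bwd₂] <;> linarith

lemma bwd₃_dom {u : E4} (hu : u ∈ P.tgt₁) : P.bwd₃ u ∈ P.dom₃ := by
  obtain ⟨h1, h2⟩ := hu
  constructor <;> simp only [bwd₃] <;> linarith

lemma ofReal_sqrt_ne {t : ℝ} (ht : 0 < t) : ((√t : ℝ) : ℂ) ≠ 0 := by
  exact_mod_cast (Real.sqrt_pos.2 ht).ne'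

lemma fwd₁_bwd₁ {u : E4} (hu : u ∈ P.tgt₁) : P.fwd₁ (P.bwd₁ u) = u := by
  obtain ⟨d1, d2⟩ := P.bwd₁_dom hu
  have n3 := ofReal_sqrt_ne (sub_pos.2 d1)
  have n4 := ofReal_sqrt_ne (sub_pos.2 d2)
  simp only [bwd₁] at n3 n4
  simp only [fwd₁, bwd₁]
  rw [mul_div_cancel_right₀ _ n3, mul_div_cancel_right₀ _ (by push_cast; exact mul_ne_zero n4 n3)]
  simp

lemma fwd₂_bwd₂ {u : E4} (hu : u ∈ P.tgt₂) : P.fwd₂ (P.bwd₂ u) = u := by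
  obtain ⟨d1, d2⟩ := P.bwd₂_dom hu
  have n3 := ofReal_sqrt_ne (sub_pos.2 d1)
  have n4 := ofReal_sqrt_ne (sub_pos.2 d2)
  simp only [bwd₂] at n3 n4
  simp only [fwd₂, bwd₂, map_mul, Complex.conj_conj, Complex.conj_ofReal]
  rw [mul_div_cancel_right₀ _ (by push_cast; exact mul_ne_zero n3 n4),
    mul_div_cancel_right₀ _ (by push_cast; exact mul_ne_zero n3 n4)]
  simp

lemma fwd₃_bwd₃ {u : E4} (hu : u ∈ P.tgt₁) : P.fwd₃ (P.bwd₃ u) = u := by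
  obtain ⟨d1, d2⟩ := P.bwd₃_dom hu
  have n3 := ofReal_sqrt_ne (sub_pos.2 d1)
  have n4 := ofReal_sqrt_ne (sub_pos.2 d2)
  simp only [bwd₃] at n3 n4
  simp only [fwd₃, bwd₃, map_mul, Complex.conj_conj, Complex.conj_ofReal]
  rw [mul_div_cancel_right₀ _ n4,
    mul_div_cancel_right₀ _ (by push_cast; exact mul_ne_zero n3 n4)]
  simp

lemma bwd₁_fwd₁ {q : Ambient} (hq : q ∈ P.carrier) (hd : q ∈ P.dom₁) :
    P.bwd₁ (P.fwd₁ q) = q := by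
  obtain ⟨h1, h2, h3, h4, h5, hA, hB, hC, e1, e2, e3⟩ := hq
  obtain ⟨d1, d2⟩ := hd
  have p3 : 0 < P.x₃ - q.1 := sub_pos.2 d1
  have p4 : 0 < P.x₂ - q.2.1 := sub_pos.2 d2
  have n3 := ofReal_sqrt_ne p3
  have n4 := ofReal_sqrt_ne p4
  have q3 := ofReal_sqrt_mul_self p3.le
  have hx : P.x₂ + Complex.normSq (cz (P.fwd₁ q)) = q.1 := by
    simp only [fwd₁, cz_mk4, map_div₀, Complex.normSq_ofReal]
    rw [hB, mul_mul_mul_comm, Real.mul_self_sqrt p3.le, Real.mul_self_sqrt p4.le]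
    field_simp; ring
  have hy : P.x₁ + Complex.normSq (cw (P.fwd₁ q)) = q.2.1 := by
    simp only [fwd₁, cw_mk4, map_div₀, Complex.normSq_ofReal]
    rw [hA, Real.mul_self_sqrt p3.le]
    field_simp; ring
  simp only [bwd₁, hx, hy]
  simp only [fwd₁, cz_mk4, cw_mk4, Complex.ofReal_mul]
  refine Prod.ext rfl (Prod.ext rfl (Prod.ext ?_ (Prod.ext ?_ ?_)))
  · exact div_mul_cancel₀ _ n3
  · exact div_mul_cancel₀ _ (mul_ne_zero n4 n3)
  · have n : ((P.x₃ - q.1 : ℝ) : ℂ) ≠ 0 := by exact_mod_cast p3.ne'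
    apply mul_left_cancel₀ n
    simp only
    rw [← e1, ← q3]
    field_simp

lemma bwd₂_fwd₂ {q : Ambient} (hq : q ∈ P.carrier) (hd : q ∈ P.dom₂) :
    P.bwd₂ (P.fwd₂ q) = q := by
  obtain ⟨h1, h2, h3, h4, h5, hA, hB, hC, e1, e2, e3⟩ := hq
  obtain ⟨d1, d2⟩ := hd
  have p1 : 0 < q.1 - P.x₂ := sub_pos.2 d1
  have p4 : 0 < P.x₂ - q.2.1 := sub_pos.2 d2
  have n1 := ofReal_sqrt_ne p1
  have n4 := ofReal_sqrt_ne p4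
  have q1 := ofReal_sqrt_mul_self p1.le
  have q4 := ofReal_sqrt_mul_self p4.le
  have hx : P.x₃ - Complex.normSq (cw (P.fwd₂ q)) = q.1 := by
    simp only [fwd₂, cw_mk4, map_div₀, Complex.normSq_ofReal, Complex.normSq_conj]
    rw [hB, mul_mul_mul_comm, Real.mul_self_sqrt p1.le, Real.mul_self_sqrt p4.le]
    field_simp; ring
  have hy : P.x₁ + Complex.normSq (cz (P.fwd₂ q)) = q.2.1 := by
    simp only [fwd₂, cz_mk4, map_div₀, Complex.normSq_ofReal]
    rw [hC, mul_mul_mul_comm, Real.mul_self_sqrt p1.le, Real.mul_self_sqrt p4.le]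
    field_simp; ring
  simp only [bwd₂, hx, hy]
  simp only [fwd₂, cz_mk4, cw_mk4, Complex.ofReal_mul, map_div₀, map_mul, Complex.conj_conj,
    Complex.conj_ofReal]
  refine Prod.ext rfl (Prod.ext rfl (Prod.ext ?_ (Prod.ext ?_ ?_)))
  · simp only
    rw [div_mul_div_comm, e3, Complex.ofReal_mul, ← q1, ← q4]
    field_simp
  · exact div_mul_cancel₀ _ (mul_ne_zero n1 n4)
  · exact div_mul_cancel₀ _ (mul_ne_zero n1 n4)

lemma bwd₃_fwd₃ {q : Ambient} (hq : q ∈ P.carrier) (hd : q ∈ P.dom₃) :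
    P.bwd₃ (P.fwd₃ q) = q := by
  obtain ⟨h1, h2, h3, h4, h5, hA, hB, hC, e1, e2, e3⟩ := hq
  obtain ⟨d1, d2⟩ := hd
  have p1 : 0 < q.1 - P.x₂ := sub_pos.2 d1
  have p2 : 0 < q.2.1 - P.x₁ := sub_pos.2 d2
  have n1 := ofReal_sqrt_ne p1
  have n2 := ofReal_sqrt_ne p2
  have q2 := ofReal_sqrt_mul_self p2.le
  have hx : P.x₃ - Complex.normSq (cz (P.fwd₃ q)) = q.1 := by
    simp only [fwd₃, cz_mk4, map_div₀, Complex.normSq_ofReal, Complex.normSq_conj]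
    rw [hA, Real.mul_self_sqrt p2.le]
    field_simp; ring
  have hy : P.x₂ - Complex.normSq (cw (P.fwd₃ q)) = q.2.1 := by
    simp only [fwd₃, cw_mk4, map_div₀, Complex.normSq_ofReal]
    rw [hC, mul_mul_mul_comm, Real.mul_self_sqrt p1.le, Real.mul_self_sqrt p2.le]
    field_simp; ring
  simp only [bwd₃, hx, hy]
  simp only [fwd₃, cz_mk4, cw_mk4, Complex.ofReal_mul, map_div₀, Complex.conj_conj,
    Complex.conj_ofReal]
  refine Prod.ext rfl (Prod.ext rfl (Prod.ext ?_ (Prod.ext ?_ ?_)))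
  · exact div_mul_cancel₀ _ n2
  · have n : ((q.2.1 - P.x₁ : ℝ) : ℂ) ≠ 0 := by exact_mod_cast p2.ne'
    apply mul_left_cancel₀ n
    simp only
    rw [← e2, ← q2]
    field_simp
  · exact div_mul_cancel₀ _ (mul_ne_zero n1 n2)

/-- The point of the manifold over the corner `(x₂, x₁)`. -/
def base : P.Space :=
  ⟨P.bwd₁ 0, P.bwd₁_mem (by simp [tgt₁, cz, cw, Complex.normSq, P.x₁_lt_x₂, P.x₂_lt_x₃])⟩

open Classical in
/-- The chart of the manifold given by the restriction of a map `f` of the ambient space, whose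
inverse is the parametrization `b`. -/
def mkChart (f : Ambient → E4) (b : E4 → Ambient) (D : Set Ambient) (T : Set E4)
    (hD : IsOpen D) (hT : IsOpen T) (hf : ContDiffOn ℝ ∞ f D) (hb : ContDiffOn ℝ ∞ b T)
    (bmem : ∀ {u}, u ∈ T → b u ∈ P.carrier) (bdom : ∀ {u}, u ∈ T → b u ∈ D)
    (fmem : ∀ {q}, q ∈ P.carrier → q ∈ D → f q ∈ T)
    (bf : ∀ {q}, q ∈ P.carrier → q ∈ D → b (f q) = q)
    (fb : ∀ {u}, u ∈ T → f (b u) = u) : OpenPartialHomeomorph P.Space E4 where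
  toFun p := f p.1
  invFun u := if h : u ∈ T then ⟨b u, bmem h⟩ else P.base
  source := {p | p.1 ∈ D}
  target := T
  map_source' p hp := fmem p.2 hp
  map_target' u hu := by simpa [hu] using bdom hu
  left_inv' p hp := by
    have : f p.1 ∈ T := fmem p.2 hp
    simp only [this, dite_true]
    exact Subtype.ext (bf p.2 hp)
  right_inv' u hu := by simpa [hu] using fb hu
  continuousOn_toFun := hf.continuousOn.comp continuous_subtype_val.continuousOn fun _ h => h
  continuousOn_invFun := by
    rw [Topology.IsInducing.subtypeVal.continuousOn_iff]
    refine hb.continuousOn.congr fun u hu => ?_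
    simp [hu]
  open_source := hD.preimage continuous_subtype_val
  open_target := hT

/-- The chart around the corner `(x₂, x₁)`. -/
def chart₁ : OpenPartialHomeomorph P.Space E4 :=
  P.mkChart P.fwd₁ P.bwd₁ P.dom₁ P.tgt₁ P.isOpen_dom₁ P.isOpen_tgt₁ P.contDiffOn_fwd₁
    P.contDiffOn_bwd₁ P.bwd₁_mem P.bwd₁_dom P.fwd₁_mem P.bwd₁_fwd₁ P.fwd₁_bwd₁

/-- The chart around the corner `(x₃, x₁)`. -/
def chart₂ : OpenPartialHomeomorph P.Space E4 :=
  P.mkChart P.fwd₂ P.bwd₂ P.dom₂ P.tgt₂ P.isOpen_dom₂ P.isOpen_tgt₂ P.contDiffOn_fwd₂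
    P.contDiffOn_bwd₂ P.bwd₂_mem P.bwd₂_dom P.fwd₂_mem P.bwd₂_fwd₂ P.fwd₂_bwd₂

/-- The chart around the corner `(x₃, x₂)`. -/
def chart₃ : OpenPartialHomeomorph P.Space E4 :=
  P.mkChart P.fwd₃ P.bwd₃ P.dom₃ P.tgt₁ P.isOpen_dom₃ P.isOpen_tgt₁ P.contDiffOn_fwd₃
    P.contDiffOn_bwd₃ P.bwd₃_mem P.bwd₃_dom P.fwd₃_mem P.bwd₃_fwd₃ P.fwd₃_bwd₃

open Classical in
/-- The smooth structure given by the three charts. -/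
instance instChartedSpace : ChartedSpace E4 P.Space where
  atlas := {P.chart₁, P.chart₂, P.chart₃}
  chartAt p := if p.1 ∈ P.dom₁ then P.chart₁ else if p.1 ∈ P.dom₂ then P.chart₂ else P.chart₃
  mem_chart_source p := by
    split_ifs with h1 h2
    · exact h1
    · exact h2
    · obtain ⟨k1, k2, k3, k4, k5, -⟩ := p.2
      have o1 := P.x₁_lt_x₂
      have o2 := P.x₂_lt_x₃
      simp only [dom₁, dom₂, mem_ofPred_eq, not_and, not_lt] at h1 h2
      show p.1 ∈ P.dom₃
      have l1 : P.x₂ < p.1.1 := by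
        rcases k1.lt_or_eq with h | h
        · exact h
        · have h' := h1 (by rw [← h]; exact o2)
          exact absurd ⟨h.symm, le_antisymm k4 h'⟩ k5
      have l2 := h2 l1
      exact ⟨l1, by linarith⟩
  chart_mem_atlas p := by
    split_ifs <;> simp

lemma mkChart_transition {f f' : Ambient → E4} {b b' : E4 → Ambient} {D D' : Set Ambient}
    {T T' : Set E4} (hD hT hf hb bmem bdom fmem bf fb)
    (hD' hT' hf' hb' bmem' bdom' fmem' bf' fb') :
    let e := P.mkChart f b D T hD hT hf hb bmem bdom fmem bf fb
    let e' := P.mkChart f' b' D' T' hD' hT' hf' hb' bmem' bdom' fmem' bf' fb'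
    ContDiffOn ℝ ∞ ((𝓡 4) ∘ e.symm ≫ₕ e' ∘ (𝓡 4).symm)
      ((𝓡 4).symm ⁻¹' (e.symm ≫ₕ e').source ∩ range (𝓡 4)) := by
  intro e e'
  have hs : ∀ u ∈ (𝓡 4).symm ⁻¹' (e.symm ≫ₕ e').source ∩ range (𝓡 4), u ∈ T ∧ b u ∈ D' := by
    rintro u ⟨⟨h1, h2⟩, -⟩
    have h1' : u ∈ T := h1
    have h2' : (e.symm u).1 ∈ D' := h2
    refine ⟨h1', ?_⟩
    simpa [e, mkChart, h1'] using h2'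
  refine ((hf'.comp (hb.mono fun u hu => (hs u hu).1) fun u hu => (hs u hu).2)).congr ?_
  intro u hu
  have h1 := (hs u hu).1
  simp [e, e', mkChart, h1]

instance instIsManifold : IsManifold (𝓡 4) ∞ P.Space := by
  apply isManifold_of_contDiffOn
  rintro e e' he he'
  rcases he with rfl | rfl | rfl <;> rcases he' with rfl | rfl | rfl <;>
    exact P.mkChart_transition _ _ _ _ _ _ _ _ _ _ _ _ _ _ _ _ _ _

/-! ## The metric on the manifold -/

/-- The part of the manifold on which `x₂ < x < x₃` and `x₁ < y < x₂`, where the torus acts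
freely. -/
def regular : Set P.Space :=
  {p | P.x₂ < p.1.1 ∧ p.1.1 < P.x₃ ∧ P.x₁ < p.1.2.1 ∧ p.1.2.1 < P.x₂}

/-- The differential of the angle `α`, the argument of `A`. -/
def dα (p : P.Space) (v : TangentSpace (𝓡 4) p) : ℝ :=
  ((show ℂ from mfderiv (𝓡 4) 𝓘(ℝ, ℂ) (fun q : P.Space => q.1.2.2.1) p v) / p.1.2.2.1).im

/-- The differential of the angle `β`, the argument of `B`. -/
def dβ (p : P.Space) (v : TangentSpace (𝓡 4) p) : ℝ :=
  ((show ℂ from mfderiv (𝓡 4) 𝓘(ℝ, ℂ) (fun q : P.Space => q.1.2.2.2.1) p v) / p.1.2.2.2.1).im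

/-- The components `(dx, dy, dτ, dφ)` of a tangent vector, where `(τ, φ) = α ℓ₁ + β ℓ₀`. -/
def components (p : P.Space) (v : TangentSpace (𝓡 4) p) : Fin 4 → ℝ :=
  ![mfderiv (𝓡 4) 𝓘(ℝ, ℝ) (fun q : P.Space => q.1.1) p v,
    mfderiv (𝓡 4) 𝓘(ℝ, ℝ) (fun q : P.Space => q.1.2.1) p v,
    P.ℓ₁τ * P.dα p v + P.ℓ₀τ * P.dβ p v,
    P.ℓ₁φ * P.dα p v + P.ℓ₀φ * P.dβ p v]

/-- `g` is the metric of the Chen–Teo instanton: on the dense open set where the torus acts freely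
it is given by the Chen–Teo line element. -/
def IsChenTeoMetric (g : Metric P.Space) : Prop :=
  ∀ p ∈ P.regular, ∀ v w : TangentSpace (𝓡 4) p,
    g.inner p v w = P.lineElement p.1.1 p.1.2.1 (P.components p v) (P.components p w)

end Params
end ChenTeo

end

open Set Filter Topology Manifold Bundle
open scoped ContDiff

noncomputable section

namespace ChenTeo

/-! ## Pointwise algebra in an oriented orthonormal frame -/

abbrev Mat4 : Type := Matrix (Fin 4) (Fin 4) ℝ

lemma sum_leviCivita (t : Fin 4 → Fin 4 → Fin 4 → Fin 4 → ℝ) :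
    ∑ a, ∑ b, ∑ c, ∑ d, leviCivita a b c d * t a b c d =
      t 0 1 2 3 - t 0 1 3 2 - t 0 2 1 3 + t 0 2 3 1 + t 0 3 1 2 - t 0 3 2 1
      - t 1 0 2 3 + t 1 0 3 2 + t 1 2 0 3 - t 1 2 3 0 - t 1 3 0 2 + t 1 3 2 0
      + t 2 0 1 3 - t 2 0 3 1 - t 2 1 0 3 + t 2 1 3 0 + t 2 3 0 1 - t 2 3 1 0
      - t 3 0 1 2 + t 3 0 2 1 + t 3 1 0 2 - t 3 1 2 0 - t 3 2 0 1 + t 3 2 1 0 := by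
  have h : ∀ a b c d, leviCivita a b c d =
      ((b : ℕ) - (a : ℕ) : ℝ) * ((c : ℕ) - (a : ℕ)) * ((d : ℕ) - (a : ℕ)) * ((c : ℕ) - (b : ℕ)) *
        ((d : ℕ) - (b : ℕ)) * ((d : ℕ) - (c : ℕ)) / 12 := by
    have key : ∀ f : Fin 4 → Fin 4, ((1 : Matrix (Fin 4) (Fin 4) ℤ).submatrix f id).det * 12 =
      ((f 1 : ℕ) - (f 0 : ℕ) : ℤ) * ((f 2 : ℕ) - (f 0 : ℕ)) * ((f 3 : ℕ) - (f 0 : ℕ)) *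
       ((f 2 : ℕ) - (f 1 : ℕ)) * ((f 3 : ℕ) - (f 1 : ℕ)) * ((f 3 : ℕ) - (f 2 : ℕ)) := by
      decide +kernel
    intro a b c d
    have k := key ![a, b, c, d]
    have e : ((1 : Matrix (Fin 4) (Fin 4) ℝ).submatrix ![a, b, c, d] id) =
        ((1 : Matrix (Fin 4) (Fin 4) ℤ).submatrix ![a, b, c, d] id).map (Int.castRingHom ℝ) := by
      ext i j
      simp only [Matrix.submatrix_apply, Matrix.map_apply, Matrix.one_apply]
      split_ifs <;> simp
    unfold leviCivita
    rw [e, ← RingHom.mapMatrix_apply, ← RingHom.map_det, eq_div_iff (by norm_num)]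
    have k' := congrArg (Int.castRingHom ℝ) k
    simp only [map_mul, map_sub, map_natCast] at k'
    simpa using k'
  simp only [Fin.sum_univ_four, h]
  simp
  norm_num
  ring

lemma sum_leviCivita_mul (θ : Mat4) (i j k l : Fin 4) :
    ∑ a, ∑ b, ∑ c, ∑ d, leviCivita a b c d * (θ a i * θ b j * θ c k * θ d l) =
      θ.det * leviCivita i j k l := by
  have h1 : θ.submatrix id ![i, j, k, l] = θ * (1 : Mat4).submatrix id ![i, j, k, l] := by
    ext a b
    simp [Matrix.mul_apply, Matrix.one_apply]
  have h2 : leviCivita i j k l = ((1 : Mat4).submatrix id ![i, j, k, l]).det := by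
    unfold leviCivita
    rw [← Matrix.det_transpose, Matrix.transpose_submatrix, Matrix.transpose_one]
  rw [h2, ← Matrix.det_mul, ← h1, sum_leviCivita]
  simp only [Matrix.det_succ_row_zero, Fin.sum_univ_succ, Matrix.submatrix_apply, id]
  simp [Fin.succAbove]
  ring

end ChenTeo
end

open Set Filter Topology Manifold Bundle
open scoped ContDiff

noncomputable section

namespace ChenTeo

/-- The Hodge star on 2-forms written in an oriented orthonormal frame. -/
def frameStar (n : Mat4) : Mat4 :=
  fun a b => (1 / 2) * ∑ c, ∑ d, leviCivita a b c d * n c d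

lemma sum_comm₄ (f : Fin 4 → Fin 4 → Fin 4 → Fin 4 → ℝ) :
    ∑ c, ∑ d, ∑ a, ∑ b, f c d a b = ∑ a, ∑ b, ∑ c, ∑ d, f c d a b := by
  have h : ∀ g : Fin 4 → Fin 4 → Fin 4 → ℝ, ∑ d, ∑ a, ∑ b, g d a b = ∑ a, ∑ b, ∑ d, g d a b := by
    intro g
    rw [Finset.sum_comm]
    exact Finset.sum_congr rfl fun a _ => Finset.sum_comm
  rw [Finset.sum_congr rfl fun c _ => h (f c)]
  exact h fun c a b => ∑ d, f c d a b

lemma sandwich_apply (A n B : Mat4) (i j : Fin 4) :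
    (A * n * B) i j = ∑ c, ∑ d, A i c * n c d * B d j := by
  simp only [Matrix.mul_apply, Finset.sum_mul]
  rw [Finset.sum_comm]

lemma sum_mul_eq_trace (A B : Mat4) : ∑ k, ∑ l, A k l * B k l = (A.transpose * B).trace := by
  simp only [Matrix.trace, Matrix.diag, Matrix.mul_apply, Matrix.transpose_apply]
  exact Finset.sum_comm

lemma sum_sandwich_mul {θ E : Mat4} (hE : θ * E = 1) (r n : Mat4) :
    ∑ k, ∑ l, (θ.transpose * r * θ) k l * (E * n * E.transpose) k l =
      ∑ c, ∑ d, r c d * n c d := by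
  have hE' : E.transpose * θ.transpose = 1 := by
    rw [← Matrix.transpose_mul, hE, Matrix.transpose_one]
  rw [sum_mul_eq_trace, sum_mul_eq_trace]
  simp only [Matrix.transpose_mul, Matrix.transpose_transpose]
  calc (θ.transpose * (r.transpose * θ) * (E * n * E.transpose)).trace
      = (θ.transpose * r.transpose * (θ * E) * n * E.transpose).trace := by
        simp only [Matrix.mul_assoc]
    _ = (r.transpose * n).trace := by
        rw [hE, Matrix.trace_mul_comm, Matrix.mul_one]
        simp only [← Matrix.mul_assoc, hE', Matrix.one_mul]

lemma leviCivita_contract {θ E : Mat4} (hE : θ * E = 1) (i j : Fin 4) :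
    θ.det • (E.transpose * (Matrix.of fun k l => leviCivita i j k l) * E) =
      Matrix.of fun c d => ∑ a, ∑ b, θ a i * θ b j * leviCivita a b c d := by
  have hE' : E.transpose * θ.transpose = 1 := by
    rw [← Matrix.transpose_mul, hE, Matrix.transpose_one]
  have h1 : θ.transpose * (Matrix.of fun c d => ∑ a, ∑ b, θ a i * θ b j * leviCivita a b c d) * θ =
      θ.det • Matrix.of fun k l => leviCivita i j k l := by
    ext k l
    rw [sandwich_apply, Matrix.smul_apply, Matrix.of_apply, smul_eq_mul, ← sum_leviCivita_mul]
    simp only [Matrix.transpose_apply, Matrix.of_apply, Finset.mul_sum, Finset.sum_mul]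
    rw [sum_comm₄]
    exact Finset.sum_congr rfl fun a _ => Finset.sum_congr rfl fun b _ =>
      Finset.sum_congr rfl fun c _ => Finset.sum_congr rfl fun d _ => by ring
  rw [← Matrix.smul_mul, ← Matrix.mul_smul, ← h1]
  generalize (Matrix.of fun c d => ∑ a, ∑ b, θ a i * θ b j * leviCivita a b c d : Mat4) = f
  calc E.transpose * (θ.transpose * f * θ) * E = (E.transpose * θ.transpose) * f * (θ * E) := by
        simp only [Matrix.mul_assoc]
    _ = f := by rw [hE, hE']; simp

lemma det_transpose_mul_self (θ : Mat4) : (θ.transpose * θ).det = θ.det ^ 2 := by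
  rw [Matrix.det_mul, Matrix.det_transpose, sq]

lemma inv_transpose_mul_self (θ : Mat4) :
    (θ.transpose * θ)⁻¹ = θ⁻¹ * θ⁻¹.transpose := by
  rw [Matrix.mul_inv_rev, Matrix.transpose_nonsing_inv]

section

variable {h : E4 → Mat4} {u : E4} {θ : Mat4}

lemma raise_frame (hdet : 0 < θ.det) (hh : h u = θ.transpose * θ) (n : Mat4) :
    raise h u (θ.transpose * n * θ) = θ⁻¹ * n * θ⁻¹.transpose := by
  have hu : IsUnit θ.det := isUnit_iff_ne_zero.2 hdet.ne'
  have e1 : θ * θ⁻¹ = 1 := Matrix.mul_nonsing_inv θ hu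
  have e2 : θ⁻¹.transpose * θ.transpose = 1 := by
    rw [← Matrix.transpose_mul, e1, Matrix.transpose_one]
  unfold raise
  rw [hh, inv_transpose_mul_self, Matrix.transpose_mul, Matrix.transpose_transpose]
  calc θ⁻¹ * θ⁻¹.transpose * (θ.transpose * n * θ) * (θ⁻¹ * θ⁻¹.transpose)
      = θ⁻¹ * (θ⁻¹.transpose * θ.transpose) * n * (θ * θ⁻¹) * θ⁻¹.transpose := by
        simp only [Matrix.mul_assoc]
    _ = _ := by rw [e1, e2]; simp

lemma hodgeStar_frame (hdet : 0 < θ.det) (hh : h u = θ.transpose * θ) (n : Mat4) :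
    hodgeStar h u (θ.transpose * n * θ) = θ.transpose * frameStar n * θ := by
  have hu : IsUnit θ.det := isUnit_iff_ne_zero.2 hdet.ne'
  have e1 : θ * θ⁻¹ = 1 := Matrix.mul_nonsing_inv θ hu
  have h2 : ∀ i j k l, leviCivita i j k l =
      (Matrix.of fun k l => leviCivita i j k l : Mat4) k l := fun _ _ _ _ => rfl
  ext i j
  rw [sandwich_apply]
  unfold hodgeStar frameStar
  rw [raise_frame hdet hh, hh, det_transpose_mul_self, Real.sqrt_sq hdet.le]
  have h3 := leviCivita_contract e1 i j
  have h4 : ∑ k, ∑ l, leviCivita i j k l * (θ⁻¹ * n * θ⁻¹.transpose) k l =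
      ∑ c, ∑ d, (θ⁻¹.transpose * (Matrix.of fun k l => leviCivita i j k l) * θ⁻¹) c d * n c d := by
    have := sum_sandwich_mul e1
      (θ⁻¹.transpose * (Matrix.of fun k l => leviCivita i j k l) * θ⁻¹) n
    rw [← this]
    have e2 : θ⁻¹ * θ = 1 := Matrix.nonsing_inv_mul θ hu
    have e3 : θ.transpose * θ⁻¹.transpose = 1 := by
      rw [← Matrix.transpose_mul, e2, Matrix.transpose_one]
    have e4 : θ.transpose *
        (θ⁻¹.transpose * (Matrix.of fun k l => leviCivita i j k l : Mat4) * θ⁻¹) * θ =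
        Matrix.of fun k l => leviCivita i j k l := by
      calc _ = (θ.transpose * θ⁻¹.transpose) *
            (Matrix.of fun k l => leviCivita i j k l : Mat4) * (θ⁻¹ * θ) := by
            simp only [Matrix.mul_assoc]
        _ = _ := by rw [e2, e3]; simp
    rw [e4]
    rfl
  rw [h4, mul_assoc, Finset.mul_sum]
  have h5 : ∀ c d, θ.det * (θ⁻¹.transpose *
      (Matrix.of fun k l => leviCivita i j k l : Mat4) * θ⁻¹) c d =
      ∑ a, ∑ b, θ a i * θ b j * leviCivita a b c d := by
    intro c d
    have := congrFun (congrFun h3 c) d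
    simpa using this
  simp only [Finset.mul_sum, ← mul_assoc]
  simp only [mul_assoc (1 / 2 : ℝ), h5]
  simp only [Matrix.transpose_apply, Finset.mul_sum, Finset.sum_mul]
  rw [sum_comm₄]
  exact Finset.sum_congr rfl fun a _ => Finset.sum_congr rfl fun b _ =>
    Finset.sum_congr rfl fun c _ => Finset.sum_congr rfl fun d _ => by ring

/-- The curvature of `h` at `u`, written in the coframe `θ`, has components
`Rᵃᵦ꜀ₔ = Rm c d a b`. -/
structure IsFrameCurvature (h : E4 → Mat4) (u : E4) (θ : Mat4) (Rm : Fin 4 → Fin 4 → Mat4) :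
    Prop where
  det_pos : 0 < θ.det
  metric : h u = θ.transpose * θ
  curv : ∀ i j, (Matrix.of fun l k => riemann h u l k i j) =
    θ⁻¹ * (∑ c, ∑ d, (θ c i * θ d j) • Rm c d) * θ

namespace IsFrameCurvature

variable {Rm : Fin 4 → Fin 4 → Mat4}

lemma mul_inv (H : IsFrameCurvature h u θ Rm) : θ * θ⁻¹ = 1 :=
  Matrix.mul_nonsing_inv θ (isUnit_iff_ne_zero.2 H.det_pos.ne')

lemma inv_mul (H : IsFrameCurvature h u θ Rm) : θ⁻¹ * θ = 1 :=
  Matrix.nonsing_inv_mul θ (isUnit_iff_ne_zero.2 H.det_pos.ne')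

lemma lowered (H : IsFrameCurvature h u θ Rm) (l k i j : Fin 4) :
    ∑ m, h u l m * riemann h u m k i j =
      ∑ a, ∑ b, ∑ c, ∑ d, θ a l * θ b k * θ c i * θ d j * Rm c d a b := by
  have h1 : ∑ m, h u l m * riemann h u m k i j =
      (h u * Matrix.of fun l k => riemann h u l k i j) l k := by
    rw [Matrix.mul_apply]; rfl
  rw [h1, H.curv, H.metric]
  have h2 : θ.transpose * θ * (θ⁻¹ * (∑ c, ∑ d, (θ c i * θ d j) • Rm c d) * θ) =
      θ.transpose * (∑ c, ∑ d, (θ c i * θ d j) • Rm c d) * θ := by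
    calc _ = θ.transpose * (θ * θ⁻¹) * (∑ c, ∑ d, (θ c i * θ d j) • Rm c d) * θ := by
          simp only [Matrix.mul_assoc]
      _ = _ := by rw [H.mul_inv, Matrix.mul_one]
  rw [h2, sandwich_apply]
  simp only [Matrix.sum_apply, Matrix.smul_apply, smul_eq_mul, Matrix.transpose_apply,
    Finset.sum_mul, Finset.mul_sum]
  exact Finset.sum_congr rfl fun a _ => Finset.sum_congr rfl fun b _ =>
    Finset.sum_congr rfl fun c _ => Finset.sum_congr rfl fun d _ => by ring

lemma ricci_eq (H : IsFrameCurvature h u θ Rm) (k j : Fin 4) :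
    ricci h u k j = ∑ b, ∑ d, θ b k * θ d j * ∑ a, Rm a d a b := by
  have hE : ∀ a b, ∑ l, θ b l * θ⁻¹ l a = if b = a then 1 else 0 := by
    intro a b
    rw [← Matrix.mul_apply, H.mul_inv, Matrix.one_apply]
  unfold ricci
  have h1 : ∀ l, riemann h u l k l j =
      ∑ a, ∑ b, ∑ c, ∑ d, (θ c l * θ⁻¹ l a) * (θ b k * θ d j * Rm c d a b) := by
    intro l
    have := congrFun (congrFun (H.curv l j) l) k
    rw [Matrix.of_apply] at this
    rw [this, sandwich_apply]
    simp only [Matrix.sum_apply, Matrix.smul_apply, smul_eq_mul, Finset.sum_mul, Finset.mul_sum]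
    exact Finset.sum_congr rfl fun a _ => Finset.sum_congr rfl fun b _ =>
      Finset.sum_congr rfl fun c _ => Finset.sum_congr rfl fun d _ => by ring
  simp only [h1]
  rw [Finset.sum_comm]
  calc _ = ∑ a, ∑ b, ∑ c, ∑ d, (∑ l, θ c l * θ⁻¹ l a) * (θ b k * θ d j * Rm c d a b) := by
        refine Finset.sum_congr rfl fun a _ => ?_
        rw [Finset.sum_comm]
        refine Finset.sum_congr rfl fun b _ => ?_
        rw [Finset.sum_comm]
        refine Finset.sum_congr rfl fun c _ => ?_
        rw [Finset.sum_comm]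
        simp only [Finset.sum_mul]
    _ = ∑ a, ∑ b, ∑ d, θ b k * θ d j * Rm a d a b := by
        simp only [hE]
        refine Finset.sum_congr rfl fun a _ => Finset.sum_congr rfl fun b _ => ?_
        rw [Finset.sum_comm]
        refine Finset.sum_congr rfl fun d _ => ?_
        simp
    _ = _ := by
        rw [Finset.sum_comm]
        refine Finset.sum_congr rfl fun b _ => ?_
        rw [Finset.sum_comm]
        simp only [Finset.mul_sum]

/-- The action of the curvature on 2-forms in the frame. -/
def frameOp (Rm : Fin 4 → Fin 4 → Mat4) (n : Mat4) : Mat4 :=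
  fun a b => (1 / 2) * ∑ c, ∑ d, Rm c d a b * n c d

lemma weylOp_frame (H : IsFrameCurvature h u θ Rm) (hric : ∀ b d, ∑ a, Rm a d a b = 0) (n : Mat4) :
    weylOp h u (θ.transpose * n * θ) = θ.transpose * frameOp Rm n * θ := by
  have hr : ∀ k j, ricci h u k j = 0 := fun k j => by rw [H.ricci_eq]; simp [hric]
  ext i j
  rw [sandwich_apply]
  unfold weylOp weyl scal
  simp only [hr, H.lowered]
  rw [raise_frame H.det_pos H.metric]
  have key : ∀ a b, ∑ k, ∑ l, (∑ c, ∑ d, θ c k * θ d l * Rm c d a b) *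
      (θ⁻¹ * n * θ⁻¹.transpose) k l = ∑ c, ∑ d, Rm c d a b * n c d := by
    intro a b
    refine Eq.trans ?_ (sum_sandwich_mul H.mul_inv (Matrix.of fun c d => Rm c d a b) n)
    refine Finset.sum_congr rfl fun k _ => Finset.sum_congr rfl fun l _ => ?_
    congr 1
    rw [sandwich_apply]
    exact Finset.sum_congr rfl fun c _ => Finset.sum_congr rfl fun d _ => by
      simp only [Matrix.transpose_apply, Matrix.of_apply]; ring
  simp only [frameOp, ← key, Matrix.transpose_apply]
  simp only [mul_zero, sub_self, add_zero, Finset.sum_const_zero, zero_div, zero_mul, sub_zero]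
  generalize θ⁻¹ * n * θ⁻¹.transpose = m
  have h3 : ∀ k l, (∑ a, ∑ b, ∑ c, ∑ d, θ a i * θ b j * θ c k * θ d l * Rm c d a b) =
      ∑ a, ∑ b, θ a i * θ b j * ∑ c, ∑ d, θ c k * θ d l * Rm c d a b := by
    intro k l
    simp only [Finset.mul_sum]
    exact Finset.sum_congr rfl fun a _ => Finset.sum_congr rfl fun b _ =>
      Finset.sum_congr rfl fun c _ => Finset.sum_congr rfl fun d _ => by ring
  simp only [h3]
  let F : Fin 4 → Fin 4 → Fin 4 → Fin 4 → ℝ :=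
    fun k l a b => ∑ c, ∑ d, θ c k * θ d l * Rm c d a b
  have h4 : ∀ a b k l, (∑ c, ∑ d, θ c k * θ d l * Rm c d a b) = F k l a b := fun _ _ _ _ => rfl
  simp only [h4, Finset.mul_sum, Finset.sum_mul]
  rw [sum_comm₄]
  exact Finset.sum_congr rfl fun a _ => Finset.sum_congr rfl fun b _ =>
    Finset.sum_congr rfl fun c _ => Finset.sum_congr rfl fun d _ => by ring

end IsFrameCurvature
end
end ChenTeo
end

open Set Filter Topology Manifold Bundle
open scoped ContDiff

noncomputable section

namespace ChenTeo

/-- The self-dual 2-form `p (e⁰² - e¹³) + q (e⁰³ + e¹²) + r (e⁰¹ + e²³)`. -/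
def sd (p q r : ℝ) : Mat4 :=
  !![0, r, p, q; -r, 0, q, -p; -p, -q, 0, r; -q, p, -r, 0]

/-- The anti-self-dual 2-form `p (e⁰² + e¹³) + q (e⁰³ - e¹²) + r (e⁰¹ - e²³)`. -/
def asd (p q r : ℝ) : Mat4 :=
  !![0, r, p, q; -r, 0, -q, p; -p, q, 0, -r; -q, -p, r, 0]

lemma frameStar_eq (n : Mat4) : frameStar n =
    !![0, (n 2 3 - n 3 2) / 2, (n 3 1 - n 1 3) / 2, (n 1 2 - n 2 1) / 2;
      (n 3 2 - n 2 3) / 2, 0, (n 0 3 - n 3 0) / 2, (n 2 0 - n 0 2) / 2;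
      (n 1 3 - n 3 1) / 2, (n 3 0 - n 0 3) / 2, 0, (n 0 1 - n 1 0) / 2;
      (n 2 1 - n 1 2) / 2, (n 0 2 - n 2 0) / 2, (n 1 0 - n 0 1) / 2, 0] := by
  have key : ∀ a b, ∑ c, ∑ d, leviCivita a b c d * n c d =
      ∑ a', ∑ b', ∑ c, ∑ d, leviCivita a' b' c d * (if a' = a ∧ b' = b then n c d else 0) := by
    intro a b
    have h1 : ∀ a' b', (∑ c, ∑ d, leviCivita a' b' c d * (if a' = a ∧ b' = b then n c d else 0)) =
        if a' = a then if b' = b then ∑ c, ∑ d, leviCivita a b c d * n c d else 0 else 0 := by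
      intro a' b'
      by_cases ha : a' = a <;> by_cases hb : b' = b <;> simp [ha, hb]
    simp only [h1]
    simp
  ext a b
  unfold frameStar
  rw [key, sum_leviCivita]
  fin_cases a <;> fin_cases b <;> simp <;> ring

lemma skew_eq_sd_add_asd {n : Mat4} (hn : n.transpose = -n) :
    n = sd ((n 0 2 - n 1 3) / 2) ((n 0 3 + n 1 2) / 2) ((n 0 1 + n 2 3) / 2) +
      asd ((n 0 2 + n 1 3) / 2) ((n 0 3 - n 1 2) / 2) ((n 0 1 - n 2 3) / 2) := by
  have h : ∀ a b, n b a = -n a b := fun a b => congrFun (congrFun hn a) b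
  have h0 : ∀ a, n a a = 0 := fun a => by linarith [h a a]
  ext a b
  fin_cases a <;> fin_cases b <;> simp [sd, asd, h0] <;>
    linarith [h 0 1, h 0 2, h 0 3, h 1 2, h 1 3, h 2 3]

lemma sd_skew (p q r : ℝ) : (sd p q r).transpose = -sd p q r := by
  ext a b; fin_cases a <;> fin_cases b <;> simp [sd]

lemma asd_skew (p q r : ℝ) : (asd p q r).transpose = -asd p q r := by
  ext a b; fin_cases a <;> fin_cases b <;> simp [asd]

lemma frameStar_sd (p q r : ℝ) : frameStar (sd p q r) = sd p q r := by
  rw [frameStar_eq]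
  ext a b; fin_cases a <;> fin_cases b <;> simp [sd] <;> ring

lemma frameStar_asd (p q r : ℝ) : frameStar (asd p q r) = -asd p q r := by
  rw [frameStar_eq]
  ext a b; fin_cases a <;> fin_cases b <;> simp [asd] <;> ring

lemma exists_sd {n : Mat4} (hn : n.transpose = -n) (hs : frameStar n = n) :
    ∃ p q r, n = sd p q r := by
  refine ⟨n 0 2, n 0 3, n 0 1, ?_⟩
  have h : ∀ a b, n b a = -n a b := fun a b => congrFun (congrFun hn a) b
  rw [frameStar_eq] at hs
  have s := fun a b => congrFun (congrFun hs a) b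
  have s1 := s 0 1; have s2 := s 0 2; have s3 := s 0 3
  simp at s1 s2 s3
  have h0 : ∀ a, n a a = 0 := fun a => by linarith [h a a]
  ext a b
  fin_cases a <;> fin_cases b <;> simp [sd, h0] <;>
    linarith [h 0 1, h 0 2, h 0 3, h 1 2, h 1 3, h 2 3]

lemma exists_asd {n : Mat4} (hn : n.transpose = -n) (hs : frameStar n = -n) :
    ∃ p q r, n = asd p q r := by
  refine ⟨n 0 2, n 0 3, n 0 1, ?_⟩
  have h : ∀ a b, n b a = -n a b := fun a b => congrFun (congrFun hn a) b
  rw [frameStar_eq] at hs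
  have s := fun a b => congrFun (congrFun hs a) b
  have s1 := s 0 1; have s2 := s 0 2; have s3 := s 0 3
  simp at s1 s2 s3
  have h0 : ∀ a, n a a = 0 := fun a => by linarith [h a a]
  ext a b
  fin_cases a <;> fin_cases b <;> simp [asd, h0] <;>
    linarith [h 0 1, h 0 2, h 0 3, h 1 2, h 1 3, h 2 3]

lemma sd_inj {p q r p' q' r' : ℝ} (h : sd p q r = sd p' q' r') : p = p' ∧ q = q' ∧ r = r' := by
  have s := fun a b => congrFun (congrFun h a) b
  exact ⟨by simpa [sd] using s 0 2, by simpa [sd] using s 0 3, by simpa [sd] using s 0 1⟩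

lemma asd_inj {p q r p' q' r' : ℝ} (h : asd p q r = asd p' q' r') :
    p = p' ∧ q = q' ∧ r = r' := by
  have s := fun a b => congrFun (congrFun h a) b
  exact ⟨by simpa [asd] using s 0 2, by simpa [asd] using s 0 3, by simpa [asd] using s 0 1⟩

lemma smul_sd (c p q r : ℝ) : c • sd p q r = sd (c * p) (c * q) (c * r) := by
  ext a b; fin_cases a <;> fin_cases b <;> simp [sd]

lemma smul_asd (c p q r : ℝ) : c • asd p q r = asd (c * p) (c * q) (c * r) := by
  ext a b; fin_cases a <;> fin_cases b <;> simp [asd]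

lemma sd_add (p q r p' q' r' : ℝ) :
    sd p q r + sd p' q' r' = sd (p + p') (q + q') (r + r') := by
  ext a b; fin_cases a <;> fin_cases b <;> simp [sd] <;> ring

/-- The curvature with `W⁺ = diag (c, -c/2, -c/2)` and `W⁻` given by the symmetric matrix
`((β, γ, 0), (γ, -α - β, 0), (0, 0, α))`. -/
def curvModel (c α β γ : ℝ) (k l : Fin 4) : Mat4 :=
  (1 / 2 : ℝ) • (sd (c * sd 1 0 0 k l) (-c / 2 * sd 0 1 0 k l) (-c / 2 * sd 0 0 1 k l) +
    asd (β * asd 1 0 0 k l + γ * asd 0 1 0 k l)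
      (γ * asd 1 0 0 k l + (-α - β) * asd 0 1 0 k l) (α * asd 0 0 1 k l))

lemma curvModel_ricci (c α β γ : ℝ) (b d : Fin 4) : ∑ a, curvModel c α β γ a d a b = 0 := by
  rw [Fin.sum_univ_four]
  fin_cases b <;> fin_cases d <;> simp [curvModel, sd, asd] <;> ring

open IsFrameCurvature

lemma frameOp_curvModel (c α β γ : ℝ) (n : Mat4) :
    frameOp (curvModel c α β γ) n = (1 / 4 : ℝ) •
      (sd (c * ∑ k, ∑ l, sd 1 0 0 k l * n k l) (-c / 2 * ∑ k, ∑ l, sd 0 1 0 k l * n k l)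
        (-c / 2 * ∑ k, ∑ l, sd 0 0 1 k l * n k l) +
      asd (β * (∑ k, ∑ l, asd 1 0 0 k l * n k l) + γ * ∑ k, ∑ l, asd 0 1 0 k l * n k l)
        (γ * (∑ k, ∑ l, asd 1 0 0 k l * n k l) +
          (-α - β) * ∑ k, ∑ l, asd 0 1 0 k l * n k l)
        (α * ∑ k, ∑ l, asd 0 0 1 k l * n k l)) := by
  have sd_lin : ∀ (p q r : ℝ) a b, sd p q r a b =
      p * sd 1 0 0 a b + q * sd 0 1 0 a b + r * sd 0 0 1 a b := by
    intro p q r a b; fin_cases a <;> fin_cases b <;> simp [sd]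
  have asd_lin : ∀ (p q r : ℝ) a b, asd p q r a b =
      p * asd 1 0 0 a b + q * asd 0 1 0 a b + r * asd 0 0 1 a b := by
    intro p q r a b; fin_cases a <;> fin_cases b <;> simp [asd]
  ext a b
  simp only [frameOp, curvModel, Matrix.smul_apply, Matrix.add_apply, smul_eq_mul]
  obtain ⟨s1, s2, s3, hs⟩ : ∃ s1 s2 s3 : ℝ, ∀ p q r, sd p q r a b = p * s1 + q * s2 + r * s3 :=
    ⟨_, _, _, fun p q r => sd_lin p q r a b⟩
  obtain ⟨t1, t2, t3, ht⟩ : ∃ t1 t2 t3 : ℝ, ∀ p q r, asd p q r a b = p * t1 + q * t2 + r * t3 :=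
    ⟨_, _, _, fun p q r => asd_lin p q r a b⟩
  simp only [hs, ht]
  simp only [Finset.mul_sum, Finset.sum_mul, ← Finset.sum_add_distrib]
  exact Finset.sum_congr rfl fun k _ => Finset.sum_congr rfl fun l _ => by ring

lemma sum_sd_sd (p q r p' q' r' : ℝ) : ∑ c, ∑ d, sd p q r c d * sd p' q' r' c d =
    4 * (p * p' + q * q' + r * r') := by
  simp [Fin.sum_univ_four, sd]
  ring

lemma sum_asd_asd (p q r p' q' r' : ℝ) : ∑ c, ∑ d, asd p q r c d * asd p' q' r' c d =
    4 * (p * p' + q * q' + r * r') := by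
  simp [Fin.sum_univ_four, asd]
  ring

lemma sum_sd_asd (p q r p' q' r' : ℝ) : ∑ c, ∑ d, sd p q r c d * asd p' q' r' c d = 0 := by
  simp [Fin.sum_univ_four, asd, sd]
  ring

lemma sum_asd_sd (p q r p' q' r' : ℝ) : ∑ c, ∑ d, asd p q r c d * sd p' q' r' c d = 0 := by
  simp [Fin.sum_univ_four, asd, sd]
  ring

lemma sd_zero : sd 0 0 0 = 0 := by
  ext a b; fin_cases a <;> fin_cases b <;> simp [sd]

lemma asd_zero : asd 0 0 0 = 0 := by
  ext a b; fin_cases a <;> fin_cases b <;> simp [asd]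

lemma frameOp_curvModel_sd (c α β γ p q r : ℝ) :
    frameOp (curvModel c α β γ) (sd p q r) = sd (c * p) (-c / 2 * q) (-c / 2 * r) := by
  rw [frameOp_curvModel]
  simp only [sum_sd_sd, sum_asd_sd, mul_zero, add_zero, asd_zero, smul_sd]
  congr 1 <;> ring

lemma frameOp_curvModel_asd (c α β γ p q r : ℝ) :
    frameOp (curvModel c α β γ) (asd p q r) =
      asd (β * p + γ * q) (γ * p + (-α - β) * q) (α * r) := by
  rw [frameOp_curvModel]
  simp only [sum_asd_asd, sum_sd_asd, mul_zero, sd_zero, zero_add, smul_asd]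
  congr 1 <;> ring

section

variable {h : E4 → Mat4} {u : E4} {θ : Mat4}

lemma exists_frame_form (hdet : 0 < θ.det) (η : Mat4) : ∃ n : Mat4, η = θ.transpose * n * θ := by
  have hu : IsUnit θ.det := isUnit_iff_ne_zero.2 hdet.ne'
  have e1 : θ⁻¹ * θ = 1 := Matrix.nonsing_inv_mul θ hu
  have e2 : θ.transpose * θ⁻¹.transpose = 1 := by
    rw [← Matrix.transpose_mul, e1, Matrix.transpose_one]
  refine ⟨θ⁻¹.transpose * η * θ⁻¹, ?_⟩
  calc η = (θ.transpose * θ⁻¹.transpose) * η * (θ⁻¹ * θ) := by rw [e1, e2]; simp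
    _ = _ := by simp only [Matrix.mul_assoc]

lemma frame_form_inj (hdet : 0 < θ.det) {m n : Mat4}
    (H : θ.transpose * m * θ = θ.transpose * n * θ) : m = n := by
  have hu : IsUnit θ.det := isUnit_iff_ne_zero.2 hdet.ne'
  have e1 : θ * θ⁻¹ = 1 := Matrix.mul_nonsing_inv θ hu
  have e2 : θ⁻¹.transpose * θ.transpose = 1 := by
    rw [← Matrix.transpose_mul, e1, Matrix.transpose_one]
  have H' := congrArg (fun A => θ⁻¹.transpose * A * θ⁻¹) H
  have e : ∀ m : Mat4, θ⁻¹.transpose * (θ.transpose * m * θ) * θ⁻¹ = m := by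
    intro m
    calc _ = (θ⁻¹.transpose * θ.transpose) * m * (θ * θ⁻¹) := by simp only [Matrix.mul_assoc]
      _ = m := by rw [e1, e2]; simp
  simpa only [e] using H'

lemma frame_form_transpose (n : Mat4) :
    (θ.transpose * n * θ).transpose = θ.transpose * n.transpose * θ := by
  simp [Matrix.transpose_mul, Matrix.mul_assoc]

lemma frame_form_neg (n : Mat4) : -(θ.transpose * n * θ) = θ.transpose * (-n) * θ := by
  simp

lemma frame_form_smul (c : ℝ) (n : Mat4) :
    c • (θ.transpose * n * θ) = θ.transpose * (c • n) * θ := by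
  simp

lemma frame_form_add (m n : Mat4) :
    θ.transpose * m * θ + θ.transpose * n * θ = θ.transpose * (m + n) * θ := by
  rw [Matrix.mul_add, Matrix.add_mul]

lemma two_roots_ncard {b c d a : ℝ} (h1 : (b - d) ^ 2 + 4 * c ^ 2 ≠ 0)
    (h2 : (a - b) * (a - d) ≠ c ^ 2) :
    ({t : ℝ | t = a ∨ (t - b) * (t - d) = c ^ 2}).ncard = 3 := by
  have hp : 0 < (b - d) ^ 2 + 4 * c ^ 2 := lt_of_le_of_ne (by positivity) h1.symm
  set s := √((b - d) ^ 2 + 4 * c ^ 2) with hs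
  have s2 : s ^ 2 = (b - d) ^ 2 + 4 * c ^ 2 := Real.sq_sqrt hp.le
  have s0 : 0 < s := Real.sqrt_pos.2 hp
  have key : ∀ t, (t - b) * (t - d) = c ^ 2 ↔ t = (b + d + s) / 2 ∨ t = (b + d - s) / 2 := by
    intro t
    have : (t - b) * (t - d) - c ^ 2 = (t - (b + d + s) / 2) * (t - (b + d - s) / 2) := by
      linear_combination (1 / 4 : ℝ) * s2
    rw [← sub_eq_zero, this, mul_eq_zero, sub_eq_zero, sub_eq_zero]
  have e : {t : ℝ | t = a ∨ (t - b) * (t - d) = c ^ 2} =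
      {a, (b + d + s) / 2, (b + d - s) / 2} := by
    ext t; simp [key]
  have ha := fun h => h2 ((key a).2 h)
  rw [e, Set.ncard_eq_toFinset_card']
  have h3 : (b + d + s) / 2 ≠ (b + d - s) / 2 := fun h => by linarith
  have : ¬ (a = (b + d + s) / 2 ∨ a = (b + d - s) / 2) := ha
  rw [not_or] at this
  simp [h3, this.1, this.2]

lemma IsFrameCurvature.ricci_eq_zero {c α β γ : ℝ}
    (H : IsFrameCurvature h u θ (curvModel c α β γ)) (i j : Fin 4) : ricci h u i j = 0 := by
  rw [H.ricci_eq]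
  simp [curvModel_ricci]

/-- Anti-self-dual part of the Weyl tensor: three distinct eigenvalues. -/
lemma IsFrameCurvature.ncard_weylEigenvalues {c α β γ : ℝ}
    (H : IsFrameCurvature h u θ (curvModel c α β γ))
    (h1 : (α + 2 * β) ^ 2 + 4 * γ ^ 2 ≠ 0) (h2 : (α - β) * (2 * α + β) ≠ γ ^ 2) :
    (weylEigenvalues h u (-1)).ncard = 3 := by
  have hd := H.det_pos
  have hh := H.metric
  have hW := H.weylOp_frame (curvModel_ricci c α β γ)
  have e : weylEigenvalues h u (-1) =
      {t : ℝ | t = α ∨ (t - β) * (t - (-α - β)) = γ ^ 2} := by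
    ext t
    simp only [weylEigenvalues, mem_ofPred_eq]
    constructor
    · rintro ⟨η, h0, hsk, hst, hw⟩
      obtain ⟨n, rfl⟩ := exists_frame_form hd η
      rw [frame_form_transpose, frame_form_neg] at hsk
      rw [hodgeStar_frame hd hh, frame_form_smul] at hst
      rw [hW, frame_form_smul] at hw
      obtain ⟨p, q, r, rfl⟩ := exists_asd (frame_form_inj hd hsk)
        (by simpa using frame_form_inj hd hst)
      have hw' := frame_form_inj hd hw
      rw [frameOp_curvModel_asd, smul_asd] at hw'
      obtain ⟨w1, w2, w3⟩ := asd_inj hw'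
      by_cases hr : r = 0
      · right
        by_contra hne
        have hp : p * ((t - β) * (t - (-α - β)) - γ ^ 2) = 0 := by
          linear_combination (-(t - (-α - β))) * w1 - γ * w2
        have hq : q * ((t - β) * (t - (-α - β)) - γ ^ 2) = 0 := by
          linear_combination (-(t - β)) * w2 - γ * w1
        have hne' : (t - β) * (t - (-α - β)) - γ ^ 2 ≠ 0 := sub_ne_zero.2 hne
        have hp' := (mul_eq_zero.1 hp).resolve_right hne'
        have hq' := (mul_eq_zero.1 hq).resolve_right hne'
        apply h0
        have : asd p q r = 0 := by
          rw [hp', hq', hr, asd_zero]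
        rw [this]; simp
      · left
        exact (mul_right_cancel₀ hr w3).symm
    · intro ht
      have build : ∀ p q r, (p ≠ 0 ∨ q ≠ 0 ∨ r ≠ 0) → β * p + γ * q = t * p →
          γ * p + (-α - β) * q = t * q → α * r = t * r →
          ∃ η : Mat4, η ≠ 0 ∧ η.transpose = -η ∧ hodgeStar h u η = (-1 : ℝ) • η ∧
            weylOp h u η = t • η := by
        intro p q r hne w1 w2 w3
        refine ⟨θ.transpose * asd p q r * θ, ?_, ?_, ?_, ?_⟩
        · intro h0
          have : asd p q r = asd 0 0 0 := by
            apply frame_form_inj hd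
            rw [h0]
            simp [asd_zero]
          obtain ⟨rfl, rfl, rfl⟩ := asd_inj this
          simp at hne
        · rw [frame_form_transpose, frame_form_neg, asd_skew]
        · rw [hodgeStar_frame hd hh, frame_form_smul, frameStar_asd]; simp
        · rw [hW, frame_form_smul, frameOp_curvModel_asd, smul_asd, w1, w2, w3]
      rcases ht with rfl | ht
      · exact build 0 0 1 (by simp) (by ring) (by ring) (by ring)
      · by_cases hc : γ = 0
        · subst hc
          have ht' : t = β ∨ t = -α - β := by
            have : (t - β) * (t - (-α - β)) = 0 := by rw [ht]; ring
            rcases mul_eq_zero.1 this with h | h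
            · left; linarith
            · right; linarith
          rcases ht' with rfl | rfl
          · exact build 1 0 0 (by simp) (by ring) (by ring) (by ring)
          · exact build 0 1 0 (by simp) (by ring) (by ring) (by ring)
        · exact build γ (t - β) 0 (by simp [hc]) (by ring) (by linear_combination -ht) (by ring)
  rw [e]
  exact two_roots_ncard (by convert h1 using 1; ring) (by convert h2 using 2; ring)

/-- A criterion for `W⁺` to be of type `D`, stated without a frame. -/
lemma ncard_weylEigenvalues_of_formula {ψ : Mat4} {c : ℝ} (hdet : 0 < θ.det)
    (hh : h u = θ.transpose * θ) (hsk : ψ.transpose = -ψ) (hst : hodgeStar h u ψ = ψ)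
    (hnorm : ∑ i, ∑ j, ψ i j * raise h u ψ i j = 4) (hc : c ≠ 0)
    (hW : ∀ η : Mat4, η.transpose = -η → hodgeStar h u η = η →
      weylOp h u η = (-c / 2) • η +
        (3 * c / 8 * ∑ i, ∑ j, ψ i j * raise h u η i j) • ψ) :
    (weylEigenvalues h u 1).ncard = 2 := by
  have hu : IsUnit θ.det := isUnit_iff_ne_zero.2 hdet.ne'
  have e1 : θ * θ⁻¹ = 1 := Matrix.mul_nonsing_inv θ hu
  obtain ⟨n, rfl⟩ := exists_frame_form hdet ψ
  rw [frame_form_transpose, frame_form_neg] at hsk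
  rw [hodgeStar_frame hdet hh] at hst
  obtain ⟨p, q, r, rfl⟩ := exists_sd (frame_form_inj hdet hsk) (frame_form_inj hdet hst)
  have hpair : ∀ m n : Mat4, ∑ i, ∑ j, (θ.transpose * m * θ) i j *
      raise h u (θ.transpose * n * θ) i j = ∑ c, ∑ d, m c d * n c d := by
    intro m n
    rw [raise_frame hdet hh, sum_sandwich_mul e1]
  rw [hpair, sum_sd_sd] at hnorm
  have hW' : ∀ p' q' r' : ℝ, weylOp h u (θ.transpose * sd p' q' r' * θ) =
      θ.transpose * sd (-c / 2 * p' + 3 * c / 2 * (p * p' + q * q' + r * r') * p)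
        (-c / 2 * q' + 3 * c / 2 * (p * p' + q * q' + r * r') * q)
        (-c / 2 * r' + 3 * c / 2 * (p * p' + q * q' + r * r') * r) * θ := by
    intro p' q' r'
    rw [hW _ (by rw [frame_form_transpose, frame_form_neg, sd_skew])
      (by rw [hodgeStar_frame hdet hh, frameStar_sd]), hpair, sum_sd_sd, frame_form_smul,
      frame_form_smul, frame_form_add, smul_sd, smul_sd]
    rw [sd_add]
    congr 3 <;> ring
  have e : weylEigenvalues h u 1 = {c, -c / 2} := by
    ext t
    simp only [weylEigenvalues, mem_ofPred_eq, mem_insert_iff, mem_singleton_iff]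
    constructor
    · rintro ⟨η, h0, hsk', hst', hw⟩
      obtain ⟨n, rfl⟩ := exists_frame_form hdet η
      rw [frame_form_transpose, frame_form_neg] at hsk'
      rw [hodgeStar_frame hdet hh, one_smul] at hst'
      obtain ⟨p', q', r', rfl⟩ := exists_sd (frame_form_inj hdet hsk') (frame_form_inj hdet hst')
      rw [hW', frame_form_smul, smul_sd] at hw
      obtain ⟨w1, w2, w3⟩ := sd_inj (frame_form_inj hdet hw)
      by_contra hne
      rw [not_or] at hne
      have k : (t - c) * (p * p' + q * q' + r * r') = 0 := by
        linear_combination (-p) * w1 - q * w2 - r * w3 +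
          3 * c / 8 * (p * p' + q * q' + r * r') * hnorm
      have k' := (mul_eq_zero.1 k).resolve_left (sub_ne_zero.2 hne.1)
      rw [k'] at w1 w2 w3
      have ht : t + c / 2 ≠ 0 := fun h => hne.2 (by linarith)
      have z : ∀ s, (t + c / 2) * s = 0 → s = 0 := fun s hs => (mul_eq_zero.1 hs).resolve_left ht
      have p0 := z p' (by linear_combination -w1)
      have q0 := z q' (by linear_combination -w2)
      have r0 := z r' (by linear_combination -w3)
      apply h0
      rw [p0, q0, r0, sd_zero]; simp
    · have build : ∀ p' q' r', (p' ≠ 0 ∨ q' ≠ 0 ∨ r' ≠ 0) →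
          (-c / 2 * p' + 3 * c / 2 * (p * p' + q * q' + r * r') * p = t * p') →
          (-c / 2 * q' + 3 * c / 2 * (p * p' + q * q' + r * r') * q = t * q') →
          (-c / 2 * r' + 3 * c / 2 * (p * p' + q * q' + r * r') * r = t * r') →
          ∃ η : Mat4, η ≠ 0 ∧ η.transpose = -η ∧ hodgeStar h u η = (1 : ℝ) • η ∧
            weylOp h u η = t • η := by
        intro p' q' r' hne w1 w2 w3
        refine ⟨θ.transpose * sd p' q' r' * θ, ?_, ?_, ?_, ?_⟩
        · intro h0
          have : sd p' q' r' = sd 0 0 0 := by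
            apply frame_form_inj hdet
            rw [h0, sd_zero]; simp
          obtain ⟨rfl, rfl, rfl⟩ := sd_inj this
          simp at hne
        · rw [frame_form_transpose, frame_form_neg, sd_skew]
        · rw [hodgeStar_frame hdet hh, one_smul, frameStar_sd]
        · rw [hW', frame_form_smul, smul_sd, w1, w2, w3]
      have hne : p ≠ 0 ∨ q ≠ 0 ∨ r ≠ 0 := by
        by_contra hcon
        simp only [not_or, not_not] at hcon
        obtain ⟨rfl, rfl, rfl⟩ := hcon
        norm_num at hnorm
      have hn1 : p * p + q * q + r * r = 1 := by linarith
      rintro (rfl | rfl)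
      · exact build p q r hne (by rw [hn1]; ring) (by rw [hn1]; ring) (by rw [hn1]; ring)
      · by_cases hpq : p ≠ 0 ∨ q ≠ 0
        · refine build (-q) p 0 ?_ (by ring) (by ring) (by ring)
          rcases hpq with h | h
          · simp [h]
          · simp [h]
        · simp only [not_or, not_not] at hpq
          obtain ⟨rfl, rfl⟩ := hpq
          exact build 1 0 0 (by simp) (by ring) (by ring) (by ring)
  rw [e, Set.ncard_pair]
  intro h
  apply hc
  linarith

end
end ChenTeo
end

open Set Filter Topology Manifold Bundle
open scoped ContDiff

noncomputable section

namespace ChenTeo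

/-! ## The curvature from a moving frame -/

section pd

variable {V : Set E4} {u : E4} {f g : E4 → ℝ}

lemma pd_add (i : Fin 4) (hf : DifferentiableAt ℝ f u) (hg : DifferentiableAt ℝ g u) :
    pd i (fun v => f v + g v) u = pd i f u + pd i g u := by
  unfold pd; rw [fderiv_fun_add hf hg]; rfl

lemma pd_sub (i : Fin 4) (hf : DifferentiableAt ℝ f u) (hg : DifferentiableAt ℝ g u) :
    pd i (fun v => f v - g v) u = pd i f u - pd i g u := by
  unfold pd; rw [fderiv_fun_sub hf hg]; rfl

lemma pd_mul (i : Fin 4) (hf : DifferentiableAt ℝ f u) (hg : DifferentiableAt ℝ g u) :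
    pd i (fun v => f v * g v) u = pd i f u * g u + f u * pd i g u := by
  unfold pd; rw [fderiv_fun_mul hf hg]; simp; ring

lemma pd_sum {ι : Type*} (s : Finset ι) (i : Fin 4) {F : ι → E4 → ℝ}
    (hF : ∀ k ∈ s, DifferentiableAt ℝ (F k) u) :
    pd i (fun v => ∑ k ∈ s, F k v) u = ∑ k ∈ s, pd i (F k) u := by
  unfold pd; rw [fderiv_fun_sum hF]; simp

lemma pd_congr (i : Fin 4) (h : f =ᶠ[𝓝 u] g) : pd i f u = pd i g u := by
  unfold pd; rw [h.fderiv_eq]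

lemma pd_const (i : Fin 4) (c : ℝ) : pd i (fun _ => c) u = 0 := by
  unfold pd; simp

lemma contDiffOn_pd (hV : IsOpen V) (i : Fin 4) (hf : ContDiffOn ℝ ∞ f V) :
    ContDiffOn ℝ ∞ (pd i f) V :=
  (hf.fderiv_of_isOpen hV (m := ∞) (by simp)).clm_apply contDiffOn_const

lemma pd_comm (hV : IsOpen V) (hu : u ∈ V) (i j : Fin 4) (hf : ContDiffOn ℝ ∞ f V) :
    pd i (pd j f) u = pd j (pd i f) u := by
  have hc : ContDiffAt ℝ ∞ f u := hf.contDiffAt (hV.mem_nhds hu)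
  have hs : IsSymmSndFDerivAt ℝ f u := hc.isSymmSndFDerivAt (by simpa using (WithTop.coe_le_coe.2 (le_top : (2 : ℕ∞) ≤ ⊤)))
  have hd : DifferentiableAt ℝ (fderiv ℝ f) u :=
    (hc.fderiv_right (m := ∞) (by simp)).differentiableAt (by simp)
  have key : ∀ i j, pd i (pd j f) u = fderiv ℝ (fderiv ℝ f) u (EuclideanSpace.single i 1)
      (EuclideanSpace.single j 1) := by
    intro i j
    unfold pd
    rw [fderiv_clm_apply hd (by fun_prop)]
    simp
  rw [key, key]
  exact hs _ _

lemma diffAt_of_contDiffOn (hf : ContDiffOn ℝ ∞ f V) (hV : IsOpen V) (hu : u ∈ V) :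
    DifferentiableAt ℝ f u :=
  (hf.contDiffAt (hV.mem_nhds hu)).differentiableAt (by simp)

end pd

/-- A matrix-valued function with smooth entries. -/
def SmoothMat (V : Set E4) (A : E4 → Mat4) : Prop := ∀ a b, ContDiffOn ℝ ∞ (fun v => A v a b) V

/-- The entrywise partial derivative. -/
def pdM (i : Fin 4) (A : E4 → Mat4) (u : E4) : Mat4 := Matrix.of fun a b => pd i (fun v => A v a b) u

section SmoothMat

variable {V : Set E4} {u : E4} {A B : E4 → Mat4}

lemma SmoothMat.mul (hA : SmoothMat V A) (hB : SmoothMat V B) :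
    SmoothMat V (fun v => A v * B v) := by
  intro a b
  simp only [Matrix.mul_apply]
  exact ContDiffOn.sum fun c _ => (hA a c).mul (hB c b)

lemma SmoothMat.add (hA : SmoothMat V A) (hB : SmoothMat V B) :
    SmoothMat V (fun v => A v + B v) := fun a b => (hA a b).add (hB a b)

lemma SmoothMat.neg (hA : SmoothMat V A) : SmoothMat V (fun v => -A v) := fun a b => (hA a b).neg

lemma SmoothMat.transpose (hA : SmoothMat V A) : SmoothMat V (fun v => (A v).transpose) :=
  fun a b => hA b a

lemma SmoothMat.pdM (hV : IsOpen V) (i : Fin 4) (hA : SmoothMat V A) : SmoothMat V (pdM i A) :=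
  fun a b => contDiffOn_pd hV i (hA a b)

lemma SmoothMat.det (hA : SmoothMat V A) : ContDiffOn ℝ ∞ (fun v => (A v).det) V := by
  simp only [Matrix.det_apply']
  exact ContDiffOn.sum fun σ _ => contDiffOn_const.mul (contDiffOn_prod fun i _ => hA _ _)

lemma SmoothMat.inv (hA : SmoothMat V A) (h0 : ∀ v ∈ V, (A v).det ≠ 0) :
    SmoothMat V (fun v => (A v)⁻¹) := by
  intro a b
  have h1 : SmoothMat V (fun v => (A v).updateRow b (Pi.single a 1)) := by
    intro c d
    by_cases h : c = b
    · subst h; simpa using contDiffOn_const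
    · simpa [Matrix.updateRow_ne h] using hA c d
  have h2 : ∀ v ∈ V, (A v)⁻¹ a b = (A v).det⁻¹ * ((A v).updateRow b (Pi.single a 1)).det := by
    intro v _
    rw [Matrix.inv_def, Matrix.smul_apply, Matrix.adjugate_apply, Ring.inverse_eq_inv', smul_eq_mul]
  exact ((hA.det.inv h0).mul h1.det).congr h2

lemma pdM_mul (hV : IsOpen V) (hu : u ∈ V) (i : Fin 4) (hA : SmoothMat V A) (hB : SmoothMat V B) :
    pdM i (fun v => A v * B v) u = pdM i A u * B u + A u * pdM i B u := by
  ext a b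
  simp only [pdM, Matrix.of_apply, Matrix.add_apply, Matrix.mul_apply]
  rw [pd_sum]
  · rw [← Finset.sum_add_distrib]
    exact Finset.sum_congr rfl fun c _ =>
      pd_mul i (diffAt_of_contDiffOn (hA a c) hV hu) (diffAt_of_contDiffOn (hB c b) hV hu)
  · exact fun c _ => (diffAt_of_contDiffOn (hA a c) hV hu).mul (diffAt_of_contDiffOn (hB c b) hV hu)

lemma pdM_add (hV : IsOpen V) (hu : u ∈ V) (i : Fin 4) (hA : SmoothMat V A) (hB : SmoothMat V B) :
    pdM i (fun v => A v + B v) u = pdM i A u + pdM i B u := by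
  ext a b
  exact pd_add i (diffAt_of_contDiffOn (hA a b) hV hu) (diffAt_of_contDiffOn (hB a b) hV hu)

lemma pdM_congr (hV : IsOpen V) (hu : u ∈ V) (i : Fin 4) (h : ∀ v ∈ V, A v = B v) :
    pdM i A u = pdM i B u := by
  ext a b
  exact pd_congr i (Filter.eventually_of_mem (hV.mem_nhds hu) fun v hv => by
    simp only [h v hv])

lemma pdM_comm (hV : IsOpen V) (hu : u ∈ V) (i j : Fin 4) (hA : SmoothMat V A) :
    pdM i (pdM j A) u = pdM j (pdM i A) u := by
  ext a b
  exact pd_comm hV hu i j (hA a b)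

lemma pdM_inv (hV : IsOpen V) (hu : u ∈ V) (i : Fin 4) (hA : SmoothMat V A)
    (h0 : ∀ v ∈ V, (A v).det ≠ 0) :
    pdM i (fun v => (A v)⁻¹) u = -((A u)⁻¹ * pdM i A u * (A u)⁻¹) := by
  have h1 : pdM i (fun v => (A v)⁻¹ * A v) u = 0 := by
    rw [pdM_congr (B := fun _ => 1) hV hu]
    · ext a b; simp [pdM, pd_const]
    · intro v hv
      exact Matrix.nonsing_inv_mul _ (isUnit_iff_ne_zero.2 (h0 v hv))
  rw [pdM_mul hV hu i (hA.inv h0) hA] at h1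
  have e : A u * (A u)⁻¹ = 1 := Matrix.mul_nonsing_inv _ (isUnit_iff_ne_zero.2 (h0 u hu))
  have h2 := congrArg (· * (A u)⁻¹) h1
  simp only [Matrix.add_mul, Matrix.mul_assoc, e, Matrix.mul_one, Matrix.zero_mul] at h2
  rw [eq_neg_of_add_eq_zero_left h2, Matrix.mul_assoc]

end SmoothMat

/-- The Christoffel symbols as a matrix-valued 1-form. -/
def gammaM (h : E4 → Mat4) (i : Fin 4) (u : E4) : Mat4 := Matrix.of fun l k => christoffel h l i k u

lemma riemann_eq_gammaM (h : E4 → Mat4) (u : E4) (i j : Fin 4) :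
    (Matrix.of fun l k => riemann h u l k i j) =
      pdM i (gammaM h j) u - pdM j (gammaM h i) u + gammaM h i u * gammaM h j u
        - gammaM h j u * gammaM h i u := by
  ext l k
  simp only [riemann, Matrix.of_apply, pdM, gammaM, Matrix.add_apply, Matrix.sub_apply,
    Matrix.mul_apply, Finset.sum_sub_distrib]
  ring

lemma smoothMat_gammaM {V : Set E4} (hV : IsOpen V) {h : E4 → Mat4} (hh : SmoothMat V h)
    (h0 : ∀ v ∈ V, (h v).det ≠ 0) (i : Fin 4) : SmoothMat V (gammaM h i) := by
  intro l k
  simp only [gammaM, Matrix.of_apply]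
  unfold christoffel
  refine contDiffOn_const.mul (ContDiffOn.sum fun m _ => (hh.inv h0 l m).mul ?_)
  exact ((contDiffOn_pd hV _ (hh _ _)).add (contDiffOn_pd hV _ (hh _ _))).sub
    (contDiffOn_pd hV _ (hh _ _))

/-- An orthonormal coframe `θ` of the metric `h` on the open set `V` with its connection form. -/
structure IsCartanFrame (V : Set E4) (h θ : E4 → Mat4) (Ω : Fin 4 → E4 → Mat4) : Prop where
  isOpen : IsOpen V
  det_pos : ∀ v ∈ V, 0 < (θ v).det
  metric : ∀ v ∈ V, h v = (θ v).transpose * θ v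
  smooth : SmoothMat V θ
  smooth_conn : ∀ i, SmoothMat V (Ω i)
  skew : ∀ i, ∀ v ∈ V, (Ω i v).transpose = -Ω i v
  torsion : ∀ v ∈ V, ∀ a i j, (pdM i θ v + Ω i v * θ v) a j = (pdM j θ v + Ω j v * θ v) a i

namespace IsCartanFrame

variable {V : Set E4} {h θ : E4 → Mat4} {Ω : Fin 4 → E4 → Mat4}

lemma gammaM_eq (H : IsCartanFrame V h θ Ω) {v : E4} (hv : v ∈ V) (i : Fin 4) :
    gammaM h i v = (θ v)⁻¹ * (pdM i θ v + Ω i v * θ v) := by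
  have hdet := H.det_pos v hv
  have hu : IsUnit (θ v).det := isUnit_iff_ne_zero.2 hdet.ne'
  set D : Fin 4 → Mat4 := fun i => pdM i θ v + Ω i v * θ v with hD
  have hdh : ∀ i j l, pd i (fun w => h w j l) v =
      ((D i).transpose * θ v + (θ v).transpose * D i) j l := by
    intro i j l
    have e1 : pd i (fun w => h w j l) v = pdM i (fun w => (θ w).transpose * θ w) v j l := by
      have := congrFun (congrFun (pdM_congr (A := h) H.isOpen hv i H.metric) j) l
      exact this
    rw [e1, pdM_mul H.isOpen hv i H.smooth.transpose H.smooth]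
    have e2 : pdM i (fun w => (θ w).transpose) v = (pdM i θ v).transpose := rfl
    rw [e2]
    refine congrFun (congrFun ?_ j) l
    simp only [hD, Matrix.transpose_add, Matrix.transpose_mul, Matrix.add_mul, Matrix.mul_add]
    rw [H.skew i v hv, Matrix.mul_neg, Matrix.neg_mul, Matrix.mul_assoc]
    abel
  have hsym : ∀ a i j, D i a j = D j a i := fun a i j => H.torsion v hv a i j
  ext m j
  simp only [gammaM, Matrix.of_apply]
  unfold christoffel
  have e3 : ∀ l, pd i (fun w => h w j l) v + pd j (fun w => h w i l) v - pd l (fun w => h w i j) v =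
      2 * ((θ v).transpose * D i) l j := by
    intro l
    simp only [hdh, Matrix.add_apply, Matrix.mul_apply, Matrix.transpose_apply]
    simp only [hsym _ j i, hsym _ l i, hsym _ l j]
    rw [← Finset.sum_add_distrib, ← Finset.sum_add_distrib, ← Finset.sum_add_distrib,
      ← Finset.sum_add_distrib, ← Finset.sum_sub_distrib, Finset.mul_sum]
    exact Finset.sum_congr rfl fun a _ => by ring
  simp only [e3]
  have e4 : (θ v)⁻¹ * D i = (h v)⁻¹ * ((θ v).transpose * D i) := by
    have e5 : (θ v).transpose⁻¹ * (θ v).transpose = 1 :=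
      Matrix.nonsing_inv_mul _ (by rwa [Matrix.det_transpose])
    rw [H.metric v hv, Matrix.mul_inv_rev, Matrix.mul_assoc, ← Matrix.mul_assoc _ _ (D i), e5,
      Matrix.one_mul]
  rw [e4, Matrix.mul_apply, Finset.mul_sum]
  exact Finset.sum_congr rfl fun l _ => by ring

lemma riemann_eq (H : IsCartanFrame V h θ Ω) {v : E4} (hv : v ∈ V) (i j : Fin 4) :
    (Matrix.of fun l k => riemann h v l k i j) =
      (θ v)⁻¹ * (pdM i (Ω j) v - pdM j (Ω i) v + Ω i v * Ω j v - Ω j v * Ω i v) * θ v := by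
  have h0 : ∀ v ∈ V, (θ v).det ≠ 0 := fun v hv => (H.det_pos v hv).ne'
  have hu : IsUnit (θ v).det := isUnit_iff_ne_zero.2 (h0 v hv)
  have e : θ v * (θ v)⁻¹ = 1 := Matrix.mul_nonsing_inv _ hu
  have hd : ∀ i j, pdM i (gammaM h j) v =
      -((θ v)⁻¹ * pdM i θ v * (θ v)⁻¹) * (pdM j θ v + Ω j v * θ v) +
        (θ v)⁻¹ * (pdM i (pdM j θ) v + (pdM i (Ω j) v * θ v + Ω j v * pdM i θ v)) := by
    intro i j
    have s1 := (H.smooth_conn j).mul H.smooth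
    have s2 := SmoothMat.pdM H.isOpen j H.smooth
    rw [pdM_congr (B := fun v => (θ v)⁻¹ * (pdM j θ v + Ω j v * θ v)) H.isOpen hv i
        (fun v hv => H.gammaM_eq hv j),
      pdM_mul H.isOpen hv i (H.smooth.inv h0) (s2.add s1), pdM_inv H.isOpen hv i H.smooth h0,
      pdM_add H.isOpen hv i s2 s1, pdM_mul H.isOpen hv i (H.smooth_conn j) H.smooth]
  rw [riemann_eq_gammaM, hd i j, hd j i, H.gammaM_eq hv, H.gammaM_eq hv,
    pdM_comm H.isOpen hv i j H.smooth]
  have k : ∀ A B : Mat4, (θ v)⁻¹ * A * ((θ v)⁻¹ * B) = (θ v)⁻¹ * A * (θ v)⁻¹ * B := by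
    intro A B; rw [Matrix.mul_assoc ((θ v)⁻¹ * A)]
  have k2 : ∀ A : Mat4, θ v * ((θ v)⁻¹ * A) = A := by
    intro A; rw [← Matrix.mul_assoc, e, Matrix.one_mul]
  simp only [Matrix.mul_add, Matrix.add_mul, Matrix.mul_sub, Matrix.sub_mul, Matrix.neg_mul,
    Matrix.mul_assoc, k2]
  abel

end IsCartanFrame

/-- The first Bianchi identity. -/
lemma riemann_bianchi {h : E4 → Mat4} {u : E4} (hs : ∀ᶠ v in 𝓝 u, (h v).transpose = h v)
    (l k i j : Fin 4) : riemann h u l k i j + riemann h u l i j k + riemann h u l j k i = 0 := by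
  have hg : ∀ m i j, ∀ᶠ v in 𝓝 u, christoffel h m i j v = christoffel h m j i v := by
    intro m i j
    filter_upwards [hs.eventually_nhds] with v hv
    unfold christoffel
    have h3 : ∀ l, pd l (fun w => h w i j) v = pd l (fun w => h w j i) v := fun l =>
      pd_congr l (hv.mono fun w hw => congrFun (congrFun hw j) i)
    congr 1
    exact Finset.sum_congr rfl fun l _ => by rw [h3]; ring
  have hp : ∀ n m i j, pd n (christoffel h m i j) u = pd n (christoffel h m j i) u :=
    fun n m i j => pd_congr n (hg m i j)
  have hv := fun m i j => (hg m i j).self_of_nhds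
  unfold riemann
  rw [hp i l j k, hp j l k i, hp k l i j]
  simp only [Finset.sum_sub_distrib]
  have e1 : ∑ m, christoffel h l i m u * christoffel h m j k u =
      ∑ m, christoffel h l i m u * christoffel h m k j u :=
    Finset.sum_congr rfl fun m _ => by rw [hv m j k]
  have e2 : ∑ m, christoffel h l j m u * christoffel h m k i u =
      ∑ m, christoffel h l j m u * christoffel h m i k u :=
    Finset.sum_congr rfl fun m _ => by rw [hv m k i]
  have e3 : ∑ m, christoffel h l k m u * christoffel h m i j u =
      ∑ m, christoffel h l k m u * christoffel h m j i u :=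
    Finset.sum_congr rfl fun m _ => by rw [hv m i j]
  rw [e1, e2, e3]
  ring

end ChenTeo
end

open Set Filter Topology Manifold Bundle
open scoped ContDiff

noncomputable section

namespace ChenTeo

/-! ## Torus-invariant frames -/

/-- The partial derivatives `∂ₓ, ∂ᵧ, ∂_τ, ∂_φ` of a function of `(x, y)`. -/
def dir (A : Fin 4) (f : ℝ × ℝ → ℝ) (p : ℝ × ℝ) : ℝ :=
  ![fderiv ℝ f p (1, 0), fderiv ℝ f p (0, 1), 0, 0] A

/-- Entrywise derivative. -/
def dirM (A : Fin 4) (c : ℝ × ℝ → Mat4) (p : ℝ × ℝ) : Mat4 :=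
  Matrix.of fun a b => dir A (fun q => c q a b) p

/-- Functions `(x, y) = prj` and closed 1-forms `dτ = T`, `dφ = Φ` on an open set of a chart which
form a positively oriented coframe together with `dx, dy`. -/
structure ToricCoords (V : Set E4) (W : Set (ℝ × ℝ)) (prj : E4 → ℝ × ℝ) (T Φ : Fin 4 → E4 → ℝ)
    (ξ : E4 → Mat4) : Prop where
  isOpen : IsOpen V
  isOpen' : IsOpen W
  mapsTo : ∀ v ∈ V, prj v ∈ W
  smooth_fst : ContDiffOn ℝ ∞ (fun v => (prj v).1) V
  smooth_snd : ContDiffOn ℝ ∞ (fun v => (prj v).2) V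
  smooth_T : ∀ i, ContDiffOn ℝ ∞ (T i) V
  smooth_Φ : ∀ i, ContDiffOn ℝ ∞ (Φ i) V
  closed_T : ∀ v ∈ V, ∀ i j, pd i (T j) v = pd j (T i) v
  closed_Φ : ∀ v ∈ V, ∀ i j, pd i (Φ j) v = pd j (Φ i) v
  coframe : ∀ v, ξ v = Matrix.of fun A i =>
    ![pd i (fun w => (prj w).1) v, pd i (fun w => (prj w).2) v, T i v, Φ i v] A
  det_pos : ∀ v ∈ V, 0 < (ξ v).det

namespace ToricCoords

variable {V : Set E4} {W : Set (ℝ × ℝ)} {prj : E4 → ℝ × ℝ} {T Φ : Fin 4 → E4 → ℝ} {ξ : E4 → Mat4}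

lemma smooth_prj (H : ToricCoords V W prj T Φ ξ) : ContDiffOn ℝ ∞ prj V :=
  H.smooth_fst.prodMk H.smooth_snd

lemma smooth_comp (H : ToricCoords V W prj T Φ ξ) {f : ℝ × ℝ → ℝ} (hf : ContDiffOn ℝ ∞ f W) :
    ContDiffOn ℝ ∞ (fun v => f (prj v)) V :=
  hf.comp H.smooth_prj H.mapsTo

lemma smooth_ξ (H : ToricCoords V W prj T Φ ξ) : SmoothMat V ξ := by
  intro A i
  simp only [H.coframe, Matrix.of_apply]
  fin_cases A
  · exact contDiffOn_pd H.isOpen i H.smooth_fst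
  · exact contDiffOn_pd H.isOpen i H.smooth_snd
  · exact H.smooth_T i
  · exact H.smooth_Φ i

lemma closed_ξ (H : ToricCoords V W prj T Φ ξ) {v : E4} (hv : v ∈ V) (A i j : Fin 4) :
    pd i (fun w => ξ w A j) v = pd j (fun w => ξ w A i) v := by
  simp only [H.coframe, Matrix.of_apply]
  fin_cases A
  · exact pd_comm H.isOpen hv i j H.smooth_fst
  · exact pd_comm H.isOpen hv i j H.smooth_snd
  · exact H.closed_T v hv i j
  · exact H.closed_Φ v hv i j

lemma pd_comp (H : ToricCoords V W prj T Φ ξ) {f : ℝ × ℝ → ℝ} (hf : ContDiffOn ℝ ∞ f W) {v : E4}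
    (hv : v ∈ V) (i : Fin 4) : pd i (fun w => f (prj w)) v = ∑ A, ξ v A i * dir A f (prj v) := by
  have h1 : DifferentiableAt ℝ f (prj v) :=
    (hf.contDiffAt (H.isOpen'.mem_nhds (H.mapsTo v hv))).differentiableAt (by simp)
  have h2 : DifferentiableAt ℝ (fun v => (prj v).1) v := diffAt_of_contDiffOn H.smooth_fst H.isOpen hv
  have h3 : DifferentiableAt ℝ (fun v => (prj v).2) v := diffAt_of_contDiffOn H.smooth_snd H.isOpen hv
  have h4 : HasFDerivAt prj ((fderiv ℝ (fun v => (prj v).1) v).prod (fderiv ℝ (fun v => (prj v).2) v)) v :=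
    h2.hasFDerivAt.prodMk h3.hasFDerivAt
  have h5 := (h1.hasFDerivAt.comp v h4).fderiv
  have h6 : pd i (fun w => f (prj w)) v = fderiv ℝ f (prj v)
      (pd i (fun w => (prj w).1) v, pd i (fun w => (prj w).2) v) := by
    have : (fun w => f (prj w)) = f ∘ prj := rfl
    unfold pd
    rw [this, h5]
    rfl
  rw [h6, Fin.sum_univ_four]
  simp only [H.coframe, Matrix.of_apply, dir]
  simp
  generalize pd i (fun w => (prj w).1) v = a
  generalize pd i (fun w => (prj w).2) v = b
  have : ((a, b) : ℝ × ℝ) = a • (1, 0) + b • (0, 1) := by simp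
  rw [this, map_add, map_smul, map_smul]
  simp

lemma pdM_comp (H : ToricCoords V W prj T Φ ξ) {c : ℝ × ℝ → Mat4}
    (hc : ∀ a b, ContDiffOn ℝ ∞ (fun q => c q a b) W) {v : E4}
    (hv : v ∈ V) (i : Fin 4) : pdM i (fun w => c (prj w)) v = ∑ A, ξ v A i • dirM A c (prj v) := by
  ext a b
  simp only [pdM, Matrix.of_apply, Matrix.sum_apply, Matrix.smul_apply, dirM, smul_eq_mul]
  exact H.pd_comp (hc a b) hv i

end ToricCoords

/-- The components of `dω + ω ∧ ω` of a torus-invariant connection form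
`ω = w₀ dx + w₁ dy + w₂ dτ + w₃ dφ`. -/
def toricCurv (w : Fin 4 → ℝ × ℝ → Mat4) (A B : Fin 4) (p : ℝ × ℝ) : Mat4 :=
  dirM A (w B) p - dirM B (w A) p + w A p * w B p - w B p * w A p

/-- A torus-invariant orthonormal coframe with its connection form. -/
structure IsToricFrame (W : Set (ℝ × ℝ)) (c : ℝ × ℝ → Mat4) (w : Fin 4 → ℝ × ℝ → Mat4) :
    Prop where
  smooth : ∀ a b, ContDiffOn ℝ ∞ (fun q => c q a b) W
  smooth_conn : ∀ A a b, ContDiffOn ℝ ∞ (fun q => w A q a b) W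
  det_pos : ∀ p ∈ W, 0 < (c p).det
  skew : ∀ A, ∀ p ∈ W, (w A p).transpose = -w A p
  torsion : ∀ p ∈ W, ∀ a A B,
    dir A (fun q => c q a B) p + (w A p * c p) a B = dir B (fun q => c q a A) p + (w B p * c p) a A

section

variable {V : Set E4} {W : Set (ℝ × ℝ)} {prj : E4 → ℝ × ℝ} {T Φ : Fin 4 → E4 → ℝ} {ξ : E4 → Mat4}
variable {c : ℝ × ℝ → Mat4} {w : Fin 4 → ℝ × ℝ → Mat4} {h : E4 → Mat4}

lemma IsToricFrame.isCartanFrame (F : IsToricFrame W c w) (H : ToricCoords V W prj T Φ ξ)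
    (hh : ∀ v ∈ V, h v = (c (prj v) * ξ v).transpose * (c (prj v) * ξ v)) :
    IsCartanFrame V h (fun v => c (prj v) * ξ v) (fun i v => ∑ A, ξ v A i • w A (prj v)) where
  isOpen := H.isOpen
  det_pos v hv := by
    rw [Matrix.det_mul]
    exact mul_pos (F.det_pos _ (H.mapsTo v hv)) (H.det_pos v hv)
  metric := hh
  smooth := SmoothMat.mul (fun a b => H.smooth_comp (F.smooth a b)) H.smooth_ξ
  smooth_conn i a b := by
    simp only [Matrix.sum_apply, Matrix.smul_apply, smul_eq_mul]
    exact ContDiffOn.sum fun A _ => (H.smooth_ξ A i).mul (H.smooth_comp (F.smooth_conn A a b))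
  skew i v hv := by
    rw [Matrix.transpose_sum, ← Finset.sum_neg_distrib]
    refine Finset.sum_congr rfl fun A _ => ?_
    rw [Matrix.transpose_smul, F.skew A _ (H.mapsTo v hv), smul_neg]
  torsion v hv a i j := by
    have e : ∀ i j, (pdM i (fun v => c (prj v) * ξ v) v +
        (∑ A, ξ v A i • w A (prj v)) * (c (prj v) * ξ v)) a j =
        (∑ A, ∑ B, ξ v A i * ξ v B j *
          (dir A (fun q => c q a B) (prj v) + (w A (prj v) * c (prj v)) a B)) +
        ∑ B, c (prj v) a B * pd i (fun w => ξ w B j) v := by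
      intro i j
      rw [pdM_mul H.isOpen hv i (fun a b => H.smooth_comp (F.smooth a b)) H.smooth_ξ,
        H.pdM_comp F.smooth hv]
      simp only [Matrix.add_apply, Matrix.mul_apply, Matrix.sum_apply, Matrix.smul_apply, dirM,
        Matrix.of_apply, smul_eq_mul, pdM]
      rw [add_right_comm]
      congr 1
      have e2 : ∑ x, (∑ A, ξ v A i * w A (prj v) a x) * ∑ B, c (prj v) x B * ξ v B j =
          ∑ A, ∑ B, ξ v A i * ξ v B j * ∑ x, w A (prj v) a x * c (prj v) x B := by
        simp only [Finset.sum_mul, Finset.mul_sum]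
        calc _ = ∑ A, ∑ x, ∑ B, ξ v A i * w A (prj v) a x * (c (prj v) x B * ξ v B j) := by
              rw [Finset.sum_congr rfl fun x _ => Finset.sum_comm]
              rw [Finset.sum_comm]
          _ = _ := by
              refine Finset.sum_congr rfl fun A _ => ?_
              rw [Finset.sum_comm]
              exact Finset.sum_congr rfl fun B _ => Finset.sum_congr rfl fun x _ => by ring
      have e1 : ∑ B, (∑ A, ξ v A i * dir A (fun q => c q a B) (prj v)) * ξ v B j =
          ∑ A, ∑ B, ξ v A i * ξ v B j * dir A (fun q => c q a B) (prj v) := by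
        simp only [Finset.sum_mul]
        rw [Finset.sum_comm]
        exact Finset.sum_congr rfl fun A _ => Finset.sum_congr rfl fun B _ => by ring
      rw [e1, e2]
      simp only [← Finset.sum_add_distrib, ← mul_add]
    rw [e, e]
    congr 1
    · rw [Finset.sum_comm]
      refine Finset.sum_congr rfl fun A _ => Finset.sum_congr rfl fun B _ => ?_
      rw [F.torsion _ (H.mapsTo v hv) a B A]
      ring
    · exact Finset.sum_congr rfl fun B _ => by rw [H.closed_ξ hv]

lemma IsToricFrame.isFrameCurvature (F : IsToricFrame W c w) (H : ToricCoords V W prj T Φ ξ)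
    (hh : ∀ v ∈ V, h v = (c (prj v) * ξ v).transpose * (c (prj v) * ξ v)) {v : E4} (hv : v ∈ V) :
    IsFrameCurvature h v (c (prj v) * ξ v) fun k l =>
      ∑ A, ∑ B, ((c (prj v))⁻¹ A k * (c (prj v))⁻¹ B l) • toricCurv w A B (prj v) where
  det_pos := (F.isCartanFrame H hh).det_pos v hv
  metric := hh v hv
  curv i j := by
    rw [(F.isCartanFrame H hh).riemann_eq hv]
    congr 2
    have hcu : IsUnit (c (prj v)).det := isUnit_iff_ne_zero.2 (F.det_pos _ (H.mapsTo v hv)).ne'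
    have hθ : ∀ A i, ∑ k, (c (prj v) * ξ v) k i * (c (prj v))⁻¹ A k = ξ v A i := by
      intro A i
      have : (c (prj v))⁻¹ * (c (prj v) * ξ v) = ξ v := by
        rw [← Matrix.mul_assoc, Matrix.nonsing_inv_mul _ hcu, Matrix.one_mul]
      conv_rhs => rw [← this]
      rw [Matrix.mul_apply]
      exact Finset.sum_congr rfl fun k _ => mul_comm _ _
    have e1 : ∑ k, ∑ l, ((c (prj v) * ξ v) k i * (c (prj v) * ξ v) l j) •
        ∑ A, ∑ B, ((c (prj v))⁻¹ A k * (c (prj v))⁻¹ B l) • toricCurv w A B (prj v) =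
        ∑ A, ∑ B, (ξ v A i * ξ v B j) • toricCurv w A B (prj v) := by
      ext a b
      simp only [Matrix.sum_apply, Matrix.smul_apply, smul_eq_mul, Finset.mul_sum, ← hθ,
        Finset.sum_mul]
      rw [sum_comm₄ (f := fun k l A B => _)]
      refine Finset.sum_congr rfl fun A _ => Finset.sum_congr rfl fun B _ => ?_
      rw [Finset.sum_comm]
      exact Finset.sum_congr rfl fun k _ => Finset.sum_congr rfl fun l _ => by ring
    rw [e1]
    have e2 : ∀ i j, pdM i (fun v => ∑ A, ξ v A j • w A (prj v)) v =
        (∑ B, pd i (fun v => ξ v B j) v • w B (prj v)) +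
          ∑ A, ∑ B, (ξ v A i * ξ v B j) • dirM A (w B) (prj v) := by
      intro i j
      ext a b
      simp only [pdM, Matrix.of_apply, Matrix.sum_apply, Matrix.smul_apply, smul_eq_mul,
        Matrix.add_apply, dirM]
      rw [pd_sum]
      · rw [Finset.sum_comm, ← Finset.sum_add_distrib]
        refine Finset.sum_congr rfl fun B _ => ?_
        rw [pd_mul i (diffAt_of_contDiffOn (H.smooth_ξ B j) H.isOpen hv)
          (diffAt_of_contDiffOn (H.smooth_comp (F.smooth_conn B a b)) H.isOpen hv),
          H.pd_comp (F.smooth_conn B a b) hv, Finset.mul_sum]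
        congr 1
        exact Finset.sum_congr rfl fun A _ => by ring
      · exact fun B _ => (diffAt_of_contDiffOn (H.smooth_ξ B j) H.isOpen hv).mul
          (diffAt_of_contDiffOn (H.smooth_comp (F.smooth_conn B a b)) H.isOpen hv)
    rw [e2, e2]
    have e3 : ∑ B, pd i (fun v => ξ v B j) v • w B (prj v) =
        ∑ B, pd j (fun v => ξ v B i) v • w B (prj v) :=
      Finset.sum_congr rfl fun B _ => by rw [H.closed_ξ hv]
    have e4 : ∀ i j, (∑ A, ξ v A i • w A (prj v)) * (∑ A, ξ v A j • w A (prj v)) =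
        ∑ A, ∑ B, (ξ v A i * ξ v B j) • (w A (prj v) * w B (prj v)) := by
      intro i j
      rw [Finset.sum_mul_sum]
      refine Finset.sum_congr rfl fun A _ => Finset.sum_congr rfl fun B _ => ?_
      rw [Matrix.smul_mul, Matrix.mul_smul, smul_smul]
    have e5 : ∀ f : Fin 4 → Fin 4 → Mat4, ∑ A, ∑ B, (ξ v A j * ξ v B i) • f A B =
        ∑ A, ∑ B, (ξ v A i * ξ v B j) • f B A := by
      intro f
      rw [Finset.sum_comm]
      exact Finset.sum_congr rfl fun A _ => Finset.sum_congr rfl fun B _ => by rw [mul_comm]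
    rw [e3, e4, e4, e5, e5]
    simp only [toricCurv, smul_sub, smul_add, Finset.sum_sub_distrib, Finset.sum_add_distrib]
    abel

end

end ChenTeo
end

open Set Filter Topology Manifold Bundle
open scoped ContDiff

noncomputable section

namespace ChenTeo

/-- `f` is differentiable at `p` with partial derivatives `a` and `b`. -/
def HasDir (f : ℝ × ℝ → ℝ) (p : ℝ × ℝ) (a b : ℝ) : Prop :=
  HasFDerivAt f (a • ContinuousLinearMap.fst ℝ ℝ ℝ + b • ContinuousLinearMap.snd ℝ ℝ ℝ) p

namespace HasDir

variable {f g : ℝ × ℝ → ℝ} {p : ℝ × ℝ} {a b a' b' : ℝ}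

lemma congr (h : HasDir f p a b) (ha : a = a') (hb : b = b') : HasDir f p a' b' := by
  subst ha hb; exact h

lemma dir_zero (h : HasDir f p a b) : dir 0 f p = a := by
  simp [dir, HasFDerivAt.fderiv h]

lemma dir_one (h : HasDir f p a b) : dir 1 f p = b := by
  simp [dir, HasFDerivAt.fderiv h]

lemma const (c : ℝ) : HasDir (fun _ => c) p 0 0 :=
  (hasFDerivAt_const c p).congr_fderiv (by simp)

lemma fst : HasDir (fun q => q.1) p 1 0 :=
  (hasFDerivAt_fst (𝕜 := ℝ) (E := ℝ) (F := ℝ)).congr_fderiv (by simp)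

lemma snd : HasDir (fun q => q.2) p 0 1 :=
  (hasFDerivAt_snd (𝕜 := ℝ) (E := ℝ) (F := ℝ)).congr_fderiv (by simp)

lemma add (hf : HasDir f p a b) (hg : HasDir g p a' b') :
    HasDir (fun q => f q + g q) p (a + a') (b + b') :=
  (HasFDerivAt.add hf hg).congr_fderiv (by module)

lemma sub (hf : HasDir f p a b) (hg : HasDir g p a' b') :
    HasDir (fun q => f q - g q) p (a - a') (b - b') :=
  (HasFDerivAt.sub hf hg).congr_fderiv (by module)

lemma neg (hf : HasDir f p a b) : HasDir (fun q => -f q) p (-a) (-b) :=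
  (HasFDerivAt.neg hf).congr_fderiv (by module)

lemma mul (hf : HasDir f p a b) (hg : HasDir g p a' b') :
    HasDir (fun q => f q * g q) p (a * g p + f p * a') (b * g p + f p * b') :=
  (HasFDerivAt.mul hf hg).congr_fderiv (by module)

lemma pow (hf : HasDir f p a b) (n : ℕ) :
    HasDir (fun q => f q ^ n) p (n * f p ^ (n - 1) * a) (n * f p ^ (n - 1) * b) :=
  (HasFDerivAt.pow hf n).congr_fderiv (by simp only [nsmul_eq_mul]; module)

lemma inv (hf : HasDir f p a b) (h0 : f p ≠ 0) :
    HasDir (fun q => (f q)⁻¹) p (-a / f p ^ 2) (-b / f p ^ 2) :=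
  ((hasDerivAt_inv h0).comp_hasFDerivAt p hf).congr_fderiv (by
    simp only [div_eq_mul_inv]; module)

lemma div (hf : HasDir f p a b) (hg : HasDir g p a' b') (h0 : g p ≠ 0) :
    HasDir (fun q => f q / g q) p ((a * g p - f p * a') / g p ^ 2)
      ((b * g p - f p * b') / g p ^ 2) := by
  simp only [div_eq_mul_inv]
  refine (hf.mul (hg.inv h0)).congr ?_ ?_ <;> field_simp <;> ring

lemma sqrt (hf : HasDir f p a b) (h0 : 0 < f p) :
    HasDir (fun q => √(f q)) p (a / (2 * √(f p))) (b / (2 * √(f p))) :=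
  (HasFDerivAt.sqrt hf h0.ne').congr_fderiv (by
    simp only [div_eq_mul_inv]; module)

end HasDir

namespace Params

variable (P : Params)

/-! ### Polynomials -/

@[simp] lemma a₀_eq : P.a₀ = 0 := by simp [a₀, x₄]

/-- The derivative of the quartic. -/
def quartic' (t : ℝ) : ℝ := P.a₁ + 2 * P.a₂ * t + 3 * P.a₃ * t ^ 2 + 4 * P.a₄ * t ^ 3

def N (x y : ℝ) : ℝ := P.ν * x + y

/-- The second factor of `H`. -/
def h (x y : ℝ) : ℝ :=
  (P.ν * x - y) * (P.a₁ - P.a₃ * x * y) + 2 * (1 - P.ν) * P.a₄ * x ^ 2 * y ^ 2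

def hx (x y : ℝ) : ℝ :=
  P.ν * (P.a₁ - P.a₃ * x * y) - (P.ν * x - y) * P.a₃ * y + 4 * (1 - P.ν) * P.a₄ * x * y ^ 2

def hy (x y : ℝ) : ℝ :=
  -(P.a₁ - P.a₃ * x * y) - (P.ν * x - y) * P.a₃ * x + 4 * (1 - P.ν) * P.a₄ * x ^ 2 * y

def hxx (_x y : ℝ) : ℝ := -2 * P.ν * P.a₃ * y + 4 * (1 - P.ν) * P.a₄ * y ^ 2

def hyy (x _y : ℝ) : ℝ := 2 * P.a₃ * x + 4 * (1 - P.ν) * P.a₄ * x ^ 2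

def numA (x y : ℝ) : ℝ :=
  (-P.ν ^ 2 * P.a₄ + 2 * P.ν * P.a₄ - P.a₄) * x ^ 2 * y ^ 3
    + (-P.ν ^ 2 * P.a₃ + 2 * P.ν * P.a₃) * x ^ 2 * y ^ 2 + (-P.ν ^ 2 * P.a₂) * x ^ 2 * y
    + (-P.ν ^ 2 * P.a₁) * x ^ 2 + (-2 * P.ν * P.a₄ + 2 * P.a₄) * x * y ^ 4
    + (-2 * P.ν * P.a₃) * x * y ^ 3 + 2 * P.ν * P.a₂ * x * y ^ 2 + 2 * P.ν * P.a₁ * x * y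
    + P.a₃ * y ^ 4 + (-2 * P.ν * P.a₂ + P.a₂) * y ^ 3 + (-2 * P.ν * P.a₁ + P.a₁) * y ^ 2

def numAx (x y : ℝ) : ℝ :=
  (-2 * P.ν ^ 2 * P.a₄ + 4 * P.ν * P.a₄ - 2 * P.a₄) * x * y ^ 3
    + (-2 * P.ν ^ 2 * P.a₃ + 4 * P.ν * P.a₃) * x * y ^ 2 + (-2 * P.ν ^ 2 * P.a₂) * x * y
    + (-2 * P.ν ^ 2 * P.a₁) * x + (-2 * P.ν * P.a₄ + 2 * P.a₄) * y ^ 4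
    + (-2 * P.ν * P.a₃) * y ^ 3 + 2 * P.ν * P.a₂ * y ^ 2 + 2 * P.ν * P.a₁ * y

def numAy (x y : ℝ) : ℝ :=
  (-3 * P.ν ^ 2 * P.a₄ + 6 * P.ν * P.a₄ - 3 * P.a₄) * x ^ 2 * y ^ 2
    + (-2 * P.ν ^ 2 * P.a₃ + 4 * P.ν * P.a₃) * x ^ 2 * y + (-P.ν ^ 2 * P.a₂) * x ^ 2
    + (-8 * P.ν * P.a₄ + 8 * P.a₄) * x * y ^ 3 + (-6 * P.ν * P.a₃) * x * y ^ 2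
    + 4 * P.ν * P.a₂ * x * y + 2 * P.ν * P.a₁ * x + 4 * P.a₃ * y ^ 3
    + (-6 * P.ν * P.a₂ + 3 * P.a₂) * y ^ 2 + (-4 * P.ν * P.a₁ + 2 * P.a₁) * y

def numB (x y : ℝ) : ℝ :=
  (-2 * P.ν ^ 2 * P.a₄ + 2 * P.ν * P.a₄) * x ^ 4 * y + (-P.ν ^ 2 * P.a₃) * x ^ 4
    + (P.ν ^ 2 * P.a₄ - 2 * P.ν * P.a₄ + P.a₄) * x ^ 3 * y ^ 2 + 2 * P.ν * P.a₃ * x ^ 3 * y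
    + (-P.ν ^ 2 * P.a₂) * x ^ 3 + (-2 * P.ν * P.a₃ + P.a₃) * x ^ 2 * y ^ 2
    + 2 * P.ν * P.a₂ * x ^ 2 * y + (-P.ν ^ 2 * P.a₁ + 2 * P.ν * P.a₁) * x ^ 2
    + (-2 * P.ν * P.a₂ + P.a₂) * x * y ^ 2 + (-2 * P.ν * P.a₁) * x * y + P.a₁ * y ^ 2

def numBx (x y : ℝ) : ℝ :=
  (-8 * P.ν ^ 2 * P.a₄ + 8 * P.ν * P.a₄) * x ^ 3 * y + (-4 * P.ν ^ 2 * P.a₃) * x ^ 3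
    + (3 * P.ν ^ 2 * P.a₄ - 6 * P.ν * P.a₄ + 3 * P.a₄) * x ^ 2 * y ^ 2
    + 6 * P.ν * P.a₃ * x ^ 2 * y + (-3 * P.ν ^ 2 * P.a₂) * x ^ 2
    + (-4 * P.ν * P.a₃ + 2 * P.a₃) * x * y ^ 2 + 4 * P.ν * P.a₂ * x * y
    + (-2 * P.ν ^ 2 * P.a₁ + 4 * P.ν * P.a₁) * x + (-2 * P.ν * P.a₂ + P.a₂) * y ^ 2
    + (-2 * P.ν * P.a₁) * y

def numBy (x y : ℝ) : ℝ :=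
  (-2 * P.ν ^ 2 * P.a₄ + 2 * P.ν * P.a₄) * x ^ 4
    + (2 * P.ν ^ 2 * P.a₄ - 4 * P.ν * P.a₄ + 2 * P.a₄) * x ^ 3 * y + 2 * P.ν * P.a₃ * x ^ 3
    + (-4 * P.ν * P.a₃ + 2 * P.a₃) * x ^ 2 * y + 2 * P.ν * P.a₂ * x ^ 2
    + (-4 * P.ν * P.a₂ + 2 * P.a₂) * x * y + (-2 * P.ν * P.a₁) * x + 2 * P.a₁ * y

def numC (x y : ℝ) : ℝ :=
  (-3 / 2 * P.ν ^ 2 * P.a₄ - P.ν * P.a₄ + 1 / 2 * P.a₄) * x ^ 3 * y ^ 2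
    + (-P.ν ^ 2 * P.a₃ - P.ν * P.a₃) * x ^ 3 * y + (-1 / 2 * P.ν ^ 2 * P.a₂) * x ^ 3
    + (1 / 2 * P.ν ^ 2 * P.a₄ - P.ν * P.a₄ - 3 / 2 * P.a₄) * x ^ 2 * y ^ 3
    + (-1 / 2 * P.ν ^ 2 * P.a₂ - 2 * P.ν * P.a₂) * x ^ 2 * y
    + (-P.ν ^ 2 * P.a₁ - P.ν * P.a₁) * x ^ 2 + (-P.ν * P.a₃ - P.a₃) * x * y ^ 3
    + (P.ν * P.a₂ - 1 / 2 * P.a₂) * x * y ^ 2 + (-P.ν * P.a₂ - 1 / 2 * P.a₂) * y ^ 3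
    + (-P.ν * P.a₁ - P.a₁) * y ^ 2

def numCx (x y : ℝ) : ℝ :=
  (-9 / 2 * P.ν ^ 2 * P.a₄ - 3 * P.ν * P.a₄ + 3 / 2 * P.a₄) * x ^ 2 * y ^ 2
    + (-3 * P.ν ^ 2 * P.a₃ - 3 * P.ν * P.a₃) * x ^ 2 * y + (-3 / 2 * P.ν ^ 2 * P.a₂) * x ^ 2
    + (P.ν ^ 2 * P.a₄ - 2 * P.ν * P.a₄ - 3 * P.a₄) * x * y ^ 3
    + (-P.ν ^ 2 * P.a₂ - 4 * P.ν * P.a₂) * x * y + (-2 * P.ν ^ 2 * P.a₁ - 2 * P.ν * P.a₁) * x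
    + (-P.ν * P.a₃ - P.a₃) * y ^ 3 + (P.ν * P.a₂ - 1 / 2 * P.a₂) * y ^ 2

def numCy (x y : ℝ) : ℝ :=
  (-3 * P.ν ^ 2 * P.a₄ - 2 * P.ν * P.a₄ + P.a₄) * x ^ 3 * y
    + (-P.ν ^ 2 * P.a₃ - P.ν * P.a₃) * x ^ 3
    + (3 / 2 * P.ν ^ 2 * P.a₄ - 3 * P.ν * P.a₄ - 9 / 2 * P.a₄) * x ^ 2 * y ^ 2
    + (-1 / 2 * P.ν ^ 2 * P.a₂ - 2 * P.ν * P.a₂) * x ^ 2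
    + (-3 * P.ν * P.a₃ - 3 * P.a₃) * x * y ^ 2 + (2 * P.ν * P.a₂ - P.a₂) * x * y
    + (-3 * P.ν * P.a₂ - 3 / 2 * P.a₂) * y ^ 2 + (-2 * P.ν * P.a₁ - 2 * P.a₁) * y

def numQ (x y : ℝ) : ℝ :=
  (-P.a₃ * P.a₄) * x ^ 3 * y ^ 3 + (-1 / 2 * P.a₃ ^ 2) * x ^ 3 * y ^ 2
    + (-P.a₁ * P.a₄) * x ^ 3 * y + (-1 / 2 * P.a₃ ^ 2) * x ^ 2 * y ^ 3
    + (3 * P.a₁ * P.a₄ - P.a₂ * P.a₃) * x ^ 2 * y ^ 2 + (-P.a₁ * P.a₄) * x * y ^ 3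
    + P.a₁ * P.a₂ * x * y + 1 / 2 * P.a₁ ^ 2 * x + 1 / 2 * P.a₁ ^ 2 * y

def numQx (x y : ℝ) : ℝ :=
  (-3 * P.a₃ * P.a₄) * x ^ 2 * y ^ 3 + (-3 / 2 * P.a₃ ^ 2) * x ^ 2 * y ^ 2
    + (-3 * P.a₁ * P.a₄) * x ^ 2 * y + (-P.a₃ ^ 2) * x * y ^ 3
    + (6 * P.a₁ * P.a₄ - 2 * P.a₂ * P.a₃) * x * y ^ 2 + (-P.a₁ * P.a₄) * y ^ 3
    + P.a₁ * P.a₂ * y + 1 / 2 * P.a₁ ^ 2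

def numQy (x y : ℝ) : ℝ :=
  (-3 * P.a₃ * P.a₄) * x ^ 3 * y ^ 2 + (-P.a₃ ^ 2) * x ^ 3 * y + (-P.a₁ * P.a₄) * x ^ 3
    + (-3 / 2 * P.a₃ ^ 2) * x ^ 2 * y ^ 2 + (6 * P.a₁ * P.a₄ - 2 * P.a₂ * P.a₃) * x ^ 2 * y
    + (-3 * P.a₁ * P.a₄) * x * y ^ 2 + P.a₁ * P.a₂ * x + 1 / 2 * P.a₁ ^ 2

lemma hasDir_numA (p : ℝ × ℝ) : HasDir (fun q => P.numA q.1 q.2) p (P.numAx p.1 p.2) (P.numAy p.1 p.2) := by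
  unfold numA
  refine HasDir.congr (by
    repeat' first
      | exact HasDir.const _
      | exact HasDir.fst
      | exact HasDir.snd
      | apply HasDir.pow
      | apply HasDir.add
      | apply HasDir.sub
      | apply HasDir.neg
      | apply HasDir.mul) ?_ ?_
  all_goals norm_num [numAx, numAy]
  all_goals try ring

lemma hasDir_numB (p : ℝ × ℝ) : HasDir (fun q => P.numB q.1 q.2) p (P.numBx p.1 p.2) (P.numBy p.1 p.2) := by
  unfold numB
  refine HasDir.congr (by
    repeat' first
      | exact HasDir.const _
      | exact HasDir.fst
      | exact HasDir.snd
      | apply HasDir.pow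
      | apply HasDir.add
      | apply HasDir.sub
      | apply HasDir.neg
      | apply HasDir.mul) ?_ ?_
  all_goals norm_num [numBx, numBy]
  all_goals try ring

lemma hasDir_numC (p : ℝ × ℝ) : HasDir (fun q => P.numC q.1 q.2) p (P.numCx p.1 p.2) (P.numCy p.1 p.2) := by
  unfold numC
  refine HasDir.congr (by
    repeat' first
      | exact HasDir.const _
      | exact HasDir.fst
      | exact HasDir.snd
      | apply HasDir.pow
      | apply HasDir.add
      | apply HasDir.sub
      | apply HasDir.neg
      | apply HasDir.mul) ?_ ?_
  all_goals norm_num [numCx, numCy]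
  all_goals try ring

lemma hasDir_numQ (p : ℝ × ℝ) : HasDir (fun q => P.numQ q.1 q.2) p (P.numQx p.1 p.2) (P.numQy p.1 p.2) := by
  unfold numQ
  refine HasDir.congr (by
    repeat' first
      | exact HasDir.const _
      | exact HasDir.fst
      | exact HasDir.snd
      | apply HasDir.pow
      | apply HasDir.add
      | apply HasDir.sub
      | apply HasDir.neg
      | apply HasDir.mul) ?_ ?_
  all_goals norm_num [numQx, numQy]
  all_goals try ring

lemma hasDir_h (p : ℝ × ℝ) : HasDir (fun q => P.h q.1 q.2) p (P.hx p.1 p.2) (P.hy p.1 p.2) := by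
  unfold h
  refine HasDir.congr (by
    repeat' first
      | exact HasDir.const _
      | exact HasDir.fst
      | exact HasDir.snd
      | apply HasDir.pow
      | apply HasDir.add
      | apply HasDir.sub
      | apply HasDir.neg
      | apply HasDir.mul) ?_ ?_
  all_goals norm_num [hx, hy]
  all_goals try ring

lemma hasDir_hx (p : ℝ × ℝ) : HasDir (fun q => P.hx q.1 q.2) p (P.hxx p.1 p.2) (-2 * P.a₃ * P.ν * p.1 + 2 * P.a₃ * p.2 + 8 * (1 - P.ν) * P.a₄ * p.1 * p.2) := by
  unfold hx
  refine HasDir.congr (by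
    repeat' first
      | exact HasDir.const _
      | exact HasDir.fst
      | exact HasDir.snd
      | apply HasDir.pow
      | apply HasDir.add
      | apply HasDir.sub
      | apply HasDir.neg
      | apply HasDir.mul) ?_ ?_
  all_goals norm_num [hxx]
  all_goals try ring

lemma hasDir_hy (p : ℝ × ℝ) : HasDir (fun q => P.hy q.1 q.2) p (-2 * P.a₃ * P.ν * p.1 + 2 * P.a₃ * p.2 + 8 * (1 - P.ν) * P.a₄ * p.1 * p.2) (P.hyy p.1 p.2) := by
  unfold hy
  refine HasDir.congr (by
    repeat' first
      | exact HasDir.const _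
      | exact HasDir.fst
      | exact HasDir.snd
      | apply HasDir.pow
      | apply HasDir.add
      | apply HasDir.sub
      | apply HasDir.neg
      | apply HasDir.mul) ?_ ?_
  all_goals norm_num [hyy]
  all_goals try ring

lemma hasDir_N (p : ℝ × ℝ) : HasDir (fun q => P.N q.1 q.2) p (P.ν) (1) := by
  unfold N
  refine HasDir.congr (by
    repeat' first
      | exact HasDir.const _
      | exact HasDir.fst
      | exact HasDir.snd
      | apply HasDir.pow
      | apply HasDir.add
      | apply HasDir.sub
      | apply HasDir.neg
      | apply HasDir.mul) ?_ ?_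
  all_goals norm_num [N]

lemma hasDir_X (p : ℝ × ℝ) : HasDir (fun q => P.quartic q.1) p (P.quartic' p.1) (0) := by
  unfold quartic
  refine HasDir.congr (by
    repeat' first
      | exact HasDir.const _
      | exact HasDir.fst
      | exact HasDir.snd
      | apply HasDir.pow
      | apply HasDir.add
      | apply HasDir.sub
      | apply HasDir.neg
      | apply HasDir.mul) ?_ ?_
  all_goals norm_num [quartic']
  all_goals try ring

lemma hasDir_Y (p : ℝ × ℝ) : HasDir (fun q => P.quartic q.2) p (0) (P.quartic' p.2) := by
  unfold quartic
  refine HasDir.congr (by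
    repeat' first
      | exact HasDir.const _
      | exact HasDir.fst
      | exact HasDir.snd
      | apply HasDir.pow
      | apply HasDir.add
      | apply HasDir.sub
      | apply HasDir.neg
      | apply HasDir.mul) ?_ ?_
  all_goals norm_num [quartic']
  all_goals try ring

/-! ### Identities -/

lemma H_eq (x y : ℝ) : P.H x y = P.N x y * P.h x y := by
  simp only [H, N, h, a₀_eq]; ring

lemma numB_sub_numA (x y : ℝ) : y * P.numB x y - x * P.numA x y = P.N x y * P.h x y * (x - y) := by
  simp only [N, h, numA, numB]; ring

lemma numA_numB_G (x y : ℝ) : P.quartic x * y * P.numA x y - P.quartic y * x * P.numB x y =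
    P.G x y * (x - y) ^ 2 := by
  simp only [G, quartic, numA, numB, a₀_eq]; ring

lemma numAy_add_numBx (x y : ℝ) : (P.numAy x y + P.numBx x y) * (x - y)
    + 4 * (P.numA x y - P.numB x y) = -2 * (1 + P.ν) * P.h x y * (x - y) := by
  simp only [h, numAy, numBx, numA, numB]; ring

lemma conn_x (x y : ℝ) :
    -P.quartic x * y * (P.numAx x y * (x - y) - 2 * P.numA x y)
      - P.quartic y * (P.numB x y * (x - y) - x * P.numBx x y * (x - y) + 2 * x * P.numB x y) =
    -P.quartic y * (x - y) * (P.h x y * (x - y) - P.N x y * P.h x y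
      - P.N x y * (x - y) * P.hy x y) := by
  simp only [N, h, hy, quartic, numA, numB, numAx, numBx, a₀_eq]; ring

lemma conn_y (x y : ℝ) :
    P.quartic x * (P.numA x y * (x - y) - y * P.numAy x y * (x - y) - 2 * y * P.numA x y)
      + P.quartic y * x * (P.numBy x y * (x - y) + 2 * P.numB x y) =
    P.quartic x * (x - y) * (-P.ν * P.h x y * (x - y) - P.N x y * P.h x y
      + P.N x y * (x - y) * P.hx x y) := by
  simp only [N, h, hx, quartic, numA, numB, numAy, numBy, a₀_eq]; ring

lemma quartic_identity (x y : ℝ) :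
    (x - y) * P.N x y * (y * P.quartic' x + x * P.quartic' y)
      + 2 * (1 + P.ν) * (y ^ 2 * P.quartic x - x ^ 2 * P.quartic y)
      - 4 * P.N x y * (y * P.quartic x - x * P.quartic y) = P.h x y * (x - y) ^ 2 := by
  simp only [N, h, quartic, quartic', a₀_eq]; ring

lemma numC_identity (x y : ℝ) :
    -(P.N x y * (P.quartic x * (P.numAx x y * (x - y) - 2 * P.numA x y)
        + P.quartic y * (P.numBy x y * (x - y) + 2 * P.numB x y)
        + (x - y) * (P.numA x y * P.quartic' x + P.numB x y * P.quartic' y) / 2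
        - P.quartic x * P.numA x y + P.quartic y * P.numB x y)
      - (x - y) * (P.ν * P.numA x y * P.quartic x + P.numB x y * P.quartic y)) =
    P.numC x y * P.h x y * (x - y) := by
  simp only [N, h, quartic, quartic', numA, numB, numC, numAx, numBy, a₀_eq]
  generalize P.a₁ = a1, P.a₂ = a2, P.a₃ = a3, P.a₄ = a4, P.ν = n
  ring1

lemma numQ_identity (x y : ℝ) :
    -(P.h x y * (y * P.quartic' x - x * P.quartic' y) / 2 - y * P.quartic x * P.hx x y
      + x * P.quartic y * P.hy x y) = P.N x y * P.numQ x y := by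
  simp only [N, h, hx, hy, quartic, quartic', numQ, a₀_eq]; ring

lemma euler_h (x y : ℝ) :
    y * P.hy x y - x * P.hx x y = -P.N x y * (P.a₁ - P.a₃ * x * y) := by
  simp only [N, hx, hy]; ring

end Params

end ChenTeo
end

open Set Filter Topology Manifold Bundle
open scoped ContDiff

noncomputable section

namespace ChenTeo

namespace Params

variable (P : Params)

/-! ### Signs -/

lemma ν_neg : P.ν < 0 := by
  have := P.lt_ξ
  unfold ν
  nlinarith

lemma neg_one_lt_ν : -1 < P.ν := by
  have := P.two_ξ_sq_lt
  unfold ν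
  linarith

lemma x₃_neg : P.x₃ < 0 := by
  have h1 := P.two_ξ_sq_lt
  have h2 := P.lt_ξ
  have h3 := P.x₂_neg
  have h4 : 0 < 1 - P.ξ := by nlinarith
  unfold x₃
  apply div_neg_of_neg_of_pos
  · apply mul_neg_of_pos_of_neg _ h3
    nlinarith
  · positivity

lemma quartic_eq (t : ℝ) :
    P.quartic t = P.a₄ * ((t - P.x₁) * (t - P.x₂) * (t - P.x₃) * t) := by
  simp only [quartic, a₀, a₁, a₂, a₃, x₄]; ring

lemma quartic_pos {x : ℝ} (h1 : P.x₂ < x) (h2 : x < P.x₃) : 0 < P.quartic x := by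
  rw [quartic_eq]
  have := P.x₁_lt_x₂
  have := P.x₃_neg
  have e1 : 0 < x - P.x₁ := by linarith
  have e2 : 0 < x - P.x₂ := by linarith
  have e3 : 0 < P.x₃ - x := by linarith
  have e4 : 0 < -x := by linarith
  have := mul_pos P.a₄_pos (mul_pos (mul_pos (mul_pos e1 e2) e3) e4)
  linarith

lemma quartic_neg {y : ℝ} (h1 : P.x₁ < y) (h2 : y < P.x₂) : P.quartic y < 0 := by
  rw [quartic_eq]
  have := P.x₂_lt_x₃
  have := P.x₃_neg
  have e1 : 0 < y - P.x₁ := by linarith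
  have e2 : 0 < P.x₂ - y := by linarith
  have e3 : 0 < P.x₃ - y := by linarith
  have e4 : 0 < -y := by linarith
  have := mul_pos P.a₄_pos (mul_pos (mul_pos (mul_pos e1 e2) e3) e4)
  linarith

lemma N_neg {x y : ℝ} (hx : P.x₂ ≤ x) (hy : y ≤ P.x₂) : P.N x y < 0 := by
  have h1 := P.ν_neg
  have h2 := P.neg_one_lt_ν
  have h3 := P.x₂_neg
  unfold N
  nlinarith

/-- A biconcave function on a rectangle is bounded below by its values at the vertices. -/
lemma biconcave_lower_bound {n e a b A B c : ℝ} {s : ℝ} (he : 0 ≤ e) (hn : 0 ≤ n) (ha : 1 ≤ a)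
    (haA : a ≤ A) (hb : b ≤ 1) (hbB : B ≤ b) (hB : 0 < B) (hA1 : 1 < A) (hB1 : B < 1)
    (h11 : c < (1 + n * 1) * (s - e * 1 * 1)) (h1B : c < (1 + n * B) * (s - e * 1 * B))
    (hA1' : c < (A + n * 1) * (s - e * A * 1)) (hAB : c < (A + n * B) * (s - e * A * B)) :
    c < (a + n * b) * (s - e * a * b) := by
  have key : ∀ d, 0 < d → c < (1 + n * d) * (s - e * 1 * d) → c < (A + n * d) * (s - e * A * d) →
      c < (a + n * d) * (s - e * a * d) := by
    intro d hd h1 h2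
    have : (A - 1) * ((a + n * d) * (s - e * a * d) - c) =
        (A - a) * ((1 + n * d) * (s - e * 1 * d) - c) + (a - 1) * ((A + n * d) * (s - e * A * d) - c)
          + (A - 1) * (e * d * ((a - 1) * (A - a))) := by ring
    have p1 : 0 < (A - a) * ((1 + n * d) * (s - e * 1 * d) - c) +
        (a - 1) * ((A + n * d) * (s - e * A * d) - c) := by
      rcases ha.eq_or_lt with h | h
      · subst h
        have : 0 < A - 1 := by linarith
        nlinarith
      · have : 0 ≤ (A - a) * ((1 + n * d) * (s - e * 1 * d) - c) :=
          mul_nonneg (by linarith) (by linarith)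
        have : 0 < (a - 1) * ((A + n * d) * (s - e * A * d) - c) :=
          mul_pos (by linarith) (by linarith)
        linarith
    have p2 : 0 ≤ (A - 1) * (e * d * ((a - 1) * (A - a))) := by
      have : 0 ≤ A - 1 := by linarith
      have : 0 ≤ a - 1 := by linarith
      have : 0 ≤ A - a := by linarith
      positivity
    have : 0 < (A - 1) * ((a + n * d) * (s - e * a * d) - c) := by linarith
    have := (pos_iff_pos_of_mul_pos this).1 (by linarith)
    linarith
  have k1 := key 1 one_pos h11 hA1'
  have kB := key B hB h1B hAB
  have : (1 - B) * ((a + n * b) * (s - e * a * b) - c) =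
      (1 - b) * ((a + n * B) * (s - e * a * B) - c) + (b - B) * ((a + n * 1) * (s - e * a * 1) - c)
        + (1 - B) * (n * e * a * ((b - B) * (1 - b))) := by ring
  have p1 : 0 < (1 - b) * ((a + n * B) * (s - e * a * B) - c) +
      (b - B) * ((a + n * 1) * (s - e * a * 1) - c) := by
    rcases hb.eq_or_lt with h | h
    · subst h
      have : 0 < 1 - B := by linarith
      nlinarith
    · have : 0 < (1 - b) * ((a + n * B) * (s - e * a * B) - c) :=
        mul_pos (by linarith) (by linarith)
      have : 0 ≤ (b - B) * ((a + n * 1) * (s - e * a * 1) - c) :=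
        mul_nonneg (by linarith) (by linarith)
      linarith
  have p2 : 0 ≤ (1 - B) * (n * e * a * ((b - B) * (1 - b))) := by
    have : 0 ≤ 1 - B := by linarith
    have : 0 ≤ 1 - b := by linarith
    have : 0 ≤ b - B := by linarith
    positivity
  have : 0 < (1 - B) * ((a + n * b) * (s - e * a * b) - c) := by linarith
  have := (pos_iff_pos_of_mul_pos this).1 (by linarith)
  linarith

lemma h_neg {x y : ℝ} (hx : P.x₂ ≤ x) (hx' : x ≤ P.x₃) (hy : P.x₁ ≤ y) (hy' : y ≤ P.x₂) :
    P.h x y < 0 := by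
  have o1 := P.x₁_lt_x₂
  have o2 := P.x₂_lt_x₃
  have o3 := P.x₃_neg
  have h1 := P.ν_neg
  have h2 := P.neg_one_lt_ν
  have h4 := P.a₄_pos
  have x0 : x < 0 := by linarith
  have y0 : y < 0 := by linarith
  have z1 : P.x₁ < 0 := by linarith
  have z2 : P.x₂ < 0 := by linarith
  set r₁ := P.x₁ / P.x₂ with hr₁
  set r₃ := P.x₃ / P.x₂ with hr₃
  set n := -P.ν with hn
  have n0 : 0 < n := by linarith
  have n1 : n < 1 := by linarith
  have e1 : P.x₁ = r₁ * P.x₂ := by rw [hr₁, div_mul_cancel₀ _ z2.ne]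
  have e3 : P.x₃ = r₃ * P.x₂ := by rw [hr₃, div_mul_cancel₀ _ z2.ne]
  have g1 : 1 < r₁ := by rw [hr₁, one_lt_div_of_neg z2]; exact o1
  have g3 : 0 < r₃ := div_pos_of_neg_of_neg o3 z2
  have g3' : r₃ < 1 := by rw [hr₃, div_lt_one_of_neg z2]; exact o2
  have ineq : ∀ ρ : ℝ, 1 < ρ → 1 + n < ρ + n / ρ := by
    intro ρ hρ
    have : ρ + n / ρ - (1 + n) = (ρ - 1) * (ρ - n) / ρ := by field_simp; ring
    have : 0 < (ρ - 1) * (ρ - n) / ρ := by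
      apply div_pos (mul_pos _ _) <;> linarith
    linarith
  have main : 2 * (1 + n) < (P.x₂ / x + n * (P.x₂ / y)) *
      ((1 + r₁ + r₃) - (r₁ * r₃) * (P.x₂ / x) * (P.x₂ / y)) := by
    apply biconcave_lower_bound (A := r₃⁻¹) (B := r₁⁻¹) (by positivity) n0.le
    · rw [one_le_div_of_neg x0]; exact hx
    · rw [div_le_iff_of_neg x0, hr₃, inv_div, div_mul_eq_mul_div, div_le_iff_of_neg o3]
      nlinarith
    · rw [div_le_one_of_neg y0]; exact hy'
    · rw [le_div_iff_of_neg y0, hr₁, inv_div, div_mul_eq_mul_div, le_div_iff_of_neg z1]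
      nlinarith
    · positivity
    · exact (one_lt_inv₀ g3).2 g3'
    · exact inv_lt_one_of_one_lt₀ g1
    · have : 0 < (r₁ - 1) * (1 - r₃) := mul_pos (by linarith) (by linarith)
      nlinarith
    · have := ineq r₁ g1
      have e : (1 + n * r₁⁻¹) * (1 + r₁ + r₃ - r₁ * r₃ * 1 * r₁⁻¹) = 1 + n + (r₁ + n / r₁) := by
        field_simp; ring
      linarith
    · have := ineq r₃⁻¹ ((one_lt_inv₀ g3).2 g3')
      have e : (r₃⁻¹ + n * 1) * (1 + r₁ + r₃ - r₁ * r₃ * r₃⁻¹ * 1) =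
          1 + n + (r₃⁻¹ + n / r₃⁻¹) := by
        field_simp; ring
      linarith
    · have := ineq (r₁ / r₃) ((one_lt_div g3).2 (by linarith))
      have e : (r₃⁻¹ + n * r₁⁻¹) * (1 + r₁ + r₃ - r₁ * r₃ * r₃⁻¹ * r₁⁻¹) =
          1 + n + (r₁ / r₃ + n / (r₁ / r₃)) := by
        field_simp; ring
      linarith
  have eq : P.h x y = P.a₄ * (x ^ 2 * y ^ 2) * (2 * (1 + n) -
      (P.x₂ / x + n * (P.x₂ / y)) * ((1 + r₁ + r₃) - (r₁ * r₃) * (P.x₂ / x) * (P.x₂ / y))) := by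
    have x0' := x0.ne
    have y0' := y0.ne
    simp only [h, a₁, a₃, x₄, hn]
    rw [e1, e3]
    field_simp
    ring
  rw [eq]
  have : 0 < P.a₄ * (x ^ 2 * y ^ 2) := by
    have x0' := x0.ne
    have y0' := y0.ne
    positivity
  nlinarith

end Params

end ChenTeo
end

open Set Filter Topology Manifold Bundle
open scoped ContDiff

noncomputable section

namespace ChenTeo

/-! ### The algebra behind the structure equations -/

section

variable {x y s t e κ ν D N h hx hy A Ax Ay B Bx By X' Y' C Q K : ℝ}

lemma torsion_xτ₂ (hs : s ≠ 0) (he : e ≠ 0) (hκ : κ ≠ 0) (hD : D ≠ 0) (hN : N ≠ 0) (hh : h ≠ 0)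
    (he2 : e ^ 2 = N * h * D) (z dz w lx u : ℝ) :
    z * (X' / (2 * s) - s * lx / 2) / e + s * dz / e + 1 / 2 * (t / s * u) * (t * w / e) =
      -(-(D / (κ * N * h)) * (dz * s ^ 2 + z * (X' / 2 - s ^ 2 * lx / 2) + w * (t ^ 2 / 2 * u))) *
        (κ * e / (D ^ 2 * s)) := by
  have : e / (N * h * D) = 1 / e := by rw [← he2]; field_simp
  rw [show ∀ b : ℝ, -(-(D / (κ * N * h)) * b) * (κ * e / (D ^ 2 * s)) =
    (e / (N * h * D)) * (b / s) from fun b => by field_simp, this]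
  field_simp
  ring

lemma torsion_xτ₃ (hs : s ≠ 0) (he : e ≠ 0) (hκ : κ ≠ 0) (hD : D ≠ 0) (hN : N ≠ 0) (hh : h ≠ 0)
    (he2 : e ^ 2 = N * h * D) (z dz w lx u : ℝ) :
    t * dz / e - t * z * lx / (2 * e) - 1 / 2 * (t / s * u) * (s * w / e) =
      -(-(D * s * t / (κ * N * h)) * (dz - z * lx / 2 - w / 2 * u)) *
        (κ * e / (D ^ 2 * s)) := by
  have : e / (N * h * D) = 1 / e := by rw [← he2]; field_simp
  rw [show ∀ b : ℝ, -(-(D * s * t / (κ * N * h)) * b) * (κ * e / (D ^ 2 * s)) =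
    (e / (N * h * D)) * (b * t) from fun b => by field_simp, this]
  field_simp

lemma torsion_τφ (u lx c : ℝ)
    (hC : -s ^ 2 * y * Ax + t ^ 2 * (B - x * Bx) = (y * B - x * A) * t ^ 2 * u) :
    (-(D / c) * (y * (X' / 2 - s ^ 2 * lx / 2) + x * (t ^ 2 / 2 * u))) * (s * A / e) +
      (-(D * s * t / c) * (1 - x * lx / 2 - y / 2 * u)) * (t * B / e) =
    (-(D / c) * (Ax * s ^ 2 + A * (X' / 2 - s ^ 2 * lx / 2) + B * (t ^ 2 / 2 * u)))
        * (s * y / e) +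
      (-(D * s * t / c) * (Bx - B * lx / 2 - A / 2 * u)) * (t * x / e) := by
  linear_combination -(D * s / (c * e)) * hC

end

namespace Params

variable (P : Params)

/-! ### The frame -/

/-- The open rectangle `(x₂, x₃) × (x₁, x₂)`. -/
def box : Set (ℝ × ℝ) := Ioo P.x₂ P.x₃ ×ˢ Ioo P.x₁ P.x₂

lemma isOpen_box : IsOpen P.box := isOpen_Ioo.prod isOpen_Ioo

def fA (p : ℝ × ℝ) : ℝ := P.numA p.1 p.2 / (p.1 - p.2) ^ 2
def fB (p : ℝ × ℝ) : ℝ := P.numB p.1 p.2 / (p.1 - p.2) ^ 2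
def fs (p : ℝ × ℝ) : ℝ := √(P.quartic p.1)
def ft (p : ℝ × ℝ) : ℝ := √(-P.quartic p.2)
def fe (p : ℝ × ℝ) : ℝ := √(P.N p.1 p.2 * P.h p.1 p.2 * (p.1 - p.2))
def κ : ℝ := √P.k

/-- The orthonormal coframe, with respect to `dx, dy, dτ, dφ`. -/
def frame (p : ℝ × ℝ) : Mat4 :=
  !![P.κ * P.fe p / ((p.1 - p.2) ^ 2 * P.fs p), 0, 0, 0;
    0, P.κ * P.fe p / ((p.1 - p.2) ^ 2 * P.ft p), 0, 0;
    0, 0, P.fs p * p.2 / P.fe p, P.fs p * P.fA p / P.fe p;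
    0, 0, P.ft p * p.1 / P.fe p, P.ft p * P.fB p / P.fe p]

/-- Half of the logarithmic derivatives of `N h (x - y)`. -/
def lx (p : ℝ × ℝ) : ℝ := P.ν / P.N p.1 p.2 + P.hx p.1 p.2 / P.h p.1 p.2 + 1 / (p.1 - p.2)
def ly (p : ℝ × ℝ) : ℝ := 1 / P.N p.1 p.2 + P.hy p.1 p.2 / P.h p.1 p.2 - 1 / (p.1 - p.2)
def ux (p : ℝ × ℝ) : ℝ := 1 / P.N p.1 p.2 - 1 / (p.1 - p.2) - P.hy p.1 p.2 / P.h p.1 p.2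
def uy (p : ℝ × ℝ) : ℝ := P.ν / P.N p.1 p.2 + 1 / (p.1 - p.2) - P.hx p.1 p.2 / P.h p.1 p.2

def fAx (p : ℝ × ℝ) : ℝ :=
  (P.numAx p.1 p.2 * (p.1 - p.2) - 2 * P.numA p.1 p.2) / (p.1 - p.2) ^ 3
def fAy (p : ℝ × ℝ) : ℝ :=
  (P.numAy p.1 p.2 * (p.1 - p.2) + 2 * P.numA p.1 p.2) / (p.1 - p.2) ^ 3
def fBx (p : ℝ × ℝ) : ℝ :=
  (P.numBx p.1 p.2 * (p.1 - p.2) - 2 * P.numB p.1 p.2) / (p.1 - p.2) ^ 3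
def fBy (p : ℝ × ℝ) : ℝ :=
  (P.numBy p.1 p.2 * (p.1 - p.2) + 2 * P.numB p.1 p.2) / (p.1 - p.2) ^ 3

/-! The components of the connection form. -/

def ω₀₂τ (p : ℝ × ℝ) : ℝ := -((p.1 - p.2) / (P.κ * P.N p.1 p.2 * P.h p.1 p.2)) *
  (p.2 * (P.quartic' p.1 / 2 - P.fs p ^ 2 * P.lx p / 2) + p.1 * (P.ft p ^ 2 / 2 * P.ux p))
def ω₀₂φ (p : ℝ × ℝ) : ℝ := -((p.1 - p.2) / (P.κ * P.N p.1 p.2 * P.h p.1 p.2)) *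
  (P.fAx p * P.fs p ^ 2 + P.fA p * (P.quartic' p.1 / 2 - P.fs p ^ 2 * P.lx p / 2)
    + P.fB p * (P.ft p ^ 2 / 2 * P.ux p))
def ω₁₃τ (p : ℝ × ℝ) : ℝ := -((p.1 - p.2) / (P.κ * P.N p.1 p.2 * P.h p.1 p.2)) *
  (p.1 * (-P.quartic' p.2 / 2 - P.ft p ^ 2 * P.ly p / 2) + p.2 * (P.fs p ^ 2 / 2 * P.uy p))
def ω₁₃φ (p : ℝ × ℝ) : ℝ := -((p.1 - p.2) / (P.κ * P.N p.1 p.2 * P.h p.1 p.2)) *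
  (P.fBy p * P.ft p ^ 2 + P.fB p * (-P.quartic' p.2 / 2 - P.ft p ^ 2 * P.ly p / 2)
    + P.fA p * (P.fs p ^ 2 / 2 * P.uy p))
def ω₀₃τ (p : ℝ × ℝ) : ℝ :=
  -((p.1 - p.2) * P.fs p * P.ft p / (P.κ * P.N p.1 p.2 * P.h p.1 p.2)) *
    (1 - p.1 * P.lx p / 2 - p.2 / 2 * P.ux p)
def ω₀₃φ (p : ℝ × ℝ) : ℝ :=
  -((p.1 - p.2) * P.fs p * P.ft p / (P.κ * P.N p.1 p.2 * P.h p.1 p.2)) *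
    (P.fBx p - P.fB p * P.lx p / 2 - P.fA p / 2 * P.ux p)
def ω₁₂τ (p : ℝ × ℝ) : ℝ :=
  -((p.1 - p.2) * P.ft p * P.fs p / (P.κ * P.N p.1 p.2 * P.h p.1 p.2)) *
    (1 - p.2 * P.ly p / 2 - p.1 / 2 * P.uy p)
def ω₁₂φ (p : ℝ × ℝ) : ℝ :=
  -((p.1 - p.2) * P.ft p * P.fs p / (P.κ * P.N p.1 p.2 * P.h p.1 p.2)) *
    (P.fAy p - P.fA p * P.ly p / 2 - P.fB p / 2 * P.uy p)

/-! Its self-dual part. -/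

def sd₁τ (p : ℝ × ℝ) : ℝ := -(p.1 - p.2) ^ 2 / (2 * P.κ * P.N p.1 p.2 ^ 2)
def sd₁φ (p : ℝ × ℝ) : ℝ := P.numC p.1 p.2 / (P.κ * (p.1 - p.2) * P.N p.1 p.2 ^ 2)
def sd₂φ (p : ℝ × ℝ) : ℝ := (1 + P.ν) * (P.fs p * P.ft p) / (P.κ * (p.1 - p.2) * P.N p.1 p.2)
def sd₃x (p : ℝ × ℝ) : ℝ := P.ft p / P.fs p * (1 / P.N p.1 p.2 + 1 / (p.1 - p.2))
def sd₃y (p : ℝ × ℝ) : ℝ := -(P.fs p / P.ft p) * (P.ν / P.N p.1 p.2 - 1 / (p.1 - p.2))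

/-! Its anti-self-dual part. -/

def asd₃x (p : ℝ × ℝ) : ℝ := P.ft p / P.fs p * (P.hy p.1 p.2 / P.h p.1 p.2 + 2 / (p.1 - p.2))
def asd₃y (p : ℝ × ℝ) : ℝ := -(P.fs p / P.ft p) * (P.hx p.1 p.2 / P.h p.1 p.2 - 2 / (p.1 - p.2))
def asd₁τ (p : ℝ × ℝ) : ℝ := (p.1 - p.2) * P.numQ p.1 p.2 / (P.κ * P.h p.1 p.2 ^ 2)
def asd₂τ (p : ℝ × ℝ) : ℝ :=
  P.fs p * P.ft p * (p.1 - p.2) * (P.a₁ - P.a₃ * p.1 * p.2) / (P.κ * P.h p.1 p.2 ^ 2)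

section

variable {P} {p : ℝ × ℝ}

lemma box_facts (hp : p ∈ P.box) : 0 < p.1 - p.2 ∧ P.N p.1 p.2 < 0 ∧ P.h p.1 p.2 < 0 ∧
    0 < P.quartic p.1 ∧ P.quartic p.2 < 0 := by
  obtain ⟨⟨h1, h2⟩, ⟨h3, h4⟩⟩ := hp
  exact ⟨by linarith, P.N_neg h1.le h4.le, P.h_neg h1.le h2.le h3.le h4.le, P.quartic_pos h1 h2,
    P.quartic_neg h3 h4⟩

lemma κ_pos : 0 < P.κ := Real.sqrt_pos.2 P.k_pos

lemma κ_sq : P.κ ^ 2 = P.k := Real.sq_sqrt P.k_pos.le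

lemma sub_ne (hp : p ∈ P.box) : p.1 - p.2 ≠ 0 := (box_facts hp).1.ne'
lemma N_ne (hp : p ∈ P.box) : P.N p.1 p.2 ≠ 0 := (box_facts hp).2.1.ne
lemma h_ne (hp : p ∈ P.box) : P.h p.1 p.2 ≠ 0 := (box_facts hp).2.2.1.ne
lemma fs_pos (hp : p ∈ P.box) : 0 < P.fs p := Real.sqrt_pos.2 (box_facts hp).2.2.2.1
lemma ft_pos (hp : p ∈ P.box) : 0 < P.ft p := Real.sqrt_pos.2 (neg_pos.2 (box_facts hp).2.2.2.2)
lemma NhD_pos (hp : p ∈ P.box) : 0 < P.N p.1 p.2 * P.h p.1 p.2 * (p.1 - p.2) :=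
  mul_pos (mul_pos_of_neg_of_neg (box_facts hp).2.1 (box_facts hp).2.2.1) (box_facts hp).1
lemma fe_pos (hp : p ∈ P.box) : 0 < P.fe p := Real.sqrt_pos.2 (NhD_pos hp)
lemma fs_sq (hp : p ∈ P.box) : P.fs p ^ 2 = P.quartic p.1 :=
  Real.sq_sqrt (box_facts hp).2.2.2.1.le
lemma ft_sq (hp : p ∈ P.box) : P.ft p ^ 2 = -P.quartic p.2 :=
  Real.sq_sqrt (neg_pos.2 (box_facts hp).2.2.2.2).le
lemma fe_sq (hp : p ∈ P.box) : P.fe p ^ 2 = P.N p.1 p.2 * P.h p.1 p.2 * (p.1 - p.2) :=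
  Real.sq_sqrt (NhD_pos hp).le

lemma ω_sub_τ₁ (hp : p ∈ P.box) : P.ω₀₂τ p - P.ω₁₃τ p = P.sd₁τ p := by
  have hD := sub_ne hp
  have hN := N_ne hp
  have hh := h_ne hp
  have hκ := (κ_pos (P := P)).ne'
  have key := P.quartic_identity p.1 p.2
  simp only [ω₀₂τ, ω₁₃τ, sd₁τ, lx, ly, ux, uy, fs_sq hp, ft_sq hp]
  have eN : P.N p.1 p.2 = P.ν * p.1 + p.2 := rfl
  generalize P.N p.1 p.2 = n at *
  generalize P.h p.1 p.2 = hh' at *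
  obtain ⟨x, y⟩ := p
  simp only at *
  generalize hDD : x - y = D at *
  generalize P.quartic x = X at *
  generalize P.quartic y = Y at *
  generalize P.quartic' x = X' at *
  generalize P.quartic' y = Y' at *
  field_simp
  obtain rfl : x = y + D := by linarith
  subst eN
  linear_combination -hh' * key

lemma ω_sub_φ₁ (hp : p ∈ P.box) : P.ω₀₂φ p - P.ω₁₃φ p = P.sd₁φ p := by
  have hD := sub_ne hp
  have hN := N_ne hp
  have hh := h_ne hp
  have hκ := (κ_pos (P := P)).ne'
  have key := P.numC_identity p.1 p.2
  simp only [ω₀₂φ, ω₁₃φ, sd₁φ, lx, ly, ux, uy, fA, fB, fAx, fBy, fs_sq hp, ft_sq hp]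
  have eN : P.N p.1 p.2 = P.ν * p.1 + p.2 := rfl
  generalize P.N p.1 p.2 = n at *
  generalize P.h p.1 p.2 = hh' at *
  obtain ⟨x, y⟩ := p
  simp only at *
  generalize hDD : x - y = D at *
  generalize P.quartic x = X at *
  generalize P.quartic y = Y at *
  generalize P.quartic' x = X' at *
  generalize P.quartic' y = Y' at *
  generalize P.numA x y = a at *
  generalize P.numB x y = b at *
  generalize P.numAx x y = ax at *
  generalize P.numBy x y = b_y at *
  generalize P.numC x y = c at *
  field_simp
  obtain rfl : x = y + D := by linarith
  subst eN
  linear_combination 2 * hh' * key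

lemma ω_add_τ₂ (hp : p ∈ P.box) : P.ω₀₃τ p + P.ω₁₂τ p = 0 := by
  have hD := sub_ne hp
  have hN := N_ne hp
  have hh := h_ne hp
  have hκ := (κ_pos (P := P)).ne'
  simp only [ω₀₃τ, ω₁₂τ, lx, ly, ux, uy]
  have eN : P.N p.1 p.2 = P.ν * p.1 + p.2 := rfl
  generalize P.N p.1 p.2 = n at *
  generalize P.h p.1 p.2 = hh' at *
  obtain ⟨x, y⟩ := p
  simp only at *
  generalize hDD : x - y = D at *
  field_simp
  obtain rfl : x = y + D := by linarith
  subst eN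
  ring

lemma ω_add_φ₂ (hp : p ∈ P.box) : P.ω₀₃φ p + P.ω₁₂φ p = P.sd₂φ p := by
  have hD := sub_ne hp
  have hN := N_ne hp
  have hh := h_ne hp
  have hκ := (κ_pos (P := P)).ne'
  have key := P.numAy_add_numBx p.1 p.2
  have key1 := P.numB_sub_numA p.1 p.2
  simp only [ω₀₃φ, ω₁₂φ, sd₂φ, lx, ly, ux, uy, fA, fB, fAy, fBx]
  have eN : P.N p.1 p.2 = P.ν * p.1 + p.2 := rfl
  generalize P.N p.1 p.2 = n at *
  generalize P.h p.1 p.2 = hh' at *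
  obtain ⟨x, y⟩ := p
  simp only at *
  generalize hDD : x - y = D at *
  generalize P.numA x y = a at *
  generalize P.numB x y = b at *
  generalize P.numAy x y = ay at *
  generalize P.numBx x y = bx at *
  field_simp
  obtain rfl : x = y + D := by linarith
  subst eN
  linear_combination (-2 * P.fs (y + D, y) * P.ft (y + D, y) * hh' * (P.ν * (y + D) + y)) * key
    - 2 * (1 + P.ν) * P.fs (y + D, y) * P.ft (y + D, y) * hh' * key1

lemma ω_add_τ₁ (hp : p ∈ P.box) : P.ω₀₂τ p + P.ω₁₃τ p = P.asd₁τ p := by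
  have hD := sub_ne hp
  have hN := N_ne hp
  have hh := h_ne hp
  have hκ := (κ_pos (P := P)).ne'
  have key := P.numQ_identity p.1 p.2
  simp only [ω₀₂τ, ω₁₃τ, asd₁τ, lx, ly, ux, uy, fs_sq hp, ft_sq hp]
  have eN : P.N p.1 p.2 = P.ν * p.1 + p.2 := rfl
  generalize P.N p.1 p.2 = n at *
  generalize P.h p.1 p.2 = hh' at *
  obtain ⟨x, y⟩ := p
  simp only at *
  generalize hDD : x - y = D at *
  generalize P.quartic x = X at *
  generalize P.quartic y = Y at *
  generalize P.quartic' x = X' at *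
  generalize P.quartic' y = Y' at *
  generalize P.numQ x y = q at *
  field_simp
  obtain rfl : x = y + D := by linarith
  subst eN
  linear_combination 2 * D * (P.ν * (y + D) + y) * key

lemma ω_sub_τ₂ (hp : p ∈ P.box) : P.ω₀₃τ p - P.ω₁₂τ p = P.asd₂τ p := by
  have hD := sub_ne hp
  have hN := N_ne hp
  have hh := h_ne hp
  have hκ := (κ_pos (P := P)).ne'
  have key := P.euler_h p.1 p.2
  simp only [ω₀₃τ, ω₁₂τ, asd₂τ, lx, ly, ux, uy]
  have eN : P.N p.1 p.2 = P.ν * p.1 + p.2 := rfl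
  generalize P.N p.1 p.2 = n at *
  generalize P.h p.1 p.2 = hh' at *
  obtain ⟨x, y⟩ := p
  simp only at *
  generalize hDD : x - y = D at *
  generalize P.hx x y = h1 at *
  generalize P.hy x y = h2 at *
  field_simp
  obtain rfl : x = y + D := by linarith
  subst eN
  linear_combination
    -2 * D * (P.ν * (y + D) + y) * P.fs (y + D, y) * P.ft (y + D, y) * key

lemma conn_rel_x (hp : p ∈ P.box) : -P.fs p ^ 2 * p.2 * P.fAx p
    + P.ft p ^ 2 * (P.fB p - p.1 * P.fBx p) =
    (p.2 * P.fB p - p.1 * P.fA p) * P.ft p ^ 2 * P.ux p := by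
  have hD := sub_ne hp
  have hN := N_ne hp
  have hh := h_ne hp
  have hκ := (κ_pos (P := P)).ne'
  have key := P.conn_x p.1 p.2
  have key1 := P.numB_sub_numA p.1 p.2
  simp only [ux, fA, fB, fAx, fBx, fs_sq hp, ft_sq hp]
  have eN : P.N p.1 p.2 = P.ν * p.1 + p.2 := rfl
  generalize P.N p.1 p.2 = n at *
  generalize P.h p.1 p.2 = hh' at *
  obtain ⟨x, y⟩ := p
  simp only at *
  generalize hDD : x - y = D at *
  generalize P.quartic x = X at *
  generalize P.quartic y = Y at *
  generalize P.numA x y = a at *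
  generalize P.numB x y = b at *
  generalize P.numAx x y = ax at *
  generalize P.numBx x y = bx at *
  generalize P.hy x y = h2 at *
  field_simp
  obtain rfl : x = y + D := by linarith
  subst eN
  linear_combination ((P.ν * (y + D) + y) * hh') * key
    + Y * (hh' * D - (P.ν * (y + D) + y) * hh' - (P.ν * (y + D) + y) * D * h2) * key1

lemma conn_rel_y (hp : p ∈ P.box) : -P.ft p ^ 2 * p.1 * P.fBy p
    + P.fs p ^ 2 * (P.fA p - p.2 * P.fAy p) =
    (p.1 * P.fA p - p.2 * P.fB p) * P.fs p ^ 2 * P.uy p := by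
  have hD := sub_ne hp
  have hN := N_ne hp
  have hh := h_ne hp
  have hκ := (κ_pos (P := P)).ne'
  have key := P.conn_y p.1 p.2
  have key1 := P.numB_sub_numA p.1 p.2
  simp only [uy, fA, fB, fAy, fBy, fs_sq hp, ft_sq hp]
  have eN : P.N p.1 p.2 = P.ν * p.1 + p.2 := rfl
  generalize P.N p.1 p.2 = n at *
  generalize P.h p.1 p.2 = hh' at *
  obtain ⟨x, y⟩ := p
  simp only at *
  generalize hDD : x - y = D at *
  generalize P.quartic x = X at *
  generalize P.quartic y = Y at *
  generalize P.numA x y = a at *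
  generalize P.numB x y = b at *
  generalize P.numAy x y = ay at *
  generalize P.numBy x y = b_y at *
  generalize P.hx x y = h1 at *
  field_simp
  obtain rfl : x = y + D := by linarith
  subst eN
  linear_combination ((P.ν * (y + D) + y) * hh') * key
    + X * (P.ν * hh' * D + (P.ν * (y + D) + y) * hh' - (P.ν * (y + D) + y) * D * h1) * key1

end

end Params

end ChenTeo
end

open Set Filter Topology Manifold Bundle
open scoped ContDiff

noncomputable section

namespace ChenTeo

namespace Params

variable {P : Params} {p : ℝ × ℝ}

/-! ### Derivatives of the frame -/

lemma hasDir_sub : HasDir (fun q => q.1 - q.2) p 1 (-1) :=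
  (HasDir.fst.sub HasDir.snd).congr (by ring) (by ring)

lemma hasDir_fs (hp : p ∈ P.box) : HasDir P.fs p (P.quartic' p.1 / (2 * P.fs p)) 0 :=
  ((P.hasDir_X p).sqrt (box_facts hp).2.2.2.1).congr rfl (by simp)

lemma hasDir_ft (hp : p ∈ P.box) : HasDir P.ft p 0 (-P.quartic' p.2 / (2 * P.ft p)) :=
  ((P.hasDir_Y p).neg.sqrt (neg_pos.2 (box_facts hp).2.2.2.2)).congr (by simp) rfl

lemma hasDir_fe (hp : p ∈ P.box) :
    HasDir P.fe p (P.fe p * P.lx p / 2) (P.fe p * P.ly p / 2) := by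
  have hD := sub_ne hp
  have hN := N_ne hp
  have hh := h_ne hp
  have he := (fe_pos hp).ne'
  have key := ((((P.hasDir_N p).mul (P.hasDir_h p)).mul hasDir_sub).sqrt (NhD_pos hp))
  refine key.congr ?_ ?_
  · change _ / (2 * P.fe p) = _
    rw [div_eq_iff (by positivity)]
    have : P.fe p * P.lx p / 2 * (2 * P.fe p) = P.fe p ^ 2 * P.lx p := by ring
    rw [this, fe_sq hp, lx]
    field_simp
  · change _ / (2 * P.fe p) = _
    rw [div_eq_iff (by positivity)]
    have : P.fe p * P.ly p / 2 * (2 * P.fe p) = P.fe p ^ 2 * P.ly p := by ring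
    rw [this, fe_sq hp, ly]
    field_simp
    ring

lemma hasDir_fA (hp : p ∈ P.box) : HasDir P.fA p (P.fAx p) (P.fAy p) := by
  have hD := sub_ne hp
  refine ((P.hasDir_numA p).div (hasDir_sub.pow 2) (pow_ne_zero 2 hD)).congr ?_ ?_
  · simp only [fAx]; field_simp; norm_num; ring
  · simp only [fAy]; field_simp; norm_num; ring

lemma hasDir_fB (hp : p ∈ P.box) : HasDir P.fB p (P.fBx p) (P.fBy p) := by
  have hD := sub_ne hp
  refine ((P.hasDir_numB p).div (hasDir_sub.pow 2) (pow_ne_zero 2 hD)).congr ?_ ?_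
  · simp only [fBx]; field_simp; norm_num; ring
  · simp only [fBy]; field_simp; norm_num; ring

lemma hasDir_s_mul (hp : p ∈ P.box) {z : ℝ × ℝ → ℝ} {a b : ℝ} (hz : HasDir z p a b) :
    HasDir (fun q => P.fs q * z q / P.fe q) p
      (z p * (P.quartic' p.1 / (2 * P.fs p) - P.fs p * P.lx p / 2) / P.fe p + P.fs p * a / P.fe p)
      (P.fs p * b / P.fe p - P.fs p * z p * P.ly p / (2 * P.fe p)) := by
  have he := (fe_pos hp).ne'
  refine (((hasDir_fs hp).mul hz).div (hasDir_fe hp) he).congr ?_ ?_ <;> field_simp <;> ring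

lemma hasDir_t_mul (hp : p ∈ P.box) {z : ℝ × ℝ → ℝ} {a b : ℝ} (hz : HasDir z p a b) :
    HasDir (fun q => P.ft q * z q / P.fe q) p
      (P.ft p * a / P.fe p - P.ft p * z p * P.lx p / (2 * P.fe p))
      (z p * (-P.quartic' p.2 / (2 * P.ft p) - P.ft p * P.ly p / 2) / P.fe p + P.ft p * b / P.fe p)
      := by
  have he := (fe_pos hp).ne'
  refine (((hasDir_ft hp).mul hz).div (hasDir_fe hp) he).congr ?_ ?_ <;> field_simp <;> ring

lemma dir_frame₀₀ (hp : p ∈ P.box) : dir 1 (fun q => P.κ * P.fe q / ((q.1 - q.2) ^ 2 * P.fs q)) p =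
    P.κ * P.fe p * (P.ly p / 2 + 2 / (p.1 - p.2)) / ((p.1 - p.2) ^ 2 * P.fs p) := by
  have hD := sub_ne hp
  have hs := (fs_pos hp).ne'
  rw [(((HasDir.const P.κ).mul (hasDir_fe hp)).div ((hasDir_sub.pow 2).mul (hasDir_fs hp))
    (by positivity)).dir_one]
  field_simp
  norm_num
  ring

lemma dir_frame₁₁ (hp : p ∈ P.box) : dir 0 (fun q => P.κ * P.fe q / ((q.1 - q.2) ^ 2 * P.ft q)) p =
    P.κ * P.fe p * (P.lx p / 2 - 2 / (p.1 - p.2)) / ((p.1 - p.2) ^ 2 * P.ft p) := by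
  have hD := sub_ne hp
  have ht := (ft_pos hp).ne'
  rw [(((HasDir.const P.κ).mul (hasDir_fe hp)).div ((hasDir_sub.pow 2).mul (hasDir_ft hp))
    (by positivity)).dir_zero]
  field_simp
  norm_num
  ring

/-! ### The structure equations -/

variable (P) in
def asd₁φ (p : ℝ × ℝ) : ℝ := 2 * P.ω₀₂φ p - P.sd₁φ p

variable (P) in
def asd₂φ (p : ℝ × ℝ) : ℝ := 2 * P.ω₀₃φ p - P.sd₂φ p

variable (P) in
/-- The self-dual part of the connection form. -/
def connSD (A i : Fin 4) (p : ℝ × ℝ) : ℝ :=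
  ![![0, 0, P.sd₁τ p, P.sd₁φ p] A, ![0, 0, 0, P.sd₂φ p] A, ![P.sd₃x p, P.sd₃y p, 0, 0] A, 0] i

variable (P) in
/-- The anti-self-dual part of the connection form. -/
def connASD (A i : Fin 4) (p : ℝ × ℝ) : ℝ :=
  ![![0, 0, P.asd₁τ p, P.asd₁φ p] A, ![0, 0, P.asd₂τ p, P.asd₂φ p] A,
    ![P.asd₃x p, P.asd₃y p, 0, 0] A, 0] i

variable (P) in
/-- The connection form of the frame. -/
def conn (A : Fin 4) (p : ℝ × ℝ) : Mat4 :=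
  (1 / 2 : ℝ) • (sd (P.connSD A 0 p) (P.connSD A 1 p) (P.connSD A 2 p) +
    asd (P.connASD A 0 p) (P.connASD A 1 p) (P.connASD A 2 p))

lemma conn_x_eq (p : ℝ × ℝ) : P.conn 0 p =
    !![0, 1 / 2 * (P.sd₃x p + P.asd₃x p), 0, 0; -(1 / 2 * (P.sd₃x p + P.asd₃x p)), 0, 0, 0;
      0, 0, 0, 1 / 2 * (P.ft p / P.fs p * P.ux p); 0, 0, -(1 / 2 * (P.ft p / P.fs p * P.ux p)), 0] := by
  have : P.ft p / P.fs p * P.ux p = P.sd₃x p - P.asd₃x p := by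
    simp only [ux, sd₃x, asd₃x]; ring
  rw [this]
  ext a b; fin_cases a <;> fin_cases b <;> simp [conn, sd, asd, connSD, connASD] <;> ring

lemma conn_y_eq (p : ℝ × ℝ) : P.conn 1 p =
    !![0, 1 / 2 * (P.sd₃y p + P.asd₃y p), 0, 0; -(1 / 2 * (P.sd₃y p + P.asd₃y p)), 0, 0, 0;
      0, 0, 0, -(1 / 2 * (P.fs p / P.ft p * P.uy p)); 0, 0, 1 / 2 * (P.fs p / P.ft p * P.uy p), 0] := by
  have : P.fs p / P.ft p * P.uy p = -(P.sd₃y p - P.asd₃y p) := by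
    simp only [uy, sd₃y, asd₃y]; ring
  rw [this]
  ext a b; fin_cases a <;> fin_cases b <;> simp [conn, sd, asd, connSD, connASD] <;> ring

lemma conn_τ_eq (hp : p ∈ P.box) : P.conn 2 p =
    !![0, 0, P.ω₀₂τ p, P.ω₀₃τ p; 0, 0, P.ω₁₂τ p, P.ω₁₃τ p;
      -P.ω₀₂τ p, -P.ω₁₂τ p, 0, 0; -P.ω₀₃τ p, -P.ω₁₃τ p, 0, 0] := by
  have h1 := ω_sub_τ₁ hp
  have h2 := ω_add_τ₁ hp
  have h3 := ω_add_τ₂ hp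
  have h4 := ω_sub_τ₂ hp
  ext a b; fin_cases a <;> fin_cases b <;> simp [conn, sd, asd, connSD, connASD] <;> linarith

lemma conn_φ_eq (hp : p ∈ P.box) : P.conn 3 p =
    !![0, 0, P.ω₀₂φ p, P.ω₀₃φ p; 0, 0, P.ω₁₂φ p, P.ω₁₃φ p;
      -P.ω₀₂φ p, -P.ω₁₂φ p, 0, 0; -P.ω₀₃φ p, -P.ω₁₃φ p, 0, 0] := by
  have h1 := ω_sub_φ₁ hp
  have h3 := ω_add_φ₂ hp
  ext a b; fin_cases a <;> fin_cases b <;>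
    simp [conn, sd, asd, connSD, connASD, asd₁φ, asd₂φ] <;> linarith

lemma dir_two (f : ℝ × ℝ → ℝ) : dir 2 f p = 0 := rfl
lemma dir_three (f : ℝ × ℝ → ℝ) : dir 3 f p = 0 := rfl

lemma dir_const (A : Fin 4) (c : ℝ) : dir A (fun _ => c) p = 0 := by
  fin_cases A
  · exact (HasDir.const c).dir_zero
  · exact (HasDir.const c).dir_one
  · rfl
  · rfl

lemma frame_torsion_lt (hp : p ∈ P.box) (a A B : Fin 4) (hAB : A < B) :
    dir A (fun q => P.frame q a B) p + (P.conn A p * P.frame p) a B =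
      dir B (fun q => P.frame q a A) p + (P.conn B p * P.frame p) a A := by
  have hD := sub_ne hp
  have hN := N_ne hp
  have hh := h_ne hp
  have hκ := (κ_pos (P := P)).ne'
  have hs := (fs_pos hp).ne'
  have ht := (ft_pos hp).ne'
  have he := (fe_pos hp).ne'
  have he2 := fe_sq hp
  have d22 := hasDir_s_mul hp (HasDir.snd (p := p))
  have d23 := hasDir_s_mul hp (hasDir_fA hp)
  have d32 := hasDir_t_mul hp (HasDir.fst (p := p))
  have d33 := hasDir_t_mul hp (hasDir_fB hp)
  have x2τ := torsion_xτ₂ (X' := P.quartic' p.1) (t := P.ft p) hs he hκ hD hN hh he2 p.2 0 p.1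
    (P.lx p) (P.ux p)
  have x2φ := torsion_xτ₂ (X' := P.quartic' p.1) (t := P.ft p) hs he hκ hD hN hh he2 (P.fA p)
    (P.fAx p) (P.fB p) (P.lx p) (P.ux p)
  have x3τ := torsion_xτ₃ (t := P.ft p) hs he hκ hD hN hh he2 p.1 1 p.2 (P.lx p) (P.ux p)
  have x3φ := torsion_xτ₃ (t := P.ft p) hs he hκ hD hN hh he2 (P.fB p) (P.fBx p) (P.fA p)
    (P.lx p) (P.ux p)
  have y3τ := torsion_xτ₂ (X' := -P.quartic' p.2) (t := P.fs p) ht he hκ hD hN hh he2 p.1 0 p.2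
    (P.ly p) (P.uy p)
  have y3φ := torsion_xτ₂ (X' := -P.quartic' p.2) (t := P.fs p) ht he hκ hD hN hh he2 (P.fB p)
    (P.fBy p) (P.fA p) (P.ly p) (P.uy p)
  have y2τ := torsion_xτ₃ (t := P.fs p) ht he hκ hD hN hh he2 p.2 1 p.1 (P.ly p) (P.uy p)
  have y2φ := torsion_xτ₃ (t := P.fs p) ht he hκ hD hN hh he2 (P.fA p) (P.fAy p) (P.fB p)
    (P.ly p) (P.uy p)
  have t0 := torsion_τφ (D := p.1 - p.2) (e := P.fe p) (X' := P.quartic' p.1) (P.ux p) (P.lx p)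
    (P.κ * P.N p.1 p.2 * P.h p.1 p.2) (conn_rel_x hp)
  have t1 := torsion_τφ (D := p.1 - p.2) (e := P.fe p) (X' := -P.quartic' p.2) (P.uy p) (P.ly p)
    (P.κ * P.N p.1 p.2 * P.h p.1 p.2) (conn_rel_y hp)
  have f00 := dir_frame₀₀ hp
  have f11 := dir_frame₁₁ hp
  simp only [Matrix.mul_apply, Fin.sum_univ_four]
  fin_cases A <;> fin_cases B <;> first | exact absurd hAB (by decide) | skip
  · -- dx ∧ dy
    clear x2τ x2φ x3τ x3φ y3τ y3φ y2τ y2φ t0 t1 d22 d23 d32 d33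
    fin_cases a <;> simp [conn_x_eq, conn_y_eq, frame, dir_const]
    · rw [f00]
      simp only [sd₃x, asd₃x, ly]
      field_simp
      ring
    · rw [f11]
      simp only [sd₃y, asd₃y, lx]
      field_simp
      ring
  · fin_cases a
    · simp [conn_x_eq, conn_τ_eq hp, frame, dir_const, dir_two]
    · simp [conn_x_eq, conn_τ_eq hp, frame, dir_const]
    · simp [conn_x_eq, conn_τ_eq hp, frame, dir_two]
      rw [d22.dir_zero]
      simp only [ω₀₂τ] at *
      linear_combination x2τ
    · simp [conn_x_eq, conn_τ_eq hp, frame, dir_two]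
      rw [d32.dir_zero]
      simp only [ω₀₃τ] at *
      linear_combination x3τ
  · fin_cases a
    · simp [conn_x_eq, conn_φ_eq hp, frame, dir_const, dir_three]
    · simp [conn_x_eq, conn_φ_eq hp, frame, dir_const]
    · simp [conn_x_eq, conn_φ_eq hp, frame, dir_three]
      rw [d23.dir_zero]
      simp only [ω₀₂φ] at *
      linear_combination x2φ
    · simp [conn_x_eq, conn_φ_eq hp, frame, dir_three]
      rw [d33.dir_zero]
      simp only [ω₀₃φ] at *
      linear_combination x3φ
  · fin_cases a
    · simp [conn_y_eq, conn_τ_eq hp, frame, dir_const]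
    · simp [conn_y_eq, conn_τ_eq hp, frame, dir_const, dir_two]
    · simp [conn_y_eq, conn_τ_eq hp, frame, dir_two]
      rw [d22.dir_one]
      simp only [ω₁₂τ] at *
      linear_combination y2τ
    · simp [conn_y_eq, conn_τ_eq hp, frame, dir_two]
      rw [d32.dir_one]
      simp only [ω₁₃τ] at *
      linear_combination y3τ
  · fin_cases a
    · simp [conn_y_eq, conn_φ_eq hp, frame, dir_const]
    · simp [conn_y_eq, conn_φ_eq hp, frame, dir_const, dir_three]
    · simp [conn_y_eq, conn_φ_eq hp, frame, dir_three]
      rw [d23.dir_one]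
      simp only [ω₁₂φ] at *
      linear_combination y2φ
    · simp [conn_y_eq, conn_φ_eq hp, frame, dir_three]
      rw [d33.dir_one]
      simp only [ω₁₃φ] at *
      linear_combination y3φ
  · fin_cases a
    · simp [conn_τ_eq hp, conn_φ_eq hp, frame, dir_two, dir_three]
      simp only [ω₀₂τ, ω₀₂φ, ω₀₃τ, ω₀₃φ] at *
      linear_combination t0
    · simp [conn_τ_eq hp, conn_φ_eq hp, frame, dir_two, dir_three]
      simp only [ω₁₂τ, ω₁₂φ, ω₁₃τ, ω₁₃φ] at *
      linear_combination t1
    · simp [conn_τ_eq hp, conn_φ_eq hp, frame, dir_two, dir_three]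
    · simp [conn_τ_eq hp, conn_φ_eq hp, frame, dir_two, dir_three]

lemma frame_torsion (hp : p ∈ P.box) (a A B : Fin 4) :
    dir A (fun q => P.frame q a B) p + (P.conn A p * P.frame p) a B =
      dir B (fun q => P.frame q a A) p + (P.conn B p * P.frame p) a A := by
  rcases lt_trichotomy A B with h | rfl | h
  · exact frame_torsion_lt hp a A B h
  · rfl
  · exact (frame_torsion_lt hp a B A h).symm

/-! ### Smoothness -/

section

variable (P)

lemma contDiff_N : ContDiff ℝ ∞ (fun q : ℝ × ℝ => P.N q.1 q.2) := by unfold N; fun_prop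
lemma contDiff_h : ContDiff ℝ ∞ (fun q : ℝ × ℝ => P.h q.1 q.2) := by unfold h; fun_prop
lemma contDiff_hx : ContDiff ℝ ∞ (fun q : ℝ × ℝ => P.hx q.1 q.2) := by unfold hx; fun_prop
lemma contDiff_hy : ContDiff ℝ ∞ (fun q : ℝ × ℝ => P.hy q.1 q.2) := by unfold hy; fun_prop
lemma contDiff_numA : ContDiff ℝ ∞ (fun q : ℝ × ℝ => P.numA q.1 q.2) := by unfold numA; fun_prop
lemma contDiff_numB : ContDiff ℝ ∞ (fun q : ℝ × ℝ => P.numB q.1 q.2) := by unfold numB; fun_prop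
lemma contDiff_numC : ContDiff ℝ ∞ (fun q : ℝ × ℝ => P.numC q.1 q.2) := by unfold numC; fun_prop
lemma contDiff_numQ : ContDiff ℝ ∞ (fun q : ℝ × ℝ => P.numQ q.1 q.2) := by unfold numQ; fun_prop
lemma contDiff_numAx : ContDiff ℝ ∞ (fun q : ℝ × ℝ => P.numAx q.1 q.2) := by
  unfold numAx; fun_prop
lemma contDiff_numBx : ContDiff ℝ ∞ (fun q : ℝ × ℝ => P.numBx q.1 q.2) := by
  unfold numBx; fun_prop
lemma contDiff_quartic : ContDiff ℝ ∞ P.quartic := by unfold quartic; fun_prop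
lemma contDiff_quartic' : ContDiff ℝ ∞ P.quartic' := by unfold quartic'; fun_prop

lemma contDiffOn_fs : ContDiffOn ℝ ∞ P.fs P.box :=
  ((P.contDiff_quartic.comp contDiff_fst).contDiffOn).sqrt
    fun _ hp => (box_facts hp).2.2.2.1.ne'

lemma contDiffOn_ft : ContDiffOn ℝ ∞ P.ft P.box :=
  ((P.contDiff_quartic.comp contDiff_snd).neg.contDiffOn).sqrt
    fun _ hp => (neg_pos.2 (box_facts hp).2.2.2.2).ne'

lemma contDiffOn_fe : ContDiffOn ℝ ∞ P.fe P.box :=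
  (((P.contDiff_N.mul P.contDiff_h).mul (contDiff_fst.sub contDiff_snd)).contDiffOn).sqrt
    fun _ hp => (NhD_pos hp).ne'

lemma contDiffOn_fA : ContDiffOn ℝ ∞ P.fA P.box :=
  P.contDiff_numA.contDiffOn.div ((contDiff_fst.sub contDiff_snd).pow 2).contDiffOn
    fun _ hp => pow_ne_zero 2 (sub_ne hp)

lemma contDiffOn_fB : ContDiffOn ℝ ∞ P.fB P.box :=
  P.contDiff_numB.contDiffOn.div ((contDiff_fst.sub contDiff_snd).pow 2).contDiffOn
    fun _ hp => pow_ne_zero 2 (sub_ne hp)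

lemma contDiffOn_frame (a b : Fin 4) : ContDiffOn ℝ ∞ (fun q => P.frame q a b) P.box := by
  have h1 := P.contDiffOn_fs
  have h2 := P.contDiffOn_ft
  have h3 := P.contDiffOn_fe
  have h4 := P.contDiffOn_fA
  have h5 := P.contDiffOn_fB
  have n1 : ∀ p ∈ P.box, P.fs p ≠ 0 := fun p hp => (fs_pos hp).ne'
  have n2 : ∀ p ∈ P.box, P.ft p ≠ 0 := fun p hp => (ft_pos hp).ne'
  have n3 : ∀ p ∈ P.box, P.fe p ≠ 0 := fun p hp => (fe_pos hp).ne'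
  have n4 : ∀ p ∈ P.box, (p.1 - p.2) ^ 2 ≠ 0 := fun p hp => pow_ne_zero 2 (sub_ne hp)
  have d : ContDiffOn ℝ ∞ (fun q : ℝ × ℝ => (q.1 - q.2) ^ 2) P.box := by fun_prop
  fin_cases a <;> fin_cases b <;> simp [frame] <;> try exact contDiffOn_const
  · exact (contDiffOn_const.mul h3).div (d.mul h1) fun p hp => mul_ne_zero (n4 p hp) (n1 p hp)
  · exact (contDiffOn_const.mul h3).div (d.mul h2) fun p hp => mul_ne_zero (n4 p hp) (n2 p hp)
  · exact (h1.mul contDiffOn_snd).div h3 n3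
  · exact (h1.mul h4).div h3 n3
  · exact (h2.mul contDiffOn_fst).div h3 n3
  · exact (h2.mul h5).div h3 n3

lemma contDiffOn_connSD (A i : Fin 4) : ContDiffOn ℝ ∞ (P.connSD A i) P.box := by
  have h1 := P.contDiffOn_fs
  have h2 := P.contDiffOn_ft
  have hC := P.contDiff_numC.contDiffOn (s := P.box)
  have hN := P.contDiff_N.contDiffOn (s := P.box)
  have d : ContDiffOn ℝ ∞ (fun q : ℝ × ℝ => q.1 - q.2) P.box := by fun_prop
  have n0 := (κ_pos (P := P)).ne'
  have n1 : ∀ p ∈ P.box, P.fs p ≠ 0 := fun p hp => (fs_pos hp).ne'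
  have n2 : ∀ p ∈ P.box, P.ft p ≠ 0 := fun p hp => (ft_pos hp).ne'
  have n3 : ∀ p ∈ P.box, P.N p.1 p.2 ≠ 0 := fun p hp => N_ne hp
  have n4 : ∀ p ∈ P.box, p.1 - p.2 ≠ 0 := fun p hp => sub_ne hp
  have hi : ContDiffOn ℝ ∞ (fun q : ℝ × ℝ => 1 / P.N q.1 q.2) P.box := contDiffOn_const.div hN n3
  have hν : ContDiffOn ℝ ∞ (fun q : ℝ × ℝ => P.ν / P.N q.1 q.2) P.box := contDiffOn_const.div hN n3
  have hd : ContDiffOn ℝ ∞ (fun q : ℝ × ℝ => 1 / (q.1 - q.2)) P.box := contDiffOn_const.div d n4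
  unfold connSD
  fin_cases i <;> fin_cases A <;> simp <;> try exact contDiffOn_const
  · exact (d.pow 2).neg.div (contDiffOn_const.mul (hN.pow 2))
      fun p hp => mul_ne_zero (mul_ne_zero two_ne_zero n0) (pow_ne_zero 2 (n3 p hp))
  · exact hC.div ((contDiffOn_const.mul d).mul (hN.pow 2))
      fun p hp => mul_ne_zero (mul_ne_zero n0 (n4 p hp)) (pow_ne_zero 2 (n3 p hp))
  · exact (contDiffOn_const.mul (h1.mul h2)).div ((contDiffOn_const.mul d).mul hN)
      fun p hp => mul_ne_zero (mul_ne_zero n0 (n4 p hp)) (n3 p hp)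
  · exact (h2.div h1 n1).mul (hi.add hd)
  · exact (h1.div h2 n2).neg.mul (hν.sub hd)

lemma contDiffOn_connASD (A i : Fin 4) : ContDiffOn ℝ ∞ (P.connASD A i) P.box := by
  have h1 := P.contDiffOn_fs
  have h2 := P.contDiffOn_ft
  have hQ := P.contDiff_numQ.contDiffOn (s := P.box)
  have hN := P.contDiff_N.contDiffOn (s := P.box)
  have hh := P.contDiff_h.contDiffOn (s := P.box)
  have hhx := P.contDiff_hx.contDiffOn (s := P.box)
  have hhy := P.contDiff_hy.contDiffOn (s := P.box)
  have hA := P.contDiffOn_fA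
  have hB := P.contDiffOn_fB
  have hX : ContDiffOn ℝ ∞ (fun q : ℝ × ℝ => P.quartic' q.1) P.box :=
    (P.contDiff_quartic'.comp contDiff_fst).contDiffOn
  have d : ContDiffOn ℝ ∞ (fun q : ℝ × ℝ => q.1 - q.2) P.box := by fun_prop
  have n0 := (κ_pos (P := P)).ne'
  have n1 : ∀ p ∈ P.box, P.fs p ≠ 0 := fun p hp => (fs_pos hp).ne'
  have n2 : ∀ p ∈ P.box, P.ft p ≠ 0 := fun p hp => (ft_pos hp).ne'
  have n3 : ∀ p ∈ P.box, P.N p.1 p.2 ≠ 0 := fun p hp => N_ne hp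
  have n4 : ∀ p ∈ P.box, p.1 - p.2 ≠ 0 := fun p hp => sub_ne hp
  have n5 : ∀ p ∈ P.box, P.h p.1 p.2 ≠ 0 := fun p hp => h_ne hp
  have hi : ContDiffOn ℝ ∞ (fun q : ℝ × ℝ => 1 / P.N q.1 q.2) P.box := contDiffOn_const.div hN n3
  have hν : ContDiffOn ℝ ∞ (fun q : ℝ × ℝ => P.ν / P.N q.1 q.2) P.box := contDiffOn_const.div hN n3
  have hd : ContDiffOn ℝ ∞ (fun q : ℝ × ℝ => 1 / (q.1 - q.2)) P.box := contDiffOn_const.div d n4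
  have hd2 : ContDiffOn ℝ ∞ (fun q : ℝ × ℝ => 2 / (q.1 - q.2)) P.box := contDiffOn_const.div d n4
  have hxh : ContDiffOn ℝ ∞ (fun q : ℝ × ℝ => P.hx q.1 q.2 / P.h q.1 q.2) P.box := hhx.div hh n5
  have hyh : ContDiffOn ℝ ∞ (fun q : ℝ × ℝ => P.hy q.1 q.2 / P.h q.1 q.2) P.box := hhy.div hh n5
  have hlx : ContDiffOn ℝ ∞ P.lx P.box := (hν.add hxh).add hd
  have hux : ContDiffOn ℝ ∞ P.ux P.box := (hi.sub hd).sub hyh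
  have hAx : ContDiffOn ℝ ∞ P.fAx P.box :=
    ((P.contDiff_numAx.contDiffOn.mul d).sub (contDiffOn_const.mul P.contDiff_numA.contDiffOn)).div
      (d.pow 3) fun p hp => pow_ne_zero 3 (n4 p hp)
  have hBx : ContDiffOn ℝ ∞ P.fBx P.box :=
    ((P.contDiff_numBx.contDiffOn.mul d).sub (contDiffOn_const.mul P.contDiff_numB.contDiffOn)).div
      (d.pow 3) fun p hp => pow_ne_zero 3 (n4 p hp)
  have e : ∀ p ∈ P.box, P.κ * P.N p.1 p.2 * P.h p.1 p.2 ≠ 0 := fun p hp =>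
    mul_ne_zero (mul_ne_zero n0 (n3 p hp)) (n5 p hp)
  have k2 : ∀ p ∈ P.box, P.κ * P.h p.1 p.2 ^ 2 ≠ 0 := fun p hp =>
    mul_ne_zero n0 (pow_ne_zero 2 (n5 p hp))
  have ω2 : ContDiffOn ℝ ∞ P.ω₀₂φ P.box :=
    (d.div ((contDiffOn_const.mul hN).mul hh) e).neg.mul
      (((hAx.mul (h1.pow 2)).add (hA.mul ((hX.div_const 2).sub
        (((h1.pow 2).mul hlx).div_const 2)))).add (hB.mul (((h2.pow 2).div_const 2).mul hux)))
  have ω3 : ContDiffOn ℝ ∞ P.ω₀₃φ P.box :=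
    (((d.mul h1).mul h2).div ((contDiffOn_const.mul hN).mul hh) e).neg.mul
      ((hBx.sub ((hB.mul hlx).div_const 2)).sub ((hA.div_const 2).mul hux))
  unfold connASD
  fin_cases i <;> fin_cases A <;> simp <;> try exact contDiffOn_const
  · exact (d.mul hQ).div (contDiffOn_const.mul (hh.pow 2)) k2
  · exact (contDiffOn_const.mul ω2).sub (P.contDiffOn_connSD 3 0)
  · exact (((h1.mul h2).mul d).mul (contDiffOn_const.sub
      ((contDiffOn_const.mul contDiffOn_fst).mul contDiffOn_snd))).div
      (contDiffOn_const.mul (hh.pow 2)) k2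
  · exact (contDiffOn_const.mul ω3).sub (P.contDiffOn_connSD 3 1)
  · exact (h2.div h1 n1).mul (hyh.add hd2)
  · exact (h1.div h2 n2).neg.mul (hxh.sub hd2)

end

lemma frame_det_eq (hp : p ∈ P.box) :
    (P.frame p).det = P.κ ^ 2 * (P.N p.1 p.2 * P.h p.1 p.2) / (p.1 - p.2) ^ 5 := by
  have hs := (fs_pos hp).ne'
  have ht := (ft_pos hp).ne'
  have he := (fe_pos hp).ne'
  have hD := (box_facts hp).1.ne'
  have key : p.2 * P.fB p - p.1 * P.fA p = P.N p.1 p.2 * P.h p.1 p.2 / (p.1 - p.2) := by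
    have := P.numB_sub_numA p.1 p.2
    simp only [fA, fB]
    field_simp
    linear_combination this
  have : (P.frame p).det = P.κ * P.fe p / ((p.1 - p.2) ^ 2 * P.fs p) *
      (P.κ * P.fe p / ((p.1 - p.2) ^ 2 * P.ft p)) * (P.fs p * P.ft p / P.fe p ^ 2 *
        (p.2 * P.fB p - p.1 * P.fA p)) := by
    rw [Matrix.det_succ_row_zero, Fin.sum_univ_four]
    simp [frame, Matrix.det_fin_three, Fin.succAbove, Fin.lt_def]
    field_simp
  rw [this, key]
  field_simp

lemma frame_det (hp : p ∈ P.box) : 0 < (P.frame p).det := by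
  have hκ := κ_pos (P := P)
  have hD := (box_facts hp).1
  have hH : 0 < P.N p.1 p.2 * P.h p.1 p.2 :=
    mul_pos_of_neg_of_neg (box_facts hp).2.1 (box_facts hp).2.2.1
  rw [frame_det_eq hp]
  positivity

lemma isToricFrame : IsToricFrame P.box P.frame P.conn where
  smooth := P.contDiffOn_frame
  smooth_conn A a b := by
    have h0 := P.contDiffOn_connSD A
    have h1 := P.contDiffOn_connASD A
    have h00 := h0 0; have h01 := h0 1; have h02 := h0 2
    have h10 := h1 0; have h11 := h1 1; have h12 := h1 2
    fin_cases a <;> fin_cases b <;> simp [conn, sd, asd] <;> first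
      | exact contDiffOn_const
      | fun_prop
  det_pos _ hp := frame_det hp
  skew A p _ := by
    rw [conn, Matrix.transpose_smul, Matrix.transpose_add, sd_skew, asd_skew]
    module
  torsion _ hp := frame_torsion hp

end Params

end ChenTeo
end

open Set Filter Topology Manifold Bundle
open scoped ContDiff

noncomputable section

namespace ChenTeo

/-! ### The curvature of the frame -/

lemma sd_bracket (p q r p' q' r' : ℝ) : sd p q r * sd p' q' r' - sd p' q' r' * sd p q r =
    (-2 : ℝ) • sd (q * r' - r * q') (r * p' - p * r') (p * q' - q * p') := by
  ext a b; fin_cases a <;> fin_cases b <;> simp [sd] <;> ring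

lemma asd_bracket (p q r p' q' r' : ℝ) : asd p q r * asd p' q' r' - asd p' q' r' * asd p q r =
    (2 : ℝ) • asd (q * r' - r * q') (r * p' - p * r') (p * q' - q * p') := by
  ext a b; fin_cases a <;> fin_cases b <;> simp [asd] <;> ring

lemma sd_mul_asd_comm (p q r p' q' r' : ℝ) : sd p q r * asd p' q' r' = asd p' q' r' * sd p q r := by
  ext a b; fin_cases a <;> fin_cases b <;>
    simp [asd, sd, Matrix.mul_apply, Fin.sum_univ_four] <;> ring

lemma sd_apply_eq (a b : Fin 4) (p q r : ℝ) : sd p q r a b =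
    p * sd 1 0 0 a b + q * sd 0 1 0 a b + r * sd 0 0 1 a b := by
  fin_cases a <;> fin_cases b <;> simp [sd]

lemma asd_apply_eq (a b : Fin 4) (p q r : ℝ) : asd p q r a b =
    p * asd 1 0 0 a b + q * asd 0 1 0 a b + r * asd 0 0 1 a b := by
  fin_cases a <;> fin_cases b <;> simp [asd]

/-- A curvature tensor which satisfies the Bianchi identity is determined by its self-dual part and
part of its anti-self-dual part. -/
lemma eq_curvModel {Rm : Fin 4 → Fin 4 → Mat4} {G : Fin 3 → Mat4} {c α : ℝ}
    (hR : ∀ k l, Rm k l = (1 / 2 : ℝ) • (sd (c * sd 1 0 0 k l) (-c / 2 * sd 0 1 0 k l)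
      (-c / 2 * sd 0 0 1 k l) + asd (G 0 k l) (G 1 k l) (G 2 k l)))
    (hG : ∀ i a b, G i b a = -G i a b)
    (hB : ∀ a b c d, Rm c d a b + Rm d b a c + Rm b c a d = 0)
    (h0 : G 0 0 1 = 0) (h1 : G 1 0 1 = 0) (h2 : G 2 0 1 = α) :
    Rm = curvModel c α (G 0 0 2) (G 0 0 3) ∧ G 0 1 2 = -G 0 0 3 ∧ G 0 1 3 = G 0 0 2 := by
  have d : ∀ i a, G i a a = 0 := fun i a => by linarith [hG i a a]
  suffices key : G 0 1 2 = - G 0 0 3 ∧ G 0 1 3 = G 0 0 2 ∧ G 0 2 3 = 0 ∧ G 1 0 2 = G 0 0 3 ∧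
      G 1 0 3 = -α - G 0 0 2 ∧ G 1 1 2 = - G 1 0 3 ∧ G 1 1 3 = G 1 0 2 ∧ G 1 2 3 = 0 ∧
      G 2 0 2 = 0 ∧ G 2 0 3 = 0 ∧ G 2 1 2 = 0 ∧ G 2 1 3 = 0 ∧ G 2 2 3 = -α by
    obtain ⟨k1, k2, k3, k4, k5, k6, k7, k8, k9, k10, k11, k12, k13⟩ := key
    refine ⟨?_, k1, k2⟩
    have e : ∀ k l, G 0 k l = G 0 0 2 * asd 1 0 0 k l + G 0 0 3 * asd 0 1 0 k l ∧
        G 1 k l = G 0 0 3 * asd 1 0 0 k l + (-α - G 0 0 2) * asd 0 1 0 k l ∧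
        G 2 k l = α * asd 0 0 1 k l := by
      intro k l
      fin_cases k <;> fin_cases l <;>
        simp [asd, d, h0, h1, h2, k1, k2, k3, k4, k5, k6, k7, k8, k9, k10, k11, k12, k13,
          hG _ 0 1, hG _ 0 2, hG _ 0 3, hG _ 1 2, hG _ 1 3, hG _ 2 3] <;> ring
    funext k l
    rw [hR, curvModel, (e k l).1, (e k l).2.1, (e k l).2.2]
  simp only [hR] at hB
  have e1 := hB 0 1 2 3
  have e2 := hB 1 0 2 3
  have e3 := hB 2 0 1 3
  have e4 := hB 3 0 1 2
  have f1 := hB 0 0 1 2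
  have f2 := hB 0 0 1 3
  have f3 := hB 0 0 2 3
  have g1 := hB 1 1 0 2
  have g2 := hB 1 1 0 3
  have g3 := hB 1 1 2 3
  have i1 := hB 2 2 0 1
  have i2 := hB 2 2 0 3
  have i3 := hB 2 2 1 3
  have j1 := hB 3 3 0 1
  have j2 := hB 3 3 0 2
  have j3 := hB 3 3 1 2
  simp [sd, asd] at e1 e2 e3 e4 f1 f2 f3 g1 g2 g3 i1 i2 i3 j1 j2 j3
  simp [h0, h1, h2, hG _ 0 1, hG _ 0 2, hG _ 0 3, hG _ 1 2, hG _ 1 3, hG _ 2 3] at e1 e2 e3 e4 f1 f2 f3 g1 g2 g3 i1 i2 i3 j1 j2 j3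
  clear hB hR
  refine ⟨?_, ?_, ?_, ?_, ?_, ?_, ?_, ?_, ?_, ?_, ?_, ?_, ?_⟩ <;> linarith


lemma eq_zero_of_vecMul {θ : Mat4} (hθ : θ.det ≠ 0) {v : Fin 4 → ℝ}
    (h : ∀ k, ∑ b, θ b k * v b = 0) (b : Fin 4) : v b = 0 := by
  refine congrFun (Matrix.eq_zero_of_vecMul_eq_zero hθ (v := v) ?_) b
  funext k
  simpa [Matrix.vecMul, dotProduct, mul_comm] using h k

lemma IsFrameCurvature.bianchi {h : E4 → Mat4} {u : E4} {θ : Mat4} {Rm : Fin 4 → Fin 4 → Mat4}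
    (H : IsFrameCurvature h u θ Rm) (hs : ∀ᶠ v in 𝓝 u, (h v).transpose = h v) (a b c d : Fin 4) :
    Rm c d a b + Rm d b a c + Rm b c a d = 0 := by
  have hT : ∀ a k i j, ∑ l, θ a l * riemann h u l k i j =
      ∑ b, θ b k * ∑ c, θ c i * ∑ d, θ d j * Rm c d a b := by
    intro a k i j
    have e : (θ * (Matrix.of fun l k => riemann h u l k i j)) a k =
        ((∑ c, ∑ d, (θ c i * θ d j) • Rm c d) * θ) a k := by
      rw [H.curv, ← Matrix.mul_assoc, ← Matrix.mul_assoc, H.mul_inv, Matrix.one_mul]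
    rw [Matrix.mul_apply, Matrix.mul_apply] at e
    simp only [Matrix.of_apply] at e
    rw [e]
    refine Finset.sum_congr rfl fun b _ => ?_
    rw [mul_comm]
    simp only [Matrix.sum_apply, Matrix.smul_apply, smul_eq_mul, Finset.mul_sum]
    exact Finset.sum_congr rfl fun c _ => Finset.sum_congr rfl fun d _ => by ring
  have hdet := H.det_pos.ne'
  revert b
  refine eq_zero_of_vecMul hdet fun k => ?_
  revert c
  suffices hs : ∀ c, (fun c => ∑ b, θ b k * (Rm c d a b + Rm d b a c + Rm b c a d)) c = 0 from hs
  refine eq_zero_of_vecMul hdet fun i => ?_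
  revert d
  suffices hs : ∀ d, (fun d => ∑ c, θ c i *
      ∑ b, θ b k * (Rm c d a b + Rm d b a c + Rm b c a d)) d = 0 from hs
  refine eq_zero_of_vecMul hdet fun j => ?_
  have e : ∑ l, θ a l * (riemann h u l k i j + riemann h u l i j k + riemann h u l j k i) = 0 :=
    Finset.sum_eq_zero fun l _ => by rw [riemann_bianchi hs, mul_zero]
  simp only [mul_add, Finset.sum_add_distrib, hT] at e ⊢
  rw [← e]
  simp only [Finset.mul_sum]
  congr 1
  · congr 1
    · calc _ = ∑ c, ∑ d, ∑ b, θ d j * (θ c i * (θ b k * Rm c d a b)) := Finset.sum_comm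
        _ = ∑ c, ∑ b, ∑ d, θ d j * (θ c i * (θ b k * Rm c d a b)) :=
          Finset.sum_congr rfl fun c _ => Finset.sum_comm
        _ = ∑ b, ∑ c, ∑ d, θ d j * (θ c i * (θ b k * Rm c d a b)) := Finset.sum_comm
        _ = _ := ?_
      exact Finset.sum_congr rfl fun b _ => Finset.sum_congr rfl fun c _ =>
        Finset.sum_congr rfl fun d _ => by ring
    · rw [Finset.sum_comm]
      refine Finset.sum_congr rfl fun c _ => Finset.sum_congr rfl fun d _ =>
        Finset.sum_congr rfl fun b _ => by ring
  · refine Finset.sum_congr rfl fun d _ => ?_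
    rw [Finset.sum_comm]
    exact Finset.sum_congr rfl fun b _ => Finset.sum_congr rfl fun c _ => by ring

end ChenTeo
end

open Set Filter Topology Manifold Bundle
open scoped ContDiff

noncomputable section

namespace ChenTeo

lemma HasDir.of_differentiableAt {f : ℝ × ℝ → ℝ} {p : ℝ × ℝ} (hf : DifferentiableAt ℝ f p) :
    ∃ a b, HasDir f p a b := by
  refine ⟨fderiv ℝ f p (1, 0), fderiv ℝ f p (0, 1), hf.hasFDerivAt.congr_fderiv ?_⟩
  ext <;> simp

lemma ext_skew {m n : Mat4} (hm : ∀ i j, m j i = -m i j) (hn : ∀ i j, n j i = -n i j)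
    (h : ∀ i j, i < j → m i j = n i j) : m = n := by
  ext i j
  rcases lt_trichotomy i j with hij | rfl | hij
  · exact h i j hij
  · linarith [hm i i, hn i i]
  · rw [hm j i, hn j i, h j i hij]

lemma skew_sandwich {s : Mat4} (hs : s.transpose = -s) (c : Mat4) (i j : Fin 4) :
    (c.transpose * s * c) j i = -(c.transpose * s * c) i j := by
  have : (c.transpose * s * c).transpose = -(c.transpose * s * c) := by
    simp [Matrix.mul_assoc, hs]
  exact congrFun (congrFun this i) j

namespace Params

variable {P : Params} {p : ℝ × ℝ}

/-! ### Derivatives of the connection form -/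

lemma hasDir_sd₁τ (hp : p ∈ P.box) : HasDir P.sd₁τ p
    (-((p.1 - p.2) * (P.N p.1 p.2 - P.ν * (p.1 - p.2))) / (P.κ * P.N p.1 p.2 ^ 3))
    ((p.1 - p.2) * (P.N p.1 p.2 + (p.1 - p.2)) / (P.κ * P.N p.1 p.2 ^ 3)) := by
  have hN := N_ne hp
  have hκ := (κ_pos (P := P)).ne'
  refine (((hasDir_sub.pow 2).neg).div ((HasDir.const (2 * P.κ)).mul ((P.hasDir_N p).pow 2))
    (by positivity)).congr ?_ ?_ <;> norm_num <;> field_simp <;> ring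

lemma hasDir_sd₁φ (hp : p ∈ P.box) : HasDir P.sd₁φ p
    ((P.numCx p.1 p.2 * (p.1 - p.2) * P.N p.1 p.2 - P.numC p.1 p.2 *
      (P.N p.1 p.2 + 2 * P.ν * (p.1 - p.2))) / (P.κ * (p.1 - p.2) ^ 2 * P.N p.1 p.2 ^ 3))
    ((P.numCy p.1 p.2 * (p.1 - p.2) * P.N p.1 p.2 - P.numC p.1 p.2 *
      (-P.N p.1 p.2 + 2 * (p.1 - p.2))) / (P.κ * (p.1 - p.2) ^ 2 * P.N p.1 p.2 ^ 3)) := by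
  have hN := N_ne hp
  have hD := sub_ne hp
  have hκ := (κ_pos (P := P)).ne'
  refine ((P.hasDir_numC p).div (((HasDir.const P.κ).mul hasDir_sub).mul ((P.hasDir_N p).pow 2))
    (by positivity)).congr ?_ ?_ <;> norm_num <;> field_simp

lemma hasDir_sd₂φ (hp : p ∈ P.box) : HasDir P.sd₂φ p
    ((1 + P.ν) / P.κ * (P.quartic' p.1 * P.ft p / (2 * P.fs p) / ((p.1 - p.2) * P.N p.1 p.2) -
      P.fs p * P.ft p * (P.N p.1 p.2 + P.ν * (p.1 - p.2)) / ((p.1 - p.2) * P.N p.1 p.2) ^ 2))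
    ((1 + P.ν) / P.κ * (-P.quartic' p.2 * P.fs p / (2 * P.ft p) / ((p.1 - p.2) * P.N p.1 p.2) -
      P.fs p * P.ft p * (-P.N p.1 p.2 + (p.1 - p.2)) / ((p.1 - p.2) * P.N p.1 p.2) ^ 2)) := by
  have hN := N_ne hp
  have hD := sub_ne hp
  have hs := (fs_pos hp).ne'
  have ht := (ft_pos hp).ne'
  have hκ := (κ_pos (P := P)).ne'
  refine (((HasDir.const (1 + P.ν)).mul ((hasDir_fs hp).mul (hasDir_ft hp))).div
    (((HasDir.const P.κ).mul hasDir_sub).mul (P.hasDir_N p)) (by positivity)).congr ?_ ?_ <;>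
    norm_num <;> field_simp

lemma hasDir_ft_div_fs (hp : p ∈ P.box) : HasDir (fun q => P.ft q / P.fs q) p
    (-(P.ft p * P.quartic' p.1) / (2 * P.fs p ^ 3)) (-P.quartic' p.2 / (2 * P.ft p * P.fs p)) := by
  have hs := (fs_pos hp).ne'
  have ht := (ft_pos hp).ne'
  refine ((hasDir_ft hp).div (hasDir_fs hp) hs).congr ?_ ?_ <;> field_simp <;> ring

lemma hasDir_fs_div_ft (hp : p ∈ P.box) : HasDir (fun q => P.fs q / P.ft q) p
    (P.quartic' p.1 / (2 * P.ft p * P.fs p)) (P.fs p * P.quartic' p.2 / (2 * P.ft p ^ 3)) := by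
  have hs := (fs_pos hp).ne'
  have ht := (ft_pos hp).ne'
  refine ((hasDir_fs hp).div (hasDir_ft hp) ht).congr ?_ ?_ <;> field_simp <;> ring

lemma hasDir_inv_N (hp : p ∈ P.box) (c : ℝ) : HasDir (fun q => c / P.N q.1 q.2) p
    (-(c * P.ν) / P.N p.1 p.2 ^ 2) (-c / P.N p.1 p.2 ^ 2) := by
  refine ((HasDir.const c).div (P.hasDir_N p) (N_ne hp)).congr ?_ ?_ <;> ring

lemma hasDir_inv_sub (hp : p ∈ P.box) (c : ℝ) : HasDir (fun q => c / (q.1 - q.2)) p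
    (-c / (p.1 - p.2) ^ 2) (c / (p.1 - p.2) ^ 2) := by
  refine ((HasDir.const c).div hasDir_sub (sub_ne hp)).congr ?_ ?_ <;> ring

lemma dir_sd₃x (hp : p ∈ P.box) : dir 1 P.sd₃x p =
    -P.quartic' p.2 / (2 * P.ft p * P.fs p) * (1 / P.N p.1 p.2 + 1 / (p.1 - p.2)) +
      P.ft p / P.fs p * (-1 / P.N p.1 p.2 ^ 2 + 1 / (p.1 - p.2) ^ 2) :=
  ((hasDir_ft_div_fs hp).mul ((hasDir_inv_N hp 1).add (hasDir_inv_sub hp 1))).dir_one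

lemma dir_sd₃y (hp : p ∈ P.box) : dir 0 P.sd₃y p =
    -(P.quartic' p.1 / (2 * P.ft p * P.fs p)) * (P.ν / P.N p.1 p.2 - 1 / (p.1 - p.2)) +
      -(P.fs p / P.ft p) * (-(P.ν * P.ν) / P.N p.1 p.2 ^ 2 - -1 / (p.1 - p.2) ^ 2) :=
  ((hasDir_fs_div_ft hp).neg.mul ((hasDir_inv_N hp P.ν).sub (hasDir_inv_sub hp 1))).dir_zero

lemma dir_asd₃x (hp : p ∈ P.box) : dir 1 P.asd₃x p =
    -P.quartic' p.2 / (2 * P.ft p * P.fs p) *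
        (P.hy p.1 p.2 / P.h p.1 p.2 + 2 / (p.1 - p.2)) +
      P.ft p / P.fs p * ((P.hyy p.1 p.2 * P.h p.1 p.2 - P.hy p.1 p.2 * P.hy p.1 p.2) /
        P.h p.1 p.2 ^ 2 + 2 / (p.1 - p.2) ^ 2) :=
  ((hasDir_ft_div_fs hp).mul (((P.hasDir_hy p).div (P.hasDir_h p) (h_ne hp)).add
    (hasDir_inv_sub hp 2))).dir_one

lemma dir_asd₃y (hp : p ∈ P.box) : dir 0 P.asd₃y p =
    -(P.quartic' p.1 / (2 * P.ft p * P.fs p)) *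
        (P.hx p.1 p.2 / P.h p.1 p.2 - 2 / (p.1 - p.2)) +
      -(P.fs p / P.ft p) * ((P.hxx p.1 p.2 * P.h p.1 p.2 - P.hx p.1 p.2 * P.hx p.1 p.2) /
        P.h p.1 p.2 ^ 2 - -2 / (p.1 - p.2) ^ 2) :=
  ((hasDir_fs_div_ft hp).neg.mul (((P.hasDir_hx p).div (P.hasDir_h p) (h_ne hp)).sub
    (hasDir_inv_sub hp 2))).dir_zero

lemma hasDir_asd₁τ (hp : p ∈ P.box) : HasDir P.asd₁τ p
    (((P.numQ p.1 p.2 + (p.1 - p.2) * P.numQx p.1 p.2) * P.h p.1 p.2 -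
      2 * (p.1 - p.2) * P.numQ p.1 p.2 * P.hx p.1 p.2) / (P.κ * P.h p.1 p.2 ^ 3))
    (((-P.numQ p.1 p.2 + (p.1 - p.2) * P.numQy p.1 p.2) * P.h p.1 p.2 -
      2 * (p.1 - p.2) * P.numQ p.1 p.2 * P.hy p.1 p.2) / (P.κ * P.h p.1 p.2 ^ 3)) := by
  have hh := h_ne hp
  have hκ := (κ_pos (P := P)).ne'
  refine ((hasDir_sub.mul (P.hasDir_numQ p)).div ((HasDir.const P.κ).mul ((P.hasDir_h p).pow 2))
    (by positivity)).congr ?_ ?_ <;> norm_num <;> field_simp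

/-! ### Its self-dual and anti-self-dual curvature -/

variable (P) in
/-- A component of the self-dual part of the curvature. -/
def curvSD (i j k : Fin 4) (p : ℝ × ℝ) : Mat4 := Matrix.of fun A B =>
  dir A (P.connSD B i) p - dir B (P.connSD A i) p
    - (P.connSD A j p * P.connSD B k p - P.connSD A k p * P.connSD B j p)

variable (P) in
/-- A component of the anti-self-dual part of the curvature. -/
def curvASD (i j k : Fin 4) (p : ℝ × ℝ) : Mat4 := Matrix.of fun A B =>
  dir A (P.connASD B i) p - dir B (P.connASD A i) p
    + (P.connASD A j p * P.connASD B k p - P.connASD A k p * P.connASD B j p)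

lemma dir_conn (hp : p ∈ P.box) (A B a b : Fin 4) : dir A (fun q => P.conn B q a b) p =
    1 / 2 * (sd (dir A (P.connSD B 0) p) (dir A (P.connSD B 1) p) (dir A (P.connSD B 2) p) a b +
      asd (dir A (P.connASD B 0) p) (dir A (P.connASD B 1) p) (dir A (P.connASD B 2) p) a b) := by
  have h1 : ∀ i, ∃ a b, HasDir (P.connSD B i) p a b := fun i => HasDir.of_differentiableAt (((P.contDiffOn_connSD B i).contDiffAt
      (P.isOpen_box.mem_nhds hp)).differentiableAt (by simp))
  have h2 : ∀ i, ∃ a b, HasDir (P.connASD B i) p a b := fun i => HasDir.of_differentiableAt (((P.contDiffOn_connASD B i).contDiffAt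
      (P.isOpen_box.mem_nhds hp)).differentiableAt (by simp))
  choose u v hu using h1
  choose u' v' hv using h2
  have key : HasDir (fun q => P.conn B q a b) p
      (1 / 2 * (sd (u 0) (u 1) (u 2) a b + asd (u' 0) (u' 1) (u' 2) a b))
      (1 / 2 * (sd (v 0) (v 1) (v 2) a b + asd (v' 0) (v' 1) (v' 2) a b)) := by
    have e : (fun q => P.conn B q a b) = fun q => 1 / 2 * ((P.connSD B 0 q * sd 1 0 0 a b +
        P.connSD B 1 q * sd 0 1 0 a b + P.connSD B 2 q * sd 0 0 1 a b) +
        (P.connASD B 0 q * asd 1 0 0 a b + P.connASD B 1 q * asd 0 1 0 a b +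
          P.connASD B 2 q * asd 0 0 1 a b)) := by
      funext q
      rw [← sd_apply_eq, ← asd_apply_eq]
      rfl
    rw [e]
    refine ((HasDir.const _).mul ((((hu 0).mul (HasDir.const _)).add ((hu 1).mul
      (HasDir.const _))).add ((hu 2).mul (HasDir.const _)) |>.add ((((hv 0).mul
      (HasDir.const _)).add ((hv 1).mul (HasDir.const _))).add ((hv 2).mul
      (HasDir.const _))))).congr ?_ ?_
    · rw [sd_apply_eq a b (u 0), asd_apply_eq a b (u' 0)]; ring
    · rw [sd_apply_eq a b (v 0), asd_apply_eq a b (v' 0)]; ring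
  have z : (0 : ℝ) = 1 / 2 * (sd 0 0 0 a b + asd 0 0 0 a b) := by simp [sd_zero, asd_zero]
  fin_cases A
  · simp only [Fin.zero_eta, (hu _).dir_zero, (hv _).dir_zero, key.dir_zero]
  · simp only [Fin.mk_one, (hu _).dir_one, (hv _).dir_one, key.dir_one]
  · exact z
  · exact z

lemma toricCurv_conn (hp : p ∈ P.box) (A B : Fin 4) : toricCurv P.conn A B p = (1 / 2 : ℝ) •
    (sd (P.curvSD 0 1 2 p A B) (P.curvSD 1 2 0 p A B) (P.curvSD 2 0 1 p A B) +
      asd (P.curvASD 0 1 2 p A B) (P.curvASD 1 2 0 p A B) (P.curvASD 2 0 1 p A B)) := by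
  have e : P.conn A p * P.conn B p - P.conn B p * P.conn A p = (1 / 4 : ℝ) •
      ((sd (P.connSD A 0 p) (P.connSD A 1 p) (P.connSD A 2 p) *
        sd (P.connSD B 0 p) (P.connSD B 1 p) (P.connSD B 2 p) -
        sd (P.connSD B 0 p) (P.connSD B 1 p) (P.connSD B 2 p) *
        sd (P.connSD A 0 p) (P.connSD A 1 p) (P.connSD A 2 p)) +
      (asd (P.connASD A 0 p) (P.connASD A 1 p) (P.connASD A 2 p) *
        asd (P.connASD B 0 p) (P.connASD B 1 p) (P.connASD B 2 p) -
        asd (P.connASD B 0 p) (P.connASD B 1 p) (P.connASD B 2 p) *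
        asd (P.connASD A 0 p) (P.connASD A 1 p) (P.connASD A 2 p))) := by
    simp only [conn, smul_mul_assoc, mul_smul_comm, add_mul, mul_add, smul_smul]
    rw [sd_mul_asd_comm, sd_mul_asd_comm]
    module
  rw [sd_bracket, asd_bracket] at e
  rw [toricCurv, add_sub_assoc, e]
  ext a b
  simp only [Matrix.add_apply, Matrix.sub_apply, Matrix.smul_apply, dirM, Matrix.of_apply,
    dir_conn hp, smul_eq_mul, curvSD, curvASD]
  obtain ⟨s₁, s₂, s₃, hs⟩ : ∃ s₁ s₂ s₃ : ℝ, ∀ p q r, sd p q r a b = p * s₁ + q * s₂ + r * s₃ :=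
    ⟨_, _, _, sd_apply_eq a b⟩
  obtain ⟨t₁, t₂, t₃, ht⟩ : ∃ t₁ t₂ t₃ : ℝ, ∀ p q r, asd p q r a b = p * t₁ + q * t₂ + r * t₃ :=
    ⟨_, _, _, asd_apply_eq a b⟩
  simp only [hs, ht]
  ring


lemma curvSD_skew (i j k : Fin 4) (p : ℝ × ℝ) (A B : Fin 4) :
    P.curvSD i j k p B A = -P.curvSD i j k p A B := by
  simp only [curvSD, Matrix.of_apply]; ring

lemma curvASD_skew (i j k : Fin 4) (p : ℝ × ℝ) (A B : Fin 4) :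
    P.curvASD i j k p B A = -P.curvASD i j k p A B := by
  simp only [curvASD, Matrix.of_apply]; ring

variable (P) in
/-- The eigenvalue of multiplicity one of `W⁺`. -/
def weylSD (p : ℝ × ℝ) : ℝ := -(1 + P.ν) * (p.1 - p.2) ^ 3 / (P.k * P.N p.1 p.2 ^ 3)

lemma conn_zero_fun : P.connSD 0 0 = (fun _ => 0) ∧ P.connSD 0 1 = (fun _ => 0) ∧
    P.connSD 0 2 = P.sd₃x ∧ P.connSD 1 0 = (fun _ => 0) ∧ P.connSD 1 1 = (fun _ => 0) ∧
    P.connSD 1 2 = P.sd₃y ∧ P.connSD 2 0 = P.sd₁τ ∧ P.connSD 2 1 = (fun _ => 0) ∧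
    P.connSD 2 2 = (fun _ => 0) ∧ P.connSD 3 0 = P.sd₁φ ∧ P.connSD 3 1 = P.sd₂φ ∧
    P.connSD 3 2 = fun _ => 0 :=
  ⟨rfl, rfl, rfl, rfl, rfl, rfl, rfl, rfl, rfl, rfl, rfl, rfl⟩

lemma numC_x (x y : ℝ) : P.numCx x y * (x - y) * P.N x y
    - P.numC x y * (P.N x y + 2 * P.ν * (x - y)) - (1 + P.ν) ^ 2 * P.quartic y * x * P.N x y =
    -(1 + P.ν) * P.numA x y * (x - y) := by
  simp only [N, numC, numCx, quartic, numA, a₀_eq]; ring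

lemma numC_y (x y : ℝ) : P.numCy x y * (x - y) * P.N x y
    - P.numC x y * (-P.N x y + 2 * (x - y)) + (1 + P.ν) ^ 2 * P.quartic x * y * P.N x y =
    (1 + P.ν) * P.numB x y * (x - y) := by
  simp only [N, numC, numCy, quartic, numB, a₀_eq]; ring

end Params

end ChenTeo
end

open Set Filter Topology Manifold Bundle
open scoped ContDiff

noncomputable section

namespace ChenTeo

namespace Params

variable {P : Params} {p : ℝ × ℝ}

lemma numB_eq (x y : ℝ) : P.quartic' x * (x - y) * P.N x y ^ 2
    - 2 * P.quartic x * P.N x y * (P.N x y + (x - y) * P.ν) - 2 * x * P.numC x y =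
    (x - y) * P.numB x y := by
  simp only [N, numC, quartic', quartic, numB, a₀_eq]; ring

lemma numA_eq (x y : ℝ) : -P.quartic' y * (x - y) * P.N x y ^ 2
    + 2 * P.quartic y * P.N x y * (x - y - P.N x y) - 2 * y * P.numC x y =
    (x - y) * P.numA x y := by
  simp only [N, numC, quartic', quartic, numA, a₀_eq]; ring

variable (P) in
/-- The 2-form `s` of the orthonormal frame, in the coordinates `x, y, τ, φ`. -/
def frameForm (s : Mat4) (p : ℝ × ℝ) : Mat4 := (P.frame p).transpose * s * P.frame p

lemma frame_mul₀₂ (hp : p ∈ P.box) (z : ℝ) : P.κ * P.fe p / ((p.1 - p.2) ^ 2 * P.fs p) *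
    (P.fs p * z / P.fe p) = P.κ * z / (p.1 - p.2) ^ 2 := by
  have hs := (fs_pos hp).ne'
  have he := (fe_pos hp).ne'
  have hD := sub_ne hp
  field_simp

lemma frame_mul₀₃ (hp : p ∈ P.box) (z : ℝ) : P.κ * P.fe p / ((p.1 - p.2) ^ 2 * P.fs p) *
    (P.ft p * z / P.fe p) = P.κ * (P.ft p * z) / ((p.1 - p.2) ^ 2 * P.fs p) := by
  have hs := (fs_pos hp).ne'
  have he := (fe_pos hp).ne'
  have hD := sub_ne hp
  field_simp

lemma frame_mul₁₂ (hp : p ∈ P.box) (z : ℝ) : P.κ * P.fe p / ((p.1 - p.2) ^ 2 * P.ft p) *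
    (P.fs p * z / P.fe p) = P.κ * (P.fs p * z) / ((p.1 - p.2) ^ 2 * P.ft p) := by
  have hs := (ft_pos hp).ne'
  have he := (fe_pos hp).ne'
  have hD := sub_ne hp
  field_simp

lemma frame_mul₁₃ (hp : p ∈ P.box) (z : ℝ) : P.κ * P.fe p / ((p.1 - p.2) ^ 2 * P.ft p) *
    (P.ft p * z / P.fe p) = P.κ * z / (p.1 - p.2) ^ 2 := by
  have hs := (ft_pos hp).ne'
  have he := (fe_pos hp).ne'
  have hD := sub_ne hp
  field_simp

lemma frameForm_sd (hp : p ∈ P.box) (a b c : ℝ) : P.frameForm (sd a b c) p 0 1 =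
      c * (P.κ * P.fe p / ((p.1 - p.2) ^ 2 * P.fs p) *
        (P.κ * P.fe p / ((p.1 - p.2) ^ 2 * P.ft p))) ∧
    P.frameForm (sd a b c) p 0 2 = a * (P.κ * p.2 / (p.1 - p.2) ^ 2) +
      b * (P.κ * (P.ft p * p.1) / ((p.1 - p.2) ^ 2 * P.fs p)) ∧
    P.frameForm (sd a b c) p 0 3 = a * (P.κ * P.fA p / (p.1 - p.2) ^ 2) +
      b * (P.κ * (P.ft p * P.fB p) / ((p.1 - p.2) ^ 2 * P.fs p)) ∧
    P.frameForm (sd a b c) p 1 2 = b * (P.κ * (P.fs p * p.2) / ((p.1 - p.2) ^ 2 * P.ft p)) -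
      a * (P.κ * p.1 / (p.1 - p.2) ^ 2) ∧
    P.frameForm (sd a b c) p 1 3 = b * (P.κ * (P.fs p * P.fA p) / ((p.1 - p.2) ^ 2 * P.ft p)) -
      a * (P.κ * P.fB p / (p.1 - p.2) ^ 2) ∧
    P.frameForm (sd a b c) p 2 3 = c * ((P.fs p * p.2 / P.fe p) * (P.ft p * P.fB p / P.fe p) -
      (P.ft p * p.1 / P.fe p) * (P.fs p * P.fA p / P.fe p)) := by
  refine ⟨?_, ?_, ?_, ?_, ?_, ?_⟩ <;>
    simp [frameForm, frame, sd, Matrix.mul_apply, Fin.sum_univ_four]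
  · ring
  · linear_combination a * frame_mul₀₂ hp p.2 + b * frame_mul₀₃ hp p.1
  · linear_combination a * frame_mul₀₂ hp (P.fA p) + b * frame_mul₀₃ hp (P.fB p)
  · linear_combination b * frame_mul₁₂ hp p.2 - a * frame_mul₁₃ hp p.1
  · linear_combination b * frame_mul₁₂ hp (P.fA p) - a * frame_mul₁₃ hp (P.fB p)
  · ring

lemma frameForm_skew {s : Mat4} (hs : s.transpose = -s) (p : ℝ × ℝ) (A B : Fin 4) :
    P.frameForm s p B A = -P.frameForm s p A B := skew_sandwich hs _ _ _

lemma curvSD_one (hp : p ∈ P.box) : P.curvSD 0 1 2 p = P.frameForm (sd (P.weylSD p) 0 0) p := by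
  have hD := sub_ne hp
  have hN := N_ne hp
  have hs := (fs_pos hp).ne'
  have hκ := (κ_pos (P := P)).ne'
  obtain ⟨c1, c2, c3, c4, c5, c6, c7, c8, c9, c10, c11, c12⟩ := conn_zero_fun (P := P)
  obtain ⟨f1, f2, f3, f4, f5, f6⟩ := frameForm_sd hp (P.weylSD p) 0 0
  have k1 := P.numC_x p.1 p.2
  have k2 := P.numC_y p.1 p.2
  have ek := κ_sq (P := P)
  have hs2 := fs_sq hp
  have ht2 := ft_sq hp
  have ht := (ft_pos hp).ne'
  refine ext_skew (curvSD_skew _ _ _ _) (frameForm_skew (sd_skew _ _ _) p) ?_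
  intro A B hAB
  fin_cases A <;> fin_cases B <;> first | exact absurd hAB (by decide) | skip
  all_goals simp only [Fin.zero_eta, Fin.mk_one, Fin.reduceFinMk, Fin.isValue, f1, f2, f3, f4, f5,
    f6, curvSD, Matrix.of_apply, c1, c2, c3, c4, c5, c6, c7, c8, c9, c10, c11, c12, dir_const,
    dir_two, dir_three, (hasDir_sd₁τ hp).dir_zero, (hasDir_sd₁τ hp).dir_one,
    (hasDir_sd₁φ hp).dir_zero, (hasDir_sd₁φ hp).dir_one]
  · ring
  · simp only [weylSD, ← ek]
    field_simp
    simp only [N]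
    ring
  · simp only [weylSD, ← ek, sd₂φ, sd₃x, fA]
    have k : P.numCx p.1 p.2 = (P.numC p.1 p.2 * (P.N p.1 p.2 + 2 * P.ν * (p.1 - p.2)) -
        (1 + P.ν) ^ 2 * P.ft p ^ 2 * p.1 * P.N p.1 p.2 -
        (1 + P.ν) * P.numA p.1 p.2 * (p.1 - p.2)) / ((p.1 - p.2) * P.N p.1 p.2) := by
      rw [eq_div_iff (mul_ne_zero hD hN), ht2]
      linear_combination k1
    rw [k]
    field_simp
    simp only [N]
    ring
  · simp only [weylSD, ← ek]
    field_simp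
    simp only [N]
    ring
  · simp only [weylSD, ← ek, sd₂φ, sd₃y, fB]
    have k : P.numCy p.1 p.2 = (P.numC p.1 p.2 * (-P.N p.1 p.2 + 2 * (p.1 - p.2)) -
        (1 + P.ν) ^ 2 * P.fs p ^ 2 * p.2 * P.N p.1 p.2 +
        (1 + P.ν) * P.numB p.1 p.2 * (p.1 - p.2)) / ((p.1 - p.2) * P.N p.1 p.2) := by
      rw [eq_div_iff (mul_ne_zero hD hN), hs2]
      linear_combination k2
    rw [k]
    field_simp
    simp only [N]
    ring
  · ring

lemma curvSD_two (hp : p ∈ P.box) :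
    P.curvSD 1 2 0 p = P.frameForm (sd 0 (-P.weylSD p / 2) 0) p := by
  have hD := sub_ne hp
  have hN := N_ne hp
  have hs := (fs_pos hp).ne'
  have hκ := (κ_pos (P := P)).ne'
  obtain ⟨c1, c2, c3, c4, c5, c6, c7, c8, c9, c10, c11, c12⟩ := conn_zero_fun (P := P)
  obtain ⟨f1, f2, f3, f4, f5, f6⟩ := frameForm_sd hp 0 (-P.weylSD p / 2) 0
  have ek := κ_sq (P := P)
  have hs2 := fs_sq hp
  have ht2 := ft_sq hp
  have ht := (ft_pos hp).ne'
  refine ext_skew (curvSD_skew _ _ _ _) (frameForm_skew (sd_skew _ _ _) p) ?_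
  intro A B hAB
  fin_cases A <;> fin_cases B <;> first | exact absurd hAB (by decide) | skip
  all_goals simp only [Fin.zero_eta, Fin.mk_one, Fin.reduceFinMk, Fin.isValue, f1, f2, f3, f4, f5,
    f6, curvSD, Matrix.of_apply, c1, c2, c3, c4, c5, c6, c7, c8, c9, c10, c11, c12, dir_const,
    dir_two, dir_three, (hasDir_sd₂φ hp).dir_zero, (hasDir_sd₂φ hp).dir_one]
  · ring
  · simp only [weylSD, ← ek, sd₁τ, sd₃x]
    field_simp
    simp only [N]
    ring
  · simp only [weylSD, ← ek, sd₁φ, sd₃x, fB]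
    have k : P.numB p.1 p.2 = (P.quartic' p.1 * (p.1 - p.2) * P.N p.1 p.2 ^ 2
        - 2 * P.fs p ^ 2 * P.N p.1 p.2 * (P.N p.1 p.2 + (p.1 - p.2) * P.ν)
        - 2 * p.1 * P.numC p.1 p.2) / (p.1 - p.2) := by
      rw [eq_div_iff hD, hs2]
      linear_combination -P.numB_eq p.1 p.2
    rw [k]
    field_simp
    simp only [N]
    ring
  · simp only [weylSD, ← ek, sd₁τ, sd₃y]
    field_simp
    simp only [N]
    ring
  · simp only [weylSD, ← ek, sd₁φ, sd₃y, fA]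
    have k : P.numA p.1 p.2 = (-P.quartic' p.2 * (p.1 - p.2) * P.N p.1 p.2 ^ 2
        - 2 * P.ft p ^ 2 * P.N p.1 p.2 * (p.1 - p.2 - P.N p.1 p.2)
        - 2 * p.2 * P.numC p.1 p.2) / (p.1 - p.2) := by
      rw [eq_div_iff hD, ht2]
      linear_combination -P.numA_eq p.1 p.2
    rw [k]
    field_simp
    simp only [N]
    ring
  · ring

lemma fB_sub_fA (hp : p ∈ P.box) : p.2 * P.fB p - p.1 * P.fA p =
    P.N p.1 p.2 * P.h p.1 p.2 / (p.1 - p.2) := by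
  have hD := sub_ne hp
  have := P.numB_sub_numA p.1 p.2
  simp only [fA, fB]
  field_simp
  linear_combination this

lemma curvSD_three (hp : p ∈ P.box) :
    P.curvSD 2 0 1 p = P.frameForm (sd 0 0 (-P.weylSD p / 2)) p := by
  have hD := sub_ne hp
  have hN := N_ne hp
  have hs := (fs_pos hp).ne'
  have hκ := (κ_pos (P := P)).ne'
  obtain ⟨c1, c2, c3, c4, c5, c6, c7, c8, c9, c10, c11, c12⟩ := conn_zero_fun (P := P)
  obtain ⟨f1, f2, f3, f4, f5, f6⟩ := frameForm_sd hp 0 0 (-P.weylSD p / 2)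
  have ek := κ_sq (P := P)
  have hs2 := fs_sq hp
  have ht2 := ft_sq hp
  have ht := (ft_pos hp).ne'
  refine ext_skew (curvSD_skew _ _ _ _) (frameForm_skew (sd_skew _ _ _) p) ?_
  intro A B hAB
  fin_cases A <;> fin_cases B <;> first | exact absurd hAB (by decide) | skip
  all_goals simp only [Fin.zero_eta, Fin.mk_one, Fin.reduceFinMk, Fin.isValue, f1, f2, f3, f4, f5,
    f6, curvSD, Matrix.of_apply, c1, c2, c3, c4, c5, c6, c7, c8, c9, c10, c11, c12, dir_const,
    dir_two, dir_three, dir_sd₃x hp, dir_sd₃y hp]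
  · rw [show P.κ * P.fe p / ((p.1 - p.2) ^ 2 * P.fs p) *
        (P.κ * P.fe p / ((p.1 - p.2) ^ 2 * P.ft p)) =
      P.κ ^ 2 * P.fe p ^ 2 / ((p.1 - p.2) ^ 4 * P.fs p * P.ft p) by field_simp, fe_sq hp]
    have k : P.h p.1 p.2 = ((p.1 - p.2) * P.N p.1 p.2 * (p.2 * P.quartic' p.1 + p.1 * P.quartic' p.2)
        + 2 * (1 + P.ν) * (p.2 ^ 2 * P.fs p ^ 2 + p.1 ^ 2 * P.ft p ^ 2)
        - 4 * P.N p.1 p.2 * (p.2 * P.fs p ^ 2 + p.1 * P.ft p ^ 2)) / (p.1 - p.2) ^ 2 := by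
      rw [eq_div_iff (pow_ne_zero 2 hD), hs2, ht2]
      linear_combination -P.quartic_identity p.1 p.2
    simp only [weylSD, ← ek, k]
    field_simp
    simp only [N]
    ring
  · ring
  · ring
  · ring
  · ring
  · have he := (fe_pos hp).ne'
    rw [show P.fs p * p.2 / P.fe p * (P.ft p * P.fB p / P.fe p) -
        P.ft p * p.1 / P.fe p * (P.fs p * P.fA p / P.fe p) =
      P.fs p * P.ft p * (p.2 * P.fB p - p.1 * P.fA p) / P.fe p ^ 2 by field_simp, fe_sq hp]
    have hh := h_ne hp
    rw [fB_sub_fA hp]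
    simp only [weylSD, ← ek, sd₁τ, sd₂φ]
    field_simp
    ring

end Params

end ChenTeo
end

open Set Filter Topology Manifold Bundle
open scoped ContDiff

noncomputable section

namespace ChenTeo

namespace Params

variable {P : Params} {p : ℝ × ℝ}

section

variable (P)

/-- The numerator of the eigenvalue `weylα`. -/
def numα (x y : ℝ) : ℝ :=
  (x - y) * P.h x y * (P.quartic' x * (P.hx x y * (x - y) - 2 * P.h x y)
    - P.quartic' y * (P.hy x y * (x - y) + 2 * P.h x y)) / 2
  + P.quartic x * (P.hxx x y * P.h x y * (x - y) ^ 2 - P.hx x y ^ 2 * (x - y) ^ 2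
    + 2 * P.h x y ^ 2)
  - P.quartic y * (P.hyy x y * P.h x y * (x - y) ^ 2 - P.hy x y ^ 2 * (x - y) ^ 2
    + 2 * P.h x y ^ 2)

/-! The components of `W⁻` in the frame. -/

def weylα (p : ℝ × ℝ) : ℝ :=
  -((p.1 - p.2) * P.numα p.1 p.2) / (P.k * P.N p.1 p.2 * P.h p.1 p.2 ^ 3)
def weylT (p : ℝ × ℝ) : ℝ :=
  6 * (P.ν - 1) * (p.1 - p.2) * (P.a₃ * p.1 * p.2 - P.a₁) / (P.k * P.h p.1 p.2 ^ 3)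
def weylQ (p : ℝ × ℝ) : ℝ :=
  6 * (P.ν - 1) * (p.1 - p.2) * P.numQ p.1 p.2 / (P.k * P.h p.1 p.2 ^ 3)
def weylβ (p : ℝ × ℝ) : ℝ := P.quartic p.1 * P.quartic p.2 * P.weylT p - 2 * P.weylα p
def weylγ (p : ℝ × ℝ) : ℝ := -P.weylQ p * (P.fs p * P.ft p)

lemma numQ_x (x y : ℝ) : P.N x y * (x - y) * ((P.numQ x y + (x - y) * P.numQx x y) * P.h x y
      - 2 * (x - y) * P.numQ x y * P.hx x y
      + P.quartic y * (P.hy x y * (x - y) + 2 * P.h x y) * (P.a₁ - P.a₃ * x * y)) =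
    y * (6 * (P.ν - 1) * P.N x y * P.quartic x * P.quartic y * (P.a₃ * x * y - P.a₁)
      + 2 * P.numα x y) + 6 * (P.ν - 1) * P.N x y * x * P.numQ x y * P.quartic y := by
  simp only [N, h, hx, hy, hxx, hyy, quartic, quartic', numQ, numQx, numα, a₀_eq]
  generalize P.a₁ = a, P.a₂ = b, P.a₃ = c, P.a₄ = d, P.ν = n
  ring1

lemma numQ_y (x y : ℝ) : P.N x y * (x - y) * ((-P.numQ x y + (x - y) * P.numQy x y) * P.h x y
      - 2 * (x - y) * P.numQ x y * P.hy x y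
      + P.quartic x * (P.hx x y * (x - y) - 2 * P.h x y) * (P.a₁ - P.a₃ * x * y)) =
    x * (6 * (P.ν - 1) * P.N x y * P.quartic x * P.quartic y * (P.a₃ * x * y - P.a₁)
      + 2 * P.numα x y) + 6 * (P.ν - 1) * P.N x y * y * P.numQ x y * P.quartic x := by
  simp only [N, h, hx, hy, hxx, hyy, quartic, quartic', numQ, numQy, numα, a₀_eq]
  generalize P.a₁ = a, P.a₂ = b, P.a₃ = c, P.a₄ = d, P.ν = n
  ring1

end

end Params

end ChenTeo
end

open Set Filter Topology Manifold Bundle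
open scoped ContDiff

noncomputable section

namespace ChenTeo

namespace Params

variable {P : Params} {p : ℝ × ℝ}

lemma curvASD_xy (hp : p ∈ P.box) : P.curvASD 0 1 2 p 0 1 = 0 ∧ P.curvASD 1 2 0 p 0 1 = 0 ∧
    P.curvASD 2 0 1 p 0 1 = P.frame p 0 0 * P.frame p 1 1 * P.weylα p := by
  refine ⟨?_, ?_, ?_⟩
  · change dir 0 (fun _ => (0 : ℝ)) p - dir 1 (fun _ => (0 : ℝ)) p
      + (0 * P.asd₃y p - P.asd₃x p * 0) = 0
    simp [dir_const]
  · change dir 0 (fun _ => (0 : ℝ)) p - dir 1 (fun _ => (0 : ℝ)) p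
      + (P.asd₃x p * 0 - 0 * P.asd₃y p) = 0
    simp [dir_const]
  · change dir 0 P.asd₃y p - dir 1 P.asd₃x p + (0 * 0 - 0 * 0) =
      P.κ * P.fe p / ((p.1 - p.2) ^ 2 * P.fs p) * (P.κ * P.fe p / ((p.1 - p.2) ^ 2 * P.ft p)) * _
    have hD := sub_ne hp
    have hN := N_ne hp
    have hh := h_ne hp
    have hs := (fs_pos hp).ne'
    have ht := (ft_pos hp).ne'
    have hκ := (κ_pos (P := P)).ne'
    rw [dir_asd₃x hp, dir_asd₃y hp, show P.κ * P.fe p / ((p.1 - p.2) ^ 2 * P.fs p) *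
        (P.κ * P.fe p / ((p.1 - p.2) ^ 2 * P.ft p)) =
      P.κ ^ 2 * P.fe p ^ 2 / ((p.1 - p.2) ^ 4 * P.fs p * P.ft p) by field_simp, fe_sq hp]
    have hs2 := fs_sq hp
    have ht2 := ft_sq hp
    have e2 : P.quartic p.2 = -P.ft p ^ 2 := by linarith
    simp only [weylα, ← κ_sq (P := P), numα, ← hs2, e2]
    field_simp
    ring

lemma curvASD_xτ (hp : p ∈ P.box) : P.curvASD 0 1 2 p 0 2 =
    P.frame p 0 0 * (P.frame p 2 2 * P.weylβ p + P.frame p 3 2 * P.weylγ p) := by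
  change dir 0 P.asd₁τ p - 0 + (0 * 0 - P.asd₃x p * P.asd₂τ p) =
      P.κ * P.fe p / ((p.1 - p.2) ^ 2 * P.fs p) *
        (P.fs p * p.2 / P.fe p * P.weylβ p + P.ft p * p.1 / P.fe p * P.weylγ p)
  have hD := sub_ne hp
  have hN := N_ne hp
  have hh := h_ne hp
  have hs := (fs_pos hp).ne'
  have hκ := (κ_pos (P := P)).ne'
  have ht2 := ft_sq hp
  have e2 : P.quartic p.2 = -P.ft p ^ 2 := by linarith
  have k : P.numQx p.1 p.2 = (p.2 * (6 * (P.ν - 1) * P.N p.1 p.2 * P.quartic p.1 * P.quartic p.2 *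
      (P.a₃ * p.1 * p.2 - P.a₁) + 2 * P.numα p.1 p.2)
      + 6 * (P.ν - 1) * P.N p.1 p.2 * p.1 * P.numQ p.1 p.2 * P.quartic p.2
      - P.N p.1 p.2 * (p.1 - p.2) * (P.numQ p.1 p.2 * P.h p.1 p.2
        - 2 * (p.1 - p.2) * P.numQ p.1 p.2 * P.hx p.1 p.2 + P.quartic p.2 *
        (P.hy p.1 p.2 * (p.1 - p.2) + 2 * P.h p.1 p.2) * (P.a₁ - P.a₃ * p.1 * p.2))) /
      (P.N p.1 p.2 * (p.1 - p.2) ^ 2 * P.h p.1 p.2) := by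
    rw [eq_div_iff (by positivity)]
    linear_combination P.numQ_x p.1 p.2
  rw [mul_add, ← mul_assoc, ← mul_assoc, frame_mul₀₂ hp, frame_mul₀₃ hp,
    (hasDir_asd₁τ hp).dir_zero, k]
  simp only [weylβ, weylγ, weylα, weylT, weylQ, ← κ_sq (P := P), asd₃x, asd₂τ, e2]
  field_simp
  ring

lemma curvASD_yτ (hp : p ∈ P.box) : P.curvASD 0 1 2 p 1 2 =
    P.frame p 1 1 * (P.frame p 3 2 * P.weylβ p - P.frame p 2 2 * P.weylγ p) := by
  change dir 1 P.asd₁τ p - 0 + (0 * 0 - P.asd₃y p * P.asd₂τ p) =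
      P.κ * P.fe p / ((p.1 - p.2) ^ 2 * P.ft p) *
        (P.ft p * p.1 / P.fe p * P.weylβ p - P.fs p * p.2 / P.fe p * P.weylγ p)
  have hD := sub_ne hp
  have hN := N_ne hp
  have hh := h_ne hp
  have ht := (ft_pos hp).ne'
  have hκ := (κ_pos (P := P)).ne'
  have hs2 := fs_sq hp
  have k : P.numQy p.1 p.2 = (p.1 * (6 * (P.ν - 1) * P.N p.1 p.2 * P.quartic p.1 * P.quartic p.2 *
      (P.a₃ * p.1 * p.2 - P.a₁) + 2 * P.numα p.1 p.2)
      + 6 * (P.ν - 1) * P.N p.1 p.2 * p.2 * P.numQ p.1 p.2 * P.quartic p.1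
      - P.N p.1 p.2 * (p.1 - p.2) * (-P.numQ p.1 p.2 * P.h p.1 p.2
        - 2 * (p.1 - p.2) * P.numQ p.1 p.2 * P.hy p.1 p.2 + P.quartic p.1 *
        (P.hx p.1 p.2 * (p.1 - p.2) - 2 * P.h p.1 p.2) * (P.a₁ - P.a₃ * p.1 * p.2))) /
      (P.N p.1 p.2 * (p.1 - p.2) ^ 2 * P.h p.1 p.2) := by
    rw [eq_div_iff (by positivity)]
    linear_combination P.numQ_y p.1 p.2
  rw [mul_sub, ← mul_assoc, ← mul_assoc, frame_mul₁₂ hp, frame_mul₁₃ hp,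
    (hasDir_asd₁τ hp).dir_one, k]
  simp only [weylβ, weylγ, weylα, weylT, weylQ, ← κ_sq (P := P), asd₃y, asd₂τ, ← hs2]
  field_simp
  ring

/-- The 2-form with values in the frame which has the coordinate components `m`. -/
lemma sandwich_inv {c : Mat4} (hc : 0 < c.det) (m : Mat4) :
    c.transpose * (c⁻¹.transpose * m * c⁻¹) * c = m := by
  have h1 : c⁻¹ * c = 1 := Matrix.nonsing_inv_mul c (isUnit_iff_ne_zero.2 hc.ne')
  have h2 : c.transpose * c⁻¹.transpose = 1 := by rw [← Matrix.transpose_mul, h1,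
    Matrix.transpose_one]
  calc _ = (c.transpose * c⁻¹.transpose) * m * (c⁻¹ * c) := by simp only [Matrix.mul_assoc]
    _ = m := by rw [h1, h2, Matrix.one_mul, Matrix.mul_one]

lemma inv_sandwich {c : Mat4} (hc : 0 < c.det) (m : Mat4) :
    c⁻¹.transpose * (c.transpose * m * c) * c⁻¹ = m := by
  have h1 : c * c⁻¹ = 1 := Matrix.mul_nonsing_inv c (isUnit_iff_ne_zero.2 hc.ne')
  have h2 : c⁻¹.transpose * c.transpose = 1 := by rw [← Matrix.transpose_mul, h1,
    Matrix.transpose_one]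
  calc _ = (c⁻¹.transpose * c.transpose) * m * (c * c⁻¹) := by simp only [Matrix.mul_assoc]
    _ = m := by rw [h1, h2, Matrix.one_mul, Matrix.mul_one]

lemma sum_smul_toricCurv (hp : p ∈ P.box) (E : Mat4) (k l : Fin 4) :
    ∑ A, ∑ B, (E A k * E B l) • toricCurv P.conn A B p = (1 / 2 : ℝ) •
    (sd ((E.transpose * P.curvSD 0 1 2 p * E) k l) ((E.transpose * P.curvSD 1 2 0 p * E) k l)
        ((E.transpose * P.curvSD 2 0 1 p * E) k l) +
      asd ((E.transpose * P.curvASD 0 1 2 p * E) k l) ((E.transpose * P.curvASD 1 2 0 p * E) k l)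
        ((E.transpose * P.curvASD 2 0 1 p * E) k l)) := by
  have e : ∀ m : Mat4, (E.transpose * m * E) k l = ∑ A, ∑ B, E A k * E B l * m A B := by
    intro m
    simp only [Matrix.mul_apply, Matrix.transpose_apply, Finset.sum_mul]
    rw [Finset.sum_comm]
    exact Finset.sum_congr rfl fun A _ => Finset.sum_congr rfl fun B _ => by ring
  ext a b
  simp only [toricCurv_conn hp, e, Matrix.sum_apply, Matrix.add_apply, Matrix.smul_apply,
    smul_eq_mul]
  obtain ⟨s₁, s₂, s₃, hs⟩ : ∃ s₁ s₂ s₃ : ℝ, ∀ p q r, sd p q r a b = p * s₁ + q * s₂ + r * s₃ :=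
    ⟨_, _, _, sd_apply_eq a b⟩
  obtain ⟨t₁, t₂, t₃, ht⟩ : ∃ t₁ t₂ t₃ : ℝ, ∀ p q r, asd p q r a b = p * t₁ + q * t₂ + r * t₃ :=
    ⟨_, _, _, asd_apply_eq a b⟩
  simp only [hs, ht, Finset.sum_mul, Finset.mul_sum, ← Finset.sum_add_distrib]
  exact Finset.sum_congr rfl fun A _ => Finset.sum_congr rfl fun B _ => by ring

variable {V : Set E4} {prj : E4 → ℝ × ℝ} {T Φ : Fin 4 → E4 → ℝ} {ξ : E4 → Mat4} {h : E4 → Mat4}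

/-- The curvature of the Chen–Teo metric in the orthonormal frame. -/
theorem isFrameCurvature (H : ToricCoords V P.box prj T Φ ξ)
    (hh : ∀ v ∈ V, h v = (P.frame (prj v) * ξ v).transpose * (P.frame (prj v) * ξ v)) {v : E4}
    (hv : v ∈ V) : IsFrameCurvature h v (P.frame (prj v) * ξ v)
      (curvModel (P.weylSD (prj v)) (P.weylα (prj v)) (P.weylβ (prj v)) (P.weylγ (prj v))) := by
  have hp := H.mapsTo v hv
  have F := isToricFrame.isFrameCurvature H hh hv
  set p := prj v with hpv
  have hc := frame_det hp
  set E := (P.frame p)⁻¹ with hE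
  set Rm : Fin 4 → Fin 4 → Mat4 := fun k l =>
    ∑ A, ∑ B, (E A k * E B l) • toricCurv P.conn A B p with hRm
  let G : Fin 3 → Mat4 := ![E.transpose * P.curvASD 0 1 2 p * E,
    E.transpose * P.curvASD 1 2 0 p * E, E.transpose * P.curvASD 2 0 1 p * E]
  have hR : ∀ k l, Rm k l = (1 / 2 : ℝ) • (sd (P.weylSD p * sd 1 0 0 k l)
      (-P.weylSD p / 2 * sd 0 1 0 k l) (-P.weylSD p / 2 * sd 0 0 1 k l) +
      asd (G 0 k l) (G 1 k l) (G 2 k l)) := by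
    intro k l
    simp only [hRm, sum_smul_toricCurv hp, curvSD_one hp, curvSD_two hp, curvSD_three hp, frameForm,
      hE, inv_sandwich hc]
    rw [sd_apply_eq k l (P.weylSD p), sd_apply_eq k l 0 (-P.weylSD p / 2),
      sd_apply_eq k l 0 0 (-P.weylSD p / 2)]
    simp [G, hE]
  have hG : ∀ i a b, G i b a = -G i a b := by
    intro i a b
    have : ∀ m : Mat4, m.transpose = -m → (E.transpose * m * E) b a = -(E.transpose * m * E) a b :=
      fun m hm => skew_sandwich hm E a b
    have hs : ∀ i j k, (P.curvASD i j k p).transpose = -P.curvASD i j k p := fun i j k => by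
      ext a b; exact curvASD_skew i j k p a b
    fin_cases i <;> exact this _ (hs _ _ _)
  have hB := F.bianchi (Filter.eventually_of_mem (H.isOpen.mem_nhds hv) fun w hw => by
    rw [hh w hw]; simp)
  have hGc : ∀ m : Mat4, (P.frame p).transpose * (E.transpose * m * E) * P.frame p = m :=
    sandwich_inv hc
  have n00 : 0 < P.frame p 0 0 := by
    have := fe_pos hp
    have := fs_pos hp
    have := (box_facts hp).1
    have := κ_pos (P := P)
    simp only [frame, Matrix.of_apply, Matrix.cons_val_zero]
    positivity
  have n11 : 0 < P.frame p 1 1 := by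
    have := fe_pos hp
    have := ft_pos hp
    have := (box_facts hp).1
    have := κ_pos (P := P)
    change 0 < P.κ * P.fe p / ((p.1 - p.2) ^ 2 * P.ft p)
    positivity
  have cz : P.frame p 0 1 = 0 ∧ P.frame p 0 2 = 0 ∧ P.frame p 0 3 = 0 ∧ P.frame p 1 0 = 0 ∧
    P.frame p 1 2 = 0 ∧ P.frame p 1 3 = 0 ∧ P.frame p 2 0 = 0 ∧ P.frame p 2 1 = 0 ∧
    P.frame p 3 0 = 0 ∧ P.frame p 3 1 = 0 := ⟨rfl, rfl, rfl, rfl, rfl, rfl, rfl, rfl, rfl, rfl⟩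
  obtain ⟨z1, z2, z3, z4, z5, z6, z7, z8, z9, z10⟩ := cz
  have e01 : ∀ n : Mat4, ((P.frame p).transpose * n * P.frame p) 0 1 =
      P.frame p 0 0 * P.frame p 1 1 * n 0 1 := by
    intro n
    simp [Matrix.mul_apply, Fin.sum_univ_four, z1, z4, z7, z8, z9, z10]
    ring
  have e02 : ∀ n : Mat4, ((P.frame p).transpose * n * P.frame p) 0 2 =
      P.frame p 0 0 * (P.frame p 2 2 * n 0 2 + P.frame p 3 2 * n 0 3) := by
    intro n
    simp [Matrix.mul_apply, Fin.sum_univ_four, z2, z4, z5, z7, z9]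
    ring
  have e12 : ∀ n : Mat4, ((P.frame p).transpose * n * P.frame p) 1 2 =
      P.frame p 1 1 * (P.frame p 2 2 * n 1 2 + P.frame p 3 2 * n 1 3) := by
    intro n
    simp [Matrix.mul_apply, Fin.sum_univ_four, z1, z2, z5, z8, z10]
    ring
  obtain ⟨a1, a2, a3⟩ := curvASD_xy hp
  have n01 : P.frame p 0 0 * P.frame p 1 1 ≠ 0 := (mul_pos n00 n11).ne'
  have g0 : G 0 0 1 = 0 := by
    have := e01 (G 0)
    rw [show G 0 = E.transpose * P.curvASD 0 1 2 p * E from rfl, hGc, a1] at this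
    exact (mul_eq_zero.1 this.symm).resolve_left n01
  have g1 : G 1 0 1 = 0 := by
    have := e01 (G 1)
    rw [show G 1 = E.transpose * P.curvASD 1 2 0 p * E from rfl, hGc, a2] at this
    exact (mul_eq_zero.1 this.symm).resolve_left n01
  have g2 : G 2 0 1 = P.weylα p := by
    have := e01 (G 2)
    rw [show G 2 = E.transpose * P.curvASD 2 0 1 p * E from rfl, hGc, a3] at this
    exact (mul_left_cancel₀ n01 this).symm
  obtain ⟨key, k1, k2⟩ := eq_curvModel hR hG hB g0 g1 g2
  have l1 : P.frame p 2 2 * G 0 0 2 + P.frame p 3 2 * G 0 0 3 =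
      P.frame p 2 2 * P.weylβ p + P.frame p 3 2 * P.weylγ p := by
    have := e02 (G 0)
    rw [show G 0 = E.transpose * P.curvASD 0 1 2 p * E from rfl, hGc, curvASD_xτ hp] at this
    exact (mul_left_cancel₀ n00.ne' this).symm
  have l2 : P.frame p 3 2 * G 0 0 2 - P.frame p 2 2 * G 0 0 3 =
      P.frame p 3 2 * P.weylβ p - P.frame p 2 2 * P.weylγ p := by
    have := e12 (G 0)
    rw [k1, k2, show G 0 = E.transpose * P.curvASD 0 1 2 p * E from rfl, hGc,
      curvASD_yτ hp] at this
    have := mul_left_cancel₀ n11.ne' this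
    change _ = P.frame p 2 2 * -G 0 0 3 + P.frame p 3 2 * G 0 0 2 at this
    linarith
  have y0 : P.frame p 2 2 ≠ 0 := by
    change P.fs p * p.2 / P.fe p ≠ 0
    have : p.2 < 0 := lt_trans hp.2.2 P.x₂_neg
    exact div_ne_zero (mul_ne_zero (fs_pos hp).ne' this.ne) (fe_pos hp).ne'
  have y1 : 0 < P.frame p 2 2 ^ 2 + P.frame p 3 2 ^ 2 := by positivity
  have b1 : G 0 0 2 = P.weylβ p := by
    apply mul_left_cancel₀ y1.ne'
    linear_combination P.frame p 2 2 * l1 + P.frame p 3 2 * l2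
  have b2 : G 0 0 3 = P.weylγ p := by
    apply mul_left_cancel₀ y1.ne'
    linear_combination P.frame p 3 2 * l1 - P.frame p 2 2 * l2
  rw [b1, b2] at key
  rw [← key]
  exact F

end Params

end ChenTeo
end

open Set Filter Topology Manifold Bundle
open scoped ContDiff

noncomputable section

namespace ChenTeo

namespace Params

variable {P : Params} {p : ℝ × ℝ}

lemma F_pos (hp : p ∈ P.box) : 0 < P.F p.1 p.2 := by
  have h1 := (box_facts hp).2.2.2.1
  have h2 := (box_facts hp).2.2.2.2
  have h3 : p.2 < 0 := lt_trans hp.2.2 P.x₂_neg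
  have : 0 < p.2 ^ 2 := by nlinarith
  have := sq_nonneg p.1
  unfold F
  nlinarith

lemma sum_frameForm_one (hp : p ∈ P.box) (v w : Fin 4 → ℝ) :
    ∑ A, ∑ B, P.frameForm 1 p A B * v A * w B =
      P.k * (P.N p.1 p.2 * P.h p.1 p.2) / ((p.1 - p.2) ^ 3 * P.quartic p.1) * (v 0 * w 0) +
      -P.k * (P.N p.1 p.2 * P.h p.1 p.2) / ((p.1 - p.2) ^ 3 * P.quartic p.2) * (v 1 * w 1) +
      P.quartic p.1 * (p.2 * v 2 + P.fA p * v 3) * (p.2 * w 2 + P.fA p * w 3) /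
        (P.N p.1 p.2 * P.h p.1 p.2 * (p.1 - p.2)) -
      P.quartic p.2 * (p.1 * v 2 + P.fB p * v 3) * (p.1 * w 2 + P.fB p * w 3) /
        (P.N p.1 p.2 * P.h p.1 p.2 * (p.1 - p.2)) := by
  have hD := sub_ne hp
  have hN := N_ne hp
  have hh := h_ne hp
  have hs := (fs_pos hp).ne'
  have ht := (ft_pos hp).ne'
  have he := (fe_pos hp).ne'
  have hX : P.quartic p.1 ≠ 0 := (box_facts hp).2.2.2.1.ne'
  have hY : P.quartic p.2 ≠ 0 := (box_facts hp).2.2.2.2.ne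
  have hs2 := fs_sq hp
  have ht2 := ft_sq hp
  have he2 := fe_sq hp
  have e1 : (P.κ * P.fe p / ((p.1 - p.2) ^ 2 * P.fs p)) ^ 2 =
      P.k * (P.N p.1 p.2 * P.h p.1 p.2) / ((p.1 - p.2) ^ 3 * P.quartic p.1) := by
    rw [div_pow, mul_pow, mul_pow, hs2, he2, κ_sq]
    field_simp
  have e2 : (P.κ * P.fe p / ((p.1 - p.2) ^ 2 * P.ft p)) ^ 2 =
      -P.k * (P.N p.1 p.2 * P.h p.1 p.2) / ((p.1 - p.2) ^ 3 * P.quartic p.2) := by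
    rw [div_pow, mul_pow, mul_pow, ht2, he2, κ_sq]
    field_simp
  have q : ∀ z w : ℝ, (P.fs p * z / P.fe p) * (P.fs p * w / P.fe p) +
      0 = P.quartic p.1 * z * w / (P.N p.1 p.2 * P.h p.1 p.2 * (p.1 - p.2)) := by
    intro z w
    rw [← hs2, ← he2]; field_simp; ring
  have q' : ∀ z w : ℝ, (P.ft p * z / P.fe p) * (P.ft p * w / P.fe p) +
      0 = -P.quartic p.2 * z * w / (P.N p.1 p.2 * P.h p.1 p.2 * (p.1 - p.2)) := by
    intro z w
    rw [← ht2, ← he2]; field_simp; ring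
  have r1 := q (p.2 * v 2 + P.fA p * v 3) (p.2 * w 2 + P.fA p * w 3)
  have r2 := q' (p.1 * v 2 + P.fB p * v 3) (p.1 * w 2 + P.fB p * w 3)
  rw [← e1, ← e2]
  simp only [frameForm, Matrix.mul_one, Matrix.mul_apply, Fin.sum_univ_four,
    Matrix.transpose_apply]
  simp [frame]
  linear_combination r1 + r2

lemma sum_frameForm_sd (hp : p ∈ P.box) (v w : Fin 4 → ℝ) :
    ∑ A, ∑ B, P.frameForm (sd 1 0 0) p A B * v A * w B = P.κ / (p.1 - p.2) ^ 2 *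
      (v 0 * (p.2 * w 2 + P.fA p * w 3) - w 0 * (p.2 * v 2 + P.fA p * v 3) -
        v 1 * (p.1 * w 2 + P.fB p * w 3) + w 1 * (p.1 * v 2 + P.fB p * v 3)) := by
  obtain ⟨f1, f2, f3, f4, f5, f6⟩ := frameForm_sd hp 1 0 0
  have d := fun A => frameForm_skew (P := P) (sd_skew 1 0 0) p A A
  have d0 := d 0
  have d1 := d 1
  have d2 := d 2
  have d3 := d 3
  have sk := frameForm_skew (P := P) (sd_skew 1 0 0) p
  simp only [Fin.sum_univ_four, sk 0 1, sk 0 2, sk 0 3, sk 1 2, sk 1 3, sk 2 3, f1, f2, f3, f4, f5,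
    f6, self_eq_neg.1 d0, self_eq_neg.1 d1, self_eq_neg.1 d2, self_eq_neg.1 d3]
  ring

/-- The line element in terms of the frame. -/
lemma lineElement_eq (hp : p ∈ P.box) (v w : Fin 4 → ℝ) :
    P.lineElement p.1 p.2 v w = ∑ A, ∑ B, P.frameForm 1 p A B * v A * w B := by
  have hF := (F_pos hp).ne'
  have hD := sub_ne hp
  have hN := N_ne hp
  have hh := h_ne hp
  have hX : P.quartic p.1 ≠ 0 := (box_facts hp).2.2.2.1.ne'
  have hY : P.quartic p.2 ≠ 0 := (box_facts hp).2.2.2.2.ne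
  have k1 : P.quartic p.1 * p.2 * P.fA p - P.quartic p.2 * p.1 * P.fB p = P.G p.1 p.2 := by
    have := P.numA_numB_G p.1 p.2
    simp only [fA, fB]
    field_simp
    linear_combination this
  have k2 := fB_sub_fA hp
  have F1 : P.F p.1 p.2 = P.quartic p.1 * p.2 ^ 2 - p.1 ^ 2 * P.quartic p.2 := rfl
  rw [sum_frameForm_one hp, lineElement, P.H_eq]
  rw [← k1]
  generalize P.fA p = A at *
  generalize P.fB p = B at *
  generalize P.N p.1 p.2 = n at *
  generalize P.h p.1 p.2 = h at *
  have k3 : n * h = (p.2 * B - p.1 * A) * (p.1 - p.2) := by rw [k2]; field_simp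
  have hk3 : (p.2 * B - p.1 * A) * (p.1 - p.2) ≠ 0 := by rw [← k3]; exact mul_ne_zero hN hh
  have hk4 : (p.2 * B - p.1 * A) ≠ 0 := left_ne_zero_of_mul hk3
  have hk := P.k_pos.ne'
  rw [k3]
  generalize P.F p.1 p.2 = f at *
  generalize P.quartic p.1 = X at *
  generalize P.quartic p.2 = Y at *
  generalize p.1 = x at *
  generalize p.2 = y at *
  generalize x - y = D at *
  generalize hE : y * B - x * A = E at *
  have : X * A ^ 2 - Y * B ^ 2 = (-(X * Y * E ^ 2) + (X * y * A - Y * x * B) ^ 2) / f := by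
    rw [eq_div_iff hF, F1, ← hE]; ring
  field_simp
  rw [eq_div_iff hF] at this
  linear_combination X * Y * f * v 2 * w 2 * F1 - X * Y * v 3 * w 3 * this

/-! ### Where `W⁻` is algebraically general -/

variable (P) in
/-- The numerator of the determinant of the endomorphism `W⁻` minus its eigenvalue `weylα` on the
orthogonal complement of the eigenvector. -/
def numE (x y : ℝ) : ℝ :=
  (-3 * P.numα x y - 6 * (P.ν - 1) * P.N x y * P.quartic x * P.quartic y *
    (P.a₃ * x * y - P.a₁)) * (P.a₃ * x * y - P.a₁) + 6 * (P.ν - 1) * P.N x y * P.numQ x y ^ 2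

lemma weyl_disc (hp : p ∈ P.box) :
    (P.weylα p - P.weylβ p) * (2 * P.weylα p + P.weylβ p) - P.weylγ p ^ 2 =
      6 * (P.ν - 1) * (p.1 - p.2) ^ 2 * P.quartic p.1 * P.quartic p.2 /
        (P.k ^ 2 * P.h p.1 p.2 ^ 6 * P.N p.1 p.2) * P.numE p.1 p.2 := by
  have hD := sub_ne hp
  have hN := N_ne hp
  have hh := h_ne hp
  have hk := P.k_pos.ne'
  have hs2 := fs_sq hp
  have ht2 := ft_sq hp
  have e1 : P.weylγ p ^ 2 = -P.weylQ p ^ 2 * P.quartic p.1 * P.quartic p.2 := by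
    rw [weylγ, mul_pow, mul_pow, hs2, ht2]; ring
  rw [e1]
  simp only [weylβ, weylα, weylT, weylQ, numE]
  field_simp
  ring

variable (P) in
/-- The set over which `W⁻` is seen to be algebraically general. -/
def generic : Set (ℝ × ℝ) := {p | p ∈ P.box ∧ P.numQ p.1 p.2 ≠ 0 ∧ P.numE p.1 p.2 ≠ 0}

lemma generic_subset : P.generic ⊆ P.box := fun _ h => h.1

lemma ν_sub_one_ne : P.ν - 1 ≠ 0 := by
  have := P.ν_neg
  linarith

lemma generic_disc (hp : p ∈ P.generic) :
    (P.weylα p - P.weylβ p) * (2 * P.weylα p + P.weylβ p) ≠ P.weylγ p ^ 2 := by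
  obtain ⟨hb, -, hE⟩ := hp
  rw [← sub_ne_zero, weyl_disc hb]
  have hX : P.quartic p.1 ≠ 0 := (box_facts hb).2.2.2.1.ne'
  have hY : P.quartic p.2 ≠ 0 := (box_facts hb).2.2.2.2.ne
  have hD := sub_ne hb
  have hN := N_ne hb
  have hh := h_ne hb
  have hk := P.k_pos.ne'
  have hν := ν_sub_one_ne (P := P)
  positivity

lemma generic_γ (hp : p ∈ P.generic) :
    (P.weylα p + 2 * P.weylβ p) ^ 2 + 4 * P.weylγ p ^ 2 ≠ 0 := by
  obtain ⟨hb, hQ, -⟩ := hp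
  have hs := (fs_pos hb).ne'
  have ht := (ft_pos hb).ne'
  have hD := sub_ne hb
  have hh := h_ne hb
  have hk := P.k_pos.ne'
  have hν := ν_sub_one_ne (P := P)
  have : P.weylγ p ≠ 0 := by
    have : P.weylQ p ≠ 0 := div_ne_zero (mul_ne_zero (mul_ne_zero (mul_ne_zero (by norm_num) hν) hD)
      hQ) (mul_ne_zero hk (pow_ne_zero 3 hh))
    exact mul_ne_zero (neg_ne_zero.2 this) (mul_ne_zero hs ht)
  positivity

lemma contDiff_numE : ContDiff ℝ ∞ (fun q : ℝ × ℝ => P.numE q.1 q.2) := by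
  unfold numE numα numQ N quartic quartic' h hx hy hxx hyy; fun_prop

lemma isOpen_generic : IsOpen P.generic :=
  P.isOpen_box.inter ((isOpen_ne_fun P.contDiff_numQ.continuous continuous_const).inter
    (isOpen_ne_fun contDiff_numE.continuous continuous_const))

lemma a₁_pos : 0 < P.a₁ := by
  have h1 := P.x₁_lt_x₂.trans P.x₂_neg
  have h3 := P.x₃_neg
  have h := P.a₄_pos
  have h2 := P.x₂_neg
  have : P.a₁ = P.a₄ * (P.x₁ * P.x₂ * -P.x₃) := by simp [a₁, x₄]
  rw [this]
  exact mul_pos h (mul_pos (mul_pos_of_neg_of_neg h1 h2) (neg_pos.2 h3))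

lemma numE_zero (y : ℝ) : P.numE 0 y * P.numQ 0 y = 3 / 2 * P.a₁ ^ 5 * P.a₄ * y ^ 7 := by
  simp only [numE, numα, numQ, N, quartic, quartic', h, hx, hy, hxx, hyy, a₀_eq]; ring

lemma box_subset_closure_generic : P.box ⊆ closure P.generic := by
  intro p hp
  rw [mem_closure_iff_nhds]
  intro U hU
  by_contra hcon
  rw [Set.not_nonempty_iff_eq_empty] at hcon
  have ev : ∀ᶠ q in 𝓝 p, P.numE q.1 q.2 * P.numQ q.1 q.2 = 0 := by
    filter_upwards [hU, P.isOpen_box.mem_nhds hp] with q hq hb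
    by_contra h0
    have : q ∈ U ∩ P.generic := ⟨hq, hb, right_ne_zero_of_mul h0, left_ne_zero_of_mul h0⟩
    rw [hcon] at this
    exact this
  have an : AnalyticOnNhd ℝ (fun x => P.numE x p.2 * P.numQ x p.2) univ := by
    intro x _
    unfold numE numα numQ N quartic quartic' h hx hy hxx hyy
    fun_prop
  have ev' : ∀ᶠ x in 𝓝 p.1, P.numE x p.2 * P.numQ x p.2 = 0 :=
    (Continuous.tendsto (f := fun x : ℝ => (x, p.2)) (by fun_prop) p.1).eventually ev
  have : P.numE 0 p.2 * P.numQ 0 p.2 = 0 := an.eqOn_zero_of_preconnected_of_eventuallyEq_zero isPreconnected_univ (mem_univ p.1) ev'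
    (mem_univ 0)
  rw [numE_zero] at this
  have y0 : p.2 ≠ 0 := (hp.2.2.trans P.x₂_neg).ne
  have := (a₁_pos (P := P)).ne'
  have := P.a₄_pos.ne'
  simp_all

end Params

end ChenTeo
end

open Set Filter Topology Manifold Bundle
open scoped ContDiff

noncomputable section

namespace ChenTeo

namespace Params

variable (P : Params)

/-! ### The rods -/

lemma numB_x₂ (y : ℝ) : P.numB P.x₂ y =
    -P.x₂ * (P.a₄ * (-P.ν ^ 2 * P.x₂ ^ 2 + 2 * P.ν * P.x₁ * P.x₃)) * (P.x₂ - y) ^ 2 := by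
  simp only [numB, a₁, a₂, a₃, x₄]; ring

lemma numB_x₃ (y : ℝ) : P.numB P.x₃ y =
    -P.x₃ * (P.a₄ * (-P.ν ^ 2 * P.x₃ ^ 2 + 2 * P.ν * P.x₁ * P.x₂)) * (P.x₃ - y) ^ 2 := by
  simp only [numB, a₁, a₂, a₃, x₄]; ring

lemma numA_x₁ (x : ℝ) : P.numA x P.x₁ =
    -P.x₁ * (P.a₄ * (P.x₁ ^ 2 + 2 * P.ν * P.x₁ * (P.x₂ + P.x₃))) * (x - P.x₁) ^ 2 := by
  simp only [numA, a₁, a₂, a₃, x₄]; ring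

lemma numA_x₂ (x : ℝ) : P.numA x P.x₂ =
    -P.x₂ * (P.a₄ * (P.x₂ ^ 2 + 2 * P.ν * P.x₂ * (P.x₁ + P.x₃))) * (x - P.x₂) ^ 2 := by
  simp only [numA, a₁, a₂, a₃, x₄]; ring

lemma two_ξ_sub_one_ne : 1 - 2 * P.ξ ≠ 0 := P.one_sub_two_ξ_neg.ne

lemma one_sub_ξ_ne : 1 - P.ξ ≠ 0 := by
  have := P.two_ξ_sq_lt
  have := P.lt_ξ
  have : P.ξ < 1 := by nlinarith
  linarith

lemma ξ_ne : P.ξ ≠ 0 := by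
  have := P.lt_ξ
  linarith

lemma rod_relation : -P.ν ^ 2 * P.x₂ ^ 2 + 2 * P.ν * P.x₁ * P.x₃ =
    P.x₂ ^ 2 + 2 * P.ν * P.x₂ * (P.x₁ + P.x₃) := by
  have h1 := P.two_ξ_sub_one_ne
  have h2 := P.one_sub_ξ_ne
  have h3 := P.ξ_ne
  simp only [x₁, x₃, ν]
  field_simp
  ring

lemma rod_relation' : (P.x₁ - P.x₃) * (-P.ν ^ 2 * P.x₂ ^ 2 + 2 * P.ν * P.x₁ * P.x₃) -
    (P.x₂ - P.x₃) * (P.x₁ ^ 2 + 2 * P.ν * P.x₁ * (P.x₂ + P.x₃)) =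
    (P.x₁ - P.x₂) * (-P.ν ^ 2 * P.x₃ ^ 2 + 2 * P.ν * P.x₁ * P.x₂) := by
  have h1 := P.two_ξ_sub_one_ne
  have h2 := P.one_sub_ξ_ne
  have h3 := P.ξ_ne
  have e1 : P.x₁ = (P.ξ * (1 - 2 * P.ξ + 2 * P.ξ ^ 2) * P.x₂) / (2 * P.ξ - 1) := by
    rw [x₁, ← neg_div_neg_eq]; congr 1 <;> ring
  have h4 : 2 * P.ξ - 1 ≠ 0 := by intro h; apply h1; linarith
  generalize hb : 2 * P.ξ - 1 = b at e1 h4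
  generalize hc : 1 - P.ξ = c at h2
  have e3 : P.x₃ = (1 - 2 * P.ξ + 2 * P.ξ ^ 2) * P.x₂ / (4 * P.ξ ^ 2 * c) := by rw [x₃, hc]
  rw [e1, e3, ν]
  field_simp
  subst hb hc
  ring

lemma x₁_sub_x₂_ne : P.x₁ - P.x₂ ≠ 0 := (sub_neg.2 P.x₁_lt_x₂).ne
lemma x₂_sub_x₃_ne : P.x₂ - P.x₃ ≠ 0 := (sub_neg.2 P.x₂_lt_x₃).ne
lemma x₁_sub_x₃_ne : P.x₁ - P.x₃ ≠ 0 := (sub_neg.2 (P.x₁_lt_x₂.trans P.x₂_lt_x₃)).ne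
lemma x₁_ne : P.x₁ ≠ 0 := (P.x₁_lt_x₂.trans P.x₂_neg).ne

lemma ℓ₀φ_eq : P.ℓ₀φ = 2 * P.κ / (P.a₄ * (P.x₁ - P.x₂) * (P.x₂ - P.x₃)) := by
  have h1 := P.x₁_sub_x₂_ne
  have h2 := P.x₂_sub_x₃_ne
  have h3 := P.x₂_neg.ne
  have h4 := P.a₄_pos.ne'
  simp only [ℓ₀φ, κ, x₄, sub_zero]
  field_simp

lemma ℓ₁φ_eq : P.ℓ₁φ = 2 * P.κ / (P.a₄ * (P.x₁ - P.x₂) * (P.x₁ - P.x₃)) := by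
  have h1 := P.x₁_sub_x₂_ne
  have h2 := P.x₁_sub_x₃_ne
  have h3 := P.x₁_ne
  have h4 := P.a₄_pos.ne'
  simp only [ℓ₁φ, κ, x₄, sub_zero]
  field_simp

lemma ℓ₂φ_eq : P.ℓ₀φ - P.ℓ₁φ = 2 * P.κ / (P.a₄ * (P.x₁ - P.x₃) * (P.x₂ - P.x₃)) := by
  have h1 := P.x₁_sub_x₂_ne
  have h2 := P.x₁_sub_x₃_ne
  have h3 := P.x₂_sub_x₃_ne
  have h4 := P.a₄_pos.ne'
  rw [ℓ₀φ_eq, ℓ₁φ_eq]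
  field_simp
  ring

lemma ℓ₀τ_eq : P.ℓ₀τ = P.a₄ * (-P.ν ^ 2 * P.x₂ ^ 2 + 2 * P.ν * P.x₁ * P.x₃) * P.ℓ₀φ := by
  have h1 := P.x₁_sub_x₂_ne
  have h2 := P.x₂_sub_x₃_ne
  have h3 := P.x₂_neg.ne
  have h4 := P.a₄_pos.ne'
  simp only [ℓ₀φ, ℓ₀τ, x₄, sub_zero]
  field_simp
  ring

lemma ℓ₁τ_eq : P.ℓ₁τ = P.a₄ * (P.x₁ ^ 2 + 2 * P.ν * P.x₁ * (P.x₂ + P.x₃)) * P.ℓ₁φ := by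
  have h1 := P.x₁_sub_x₂_ne
  have h2 := P.x₁_sub_x₃_ne
  have h3 := P.x₁_ne
  have h4 := P.a₄_pos.ne'
  simp only [ℓ₁φ, ℓ₁τ, x₄, sub_zero]
  field_simp
  ring

lemma ℓ₂τ_eq : P.ℓ₀τ - P.ℓ₁τ =
    P.a₄ * (-P.ν ^ 2 * P.x₃ ^ 2 + 2 * P.ν * P.x₁ * P.x₂) * (P.ℓ₀φ - P.ℓ₁φ) := by
  have h1 := P.x₁_sub_x₂_ne
  have h2 := P.x₁_sub_x₃_ne
  have h3 := P.x₂_sub_x₃_ne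
  have h4 := P.a₄_pos.ne'
  rw [ℓ₀τ_eq, ℓ₁τ_eq, ℓ₂φ_eq, ℓ₀φ_eq, ℓ₁φ_eq]
  field_simp
  linear_combination P.κ * P.rod_relation'

lemma det_ℓ_pos : 0 < P.ℓ₁τ * P.ℓ₀φ - P.ℓ₀τ * P.ℓ₁φ := by
  have e : P.ℓ₁τ * P.ℓ₀φ - P.ℓ₀τ * P.ℓ₁φ =
      P.a₄ * ((P.x₁ - P.x₂) * (P.x₁ + P.x₂ + 2 * P.ν * P.x₃)) * (P.ℓ₀φ * P.ℓ₁φ) := by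
    rw [ℓ₀τ_eq, ℓ₁τ_eq, rod_relation]; ring
  have h1 := sub_neg.2 P.x₁_lt_x₂
  have h2 := sub_neg.2 P.x₂_lt_x₃
  have h3 := sub_neg.2 (P.x₁_lt_x₂.trans P.x₂_lt_x₃)
  have h4 := P.a₄_pos
  have hκ := κ_pos (P := P)
  have h5 : P.x₁ + P.x₂ + 2 * P.ν * P.x₃ < 0 := by
    nlinarith [P.neg_one_lt_ν, P.x₃_neg]
  have h6 : 0 < P.ℓ₀φ := by
    rw [ℓ₀φ_eq, mul_assoc]
    have := mul_pos_of_neg_of_neg h1 h2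
    positivity
  have h7 : 0 < P.ℓ₁φ := by
    rw [ℓ₁φ_eq, mul_assoc]
    have := mul_pos_of_neg_of_neg h1 h3
    positivity
  rw [e]
  have := mul_pos_of_neg_of_neg h1 h5
  positivity

/-- The vector `V` is collapsed on the side `x = xs`. -/
structure IsRodX (xs Vτ Vφ : ℝ) : Prop where
  ne : xs ≠ 0
  root : P.quartic xs = 0
  collapse : ∀ y, xs * Vτ * (xs - y) ^ 2 + P.numB xs y * Vφ = 0
  normalized : (P.quartic' xs * Vφ) ^ 2 = (2 * P.κ * xs) ^ 2

/-- The vector `W` is collapsed on the side `y = ys`. -/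
structure IsRodY (ys Wτ Wφ : ℝ) : Prop where
  ne : ys ≠ 0
  root : P.quartic ys = 0
  collapse : ∀ x, ys * Wτ * (x - ys) ^ 2 + P.numA x ys * Wφ = 0
  normalized : (P.quartic' ys * Wφ) ^ 2 = (2 * P.κ * ys) ^ 2

lemma quartic'_x₁ : P.quartic' P.x₁ = P.a₄ * ((P.x₁ - P.x₂) * (P.x₁ - P.x₃)) * P.x₁ := by
  simp only [quartic', a₁, a₂, a₃, x₄]; ring

lemma quartic'_x₂ : P.quartic' P.x₂ = -P.a₄ * ((P.x₁ - P.x₂) * (P.x₂ - P.x₃)) * P.x₂ := by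
  simp only [quartic', a₁, a₂, a₃, x₄]; ring

lemma quartic'_x₃ : P.quartic' P.x₃ = P.a₄ * ((P.x₁ - P.x₃) * (P.x₂ - P.x₃)) * P.x₃ := by
  simp only [quartic', a₁, a₂, a₃, x₄]; ring

lemma normalized_x₂ : (P.quartic' P.x₂ * P.ℓ₀φ) ^ 2 = (2 * P.κ * P.x₂) ^ 2 := by
  have h1 := P.x₁_sub_x₂_ne
  have h2 := P.x₂_sub_x₃_ne
  have h4 := P.a₄_pos.ne'
  rw [quartic'_x₂, ℓ₀φ_eq]
  field_simp

lemma isRodX_x₂ : P.IsRodX P.x₂ P.ℓ₀τ P.ℓ₀φ where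
  ne := P.x₂_neg.ne
  root := by rw [quartic_eq]; ring
  collapse y := by rw [numB_x₂, ℓ₀τ_eq]; ring
  normalized := P.normalized_x₂

lemma isRodX_x₃ : P.IsRodX P.x₃ (P.ℓ₀τ - P.ℓ₁τ) (P.ℓ₀φ - P.ℓ₁φ) where
  ne := P.x₃_neg.ne
  root := by rw [quartic_eq]; ring
  collapse y := by rw [numB_x₃, ℓ₂τ_eq]; ring
  normalized := by
    have h1 := P.x₁_sub_x₃_ne
    have h2 := P.x₂_sub_x₃_ne
    have h4 := P.a₄_pos.ne'
    rw [quartic'_x₃, ℓ₂φ_eq]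
    field_simp

lemma isRodY_x₂ : P.IsRodY P.x₂ P.ℓ₀τ P.ℓ₀φ where
  ne := P.x₂_neg.ne
  root := by rw [quartic_eq]; ring
  collapse y := by rw [numA_x₂, ℓ₀τ_eq, rod_relation]; ring
  normalized := P.normalized_x₂

lemma isRodY_x₁ : P.IsRodY P.x₁ P.ℓ₁τ P.ℓ₁φ where
  ne := P.x₁_ne
  root := by rw [quartic_eq]; ring
  collapse y := by rw [numA_x₁, ℓ₁τ_eq]; ring
  normalized := by
    have h1 := P.x₁_sub_x₃_ne
    have h2 := P.x₁_sub_x₂_ne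
    have h4 := P.a₄_pos.ne'
    rw [quartic'_x₁, ℓ₁φ_eq]
    field_simp

variable {P} in
lemma IsRodX.neg {xs Vτ Vφ : ℝ} (H : P.IsRodX xs Vτ Vφ) : P.IsRodX xs (-Vτ) (-Vφ) where
  ne := H.ne
  root := H.root
  collapse y := by linear_combination -H.collapse y
  normalized := by rw [← H.normalized]; ring

end Params

end ChenTeo
end

open Set Filter Topology Manifold Bundle
open scoped ContDiff

noncomputable section

namespace ChenTeo

/-! ### Smooth difference quotients -/

/-- The difference `f - f ∘ r` is a smooth multiple of `l`. -/
structure HasQuot (r : ℝ × ℝ → ℝ × ℝ) (l f : ℝ × ℝ → ℝ) : Prop where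
  smooth : ContDiff ℝ ∞ f
  smooth_comp : ContDiff ℝ ∞ (f ∘ r)
  quot : ∃ q, ContDiff ℝ ∞ q ∧ ∀ p, f p = f (r p) + l p * q p

namespace HasQuot

variable {r : ℝ × ℝ → ℝ × ℝ} {l f g : ℝ × ℝ → ℝ}

lemma const (c : ℝ) : HasQuot r l fun _ => c :=
  ⟨contDiff_const, contDiff_const, 0, contDiff_const, fun p => by simp⟩

lemma add (hf : HasQuot r l f) (hg : HasQuot r l g) : HasQuot r l fun p => f p + g p := by
  obtain ⟨q, hq, e⟩ := hf.quot
  obtain ⟨q', hq', e'⟩ := hg.quot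
  exact ⟨hf.smooth.add hg.smooth, hf.smooth_comp.add hg.smooth_comp, _, hq.add hq',
    fun p => by linear_combination e p + e' p⟩

lemma mul (hf : HasQuot r l f) (hg : HasQuot r l g) : HasQuot r l fun p => f p * g p := by
  obtain ⟨q, hq, e⟩ := hf.quot
  obtain ⟨q', hq', e'⟩ := hg.quot
  exact ⟨hf.smooth.mul hg.smooth, hf.smooth_comp.mul hg.smooth_comp, _,
    (hq.mul hg.smooth).add (hf.smooth_comp.mul hq'),
    fun p => by simp only [Function.comp]; linear_combination g p * e p + f (r p) * e' p⟩

lemma neg (hf : HasQuot r l f) : HasQuot r l fun p => -f p := by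
  simpa using (const (-1)).mul hf

lemma sub (hf : HasQuot r l f) (hg : HasQuot r l g) : HasQuot r l fun p => f p - g p := by
  simpa [sub_eq_add_neg] using hf.add hg.neg

lemma pow (hf : HasQuot r l f) (n : ℕ) : HasQuot r l fun p => f p ^ n := by
  induction n with
  | zero => simpa using const 1
  | succ n ih => simpa [pow_succ] using ih.mul hf

lemma exists_eq_mul (hf : HasQuot r l f) (h0 : ∀ p, f (r p) = 0) :
    ∃ q, ContDiff ℝ ∞ q ∧ ∀ p, f p = l p * q p := by
  obtain ⟨q, hq, e⟩ := hf.quot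
  exact ⟨q, hq, fun p => by rw [e, h0, zero_add]⟩

lemma fst_of_fst (c : ℝ) : HasQuot (fun p => (c, p.2)) (fun p => p.1 - c) fun p => p.1 :=
  ⟨contDiff_fst, contDiff_const, 1, contDiff_const, fun p => by simp⟩

lemma snd_of_fst (c : ℝ) : HasQuot (fun p => (c, p.2)) (fun p => p.1 - c) fun p => p.2 :=
  ⟨contDiff_snd, contDiff_snd, 0, contDiff_const, fun p => by simp⟩

lemma fst_of_snd (c : ℝ) : HasQuot (fun p => (p.1, c)) (fun p => p.2 - c) fun p => p.1 :=
  ⟨contDiff_fst, contDiff_fst, 0, contDiff_const, fun p => by simp⟩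

lemma snd_of_snd (c : ℝ) : HasQuot (fun p => (p.1, c)) (fun p => p.2 - c) fun p => p.2 :=
  ⟨contDiff_snd, contDiff_const, 1, contDiff_const, fun p => by simp⟩

end HasQuot

namespace Params

variable {P : Params}

section

variable {r : ℝ × ℝ → ℝ × ℝ} {l : ℝ × ℝ → ℝ}

lemma hasQuot_numA (h1 : HasQuot r l fun p => p.1) (h2 : HasQuot r l fun p => p.2) :
    HasQuot r l fun p => P.numA p.1 p.2 := by
  unfold numA
  repeat' first
    | exact h1 | exact h2 | exact HasQuot.const _ | apply HasQuot.add | apply HasQuot.sub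
    | apply HasQuot.mul

lemma hasQuot_numB (h1 : HasQuot r l fun p => p.1) (h2 : HasQuot r l fun p => p.2) :
    HasQuot r l fun p => P.numB p.1 p.2 := by
  unfold numB
  repeat' first
    | exact h1 | exact h2 | exact HasQuot.const _ | apply HasQuot.add | apply HasQuot.sub
    | apply HasQuot.mul

lemma hasQuot_Nh (h1 : HasQuot r l fun p => p.1) (h2 : HasQuot r l fun p => p.2) :
    HasQuot r l fun p => P.N p.1 p.2 * P.h p.1 p.2 := by
  unfold N h
  repeat' first
    | exact h1 | exact h2 | exact HasQuot.const _ | apply HasQuot.add | apply HasQuot.sub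
    | apply HasQuot.mul | apply HasQuot.pow | apply HasQuot.neg

end

variable (P) in
/-- The difference quotient `(quartic t - quartic c) / (t - c)`. -/
def quarticQuot (c t : ℝ) : ℝ := P.a₁ + P.a₂ * (t + c) + P.a₃ * (t ^ 2 + t * c + c ^ 2) +
  P.a₄ * (t ^ 3 + t ^ 2 * c + t * c ^ 2 + c ^ 3)

lemma quartic_eq_quot {c : ℝ} (hc : P.quartic c = 0) (t : ℝ) :
    P.quartic t = (t - c) * P.quarticQuot c t := by
  have : P.quartic t = P.quartic t - P.quartic c := by rw [hc, sub_zero]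
  rw [this]; simp only [quartic, quarticQuot]; ring

lemma quarticQuot_self (c : ℝ) : P.quarticQuot c c = P.quartic' c := by
  simp only [quarticQuot, quartic']; ring

lemma hasQuot_quarticQuot {r : ℝ × ℝ → ℝ × ℝ} {l f : ℝ × ℝ → ℝ} (hf : HasQuot r l f) (c : ℝ) :
    HasQuot r l fun p => P.quarticQuot c (f p) := by
  unfold quarticQuot
  repeat' first
    | exact hf | exact HasQuot.const _ | apply HasQuot.add | apply HasQuot.sub
    | apply HasQuot.mul

lemma IsRodX.exists_quot {xs Vτ Vφ : ℝ} (R : P.IsRodX xs Vτ Vφ) :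
    (∃ b, ContDiff ℝ ∞ b ∧ ∀ p : ℝ × ℝ, p.1 * Vτ * (p.1 - p.2) ^ 2 + P.numB p.1 p.2 * Vφ =
      (p.1 - xs) * b p) ∧
    ∃ q, ContDiff ℝ ∞ q ∧ ∀ p : ℝ × ℝ,
      (P.quarticQuot xs p.1 * (p.2 * Vτ * (p.1 - p.2) ^ 2 + P.numA p.1 p.2 * Vφ)) ^ 2 -
        (2 * P.κ * (P.N p.1 p.2 * P.h p.1 p.2) * (p.1 - p.2)) ^ 2 = (p.1 - xs) * q p := by
  have h1 := HasQuot.fst_of_fst xs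
  have h2 := HasQuot.snd_of_fst xs
  constructor
  · exact HasQuot.exists_eq_mul (((h1.mul (.const Vτ)).mul ((h1.sub h2).pow 2)).add
      ((hasQuot_numB h1 h2).mul (.const Vφ))) fun p => R.collapse p.2
  · refine HasQuot.exists_eq_mul ((((hasQuot_quarticQuot h1 xs).mul
      (((h2.mul (.const Vτ)).mul ((h1.sub h2).pow 2)).add
      ((hasQuot_numA h1 h2).mul (.const Vφ)))).pow 2).sub
      ((((HasQuot.const (2 * P.κ)).mul (hasQuot_Nh h1 h2)).mul (h1.sub h2)).pow 2)) fun p => ?_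
    apply mul_left_cancel₀ (pow_ne_zero 2 R.ne)
    have e := R.collapse p.2
    have e' := P.numB_sub_numA xs p.2
    have e2 : xs * (p.2 * Vτ * (xs - p.2) ^ 2 + P.numA xs p.2 * Vφ) =
        -(P.N xs p.2 * P.h xs p.2 * (xs - p.2)) * Vφ := by
      linear_combination p.2 * e - Vφ * e'
    have e3 := R.normalized
    simp only [quarticQuot_self]
    calc _ = (P.quartic' xs * (xs * (p.2 * Vτ * (xs - p.2) ^ 2 + P.numA xs p.2 * Vφ))) ^ 2 -
          (2 * P.κ * xs) ^ 2 * (P.N xs p.2 * P.h xs p.2 * (xs - p.2)) ^ 2 := by ring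
      _ = _ := by rw [e2, ← e3]; ring

lemma IsRodY.exists_quot {ys Wτ Wφ : ℝ} (R : P.IsRodY ys Wτ Wφ) :
    (∃ a, ContDiff ℝ ∞ a ∧ ∀ p : ℝ × ℝ, p.2 * Wτ * (p.1 - p.2) ^ 2 + P.numA p.1 p.2 * Wφ =
      (p.2 - ys) * a p) ∧
    ∃ q, ContDiff ℝ ∞ q ∧ ∀ p : ℝ × ℝ,
      (P.quarticQuot ys p.2 * (p.1 * Wτ * (p.1 - p.2) ^ 2 + P.numB p.1 p.2 * Wφ)) ^ 2 -
        (2 * P.κ * (P.N p.1 p.2 * P.h p.1 p.2) * (p.1 - p.2)) ^ 2 = (p.2 - ys) * q p := by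
  have h1 := HasQuot.fst_of_snd ys
  have h2 := HasQuot.snd_of_snd ys
  constructor
  · exact HasQuot.exists_eq_mul (((h2.mul (.const Wτ)).mul ((h1.sub h2).pow 2)).add
      ((hasQuot_numA h1 h2).mul (.const Wφ))) fun p => R.collapse p.1
  · refine HasQuot.exists_eq_mul ((((hasQuot_quarticQuot h2 ys).mul
      (((h1.mul (.const Wτ)).mul ((h1.sub h2).pow 2)).add
      ((hasQuot_numB h1 h2).mul (.const Wφ)))).pow 2).sub
      ((((HasQuot.const (2 * P.κ)).mul (hasQuot_Nh h1 h2)).mul (h1.sub h2)).pow 2)) fun p => ?_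
    apply mul_left_cancel₀ (pow_ne_zero 2 R.ne)
    have e := R.collapse p.1
    have e' := P.numB_sub_numA p.1 ys
    have e2 : ys * (p.1 * Wτ * (p.1 - ys) ^ 2 + P.numB p.1 ys * Wφ) =
        (P.N p.1 ys * P.h p.1 ys * (p.1 - ys)) * Wφ := by
      linear_combination p.1 * e + Wφ * e'
    have e3 := R.normalized
    simp only [quarticQuot_self]
    calc _ = (P.quartic' ys * (ys * (p.1 * Wτ * (p.1 - ys) ^ 2 + P.numB p.1 ys * Wφ))) ^ 2 -
          (2 * P.κ * ys) ^ 2 * (P.N p.1 ys * P.h p.1 ys * (p.1 - ys)) ^ 2 := by ring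
      _ = _ := by rw [e2, ← e3]; ring

end Params

/-! ### Polar coordinates -/

open Params

/-- `ρ` is the square of the radius of one of the two planes of `ℂ²`, `r = dρ / 2`, and `ζ / ρ` is
the differential of the angle. -/
structure Polar (ρ : E4 → ℝ) (r ζ : Fin 4 → E4 → ℝ) (δ ε : Fin 4 → Fin 4 → ℝ) : Prop where
  smooth : ContDiff ℝ ∞ ρ
  smooth_r : ∀ i, ContDiff ℝ ∞ (r i)
  smooth_ζ : ∀ i, ContDiff ℝ ∞ (ζ i)
  pd_ρ : ∀ u i, pd i ρ u = 2 * r i u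
  pd_ζ : ∀ u i j, pd i (ζ j) u = ε i j
  skew : ∀ i j, ε j i = -ε i j
  dot : ∀ u i j, r i u * r j u + ζ i u * ζ j u = ρ u * δ i j
  wedge : ∀ u i j, r i u * ζ j u - r j u * ζ i u = ρ u * ε i j

lemma contDiff_coord (i : Fin 4) : ContDiff ℝ ∞ fun u : E4 => u i :=
  contDiff_euclidean.1 contDiff_id i

lemma pd_coord (i j : Fin 4) (u : E4) : pd i (fun v => v j) u = if i = j then 1 else 0 := by
  have : HasFDerivAt (fun v : E4 => v j) (EuclideanSpace.proj j : E4 →L[ℝ] ℝ) u :=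
    (EuclideanSpace.proj j : E4 →L[ℝ] ℝ).hasFDerivAt
  unfold pd
  rw [this.fderiv]
  simp [eq_comm]

lemma diff_coord (j : Fin 4) (u : E4) : DifferentiableAt ℝ (fun v : E4 => v j) u :=
  (contDiff_coord j).differentiable (by simp) u

lemma pd_neg_coord (i j : Fin 4) (u : E4) :
    pd i (fun v => -v j) u = if i = j then -1 else 0 := by
  have := pd_sub (u := u) i (differentiableAt_const (0 : ℝ)) (diff_coord j u)
  simp only [zero_sub, pd_const, pd_coord] at this
  rw [this]; split_ifs <;> simp

lemma polar_cz : Polar (fun u => Complex.normSq (cz u))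
    ![fun u => u 0, fun u => u 1, 0, 0] ![fun u => -u 1, fun u => u 0, 0, 0]
    (!![1, 0, 0, 0; 0, 1, 0, 0; 0, 0, 0, 0; 0, 0, 0, 0] : Mat4)
    (!![0, 1, 0, 0; -1, 0, 0, 0; 0, 0, 0, 0; 0, 0, 0, 0] : Mat4) where
  smooth := Params.contDiff_nz
  smooth_r i := by
    fin_cases i
    · exact contDiff_coord 0
    · exact contDiff_coord 1
    · exact contDiff_const
    · exact contDiff_const
  smooth_ζ i := by
    fin_cases i
    · exact (contDiff_coord 1).neg
    · exact contDiff_coord 0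
    · exact contDiff_const
    · exact contDiff_const
  pd_ρ u i := by
    have e : (fun u : E4 => Complex.normSq (cz u)) = fun u => u 0 * u 0 + u 1 * u 1 := rfl
    have d0 := diff_coord 0 u
    have d1 := diff_coord 1 u
    rw [e, pd_add i (d0.fun_mul d0) (d1.fun_mul d1), pd_mul i d0 d0, pd_mul i d1 d1, pd_coord, pd_coord]
    fin_cases i <;> simp <;> ring
  pd_ζ u i j := by
    have h0 : pd i (0 : E4 → ℝ) u = 0 := pd_const i 0
    fin_cases j <;> simp [pd_coord, pd_neg_coord, h0] <;> fin_cases i <;> simp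
  skew i j := by fin_cases i <;> fin_cases j <;> simp
  dot u i j := by
    fin_cases i <;> fin_cases j <;> simp [Complex.normSq, cz] <;> ring
  wedge u i j := by
    fin_cases i <;> fin_cases j <;> simp [Complex.normSq, cz] <;> ring

lemma polar_cw : Polar (fun u => Complex.normSq (cw u))
    ![0, 0, fun u => u 2, fun u => u 3] ![0, 0, fun u => -u 3, fun u => u 2]
    (!![0, 0, 0, 0; 0, 0, 0, 0; 0, 0, 1, 0; 0, 0, 0, 1] : Mat4)
    (!![0, 0, 0, 0; 0, 0, 0, 0; 0, 0, 0, 1; 0, 0, -1, 0] : Mat4) where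
  smooth := Params.contDiff_nw
  smooth_r i := by
    fin_cases i
    · exact contDiff_const
    · exact contDiff_const
    · exact contDiff_coord 2
    · exact contDiff_coord 3
  smooth_ζ i := by
    fin_cases i
    · exact contDiff_const
    · exact contDiff_const
    · exact (contDiff_coord 3).neg
    · exact contDiff_coord 2
  pd_ρ u i := by
    have e : (fun u : E4 => Complex.normSq (cw u)) = fun u => u 2 * u 2 + u 3 * u 3 := rfl
    have d0 := diff_coord 2 u
    have d1 := diff_coord 3 u
    rw [e, pd_add i (d0.fun_mul d0) (d1.fun_mul d1), pd_mul i d0 d0, pd_mul i d1 d1, pd_coord, pd_coord]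
    fin_cases i <;> simp <;> ring
  pd_ζ u i j := by
    have h0 : pd i (0 : E4 → ℝ) u = 0 := pd_const i 0
    fin_cases j <;> simp [pd_coord, pd_neg_coord, h0] <;> fin_cases i <;> simp
  skew i j := by fin_cases i <;> fin_cases j <;> simp
  dot u i j := by
    fin_cases i <;> fin_cases j <;> simp [Complex.normSq, cw] <;> ring
  wedge u i j := by
    fin_cases i <;> fin_cases j <;> simp [Complex.normSq, cw] <;> ring

lemma Polar.pd_angle {ρ : E4 → ℝ} {r ζ : Fin 4 → E4 → ℝ} {δ ε : Fin 4 → Fin 4 → ℝ}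
    (R : Polar ρ r ζ δ ε) {u : E4} (hu : ρ u ≠ 0) (i j : Fin 4) :
    pd i (fun v => ζ j v / ρ v) u = pd j (fun v => ζ i v / ρ v) u := by
  have hd := R.smooth.differentiable (by simp) u
  have hz := fun j => (R.smooth_ζ j).differentiable (by simp) u
  have hi : DifferentiableAt ℝ (fun v => (ρ v)⁻¹) u := hd.inv hu
  have key : ∀ i, pd i (fun v => (ρ v)⁻¹) u = -(2 * r i u) / ρ u ^ 2 := by
    intro i
    rw [← R.pd_ρ]
    unfold pd
    have := ((hasDerivAt_inv hu).comp_hasFDerivAt u hd.hasFDerivAt).fderiv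
    simp only [Function.comp_def] at this
    rw [this]
    simp; ring
  simp only [div_eq_mul_inv]
  rw [pd_mul i (hz j) hi, pd_mul j (hz i) hi, key, key, R.pd_ζ, R.pd_ζ, R.skew i j]
  have := R.wedge u i j
  field_simp
  linear_combination -2 * this

end ChenTeo
end

open Set Filter Topology Manifold Bundle
open scoped ContDiff

noncomputable section

namespace ChenTeo

open Params

/-- Coordinates of `ℂ²` around the corner `(xs, ys)`: `ρ` and `ρ'` are the distances of `x` and `y`
from the sides that meet there, `V` and `W` are collapsed on these sides. -/
structure Corner (P : Params) where
  tgt : Set E4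
  (xs ys σ σ' Vτ Vφ Wτ Wφ : ℝ)
  (ρ ρ' : E4 → ℝ)
  (r ζ r' ζ' : Fin 4 → E4 → ℝ)
  (δ ε δ' ε' : Fin 4 → Fin 4 → ℝ)
  isOpen : IsOpen tgt
  polar : Polar ρ r ζ δ ε
  polar' : Polar ρ' r' ζ' δ' ε'
  rodX : P.IsRodX xs Vτ Vφ
  rodY : P.IsRodY ys Wτ Wφ
  sq : σ ^ 2 = 1
  sq' : σ' ^ 2 = 1
  bounds : ∀ u ∈ tgt, (P.x₂ ≤ xs + σ * ρ u ∧ xs + σ * ρ u ≤ P.x₃) ∧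
    (P.x₁ ≤ ys + σ' * ρ' u ∧ ys + σ' * ρ' u ≤ P.x₂) ∧ ys + σ' * ρ' u < xs + σ * ρ u
  mem_box : ∀ u ∈ tgt, ρ u ≠ 0 → ρ' u ≠ 0 → (xs + σ * ρ u, ys + σ' * ρ' u) ∈ P.box
  root : ∀ u ∈ tgt, P.quartic (xs + σ * ρ u) = 0 → ρ u = 0
  root' : ∀ u ∈ tgt, P.quartic (ys + σ' * ρ' u) = 0 → ρ' u = 0
  dense : tgt ⊆ closure {u | u ∈ tgt ∧ ρ u ≠ 0 ∧ ρ' u ≠ 0}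
  orient : 0 < -(σ * σ' * (Vτ * Wφ - Wτ * Vφ))
  det : ∀ u (a b c d : ℝ), (Matrix.of fun A i => ![r i u, r' i u, a * ζ i u + b * ζ' i u,
    c * ζ i u + d * ζ' i u] A : Mat4).det = -(a * d - b * c) * (ρ u * ρ' u)

namespace Corner

variable {P : Params} (K : Corner P)

/-- The coordinates `(x, y)`. -/
def prj (u : E4) : ℝ × ℝ := (K.xs + K.σ * K.ρ u, K.ys + K.σ' * K.ρ' u)

/-- The complement of the two axes. -/
def reg : Set E4 := {u | u ∈ K.tgt ∧ K.ρ u ≠ 0 ∧ K.ρ' u ≠ 0}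

/-- The components of `dτ`. -/
def T (i : Fin 4) (u : E4) : ℝ := K.Vτ * (K.ζ i u / K.ρ u) + K.Wτ * (K.ζ' i u / K.ρ' u)

/-- The components of `dφ`. -/
def Φ (i : Fin 4) (u : E4) : ℝ := K.Vφ * (K.ζ i u / K.ρ u) + K.Wφ * (K.ζ' i u / K.ρ' u)

/-- The components of `dx, dy, dτ, dφ`. -/
def coframe (u : E4) : Mat4 :=
  Matrix.of fun A i => ![2 * K.σ * K.r i u, 2 * K.σ' * K.r' i u, K.T i u, K.Φ i u] A

lemma smooth_prj : ContDiff ℝ ∞ K.prj :=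
  (contDiff_const.add (contDiff_const.mul K.polar.smooth)).prodMk
    (contDiff_const.add (contDiff_const.mul K.polar'.smooth))

lemma reg_subset : K.reg ⊆ K.tgt := fun _ h => h.1

lemma isOpen_reg : IsOpen K.reg :=
  K.isOpen.inter (((isOpen_compl_singleton (x := (0 : ℝ))).preimage
    K.polar.smooth.continuous).inter ((isOpen_compl_singleton (x := (0 : ℝ))).preimage
    K.polar'.smooth.continuous))

lemma prj_mem {u : E4} (hu : u ∈ K.reg) : K.prj u ∈ P.box := K.mem_box u hu.1 hu.2.1 hu.2.2

lemma sub_pos {u : E4} (hu : u ∈ K.tgt) : 0 < (K.prj u).1 - (K.prj u).2 :=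
  _root_.sub_pos.2 (K.bounds u hu).2.2

lemma Nh_ne {u : E4} (hu : u ∈ K.tgt) :
    P.N (K.prj u).1 (K.prj u).2 * P.h (K.prj u).1 (K.prj u).2 ≠ 0 := by
  obtain ⟨⟨h1, h2⟩, ⟨h3, h4⟩, -⟩ := K.bounds u hu
  exact mul_ne_zero (P.N_neg h1 h4).ne (P.h_neg h1 h2 h3 h4).ne

lemma quotX_ne {u : E4} (hu : u ∈ K.tgt) : P.quarticQuot K.xs (K.prj u).1 ≠ 0 := by
  intro h0
  have h1 : P.quartic (K.prj u).1 = 0 := by rw [quartic_eq_quot K.rodX.root, h0, mul_zero]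
  have h2 := K.root u hu h1
  have h3 := K.rodX.normalized
  have h4 : (K.prj u).1 = K.xs := by simp [prj, h2]
  rw [h4, quarticQuot_self] at h0
  rw [h0, zero_mul, zero_pow two_ne_zero] at h3
  have := K.rodX.ne
  have := (κ_pos (P := P)).ne'
  exact absurd h3.symm (by positivity)

lemma quotY_ne {u : E4} (hu : u ∈ K.tgt) : P.quarticQuot K.ys (K.prj u).2 ≠ 0 := by
  intro h0
  have h1 : P.quartic (K.prj u).2 = 0 := by rw [quartic_eq_quot K.rodY.root, h0, mul_zero]
  have h2 := K.root' u hu h1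
  have h3 := K.rodY.normalized
  have h4 : (K.prj u).2 = K.ys := by simp [prj, h2]
  rw [h4, quarticQuot_self] at h0
  rw [h0, zero_mul, zero_pow two_ne_zero] at h3
  have := K.rodY.ne
  have := (κ_pos (P := P)).ne'
  exact absurd h3.symm (by positivity)

lemma pd_fst (u : E4) (i : Fin 4) : pd i (fun w => (K.prj w).1) u = 2 * K.σ * K.r i u := by
  have hd := K.polar.smooth.differentiable (by simp) u
  simp only [prj]
  rw [pd_add i (differentiableAt_const _) ((differentiableAt_const _).fun_mul hd), pd_const,
    pd_mul i (differentiableAt_const _) hd, pd_const, K.polar.pd_ρ]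
  ring

lemma pd_snd (u : E4) (i : Fin 4) : pd i (fun w => (K.prj w).2) u = 2 * K.σ' * K.r' i u := by
  have hd := K.polar'.smooth.differentiable (by simp) u
  simp only [prj]
  rw [pd_add i (differentiableAt_const _) ((differentiableAt_const _).fun_mul hd), pd_const,
    pd_mul i (differentiableAt_const _) hd, pd_const, K.polar'.pd_ρ]
  ring

lemma det_coframe {u : E4} (hu : u ∈ K.reg) :
    (K.coframe u).det = -4 * (K.σ * K.σ' * (K.Vτ * K.Wφ - K.Wτ * K.Vφ)) := by
  have h1 := hu.2.1
  have h2 := hu.2.2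
  have hM := K.det u (K.Vτ / K.ρ u) (K.Wτ / K.ρ' u) (K.Vφ / K.ρ u) (K.Wφ / K.ρ' u)
  set M : Mat4 := Matrix.of fun A i => ![K.r i u, K.r' i u,
    K.Vτ / K.ρ u * K.ζ i u + K.Wτ / K.ρ' u * K.ζ' i u,
    K.Vφ / K.ρ u * K.ζ i u + K.Wφ / K.ρ' u * K.ζ' i u] A with hM'
  have e : K.coframe u = Matrix.of fun A i => ![2 * K.σ, 2 * K.σ', 1, 1] A * M A i := by
    ext A i
    fin_cases A <;> simp [coframe, T, Φ, hM'] <;> ring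
  rw [e, Matrix.det_mul_column, hM]
  simp only [Fin.prod_univ_four]
  simp
  field_simp
  ring

lemma contDiffOn_angle (a b : ℝ) (i : Fin 4) :
    ContDiffOn ℝ ∞ (fun u => a * (K.ζ i u / K.ρ u) + b * (K.ζ' i u / K.ρ' u)) K.reg :=
  (contDiffOn_const.mul ((K.polar.smooth_ζ i).contDiffOn.div K.polar.smooth.contDiffOn
    fun _ hu => hu.2.1)).add (contDiffOn_const.mul ((K.polar'.smooth_ζ i).contDiffOn.div
      K.polar'.smooth.contDiffOn fun _ hu => hu.2.2))

lemma pd_angle (a b : ℝ) {u : E4} (hu : u ∈ K.reg) (i j : Fin 4) :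
    pd i (fun u => a * (K.ζ j u / K.ρ u) + b * (K.ζ' j u / K.ρ' u)) u =
      pd j (fun u => a * (K.ζ i u / K.ρ u) + b * (K.ζ' i u / K.ρ' u)) u := by
  have hz : ∀ j, DifferentiableAt ℝ (fun u => K.ζ j u / K.ρ u) u := fun j => by
    simpa using diffAt_of_contDiffOn (K.contDiffOn_angle 1 0 j) K.isOpen_reg hu
  have hw : ∀ j, DifferentiableAt ℝ (fun u => K.ζ' j u / K.ρ' u) u := fun j => by
    simpa using diffAt_of_contDiffOn (K.contDiffOn_angle 0 1 j) K.isOpen_reg hu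
  have c : ∀ a : ℝ, DifferentiableAt ℝ (fun _ : E4 => a) u := fun a => differentiableAt_const a
  have key : ∀ i j, pd i (fun u => a * (K.ζ j u / K.ρ u) + b * (K.ζ' j u / K.ρ' u)) u =
      a * pd i (fun u => K.ζ j u / K.ρ u) u + b * pd i (fun u => K.ζ' j u / K.ρ' u) u := by
    intro i j
    rw [pd_add i ((c a).fun_mul (hz j)) ((c b).fun_mul (hw j)), pd_mul i (c a) (hz j),
      pd_mul i (c b) (hw j), pd_const, pd_const]
    ring
  rw [key, key, K.polar.pd_angle hu.2.1, K.polar'.pd_angle hu.2.2]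

lemma toricCoords : ToricCoords K.reg P.box K.prj K.T K.Φ K.coframe where
  isOpen := K.isOpen_reg
  isOpen' := P.isOpen_box
  mapsTo _ hv := K.prj_mem hv
  smooth_fst := K.smooth_prj.fst.contDiffOn
  smooth_snd := K.smooth_prj.snd.contDiffOn
  smooth_T i := K.contDiffOn_angle _ _ i
  smooth_Φ i := K.contDiffOn_angle _ _ i
  closed_T v hv i j := K.pd_angle _ _ hv i j
  closed_Φ v hv i j := K.pd_angle _ _ hv i j
  coframe v := by
    ext A i
    simp only [coframe, Matrix.of_apply, pd_fst, pd_snd]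
  det_pos v hv := by
    rw [K.det_coframe hv]
    linarith [K.orient]

end Corner

/-! ### The metric and the fundamental form near a corner -/

lemma corner_metric_identity {κ D H ρ ρ' X Y σ σ' a b av bw q q' ri rj zi zj ri' rj' zi' zj' d d' : ℝ}
    (hD : D ≠ 0) (hH : H ≠ 0) (hρ : ρ ≠ 0) (hρ' : ρ' ≠ 0) (hX : X ≠ 0) (hY : Y ≠ 0)
    (hσ : σ ^ 2 = 1) (hσ' : σ' ^ 2 = 1)
    (h : ri * rj + zi * zj = ρ * d) (h' : ri' * rj' + zi' * zj' = ρ' * d')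
    (hq : (X * av) ^ 2 - (2 * κ * H * D) ^ 2 = σ * ρ * q)
    (hq' : (Y * bw) ^ 2 - (2 * κ * H * D) ^ 2 = σ' * ρ' * q') :
    κ ^ 2 * H / (D ^ 3 * (σ * ρ * X)) * (2 * σ * ri * (2 * σ * rj)) +
      -κ ^ 2 * H / (D ^ 3 * (σ' * ρ' * Y)) * (2 * σ' * ri' * (2 * σ' * rj')) +
      σ * ρ * X * ((zi * av / ρ + σ' * a * zi') / D ^ 2) * ((zj * av / ρ + σ' * a * zj') / D ^ 2) /
        (H * D) -
      σ' * ρ' * Y * ((σ * b * zi + zi' * bw / ρ') / D ^ 2) *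
        ((σ * b * zj + zj' * bw / ρ') / D ^ 2) / (H * D) =
    4 * κ ^ 2 * σ * H / (D ^ 3 * X) * d - 4 * κ ^ 2 * σ' * H / (D ^ 3 * Y) * d' +
      (q / X - σ' * ρ' * Y * b ^ 2) / (D ^ 5 * H) * (zi * zj) +
      (X * av * σ * σ' * a - Y * σ * σ' * b * bw) / (D ^ 5 * H) * (zi * zj' + zi' * zj) +
      (σ * ρ * X * a ^ 2 - q' / Y) / (D ^ 5 * H) * (zi' * zj') := by
  have s1 : ri * rj = ρ * d - zi * zj := by linear_combination h
  have s2 : ri' * rj' = ρ' * d' - zi' * zj' := by linear_combination h'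
  have hσ0 : σ ≠ 0 := by rintro rfl; norm_num at hσ
  have hσ0' : σ' ≠ 0 := by rintro rfl; norm_num at hσ'
  have e1 : q = σ * ((X * av) ^ 2 - (2 * κ * H * D) ^ 2) / ρ := by
    rw [eq_div_iff hρ, hq]; linear_combination (-q * ρ) * hσ
  have e2 : q' = σ' * ((Y * bw) ^ 2 - (2 * κ * H * D) ^ 2) / ρ' := by
    rw [eq_div_iff hρ', hq']; linear_combination (-q' * ρ') * hσ'
  have t1 : 2 * σ * ri * (2 * σ * rj) = 4 * (ρ * d - zi * zj) := by
    rw [← s1]; linear_combination 4 * ri * rj * hσ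
  have t2 : 2 * σ' * ri' * (2 * σ' * rj') = 4 * (ρ' * d' - zi' * zj') := by
    rw [← s2]; linear_combination 4 * ri' * rj' * hσ'
  have u1 : ∀ w, w / (D ^ 3 * (σ * ρ * X)) = σ * w / (D ^ 3 * ρ * X) := by
    intro w; field_simp; rw [hσ, mul_one]
  have u2 : ∀ w, w / (D ^ 3 * (σ' * ρ' * Y)) = σ' * w / (D ^ 3 * ρ' * Y) := by
    intro w; field_simp; rw [hσ', mul_one]
  rw [t1, t2, e1, e2, u1, u2]
  field_simp
  linear_combination (σ * ρ ^ 2 * ρ' * Y * X ^ 2 * zi' * zj' * a ^ 2) * hσ' -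
    (ρ * zi * zj * ρ' ^ 2 * Y ^ 2 * X * σ' * b ^ 2) * hσ

lemma corner_form_identity {κ D ρ ρ' σ σ' a b av bw ri rj zi zj ri' rj' zi' zj' e e' : ℝ}
    (hρ : ρ ≠ 0) (hρ' : ρ' ≠ 0)
    (h : ri * zj - rj * zi = ρ * e) (h' : ri' * zj' - rj' * zi' = ρ' * e') :
    κ / D ^ 2 * (2 * σ * ri * ((zj * av / ρ + σ' * a * zj') / D ^ 2) -
        2 * σ * rj * ((zi * av / ρ + σ' * a * zi') / D ^ 2) -
        2 * σ' * ri' * ((σ * b * zj + zj' * bw / ρ') / D ^ 2) +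
        2 * σ' * rj' * ((σ * b * zi + zi' * bw / ρ') / D ^ 2)) =
    2 * κ / D ^ 4 * (σ * av * e + σ * σ' * a * (ri * zj' - rj * zi') -
      σ * σ' * b * (ri' * zj - rj' * zi) - σ' * bw * e') := by
  have e1 : e = (ri * zj - rj * zi) / ρ := by rw [eq_div_iff hρ, h]; ring
  have e2 : e' = (ri' * zj' - rj' * zi') / ρ' := by rw [eq_div_iff hρ', h']; ring
  rw [e1, e2]
  by_cases hD : D = 0
  · simp [hD]
  field_simp
  ring

end ChenTeo
end

open Set Filter Topology Manifold Bundle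
open scoped ContDiff

noncomputable section

namespace ChenTeo

open Params

lemma transpose_sandwich_apply (m θ : Mat4) (i j : Fin 4) :
    (θ.transpose * m * θ) i j = ∑ A, ∑ B, m A B * θ A i * θ B j := by
  simp only [Matrix.mul_apply, Matrix.transpose_apply, Fin.sum_univ_four]
  ring

namespace Corner

variable {P : Params} (K : Corner P)

/-- The coefficients with which the angles enter in `y dτ + A dφ`. -/
lemma fA_angle {a : ℝ × ℝ → ℝ} (ha : ∀ p : ℝ × ℝ, p.2 * K.Wτ * (p.1 - p.2) ^ 2 +
      P.numA p.1 p.2 * K.Wφ = (p.2 - K.ys) * a p) {u : E4} (hu : u ∈ K.reg) (i : Fin 4) :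
    (K.prj u).2 * K.T i u + P.fA (K.prj u) * K.Φ i u =
      (K.ζ i u * ((K.prj u).2 * K.Vτ * ((K.prj u).1 - (K.prj u).2) ^ 2 +
        P.numA (K.prj u).1 (K.prj u).2 * K.Vφ) / K.ρ u + K.σ' * a (K.prj u) * K.ζ' i u) /
      ((K.prj u).1 - (K.prj u).2) ^ 2 := by
  have hD := (K.sub_pos hu.1).ne'
  have h1 := hu.2.1
  have h2 := hu.2.2
  have e := ha (K.prj u)
  have e2 : (K.prj u).2 - K.ys = K.σ' * K.ρ' u := by simp [prj]
  rw [e2] at e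
  simp only [T, Φ, fA]
  field_simp
  linear_combination K.ζ' i u * K.ρ u * e

/-- The coefficients with which the angles enter in `x dτ + B dφ`. -/
lemma fB_angle {b : ℝ × ℝ → ℝ} (hb : ∀ p : ℝ × ℝ, p.1 * K.Vτ * (p.1 - p.2) ^ 2 +
      P.numB p.1 p.2 * K.Vφ = (p.1 - K.xs) * b p) {u : E4} (hu : u ∈ K.reg) (i : Fin 4) :
    (K.prj u).1 * K.T i u + P.fB (K.prj u) * K.Φ i u =
      (K.σ * b (K.prj u) * K.ζ i u + K.ζ' i u * ((K.prj u).1 * K.Wτ *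
        ((K.prj u).1 - (K.prj u).2) ^ 2 + P.numB (K.prj u).1 (K.prj u).2 * K.Wφ) / K.ρ' u) /
      ((K.prj u).1 - (K.prj u).2) ^ 2 := by
  have hD := (K.sub_pos hu.1).ne'
  have h1 := hu.2.1
  have h2 := hu.2.2
  have e := hb (K.prj u)
  have e2 : (K.prj u).1 - K.xs = K.σ * K.ρ u := by simp [prj]
  rw [e2] at e
  simp only [T, Φ, fB]
  field_simp
  linear_combination K.ζ i u * K.ρ' u * e

lemma quartic_fst (u : E4) :
    P.quartic (K.prj u).1 = K.σ * K.ρ u * P.quarticQuot K.xs (K.prj u).1 := by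
  rw [quartic_eq_quot K.rodX.root]; simp [prj]

lemma quartic_snd (u : E4) :
    P.quartic (K.prj u).2 = K.σ' * K.ρ' u * P.quarticQuot K.ys (K.prj u).2 := by
  rw [quartic_eq_quot K.rodY.root]; simp [prj]

lemma contDiff_quarticQuot (c : ℝ) : ContDiff ℝ ∞ (P.quarticQuot c) := by
  unfold quarticQuot; fun_prop

/-- The metric extends smoothly over the axes. -/
theorem exists_metric : ∃ h : E4 → Mat4, SmoothMat K.tgt h ∧ ∀ u ∈ K.reg,
    h u = (K.coframe u).transpose * P.frameForm 1 (K.prj u) * K.coframe u := by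
  obtain ⟨⟨b, sb, hb⟩, ⟨q, sq, hq⟩⟩ := K.rodX.exists_quot
  obtain ⟨⟨a, sa, ha⟩, ⟨q', sq', hq'⟩⟩ := K.rodY.exists_quot
  set x : E4 → ℝ := fun u => (K.prj u).1 with hx
  set y : E4 → ℝ := fun u => (K.prj u).2 with hy
  set D : E4 → ℝ := fun u => x u - y u with hD
  set H : E4 → ℝ := fun u => P.N (x u) (y u) * P.h (x u) (y u) with hH
  set X : E4 → ℝ := fun u => P.quarticQuot K.xs (x u) with hX
  set Y : E4 → ℝ := fun u => P.quarticQuot K.ys (y u) with hY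
  set av : E4 → ℝ := fun u => y u * K.Vτ * (x u - y u) ^ 2 + P.numA (x u) (y u) * K.Vφ with hav
  set bw : E4 → ℝ := fun u => x u * K.Wτ * (x u - y u) ^ 2 + P.numB (x u) (y u) * K.Wφ with hbw
  have ss := K.smooth_prj
  have sx : ContDiff ℝ ∞ x := ss.fst
  have sy : ContDiff ℝ ∞ y := ss.snd
  have sD : ContDiff ℝ ∞ D := sx.sub sy
  have f1 := HasQuot.fst_of_fst 0
  have f2 := HasQuot.snd_of_fst 0
  have sH : ContDiff ℝ ∞ H := (hasQuot_Nh f1 f2).smooth.comp ss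
  have sA : ContDiff ℝ ∞ fun u => P.numA (x u) (y u) := (hasQuot_numA f1 f2).smooth.comp ss
  have sB : ContDiff ℝ ∞ fun u => P.numB (x u) (y u) := (hasQuot_numB f1 f2).smooth.comp ss
  have sX : ContDiff ℝ ∞ X := (contDiff_quarticQuot K.xs).comp sx
  have sY : ContDiff ℝ ∞ Y := (contDiff_quarticQuot K.ys).comp sy
  have sav : ContDiff ℝ ∞ av :=
    ((sy.mul contDiff_const).mul (sD.pow 2)).add (sA.mul contDiff_const)
  have sbw : ContDiff ℝ ∞ bw :=
    ((sx.mul contDiff_const).mul (sD.pow 2)).add (sB.mul contDiff_const)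
  have sa := sa.comp ss
  have sb := sb.comp ss
  have sq := sq.comp ss
  have sq' := sq'.comp ss
  have sρ := K.polar.smooth
  have sρ' := K.polar'.smooth
  have sζ := K.polar.smooth_ζ
  have sζ' := K.polar'.smooth_ζ
  have nD : ∀ u ∈ K.tgt, D u ≠ 0 := fun u hu => (K.sub_pos hu).ne'
  have nH : ∀ u ∈ K.tgt, H u ≠ 0 := fun u hu => K.Nh_ne hu
  have nX : ∀ u ∈ K.tgt, X u ≠ 0 := fun u hu => K.quotX_ne hu
  have nY : ∀ u ∈ K.tgt, Y u ≠ 0 := fun u hu => K.quotY_ne hu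
  refine ⟨fun u i j => 4 * P.κ ^ 2 * K.σ * H u / (D u ^ 3 * X u) * K.δ i j -
      4 * P.κ ^ 2 * K.σ' * H u / (D u ^ 3 * Y u) * K.δ' i j +
      ((q ∘ K.prj) u / X u - K.σ' * K.ρ' u * Y u * (b ∘ K.prj) u ^ 2) / (D u ^ 5 * H u) *
        (K.ζ i u * K.ζ j u) +
      (X u * av u * K.σ * K.σ' * (a ∘ K.prj) u - Y u * K.σ * K.σ' * (b ∘ K.prj) u * bw u) /
        (D u ^ 5 * H u) * (K.ζ i u * K.ζ' j u + K.ζ' i u * K.ζ j u) +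
      (K.σ * K.ρ u * X u * (a ∘ K.prj) u ^ 2 - (q' ∘ K.prj) u / Y u) / (D u ^ 5 * H u) *
        (K.ζ' i u * K.ζ' j u), ?_, ?_⟩
  · intro i j
    have sζi := sζ i
    have sζj := sζ j
    have sζi' := sζ' i
    have sζj' := sζ' j
    have n5 : ∀ u ∈ K.tgt, D u ^ 5 * H u ≠ 0 := fun u hu =>
      mul_ne_zero (pow_ne_zero _ (nD u hu)) (nH u hu)
    have nDX : ∀ u ∈ K.tgt, D u ^ 3 * X u ≠ 0 := fun u hu =>
      mul_ne_zero (pow_ne_zero _ (nD u hu)) (nX u hu)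
    have nDY : ∀ u ∈ K.tgt, D u ^ 3 * Y u ≠ 0 := fun u hu =>
      mul_ne_zero (pow_ne_zero _ (nD u hu)) (nY u hu)
    refine ContDiffOn.add (ContDiffOn.add (ContDiffOn.add (ContDiffOn.sub ?_ ?_) ?_) ?_) ?_
    · exact (ContDiffOn.div (by fun_prop) (by fun_prop) nDX).mul contDiffOn_const
    · exact (ContDiffOn.div (by fun_prop) (by fun_prop) nDY).mul contDiffOn_const
    · refine ContDiffOn.mul (ContDiffOn.div (ContDiffOn.sub (ContDiffOn.div (by fun_prop)
        (by fun_prop) nX) (by fun_prop)) (by fun_prop) n5) (by fun_prop)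
    · exact (ContDiffOn.div (by fun_prop) (by fun_prop) n5).mul (by fun_prop)
    · refine ContDiffOn.mul (ContDiffOn.div (ContDiffOn.sub (by fun_prop) (ContDiffOn.div
        (by fun_prop) (by fun_prop) nY)) (by fun_prop) n5) (by fun_prop)
  · intro u hu
    ext i j
    have hp := K.prj_mem hu
    rw [transpose_sandwich_apply, sum_frameForm_one hp (fun A => K.coframe u A i)
      (fun A => K.coframe u A j)]
    have c0 : ∀ i, K.coframe u 0 i = 2 * K.σ * K.r i u := fun _ => rfl
    have c1 : ∀ i, K.coframe u 1 i = 2 * K.σ' * K.r' i u := fun _ => rfl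
    have c2 : ∀ i, K.coframe u 2 i = K.T i u := fun _ => rfl
    have c3 : ∀ i, K.coframe u 3 i = K.Φ i u := fun _ => rfl
    simp only [c0, c1, c2, c3, K.fA_angle ha hu, K.fB_angle hb hu, K.quartic_fst, K.quartic_snd,
      ← κ_sq]
    have e1 := hq (K.prj u)
    have e2 := hq' (K.prj u)
    have g1 : (K.prj u).1 - K.xs = K.σ * K.ρ u := by simp [prj]
    have g2 : (K.prj u).2 - K.ys = K.σ' * K.ρ' u := by simp [prj]
    rw [g1] at e1
    rw [g2] at e2
    exact (corner_metric_identity (nD u hu.1) (nH u hu.1) hu.2.1 hu.2.2 (nX u hu.1) (nY u hu.1)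
      K.sq K.sq' (K.polar.dot u i j) (K.polar'.dot u i j) e1 e2).symm

/-- The fundamental form extends smoothly over the axes. -/
theorem exists_form : ∃ h : E4 → Mat4, SmoothMat K.tgt h ∧ ∀ u ∈ K.reg,
    h u = (K.coframe u).transpose * P.frameForm (sd 1 0 0) (K.prj u) * K.coframe u := by
  obtain ⟨⟨b, sb, hb⟩, -⟩ := K.rodX.exists_quot
  obtain ⟨⟨a, sa, ha⟩, -⟩ := K.rodY.exists_quot
  set x : E4 → ℝ := fun u => (K.prj u).1 with hx
  set y : E4 → ℝ := fun u => (K.prj u).2 with hy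
  set D : E4 → ℝ := fun u => x u - y u with hD
  set av : E4 → ℝ := fun u => y u * K.Vτ * (x u - y u) ^ 2 + P.numA (x u) (y u) * K.Vφ with hav
  set bw : E4 → ℝ := fun u => x u * K.Wτ * (x u - y u) ^ 2 + P.numB (x u) (y u) * K.Wφ with hbw
  have ss := K.smooth_prj
  have sx : ContDiff ℝ ∞ x := ss.fst
  have sy : ContDiff ℝ ∞ y := ss.snd
  have sD : ContDiff ℝ ∞ D := sx.sub sy
  have f1 := HasQuot.fst_of_fst 0
  have f2 := HasQuot.snd_of_fst 0
  have sA : ContDiff ℝ ∞ fun u => P.numA (x u) (y u) := (hasQuot_numA f1 f2).smooth.comp ss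
  have sB : ContDiff ℝ ∞ fun u => P.numB (x u) (y u) := (hasQuot_numB f1 f2).smooth.comp ss
  have sav : ContDiff ℝ ∞ av :=
    ((sy.mul contDiff_const).mul (sD.pow 2)).add (sA.mul contDiff_const)
  have sbw : ContDiff ℝ ∞ bw :=
    ((sx.mul contDiff_const).mul (sD.pow 2)).add (sB.mul contDiff_const)
  have sa := sa.comp ss
  have sb := sb.comp ss
  have nD : ∀ u ∈ K.tgt, D u ^ 4 ≠ 0 := fun u hu => pow_ne_zero _ (K.sub_pos hu).ne'
  refine ⟨fun u i j => 2 * P.κ / D u ^ 4 * (K.σ * av u * K.ε i j +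
      K.σ * K.σ' * (a ∘ K.prj) u * (K.r i u * K.ζ' j u - K.r j u * K.ζ' i u) -
      K.σ * K.σ' * (b ∘ K.prj) u * (K.r' i u * K.ζ j u - K.r' j u * K.ζ i u) -
      K.σ' * bw u * K.ε' i j), ?_, ?_⟩
  · intro i j
    have := K.polar.smooth_r i
    have := K.polar.smooth_r j
    have := K.polar'.smooth_r i
    have := K.polar'.smooth_r j
    have := K.polar.smooth_ζ i
    have := K.polar.smooth_ζ j
    have := K.polar'.smooth_ζ i
    have := K.polar'.smooth_ζ j
    exact (ContDiffOn.div (by fun_prop) (by fun_prop) nD).mul (by fun_prop)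
  · intro u hu
    ext i j
    have hp := K.prj_mem hu
    rw [transpose_sandwich_apply, sum_frameForm_sd hp (fun A => K.coframe u A i)
      (fun A => K.coframe u A j)]
    have c0 : ∀ i, K.coframe u 0 i = 2 * K.σ * K.r i u := fun _ => rfl
    have c1 : ∀ i, K.coframe u 1 i = 2 * K.σ' * K.r' i u := fun _ => rfl
    have c2 : ∀ i, K.coframe u 2 i = K.T i u := fun _ => rfl
    have c3 : ∀ i, K.coframe u 3 i = K.Φ i u := fun _ => rfl
    simp only [c0, c1, c2, c3, K.fA_angle ha hu, K.fB_angle hb hu]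
    exact (corner_form_identity hu.2.1 hu.2.2 (K.polar.wedge u i j) (K.polar'.wedge u i j)).symm

end Corner

end ChenTeo
end

open Set Filter Topology Manifold Bundle
open scoped ContDiff

noncomputable section

namespace ChenTeo

open Params

lemma nonneg_of_subset_closure {s t : Set E4} {f : E4 → ℝ} (hf : ContinuousOn f t) (hst : s ⊆ t)
    (hts : t ⊆ closure s) (h : ∀ u ∈ s, 0 ≤ f u) {u : E4} (hu : u ∈ t) : 0 ≤ f u := by
  have e : EqOn (fun u => max (f u) 0) f s := fun v hv => max_eq_left (h v hv)
  have := e.of_subset_closure (hf.sup continuousOn_const) hf hst hts hu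
  exact max_eq_left_iff.1 this

namespace Corner

variable {P : Params} (K : Corner P)

lemma eqOn_of_reg {α : Type*} [TopologicalSpace α] [T2Space α] {f g : E4 → α}
    (hf : ContinuousOn f K.tgt) (hg : ContinuousOn g K.tgt) (h : ∀ u ∈ K.reg, f u = g u) {u : E4}
    (hu : u ∈ K.tgt) : f u = g u :=
  EqOn.of_subset_closure h hf hg K.reg_subset K.dense hu

/-- A smooth extension of the line element over the axes is positive definite. -/
lemma posDef {h : E4 → Mat4} (sh : SmoothMat K.tgt h) (eh : ∀ u ∈ K.reg,
    h u = (K.coframe u).transpose * P.frameForm 1 (K.prj u) * K.coframe u) {u : E4}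
    (hu : u ∈ K.tgt) : (h u).PosDef := by
  have ch : ContinuousOn h K.tgt :=
    continuousOn_pi.2 fun i => continuousOn_pi.2 fun j => (sh i j).continuousOn
  have eh' : ∀ u ∈ K.reg, h u = (P.frame (K.prj u) * K.coframe u).transpose *
      (P.frame (K.prj u) * K.coframe u) := fun u hu => by
    rw [eh u hu, frameForm, Matrix.transpose_mul]; simp [Matrix.mul_assoc]
  have symm : ∀ u ∈ K.tgt, (h u).transpose = h u := fun u hu =>
    Matrix.ext fun i j => K.eqOn_of_reg (f := fun u => h u j i) (sh j i).continuousOn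
      (sh i j).continuousOn (fun u hu => by
        have : (h u).transpose i j = h u i j := by
          rw [eh' u hu, Matrix.transpose_mul, Matrix.transpose_transpose]
        exact this) hu
  have nonneg : ∀ v : Fin 4 → ℝ, 0 ≤ v ⬝ᵥ (h u).mulVec v := fun v => by
    refine nonneg_of_subset_closure (f := fun u => v ⬝ᵥ (h u).mulVec v) ?_ K.reg_subset
      K.dense ?_ hu
    · simp only [dotProduct, Matrix.mulVec]
      exact continuousOn_finsetSum _ fun i _ => continuousOn_const.mul
        (continuousOn_finsetSum _ fun j _ => (sh i j).continuousOn.mul continuousOn_const)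
    · intro w hw
      rw [eh' w hw]
      have := (Matrix.posSemidef_conjTranspose_mul_self
        (P.frame (K.prj w) * K.coframe w)).dotProduct_mulVec_nonneg v
      simpa using this
  have psd : (h u).PosSemidef := by
    refine .of_dotProduct_mulVec_nonneg ?_ fun v => by simpa using nonneg v
    rw [Matrix.IsHermitian, Matrix.conjTranspose_eq_transpose_of_trivial, symm u hu]
  rw [psd.posDef_iff_isUnit, Matrix.isUnit_iff_isUnit_det, isUnit_iff_ne_zero]
  have hd : (h u).det = (P.κ ^ 2 * (P.N (K.prj u).1 (K.prj u).2 * P.h (K.prj u).1 (K.prj u).2) /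
      ((K.prj u).1 - (K.prj u).2) ^ 5) ^ 2 *
      (-4 * (K.σ * K.σ' * (K.Vτ * K.Wφ - K.Wτ * K.Vφ))) ^ 2 := by
    refine K.eqOn_of_reg (f := fun u => (h u).det) (g := fun u => (P.κ ^ 2 *
      (P.N (K.prj u).1 (K.prj u).2 * P.h (K.prj u).1 (K.prj u).2) /
      ((K.prj u).1 - (K.prj u).2) ^ 5) ^ 2 *
      (-4 * (K.σ * K.σ' * (K.Vτ * K.Wφ - K.Wτ * K.Vφ))) ^ 2) ?_ ?_ ?_ hu
    · exact (Continuous.matrix_det continuous_id).comp_continuousOn ch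
    · have f1 := HasQuot.fst_of_fst 0
      have f2 := HasQuot.snd_of_fst 0
      have sH := ((hasQuot_Nh (P := P) f1 f2).smooth.comp K.smooth_prj).continuous.continuousOn
        (s := K.tgt)
      have sD := ((K.smooth_prj.fst).sub (K.smooth_prj.snd)).continuous.continuousOn (s := K.tgt)
      exact (((continuousOn_const.mul sH).div (sD.pow 5) fun u hu =>
        pow_ne_zero _ (K.sub_pos hu).ne').pow 2).mul continuousOn_const
    · intro w hw
      rw [eh' w hw, Matrix.det_mul, Matrix.det_transpose, Matrix.det_mul, K.det_coframe hw,
        frame_det_eq (K.prj_mem hw)]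
      ring
  rw [hd]
  have h1 := (K.sub_pos hu).ne'
  have h2 := K.Nh_ne hu
  have h3 := (κ_pos (P := P)).ne'
  have h4 := K.orient.ne'
  refine mul_ne_zero (pow_ne_zero _ (div_ne_zero (mul_ne_zero (pow_ne_zero _ h3) h2)
    (pow_ne_zero _ h1))) (pow_ne_zero _ ?_)
  intro h0
  apply h4
  linarith

end Corner

/-! ### The three corners -/

lemma eventually_ne_punctured (c : ℝ) : ∀ᶠ t in 𝓝[≠] (0 : ℝ), t ≠ c := by
  by_cases hc : c = 0
  · rw [hc]; exact eventually_mem_nhdsWithin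
  · exact (eventually_ne_nhds (Ne.symm hc)).filter_mono nhdsWithin_le_nhds

lemma subset_closure_off_axes {T : Set E4} (hT : IsOpen T) :
    T ⊆ closure {u | u ∈ T ∧ Complex.normSq (cz u) ≠ 0 ∧ Complex.normSq (cw u) ≠ 0} := by
  intro u hu
  have hc : Continuous fun t : ℝ => u + t • (!₂[1, 0, 1, 0] : E4) := by fun_prop
  have ht : Tendsto (fun t : ℝ => u + t • (!₂[1, 0, 1, 0] : E4)) (𝓝[≠] 0) (𝓝 u) := by
    have := (hc.tendsto 0).mono_left (nhdsWithin_le_nhds (s := {0}ᶜ))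
    simpa using this
  refine mem_closure_of_tendsto ht ?_
  filter_upwards [ht.eventually (hT.mem_nhds hu), eventually_ne_punctured (-u 0),
    eventually_ne_punctured (-u 2)] with t h1 h2 h3
  refine ⟨h1, ?_, ?_⟩
  · rw [Complex.normSq_eq_zero.ne]
    intro h0
    have := congrArg Complex.re h0
    simp [cz] at this
    exact h2 (by linarith)
  · rw [Complex.normSq_eq_zero.ne]
    intro h0
    have := congrArg Complex.re h0
    simp [cw] at this
    exact h3 (by linarith)

lemma quartic_eq_zero_of_mem {P : Params} {x : ℝ} (h1 : P.x₂ ≤ x) (h2 : x ≤ P.x₃)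
    (h : P.quartic x = 0) : x = P.x₂ ∨ x = P.x₃ := by
  rcases h1.eq_or_lt with h1 | h1
  · exact .inl h1.symm
  rcases h2.eq_or_lt with h2 | h2
  · exact .inr h2
  exact absurd h (P.quartic_pos h1 h2).ne'

lemma quartic_eq_zero_of_mem' {P : Params} {y : ℝ} (h1 : P.x₁ ≤ y) (h2 : y ≤ P.x₂)
    (h : P.quartic y = 0) : y = P.x₁ ∨ y = P.x₂ := by
  rcases h1.eq_or_lt with h1 | h1
  · exact .inl h1.symm
  rcases h2.eq_or_lt with h2 | h2
  · exact .inr h2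
  exact absurd h (P.quartic_neg h1 h2).ne

namespace Params

variable (P : Params)

/-- The corner `(x₂, x₁)`. -/
def corner₁ : Corner P where
  tgt := P.tgt₁
  xs := P.x₂
  ys := P.x₁
  σ := 1
  σ' := 1
  Vτ := P.ℓ₀τ
  Vφ := P.ℓ₀φ
  Wτ := P.ℓ₁τ
  Wφ := P.ℓ₁φ
  isOpen := P.isOpen_tgt₁
  ρ := fun u => Complex.normSq (cz u)
  r := ![fun u => u 0, fun u => u 1, 0, 0]
  ζ := ![fun u => -u 1, fun u => u 0, 0, 0]
  δ := (!![1, 0, 0, 0; 0, 1, 0, 0; 0, 0, 0, 0; 0, 0, 0, 0] : Mat4)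
  ε := (!![0, 1, 0, 0; -1, 0, 0, 0; 0, 0, 0, 0; 0, 0, 0, 0] : Mat4)
  ρ' := fun u => Complex.normSq (cw u)
  r' := ![0, 0, fun u => u 2, fun u => u 3]
  ζ' := ![0, 0, fun u => -u 3, fun u => u 2]
  δ' := (!![0, 0, 0, 0; 0, 0, 0, 0; 0, 0, 1, 0; 0, 0, 0, 1] : Mat4)
  ε' := (!![0, 0, 0, 0; 0, 0, 0, 0; 0, 0, 0, 1; 0, 0, -1, 0] : Mat4)
  polar := polar_cz
  polar' := polar_cw
  rodX := P.isRodX_x₂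
  rodY := P.isRodY_x₁
  sq := one_pow 2
  sq' := one_pow 2
  bounds u hu := by
    have h1 := hu.1
    have h2 := hu.2
    have h3 := Complex.normSq_nonneg (cz u)
    have h4 := Complex.normSq_nonneg (cw u)
    have := P.x₁_lt_x₂
    refine ⟨⟨?_, ?_⟩, ⟨?_, ?_⟩, ?_⟩ <;> linarith
  mem_box u hu h h' := by
    have h1 := hu.1
    have h2 := hu.2
    have h3 := (Complex.normSq_nonneg (cz u)).lt_of_ne' h
    have h4 := (Complex.normSq_nonneg (cw u)).lt_of_ne' h'
    refine ⟨⟨?_, ?_⟩, ⟨?_, ?_⟩⟩ <;> simp only <;> linarith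
  root u hu h0 := by
    have h1 := hu.1
    have h3 := Complex.normSq_nonneg (cz u)
    rcases quartic_eq_zero_of_mem (by linarith) (by linarith) h0 with h | h <;> linarith
  root' u hu h0 := by
    have h1 := hu.2
    have h3 := Complex.normSq_nonneg (cw u)
    rcases quartic_eq_zero_of_mem' (by linarith) (by linarith) h0 with h | h <;> linarith
  dense := subset_closure_off_axes P.isOpen_tgt₁
  orient := by linarith [P.det_ℓ_pos]
  det u a b c d := by
    rw [Matrix.det_succ_row_zero, Fin.sum_univ_four]
    simp [Matrix.det_fin_three, Fin.succAbove, Fin.lt_def, Complex.normSq, cz, cw]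
    ring

/-- The corner `(x₃, x₁)`. -/
def corner₂ : Corner P where
  tgt := P.tgt₂
  xs := P.x₃
  ys := P.x₁
  σ := -1
  σ' := 1
  Vτ := -(P.ℓ₀τ - P.ℓ₁τ)
  Vφ := -(P.ℓ₀φ - P.ℓ₁φ)
  Wτ := P.ℓ₁τ
  Wφ := P.ℓ₁φ
  isOpen := P.isOpen_tgt₂
  ρ := fun u => Complex.normSq (cw u)
  r := ![0, 0, fun u => u 2, fun u => u 3]
  ζ := ![0, 0, fun u => -u 3, fun u => u 2]
  δ := (!![0, 0, 0, 0; 0, 0, 0, 0; 0, 0, 1, 0; 0, 0, 0, 1] : Mat4)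
  ε := (!![0, 0, 0, 0; 0, 0, 0, 0; 0, 0, 0, 1; 0, 0, -1, 0] : Mat4)
  ρ' := fun u => Complex.normSq (cz u)
  r' := ![fun u => u 0, fun u => u 1, 0, 0]
  ζ' := ![fun u => -u 1, fun u => u 0, 0, 0]
  δ' := (!![1, 0, 0, 0; 0, 1, 0, 0; 0, 0, 0, 0; 0, 0, 0, 0] : Mat4)
  ε' := (!![0, 1, 0, 0; -1, 0, 0, 0; 0, 0, 0, 0; 0, 0, 0, 0] : Mat4)
  polar := polar_cw
  polar' := polar_cz
  rodX := P.isRodX_x₃.neg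
  rodY := P.isRodY_x₁
  sq := by norm_num
  sq' := one_pow 2
  bounds u hu := by
    have h1 := hu.1
    have h2 := hu.2
    have h3 := Complex.normSq_nonneg (cz u)
    have h4 := Complex.normSq_nonneg (cw u)
    have := P.x₁_lt_x₂
    refine ⟨⟨?_, ?_⟩, ⟨?_, ?_⟩, ?_⟩ <;> linarith
  mem_box u hu h h' := by
    have h1 := hu.1
    have h2 := hu.2
    have h3 := (Complex.normSq_nonneg (cw u)).lt_of_ne' h
    have h4 := (Complex.normSq_nonneg (cz u)).lt_of_ne' h'
    refine ⟨⟨?_, ?_⟩, ⟨?_, ?_⟩⟩ <;> simp only <;> linarith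
  root u hu h0 := by
    have h1 := hu.2
    have h3 := Complex.normSq_nonneg (cw u)
    rcases quartic_eq_zero_of_mem (by linarith) (by linarith) h0 with h | h <;> linarith
  root' u hu h0 := by
    have h1 := hu.1
    have h3 := Complex.normSq_nonneg (cz u)
    rcases quartic_eq_zero_of_mem' (by linarith) (by linarith) h0 with h | h <;> linarith
  dense := (subset_closure_off_axes P.isOpen_tgt₂).trans
    (closure_mono fun _ h => ⟨h.1, h.2.2, h.2.1⟩)
  orient := by linarith [P.det_ℓ_pos]
  det u a b c d := by
    rw [Matrix.det_succ_row_zero, Fin.sum_univ_four]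
    simp [Matrix.det_fin_three, Fin.succAbove, Fin.lt_def, Complex.normSq, cz, cw]
    ring

/-- The corner `(x₃, x₂)`. -/
def corner₃ : Corner P where
  tgt := P.tgt₁
  xs := P.x₃
  ys := P.x₂
  σ := -1
  σ' := -1
  Vτ := P.ℓ₀τ - P.ℓ₁τ
  Vφ := P.ℓ₀φ - P.ℓ₁φ
  Wτ := P.ℓ₀τ
  Wφ := P.ℓ₀φ
  isOpen := P.isOpen_tgt₁
  ρ := fun u => Complex.normSq (cz u)
  r := ![fun u => u 0, fun u => u 1, 0, 0]
  ζ := ![fun u => -u 1, fun u => u 0, 0, 0]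
  δ := (!![1, 0, 0, 0; 0, 1, 0, 0; 0, 0, 0, 0; 0, 0, 0, 0] : Mat4)
  ε := (!![0, 1, 0, 0; -1, 0, 0, 0; 0, 0, 0, 0; 0, 0, 0, 0] : Mat4)
  ρ' := fun u => Complex.normSq (cw u)
  r' := ![0, 0, fun u => u 2, fun u => u 3]
  ζ' := ![0, 0, fun u => -u 3, fun u => u 2]
  δ' := (!![0, 0, 0, 0; 0, 0, 0, 0; 0, 0, 1, 0; 0, 0, 0, 1] : Mat4)
  ε' := (!![0, 0, 0, 0; 0, 0, 0, 0; 0, 0, 0, 1; 0, 0, -1, 0] : Mat4)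
  polar := polar_cz
  polar' := polar_cw
  rodX := P.isRodX_x₃
  rodY := P.isRodY_x₂
  sq := by norm_num
  sq' := by norm_num
  bounds u hu := by
    have h1 := hu.1
    have h2 := hu.2
    have h3 := Complex.normSq_nonneg (cz u)
    have h4 := Complex.normSq_nonneg (cw u)
    have := P.x₁_lt_x₂
    refine ⟨⟨?_, ?_⟩, ⟨?_, ?_⟩, ?_⟩ <;> linarith
  mem_box u hu h h' := by
    have h1 := hu.1
    have h2 := hu.2
    have h3 := (Complex.normSq_nonneg (cz u)).lt_of_ne' h
    have h4 := (Complex.normSq_nonneg (cw u)).lt_of_ne' h'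
    refine ⟨⟨?_, ?_⟩, ⟨?_, ?_⟩⟩ <;> simp only <;> linarith
  root u hu h0 := by
    have h1 := hu.1
    have h3 := Complex.normSq_nonneg (cz u)
    rcases quartic_eq_zero_of_mem (by linarith) (by linarith) h0 with h | h <;> linarith
  root' u hu h0 := by
    have h1 := hu.2
    have h3 := Complex.normSq_nonneg (cw u)
    rcases quartic_eq_zero_of_mem' (by linarith) (by linarith) h0 with h | h <;> linarith
  dense := subset_closure_off_axes P.isOpen_tgt₁
  orient := by linarith [P.det_ℓ_pos]
  det u a b c d := by
    rw [Matrix.det_succ_row_zero, Fin.sum_univ_four]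
    simp [Matrix.det_fin_three, Fin.succAbove, Fin.lt_def, Complex.normSq, cz, cw]
    ring

end Params

end ChenTeo
end

open Set Filter Topology Manifold Bundle
open scoped ContDiff

noncomputable section

namespace ChenTeo

section

variable {M : Type} [TopologicalSpace M] [ChartedSpace E4 M] [IsManifold (𝓡 4) ∞ M]

lemma symmL_trivializationAt_eq {p₀ p : M} (hp : p ∈ (chartAt E4 p₀).source) (v : E4) :
    (trivializationAt E4 (TangentSpace (𝓡 4)) p₀).symmL ℝ p v =
      mfderiv (𝓡 4) (𝓡 4) (chartAt E4 p₀).symm (chartAt E4 p₀ p) v := by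
  rw [TangentBundle.symmL_trivializationAt hp]
  simp [mfderivWithin_univ, mfld_simps]
  rfl

/-- The coordinate frame of the chart at `p₀`. -/
def frameVec (p₀ : M) (i : Fin 4) (p : M) : TangentSpace (𝓡 4) p :=
  (trivializationAt E4 (TangentSpace (𝓡 4)) p₀).symmL ℝ p (EuclideanSpace.single i (1 : ℝ) : E4)

lemma contMDiffAt_frameVec {p₀ p : M} (hp : p ∈ (chartAt E4 p₀).source) (i : Fin 4) :
    ContMDiffAt (𝓡 4) ((𝓡 4).prod 𝓘(ℝ, E4)) ∞ (fun q => TotalSpace.mk' E4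
      (E := fun q : M => TangentSpace (𝓡 4) q) q (frameVec p₀ i q)) p := by
  set e := trivializationAt E4 (TangentSpace (𝓡 4) : M → Type) p₀ with he
  have hb : p ∈ e.baseSet := hp
  have : ContMDiffVectorBundle ∞ E4 (TangentSpace (𝓡 4) : M → Type) (𝓡 4) := inferInstance
  rw [e.contMDiffAt_section_iff hb]
  refine (contMDiffAt_const (c := (EuclideanSpace.single i (1 : ℝ) : E4))).congr_of_eventuallyEq ?_
  filter_upwards [e.open_baseSet.mem_nhds hb] with q hq
  rw [frameVec, e.symmL_apply hq]
  exact congrArg Prod.snd (e.apply_mk_symm hq _)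

/-- A homomorphism from the tangent bundle to a vector bundle is smooth if its values on the
coordinate frame are. -/
lemma contMDiffAt_hom_of_frameVec {F : Type} [NormedAddCommGroup F] [NormedSpace ℝ F]
    {E : M → Type} [TopologicalSpace (TotalSpace F E)] [∀ x, TopologicalSpace (E x)]
    [∀ x, AddCommGroup (E x)] [∀ x, Module ℝ (E x)] [FiberBundle F E] [VectorBundle ℝ F E]
    [∀ x, IsTopologicalAddGroup (E x)] [∀ x, ContinuousSMul ℝ (E x)]
    {φ : ∀ p : M, TangentSpace (𝓡 4) p →L[ℝ] E p} {p : M}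
    (h : ∀ i, ContMDiffAt (𝓡 4) ((𝓡 4).prod 𝓘(ℝ, F)) ∞
      (fun q => TotalSpace.mk' F (E := E) q (φ q (frameVec p i q))) p) :
    ContMDiffAt (𝓡 4) ((𝓡 4).prod 𝓘(ℝ, E4 →L[ℝ] F)) ∞ (fun q => TotalSpace.mk' (E4 →L[ℝ] F)
      (E := fun q : M => TangentSpace (𝓡 4) q →L[ℝ] E q) q (φ q)) p := by
  rw [contMDiffAt_hom_bundle]
  refine ⟨contMDiffAt_id, ?_⟩
  set e := trivializationAt E4 (TangentSpace (𝓡 4) : M → Type) p with he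
  set e' := trivializationAt F E p with he'
  have h' : ∀ i, ContMDiffAt (𝓡 4) 𝓘(ℝ, F) ∞ (fun q => (e' ⟨q, φ q (frameVec p i q)⟩).2) p :=
    fun i => (contMDiffAt_section _).1 (h i)
  have key : ContMDiffAt (𝓡 4) 𝓘(ℝ, E4 →L[ℝ] F) ∞ (fun q => ∑ i : Fin 4,
      (ContinuousLinearMap.smulRightL ℝ E4 F (EuclideanSpace.proj i : E4 →L[ℝ] ℝ))
        ((e' ⟨q, φ q (frameVec p i q)⟩).2)) p := by
    refine contMDiffAt_finsetSum fun i _ => ?_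
    exact (ContinuousLinearMap.smulRightL ℝ E4 F
      (EuclideanSpace.proj i : E4 →L[ℝ] ℝ)).contMDiff.contMDiffAt.comp p (h' i)
  refine key.congr_of_eventuallyEq ?_
  have hb : p ∈ e.baseSet := mem_baseSet_trivializationAt _ _ _
  have hb' : p ∈ e'.baseSet := mem_baseSet_trivializationAt _ _ _
  filter_upwards [e.open_baseSet.mem_nhds hb, e'.open_baseSet.mem_nhds hb'] with q hq hq'
  rw [ContinuousLinearMap.inCoordinates_eq hq hq']
  ext v
  have hv : v = ∑ i : Fin 4, v i • (EuclideanSpace.single i (1 : ℝ) : E4) := by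
    ext j; simp [Finset.sum_apply, Pi.single_apply]
  conv_lhs => rw [hv]
  simp [frameVec, e.symmL_apply hq, ← he, ← he']

/-- A bilinear form is smooth if its components with respect to the coordinate frame are. -/
lemma contMDiffAt_bilin_of_frameVec
    {φ : ∀ p : M, TangentSpace (𝓡 4) p →L[ℝ] TangentSpace (𝓡 4) p →L[ℝ] ℝ} {p : M}
    (h : ∀ i j, ContMDiffAt (𝓡 4) 𝓘(ℝ, ℝ) ∞
      (fun q => φ q (frameVec p i q) (frameVec p j q)) p) :
    ContMDiffAt (𝓡 4) ((𝓡 4).prod 𝓘(ℝ, E4 →L[ℝ] E4 →L[ℝ] ℝ)) ∞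
      (fun q => TotalSpace.mk' (E4 →L[ℝ] E4 →L[ℝ] ℝ)
      (E := fun q : M => TangentSpace (𝓡 4) q →L[ℝ] TangentSpace (𝓡 4) q →L[ℝ] ℝ) q (φ q)) p := by
  refine contMDiffAt_hom_of_frameVec (F := E4 →L[ℝ] ℝ)
    (E := fun q : M => TangentSpace (𝓡 4) q →L[ℝ] Bundle.Trivial M ℝ q) fun i => ?_
  refine contMDiffAt_hom_of_frameVec (F := ℝ) (E := Bundle.Trivial M ℝ) fun j => ?_
  exact (contMDiffAt_section _).2 (h i j)

/-- The components of a smooth metric with respect to a coordinate frame are smooth. -/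
lemma contMDiffAt_inner_frameVec (g : Metric M) {p₀ p : M} (hp : p ∈ (chartAt E4 p₀).source)
    (i j : Fin 4) : ContMDiffAt (𝓡 4) 𝓘(ℝ, ℝ) ∞
      (fun q => g.inner q (frameVec p₀ i q) (frameVec p₀ j q)) p := by
  have : ContMDiffAt (𝓡 4) ((𝓡 4).prod 𝓘(ℝ)) ∞ (fun q => TotalSpace.mk' ℝ
      (E := Bundle.Trivial M ℝ) q (g.inner q (frameVec p₀ i q) (frameVec p₀ j q))) p := by
    apply ContMDiffAt.clm_bundle_apply₂ (F₁ := E4) (F₂ := E4)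
    · exact g.contMDiff.contMDiffAt
    · exact contMDiffAt_frameVec hp i
    · exact contMDiffAt_frameVec hp j
  simp only [contMDiffAt_totalSpace] at this
  exact this.2

/-- The coordinate vector fields as values of the frame. -/
lemma coordVec_chartAt (p₀ : M) {u : E4} (hu : u ∈ (chartAt E4 p₀).target) (i : Fin 4) :
    coordVec (chartAt E4 p₀) u i = frameVec p₀ i ((chartAt E4 p₀).symm u) := by
  rw [frameVec, symmL_trivializationAt_eq ((chartAt E4 p₀).map_target hu),
    (chartAt E4 p₀).right_inv hu]
  rfl

lemma contDiffOn_comp_symm {f : M → ℝ} (p₀ : M)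
    (hf : ∀ p ∈ (chartAt E4 p₀).source, ContMDiffAt (𝓡 4) 𝓘(ℝ, ℝ) ∞ f p) :
    ContDiffOn ℝ ∞ (fun u => f ((chartAt E4 p₀).symm u)) (chartAt E4 p₀).target := by
  rw [← contMDiffOn_iff_contDiffOn]
  intro u hu
  have h1 : ContMDiffAt (𝓡 4) (𝓡 4) ∞ (chartAt E4 p₀).symm u :=
    (contMDiffOn_chart_symm (n := ∞) (I := 𝓡 4) (x := p₀)).contMDiffAt
      ((chartAt E4 p₀).open_target.mem_nhds hu)
  exact ((hf _ ((chartAt E4 p₀).map_target hu)).comp u h1).contMDiffWithinAt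

lemma contMDiffAt_comp_chart {f : E4 → ℝ} {p : M}
    (hf : ContDiffOn ℝ ∞ f (chartAt E4 p).target) :
    ContMDiffAt (𝓡 4) 𝓘(ℝ, ℝ) ∞ (fun q => f (chartAt E4 p q)) p := by
  have h1 : ContMDiffAt (𝓡 4) (𝓡 4) ∞ (chartAt E4 p) p :=
    contMDiffAt_of_mem_maximalAtlas (IsManifold.chart_mem_maximalAtlas p) (mem_chart_source E4 p)
  have h2 : ContMDiffAt (𝓡 4) 𝓘(ℝ, ℝ) ∞ f (chartAt E4 p p) :=
    (hf.contDiffAt ((chartAt E4 p).open_target.mem_nhds (mem_chart_target E4 p))).contMDiffAt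
  exact h2.comp p h1

lemma smoothMat_gram (g : Metric M) (p₀ : M) :
    SmoothMat (chartAt E4 p₀).target (gram g (chartAt E4 p₀)) := fun i j => by
  refine (contDiffOn_comp_symm p₀ fun p hp => contMDiffAt_inner_frameVec g hp i j).congr
    fun u hu => ?_
  simp only [gram, coordVec_chartAt p₀ hu]

end

end ChenTeo
end

open Set Filter Topology Manifold Bundle
open scoped ContDiff

noncomputable section

namespace ChenTeo

section

variable {M : Type} [TopologicalSpace M] [ChartedSpace E4 M] [IsManifold (𝓡 4) ∞ M]

/-- The coordinate coframe of the chart at `p₀`. -/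
def coordForm (p₀ : M) (i : Fin 4) (p : M) : TangentSpace (𝓡 4) p →L[ℝ] ℝ :=
  (EuclideanSpace.proj i : E4 →L[ℝ] ℝ).comp (mfderiv (𝓡 4) (𝓡 4) (chartAt E4 p₀) p)

omit [IsManifold (𝓡 4) ∞ M] in
lemma coordForm_apply (p₀ : M) (i : Fin 4) (p : M) (v : TangentSpace (𝓡 4) p) :
    coordForm p₀ i p v = (show E4 from mfderiv (𝓡 4) (𝓡 4) (chartAt E4 p₀) p v) i := rfl

lemma frameVec_eq {p₀ p : M} (hp : p ∈ (chartAt E4 p₀).source) (i : Fin 4) :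
    frameVec p₀ i p = mfderiv (𝓡 4) (𝓡 4) (chartAt E4 p₀).symm (chartAt E4 p₀ p)
      (EuclideanSpace.single i (1 : ℝ) : E4) := symmL_trivializationAt_eq hp _

lemma coordForm_frameVec {p₀ p : M} (hp : p ∈ (chartAt E4 p₀).source) (i j : Fin 4) :
    coordForm p₀ i p (frameVec p₀ j p) = if i = j then 1 else 0 := by
  have h := (mdifferentiable_chart (I := 𝓡 4) p₀).comp_symm_deriv
    ((chartAt E4 p₀).map_source hp)
  rw [(chartAt E4 p₀).left_inv hp] at h
  have h2 := congrArg (fun L : E4 →L[ℝ] E4 => L (EuclideanSpace.single j (1 : ℝ)) i) h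
  rw [coordForm_apply, frameVec_eq hp]
  refine h2.trans ?_
  change (EuclideanSpace.single j (1 : ℝ) : E4) i = _
  simp

lemma eq_sum_frameVec {p₀ p : M} (hp : p ∈ (chartAt E4 p₀).source) (v : TangentSpace (𝓡 4) p) :
    v = ∑ i, coordForm p₀ i p v • frameVec p₀ i p := by
  have h := (mdifferentiable_chart (I := 𝓡 4) p₀).symm_comp_deriv hp
  have h2 := congrArg (fun L : TangentSpace (𝓡 4) p →L[ℝ] TangentSpace (𝓡 4) p => L v) h
  simp only [frameVec_eq hp, coordForm_apply]
  refine h2.symm.trans ?_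
  set w : E4 := mfderiv (𝓡 4) (𝓡 4) (chartAt E4 p₀) p v with hw
  have hs : w = ∑ i : Fin 4, w i • (EuclideanSpace.single i (1 : ℝ) : E4) := by
    ext j; simp [Finset.sum_apply, Pi.single_apply]
  set L : E4 →L[ℝ] E4 := mfderiv (𝓡 4) (𝓡 4) (chartAt E4 p₀).symm (chartAt E4 p₀ p) with hL
  have : L w = ∑ i : Fin 4, w i • L (EuclideanSpace.single i (1 : ℝ)) := by
    conv_lhs => rw [hs]
    simp only [map_sum, map_smul]
  exact this

lemma trivializationAt_snd {p₀ p : M} (hp : p ∈ (chartAt E4 p₀).source)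
    (v : TangentSpace (𝓡 4) p) : ((trivializationAt E4 (TangentSpace (𝓡 4) : M → Type) p₀)
      (TotalSpace.mk' E4 p v)).2 = mfderiv (𝓡 4) (𝓡 4) (chartAt E4 p₀) p v := by
  have h := TangentBundle.continuousLinearMapAt_trivializationAt (I := 𝓡 4) hp
  have h2 : (trivializationAt E4 (TangentSpace (𝓡 4) : M → Type) p₀).continuousLinearMapAt ℝ p v =
      mfderiv (𝓡 4) (𝓡 4) (chartAt E4 p₀) p v := by
    rw [h]; rfl
  rw [← h2, Trivialization.continuousLinearMapAt_apply, Trivialization.coe_linearMapAt_of_mem]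
  exact hp

lemma contMDiffAt_coordForm {p₀ p : M} (hp : p ∈ (chartAt E4 p₀).source) (i : Fin 4)
    {s : ∀ q : M, TangentSpace (𝓡 4) q}
    (hs : ContMDiffAt (𝓡 4) ((𝓡 4).prod 𝓘(ℝ, E4)) ∞ (fun q => TotalSpace.mk' E4
      (E := fun q : M => TangentSpace (𝓡 4) q) q (s q)) p) :
    ContMDiffAt (𝓡 4) 𝓘(ℝ, ℝ) ∞ (fun q => coordForm p₀ i q (s q)) p := by
  set e := trivializationAt E4 (TangentSpace (𝓡 4) : M → Type) p₀ with he
  have hb : p ∈ e.baseSet := hp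
  have : ContMDiffVectorBundle ∞ E4 (TangentSpace (𝓡 4) : M → Type) (𝓡 4) := inferInstance
  rw [e.contMDiffAt_section_iff hb] at hs
  have h2 := (EuclideanSpace.proj i : E4 →L[ℝ] ℝ).contMDiff.contMDiffAt.comp p hs
  refine h2.congr_of_eventuallyEq ?_
  filter_upwards [(chartAt E4 p₀).open_source.mem_nhds hp] with q hq
  simp only [Function.comp, he, trivializationAt_snd hq]
  rfl

/-- A smooth field of bilinear forms. -/
def IsSmoothBilin (φ : ∀ p : M, TangentSpace (𝓡 4) p →L[ℝ] TangentSpace (𝓡 4) p →L[ℝ] ℝ) : Prop :=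
  ContMDiff (𝓡 4) ((𝓡 4).prod 𝓘(ℝ, E4 →L[ℝ] E4 →L[ℝ] ℝ)) ∞
    (fun q => TotalSpace.mk' (E4 →L[ℝ] E4 →L[ℝ] ℝ)
    (E := fun q : M => TangentSpace (𝓡 4) q →L[ℝ] TangentSpace (𝓡 4) q →L[ℝ] ℝ) q (φ q))

lemma isSmoothBilin_inner (g : Metric M) : IsSmoothBilin g.inner := g.contMDiff

/-- A smooth bilinear form from its components in the charts, if these agree on a dense set. -/
theorem exists_bilin {R : Set M} (hR : Dense R)
    (m : ∀ p : M, TangentSpace (𝓡 4) p →L[ℝ] TangentSpace (𝓡 4) p →L[ℝ] ℝ) (b : M → E4 → Mat4)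
    (hb : ∀ p₀, SmoothMat (chartAt E4 p₀).target (b p₀))
    (hm : ∀ p₀, ∀ p ∈ (chartAt E4 p₀).source, p ∈ R → ∀ i j,
      m p (frameVec p₀ i p) (frameVec p₀ j p) = b p₀ (chartAt E4 p₀ p) i j) :
    ∃ B : ∀ p : M, TangentSpace (𝓡 4) p →L[ℝ] TangentSpace (𝓡 4) p →L[ℝ] ℝ,
      IsSmoothBilin B ∧
      (∀ p ∈ R, B p = m p) ∧
      ∀ p₀, ∀ p ∈ (chartAt E4 p₀).source, ∀ i j,
        B p (frameVec p₀ i p) (frameVec p₀ j p) = b p₀ (chartAt E4 p₀ p) i j := by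
  have hbs : ∀ p₀ p, p ∈ (chartAt E4 p₀).source → ∀ i j,
      ContMDiffAt (𝓡 4) 𝓘(ℝ, ℝ) ∞ (fun q => b p₀ (chartAt E4 p₀ q) i j) p := by
    intro p₀ p hp i j
    have h1 : ContMDiffAt (𝓡 4) (𝓡 4) ∞ (chartAt E4 p₀) p :=
      contMDiffAt_of_mem_maximalAtlas (IsManifold.chart_mem_maximalAtlas p₀) hp
    have h2 : ContMDiffAt (𝓡 4) 𝓘(ℝ, ℝ) ∞ (fun u => b p₀ u i j) (chartAt E4 p₀ p) :=
      ((hb p₀ i j).contDiffAt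
        ((chartAt E4 p₀).open_target.mem_nhds ((chartAt E4 p₀).map_source hp))).contMDiffAt
    exact h2.comp p h1
  have exp : ∀ (p₀ p : M) (B : TangentSpace (𝓡 4) p →L[ℝ] TangentSpace (𝓡 4) p →L[ℝ] ℝ),
      p ∈ (chartAt E4 p₀).source → ∀ v w, B v w = ∑ k, ∑ l, coordForm p₀ k p v *
        coordForm p₀ l p w * B (frameVec p₀ k p) (frameVec p₀ l p) := by
    intro p₀ p B hp v w
    conv_lhs => rw [eq_sum_frameVec hp v, eq_sum_frameVec hp w]
    simp only [map_sum, map_smul, sum_apply, smul_apply,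
      smul_eq_mul]
    simp only [Finset.mul_sum]
    rw [Finset.sum_comm]
    refine Finset.sum_congr rfl fun k _ => Finset.sum_congr rfl fun l _ => by ring
  set B : ∀ p : M, TangentSpace (𝓡 4) p →L[ℝ] TangentSpace (𝓡 4) p →L[ℝ] ℝ := fun p =>
    ∑ k, ∑ l, (coordForm p k p).smulRight (b p (chartAt E4 p p) k l • coordForm p l p) with hB
  have hB' : ∀ p v w, B p v w = ∑ k, ∑ l, coordForm p k p v * coordForm p l p w *
      b p (chartAt E4 p p) k l := by
    intro p v w
    simp only [hB, sum_apply, ContinuousLinearMap.smulRight_apply,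
      smul_apply, smul_eq_mul]
    refine Finset.sum_congr rfl fun k _ => Finset.sum_congr rfl fun l _ => by ring
  have key : ∀ p₀, ∀ p ∈ (chartAt E4 p₀).source, ∀ i j,
      B p (frameVec p₀ i p) (frameVec p₀ j p) = b p₀ (chartAt E4 p₀ p) i j := by
    intro p₀ p hp i j
    rw [hB']
    set U : Set M := (chartAt E4 p₀).source ∩ (chartAt E4 p).source with hU
    have oU : IsOpen U := (chartAt E4 p₀).open_source.inter (chartAt E4 p).open_source
    have hpU : p ∈ U := ⟨hp, mem_chart_source E4 p⟩
    have e : EqOn (fun q => ∑ k, ∑ l, coordForm p k q (frameVec p₀ i q) *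
        coordForm p l q (frameVec p₀ j q) * b p (chartAt E4 p q) k l)
        (fun q => b p₀ (chartAt E4 p₀ q) i j) (U ∩ R) := by
      intro q hq
      simp only
      rw [← hm p₀ q hq.1.1 hq.2, exp p q (m q) hq.1.2]
      refine Finset.sum_congr rfl fun k _ => Finset.sum_congr rfl fun l _ => ?_
      rw [hm p q hq.1.2 hq.2]
    refine e.of_subset_closure (t := U) ?_ ?_ inter_subset_left (hR.open_subset_closure_inter oU)
      hpU
    · intro q hq
      refine ContMDiffAt.continuousAt (I := 𝓡 4) (I' := 𝓘(ℝ, ℝ)) (n := ∞) ?_ |>.continuousWithinAt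
      refine contMDiffAt_finsetSum fun k _ => contMDiffAt_finsetSum fun l _ => ?_
      exact ((contMDiffAt_coordForm hq.2 k (contMDiffAt_frameVec hq.1 i)).mul
        (contMDiffAt_coordForm hq.2 l (contMDiffAt_frameVec hq.1 j))).mul (hbs p q hq.2 k l)
    · intro q hq
      exact (hbs p₀ q hq.1 i j).continuousAt.continuousWithinAt
  refine ⟨B, fun p => contMDiffAt_bilin_of_frameVec fun i j => ?_, fun p hp => ?_, key⟩
  · refine (hbs p p (mem_chart_source E4 p) i j).congr_of_eventuallyEq ?_
    filter_upwards [(chartAt E4 p).open_source.mem_nhds (mem_chart_source E4 p)] with q hq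
    exact key p q hq i j
  · ext v w
    have h := mem_chart_source E4 p
    rw [hB', exp p p (m p) h]
    refine Finset.sum_congr rfl fun k _ => Finset.sum_congr rfl fun l _ => ?_
    rw [hm p p h hp]

end

end ChenTeo
end

open Set Filter Topology Manifold Bundle
open scoped ContDiff

noncomputable section

namespace ChenTeo

section

variable {M : Type} [TopologicalSpace M] [ChartedSpace E4 M] [IsManifold (𝓡 4) ∞ M]

/-- The components of a bilinear form with respect to the frame of the chart at `p₀`. -/
def bilinMatrix (φ : ∀ p : M, TangentSpace (𝓡 4) p →L[ℝ] TangentSpace (𝓡 4) p →L[ℝ] ℝ) (p₀ p : M) :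
    Mat4 := fun i j => φ p (frameVec p₀ i p) (frameVec p₀ j p)

lemma bilin_eq_sum (φ : ∀ p : M, TangentSpace (𝓡 4) p →L[ℝ] TangentSpace (𝓡 4) p →L[ℝ] ℝ)
    {p₀ p : M} (hp : p ∈ (chartAt E4 p₀).source) (v w : TangentSpace (𝓡 4) p) :
    φ p v w = ∑ i, ∑ j, coordForm p₀ i p v * coordForm p₀ j p w * bilinMatrix φ p₀ p i j := by
  conv_lhs => rw [eq_sum_frameVec hp v, eq_sum_frameVec hp w]
  simp only [map_sum, map_smul, sum_apply, smul_apply, smul_eq_mul, Finset.mul_sum, bilinMatrix]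
  rw [Finset.sum_comm]
  refine Finset.sum_congr rfl fun k _ => Finset.sum_congr rfl fun l _ => by ring

lemma gram_eq_bilinMatrix (g : Metric M) (p₀ : M) {u : E4} (hu : u ∈ (chartAt E4 p₀).target) :
    gram g (chartAt E4 p₀) u = bilinMatrix g.inner p₀ ((chartAt E4 p₀).symm u) := by
  ext i j
  simp only [gram, coordVec_chartAt p₀ hu, bilinMatrix]

lemma coordForm_sum {p₀ p : M} (hp : p ∈ (chartAt E4 p₀).source) (a : Fin 4 → ℝ) (i : Fin 4) :
    coordForm p₀ i p (∑ j, a j • frameVec p₀ j p) = a i := by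
  simp [coordForm_frameVec hp]

lemma bilinMatrix_posDef (g : Metric M) {p₀ p : M} (hp : p ∈ (chartAt E4 p₀).source) :
    (bilinMatrix g.inner p₀ p).PosDef := by
  refine .of_dotProduct_mulVec_pos ?_ fun v hv => ?_
  · ext i j
    simp [bilinMatrix, g.symm p (frameVec p₀ i p)]
  · have h1 : (∑ j, v j • frameVec p₀ j p : TangentSpace (𝓡 4) p) ≠ 0 := by
      intro h0
      apply hv
      ext i
      rw [← coordForm_sum hp v i, h0]; simp
    have h2 := g.pos p _ h1
    rw [bilin_eq_sum g.inner hp] at h2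
    simp only [coordForm_sum hp] at h2
    simp only [star_trivial, dotProduct, Matrix.mulVec, Finset.mul_sum]
    exact h2.trans_eq (Finset.sum_congr rfl fun i _ => Finset.sum_congr rfl fun j _ => by ring)

lemma gram_posDef (g : Metric M) (p₀ : M) {u : E4} (hu : u ∈ (chartAt E4 p₀).target) :
    (gram g (chartAt E4 p₀) u).PosDef := by
  rw [gram_eq_bilinMatrix g p₀ hu]
  exact bilinMatrix_posDef g ((chartAt E4 p₀).map_target hu)

lemma contMDiffAt_bilinMatrix
    {φ : ∀ p : M, TangentSpace (𝓡 4) p →L[ℝ] TangentSpace (𝓡 4) p →L[ℝ] ℝ}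
    (hφ : IsSmoothBilin φ)
    {p₀ p : M} (hp : p ∈ (chartAt E4 p₀).source) (i j : Fin 4) :
    ContMDiffAt (𝓡 4) 𝓘(ℝ, ℝ) ∞ (fun q => bilinMatrix φ p₀ q i j) p := by
  have : ContMDiffAt (𝓡 4) ((𝓡 4).prod 𝓘(ℝ)) ∞ (fun q => TotalSpace.mk' ℝ
      (E := Bundle.Trivial M ℝ) q (φ q (frameVec p₀ i q) (frameVec p₀ j q))) p := by
    apply ContMDiffAt.clm_bundle_apply₂ (F₁ := E4) (F₂ := E4)
    · exact hφ.contMDiffAt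
    · exact contMDiffAt_frameVec hp i
    · exact contMDiffAt_frameVec hp j
  simp only [contMDiffAt_totalSpace] at this
  exact this.2

lemma endMatrix_apply (J : EndField M) (p₀ : M) {u : E4} (hu : u ∈ (chartAt E4 p₀).target)
    (i j : Fin 4) : endMatrix J (chartAt E4 p₀) u i j =
      coordForm p₀ i ((chartAt E4 p₀).symm u)
        (J ((chartAt E4 p₀).symm u) (frameVec p₀ j ((chartAt E4 p₀).symm u))) := by
  rw [coordForm_apply, ← coordVec_chartAt p₀ hu]; rfl

lemma smoothMat_endMatrix {J : EndField M} (hJ : IsSmoothEnd J) (p₀ : M) :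
    SmoothMat (chartAt E4 p₀).target (endMatrix J (chartAt E4 p₀)) := fun i j => by
  refine (contDiffOn_comp_symm p₀ (f := fun q => coordForm p₀ i q (J q (frameVec p₀ j q)))
    fun p hp => contMDiffAt_coordForm hp i ?_).congr fun u hu => endMatrix_apply J p₀ hu i j
  exact ContMDiffAt.clm_bundle_apply (F₁ := E4) (F₂ := E4) (hJ p) (contMDiffAt_frameVec hp j)

lemma eq_of_inner_eq (g : Metric M) {p : M} {v v' : TangentSpace (𝓡 4) p}
    (h : ∀ w, g.inner p v w = g.inner p v' w) : v = v' := by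
  by_contra hne
  have h1 := g.pos p (v - v') (sub_ne_zero.2 hne)
  have h2 : g.inner p (v - v') (v - v') = 0 := by
    rw [show g.inner p (v - v') = g.inner p v - g.inner p v' from map_sub _ _ _, sub_apply, h,
      sub_self]
  exact h1.ne' h2

/-- The endomorphism field `J` with `g(J v, w) = φ(v, w)`. -/
theorem exists_end (g : Metric M)
    {φ : ∀ p : M, TangentSpace (𝓡 4) p →L[ℝ] TangentSpace (𝓡 4) p →L[ℝ] ℝ}
    (hφ : IsSmoothBilin φ) :
    ∃ J : EndField M, IsSmoothEnd J ∧ ∀ p v w, g.inner p (J p v) w = φ p v w := by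
  set a : M → M → Mat4 := fun p₀ p =>
    (bilinMatrix g.inner p₀ p)⁻¹ * (bilinMatrix φ p₀ p).transpose with ha
  have key : ∀ {p₀ p : M}, p ∈ (chartAt E4 p₀).source → ∀ j w,
      g.inner p (∑ i, a p₀ p i j • frameVec p₀ i p) w = φ p (frameVec p₀ j p) w := by
    intro p₀ p hp j w
    have hd : IsUnit (bilinMatrix g.inner p₀ p).det :=
      (Matrix.isUnit_iff_isUnit_det _).1 (bilinMatrix_posDef g hp).isUnit
    have hsymm : ∀ i l, bilinMatrix g.inner p₀ p l i = bilinMatrix g.inner p₀ p i l :=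
      fun i l => g.symm _ _ _
    have h1 : bilinMatrix g.inner p₀ p * a p₀ p = (bilinMatrix φ p₀ p).transpose := by
      rw [ha, Matrix.mul_nonsing_inv_cancel_left _ _ hd]
    have h2 : ∀ l, ∑ i, a p₀ p i j * bilinMatrix g.inner p₀ p i l = bilinMatrix φ p₀ p j l := by
      intro l
      have := congrFun (congrFun h1 l) j
      rw [Matrix.mul_apply, Matrix.transpose_apply] at this
      rw [← this]
      exact Finset.sum_congr rfl fun i _ => by rw [hsymm i l]; ring
    rw [eq_sum_frameVec hp w]
    simp only [map_sum, map_smul, sum_apply, smul_apply, smul_eq_mul]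
    refine Finset.sum_congr rfl fun l _ => ?_
    exact congrArg _ (h2 l)
  set J : EndField M := fun p => ∑ i, ∑ j, (coordForm p j p).smulRight
    (a p p i j • frameVec p i p) with hJ
  have hJ' : ∀ p v w, g.inner p (J p v) w = φ p v w := by
    intro p v w
    have h := mem_chart_source E4 p
    have e : J p v = ∑ j, coordForm p j p v • ∑ i, a p p i j • frameVec p i p := by
      simp only [hJ, sum_apply, ContinuousLinearMap.smulRight_apply, Finset.smul_sum]
      rw [Finset.sum_comm]
    conv_rhs => rw [eq_sum_frameVec h v]
    rw [e]
    simp only [map_sum, map_smul, sum_apply, smul_apply]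
    refine Finset.sum_congr rfl fun j _ => ?_
    rw [← key h j w]
    simp only [map_sum, map_smul, sum_apply, smul_apply]
  refine ⟨J, fun p => ?_, hJ'⟩
  refine contMDiffAt_hom_of_frameVec (F := E4) (E := fun q : M => TangentSpace (𝓡 4) q) fun j => ?_
  have hp := mem_chart_source E4 p
  have hs : ContMDiffAt (𝓡 4) ((𝓡 4).prod 𝓘(ℝ, E4)) ∞ (fun q => TotalSpace.mk' E4
      (E := fun q : M => TangentSpace (𝓡 4) q) q (∑ i, a p q i j • frameVec p i q)) p := by
    refine ContMDiffAt.sum_section fun i _ => ContMDiffAt.smul_section ?_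
      (contMDiffAt_frameVec hp i)
    have hsm : SmoothMat (chartAt E4 p).target (fun u => a p ((chartAt E4 p).symm u)) := by
      refine SmoothMat.mul (SmoothMat.inv ?_ ?_) (SmoothMat.transpose ?_)
      · exact fun i j => contDiffOn_comp_symm p fun q hq =>
          contMDiffAt_bilinMatrix (isSmoothBilin_inner g) hq i j
      · exact fun u hu => (bilinMatrix_posDef g ((chartAt E4 p).map_target hu)).det_pos.ne'
      · exact fun i j => contDiffOn_comp_symm p fun q hq => contMDiffAt_bilinMatrix hφ hq i j
    refine (contMDiffAt_comp_chart (hsm i j)).congr_of_eventuallyEq ?_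
    filter_upwards [(chartAt E4 p).open_source.mem_nhds hp] with q hq
    rw [(chartAt E4 p).left_inv hq]
  refine hs.congr_of_eventuallyEq ?_
  filter_upwards [(chartAt E4 p).open_source.mem_nhds hp] with q hq
  congr 1
  exact eq_of_inner_eq g fun w => by rw [hJ', key hq]

end

end ChenTeo
end

open Set Filter Topology Manifold Bundle
open scoped ContDiff

noncomputable section

namespace ChenTeo

open Params

lemma mfderiv_coordVec {M : Type} [TopologicalSpace M] [ChartedSpace E4 M] [IsManifold (𝓡 4) ∞ M]
    {N : Type} [NormedAddCommGroup N] [NormedSpace ℝ N] {f : M → N} {F : E4 → N}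
    {e : OpenPartialHomeomorph M E4} (he : e ∈ atlas E4 M) {u : E4} (hu : u ∈ e.target)
    (hF : ∀ v ∈ e.target, f (e.symm v) = F v) (hd : DifferentiableAt ℝ F u) (i : Fin 4) :
    mfderiv (𝓡 4) 𝓘(ℝ, N) f (e.symm u) (coordVec e u i) =
      fderiv ℝ F u (EuclideanSpace.single i (1 : ℝ) : E4) := by
  have hm := mdifferentiable_of_mem_atlas (I := 𝓡 4) he
  have hp : e.symm u ∈ e.source := e.map_target hu
  have h1 : f =ᶠ[𝓝 (e.symm u)] F ∘ e := by
    filter_upwards [e.open_source.mem_nhds hp] with q hq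
    rw [Function.comp, ← hF _ (e.map_source hq), e.left_inv hq]
  have hd' : MDifferentiableAt (𝓡 4) 𝓘(ℝ, N) F (e (e.symm u)) := by
    rw [e.right_inv hu]; exact hd.mdifferentiableAt
  have h := hm.comp_symm_deriv hu
  have h2 := congrArg (fun L : E4 →L[ℝ] E4 => L (EuclideanSpace.single i (1 : ℝ))) h
  have h3 : mfderiv (𝓡 4) (𝓡 4) e (e.symm u) (coordVec e u i) =
      (EuclideanSpace.single i (1 : ℝ) : E4) := h2
  have h4 : mfderiv (𝓡 4) 𝓘(ℝ, N) f (e.symm u) (coordVec e u i) =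
      (mfderiv (𝓡 4) 𝓘(ℝ, N) F (e (e.symm u)) : E4 →L[ℝ] N)
        (mfderiv (𝓡 4) (𝓡 4) e (e.symm u) (coordVec e u i)) := by
    rw [h1.mfderiv_eq]
    exact congrArg (fun L : E4 →L[ℝ] N => L (coordVec e u i))
      (mfderiv_comp _ hd' (hm.mdifferentiableAt hp))
  have h5 : (mfderiv (𝓡 4) 𝓘(ℝ, N) F (e (e.symm u)) : E4 →L[ℝ] N) = fderiv ℝ F u := by
    rw [e.right_inv hu]; exact mfderiv_eq_fderiv
  exact h4.trans (congrArg₂ (fun (L : E4 →L[ℝ] N) (v : E4) => L v) h5 h3)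

/-! ### The differential of the argument -/

/-- The argument of the complex function `f` has the partial derivatives `t i` at `u`. -/
def HasDArg (f : E4 → ℂ) (u : E4) (t : Fin 4 → ℝ) : Prop :=
  DifferentiableAt ℝ f u ∧ f u ≠ 0 ∧
    ∀ i, (fderiv ℝ f u (EuclideanSpace.single i (1 : ℝ)) / f u).im = t i

lemma HasDArg.mul {f g : E4 → ℂ} {u : E4} {s t : Fin 4 → ℝ} (hf : HasDArg f u s)
    (hg : HasDArg g u t) : HasDArg (fun v => f v * g v) u fun i => s i + t i := by
  obtain ⟨f1, f2, f3⟩ := hf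
  obtain ⟨g1, g2, g3⟩ := hg
  refine ⟨f1.fun_mul g1, mul_ne_zero f2 g2, fun i => ?_⟩
  simp only
  rw [← f3, ← g3, ← Complex.add_im, fderiv_fun_mul f1 g1]
  congr 1
  simp
  field_simp
  ring

lemma HasDArg.conj {f : E4 → ℂ} {u : E4} {t : Fin 4 → ℝ} (hf : HasDArg f u t) :
    HasDArg (fun v => (starRingEnd ℂ) (f v)) u fun i => -t i := by
  obtain ⟨f1, f2, f3⟩ := hf
  have hc := (Complex.conjCLE : ℂ →L[ℝ] ℂ).hasFDerivAt.comp u f1.hasFDerivAt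
  refine ⟨hc.differentiableAt, by simpa using f2, fun i => ?_⟩
  have : fderiv ℝ (fun v => (starRingEnd ℂ) (f v)) u = _ := hc.fderiv
  simp only
  rw [this, ← f3, ← Complex.conj_im, map_div₀]
  rfl

lemma HasDArg.ofReal {f : E4 → ℝ} {u : E4} (hf : DifferentiableAt ℝ f u) (h0 : f u ≠ 0) :
    HasDArg (fun v => ((f v : ℝ) : ℂ)) u fun _ => 0 := by
  have hc := Complex.ofRealCLM.hasFDerivAt.comp u hf.hasFDerivAt
  refine ⟨hc.differentiableAt, Complex.ofReal_ne_zero.2 h0, fun i => ?_⟩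
  have : fderiv ℝ (fun v => ((f v : ℝ) : ℂ)) u = _ := hc.fderiv
  rw [this]
  simp [← Complex.ofReal_div]

lemma fderiv_re {f : E4 → ℂ} {u : E4} (hf : DifferentiableAt ℝ f u) (v : E4) :
    (fderiv ℝ f u v).re = fderiv ℝ (fun w => (f w).re) u v := by
  have hc := Complex.reCLM.hasFDerivAt.comp u hf.hasFDerivAt
  have : fderiv ℝ (fun w => (f w).re) u = _ := hc.fderiv
  rw [this]; rfl

lemma fderiv_im {f : E4 → ℂ} {u : E4} (hf : DifferentiableAt ℝ f u) (v : E4) :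
    (fderiv ℝ f u v).im = fderiv ℝ (fun w => (f w).im) u v := by
  have hc := Complex.imCLM.hasFDerivAt.comp u hf.hasFDerivAt
  have : fderiv ℝ (fun w => (f w).im) u = _ := hc.fderiv
  rw [this]; rfl

lemma hasDArg_cz {u : E4} (hu : Complex.normSq (cz u) ≠ 0) : HasDArg cz u fun i =>
    (![fun u => -u 1, fun u => u 0, 0, 0] : Fin 4 → E4 → ℝ) i u / Complex.normSq (cz u) := by
  have hd : DifferentiableAt ℝ cz u := contDiff_cz.differentiable (by simp) u
  refine ⟨hd, by simpa using hu, fun i => ?_⟩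
  have h1 : (fderiv ℝ cz u (EuclideanSpace.single i 1)).re = if i = 0 then 1 else 0 := by
    rw [fderiv_re hd]; exact pd_coord i 0 u
  have h2 : (fderiv ℝ cz u (EuclideanSpace.single i 1)).im = if i = 1 then 1 else 0 := by
    rw [fderiv_im hd]; exact pd_coord i 1 u
  rw [Complex.div_im, h1, h2]
  fin_cases i <;> (simp [cz]; try ring)

lemma hasDArg_cw {u : E4} (hu : Complex.normSq (cw u) ≠ 0) : HasDArg cw u fun i =>
    (![0, 0, fun u => -u 3, fun u => u 2] : Fin 4 → E4 → ℝ) i u / Complex.normSq (cw u) := by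
  have hd : DifferentiableAt ℝ cw u := contDiff_cw.differentiable (by simp) u
  refine ⟨hd, by simpa using hu, fun i => ?_⟩
  have h1 : (fderiv ℝ cw u (EuclideanSpace.single i 1)).re = if i = 2 then 1 else 0 := by
    rw [fderiv_re hd]; exact pd_coord i 2 u
  have h2 : (fderiv ℝ cw u (EuclideanSpace.single i 1)).im = if i = 3 then 1 else 0 := by
    rw [fderiv_im hd]; exact pd_coord i 3 u
  rw [Complex.div_im, h1, h2]
  fin_cases i <;> (simp [cw]; try ring)

lemma HasDArg.congr {f g : E4 → ℂ} {u : E4} {t : Fin 4 → ℝ} (hf : HasDArg f u t) {V : Set E4}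
    (hV : IsOpen V) (hu : u ∈ V) (h : ∀ v ∈ V, g v = f v) : HasDArg g u t := by
  have e : g =ᶠ[𝓝 u] f := by filter_upwards [hV.mem_nhds hu] with v hv using h v hv
  obtain ⟨f1, f2, f3⟩ := hf
  refine ⟨f1.congr_of_eventuallyEq e, by rwa [h u hu], fun i => ?_⟩
  rw [e.fderiv_eq, h u hu, f3]

namespace Params

variable {P : Params}

/-- The chart `e` has the form described by the corner `K`. -/
structure IsCornerChart (e : OpenPartialHomeomorph P.Space E4) (K : Corner P) : Prop where
  target : e.target = K.tgt
  fst : ∀ u ∈ e.target, (e.symm u).1.1 = (K.prj u).1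
  snd : ∀ u ∈ e.target, (e.symm u).1.2.1 = (K.prj u).2
  angle : ∀ u ∈ K.reg, ∃ t s, HasDArg (fun v => (e.symm v).1.2.2.1) u t ∧
    HasDArg (fun v => (e.symm v).1.2.2.2.1) u s ∧
    ∀ i, P.ℓ₁τ * t i + P.ℓ₀τ * s i = K.T i u ∧ P.ℓ₁φ * t i + P.ℓ₀φ * s i = K.Φ i u

lemma IsCornerChart.components {e : OpenPartialHomeomorph P.Space E4} {K : Corner P}
    (H : IsCornerChart e K) (he : e ∈ atlas E4 P.Space) {u : E4} (hu : u ∈ K.reg) (i A : Fin 4) :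
    P.components (e.symm u) (coordVec e u i) A = K.coframe u A i := by
  have ht : u ∈ e.target := by rw [H.target]; exact hu.1
  have hx : mfderiv (𝓡 4) 𝓘(ℝ, ℝ) (fun q : P.Space => q.1.1) (e.symm u) (coordVec e u i) =
      2 * K.σ * K.r i u := by
    rw [mfderiv_coordVec he ht H.fst (K.smooth_prj.fst.differentiable (by simp) u)]
    exact K.pd_fst u i
  have hy : mfderiv (𝓡 4) 𝓘(ℝ, ℝ) (fun q : P.Space => q.1.2.1) (e.symm u) (coordVec e u i) =
      2 * K.σ' * K.r' i u := by
    rw [mfderiv_coordVec he ht H.snd (K.smooth_prj.snd.differentiable (by simp) u)]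
    exact K.pd_snd u i
  obtain ⟨t, s, ha, hb, hts⟩ := H.angle u hu
  have hα : P.dα (e.symm u) (coordVec e u i) = t i := by
    rw [dα, mfderiv_coordVec he ht (F := fun v => (e.symm v).1.2.2.1) (fun _ _ => rfl) ha.1]
    exact ha.2.2 i
  have hβ : P.dβ (e.symm u) (coordVec e u i) = s i := by
    rw [dβ, mfderiv_coordVec he ht (F := fun v => (e.symm v).1.2.2.2.1) (fun _ _ => rfl) hb.1]
    exact hb.2.2 i
  fin_cases A
  · exact hx
  · exact hy
  · simp [Params.components, hα, hβ, (hts i).1, Corner.coframe]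
  · simp [Params.components, hα, hβ, (hts i).2, Corner.coframe]

lemma isCornerChart₁ : IsCornerChart P.chart₁ P.corner₁ where
  target := rfl
  fst u hu := by
    have hu' : u ∈ P.tgt₁ := hu
    simp [chart₁, mkChart, hu', bwd₁, Corner.prj, corner₁]
  snd u hu := by
    have hu' : u ∈ P.tgt₁ := hu
    simp [chart₁, mkChart, hu', bwd₁, Corner.prj, corner₁]
  angle u hu := by
    obtain ⟨ht, h1, h2⟩ := hu
    have ht' : u ∈ P.tgt₁ := ht
    have hz := hasDArg_cz h1
    have hw := hasDArg_cw h2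
    have d3 : DifferentiableAt ℝ (fun u => √(P.x₃ - (P.x₂ + Complex.normSq (cz u)))) u := by
      refine ((contDiff_const.sub (contDiff_const.add contDiff_nz)).differentiable (n := ∞)
        (by simp) u).sqrt ?_
      have := ht'.1; exact (by linarith : (0 : ℝ) < _).ne'
    have d2 : DifferentiableAt ℝ (fun u => √(P.x₂ - (P.x₁ + Complex.normSq (cw u)))) u := by
      refine ((contDiff_const.sub (contDiff_const.add contDiff_nw)).differentiable (n := ∞)
        (by simp) u).sqrt ?_
      have := ht'.2; exact (by linarith : (0 : ℝ) < _).ne'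
    have p3 : √(P.x₃ - (P.x₂ + Complex.normSq (cz u))) ≠ 0 :=
      (Real.sqrt_pos.2 (by have := ht'.1; linarith)).ne'
    have p2 : √(P.x₂ - (P.x₁ + Complex.normSq (cw u))) ≠ 0 :=
      (Real.sqrt_pos.2 (by have := ht'.2; linarith)).ne'
    refine ⟨_, _, (hw.mul (.ofReal d3 p3)).congr P.isOpen_tgt₁ ht' fun v hv => ?_,
      (hz.mul (.ofReal (d2.fun_mul d3) (mul_ne_zero p2 p3))).congr P.isOpen_tgt₁ ht'
        fun v hv => ?_, fun i => ⟨?_, ?_⟩⟩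
    · simp [chart₁, mkChart, hv, bwd₁]
    · simp [chart₁, mkChart, hv, bwd₁]
    · simp only [Corner.T, corner₁]; ring
    · simp only [Corner.Φ, corner₁]; ring

lemma isCornerChart₂ : IsCornerChart P.chart₂ P.corner₂ where
  target := rfl
  fst u hu := by
    have hu' : u ∈ P.tgt₂ := hu
    simp [chart₂, mkChart, hu', bwd₂, Corner.prj, corner₂, sub_eq_add_neg]
  snd u hu := by
    have hu' : u ∈ P.tgt₂ := hu
    simp [chart₂, mkChart, hu', bwd₂, Corner.prj, corner₂]
  angle u hu := by
    obtain ⟨ht, h1, h2⟩ := hu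
    have ht' : u ∈ P.tgt₂ := ht
    have hz := hasDArg_cz h2
    have hw := hasDArg_cw h1
    have d3 : DifferentiableAt ℝ (fun u => √(P.x₃ - Complex.normSq (cw u) - P.x₂)) u := by
      refine (((contDiff_const.sub contDiff_nw).sub contDiff_const).differentiable (n := ∞)
        (by simp) u).sqrt ?_
      have := ht'.2; exact (by linarith : (0 : ℝ) < _).ne'
    have d2 : DifferentiableAt ℝ (fun u => √(P.x₂ - (P.x₁ + Complex.normSq (cz u)))) u := by
      refine ((contDiff_const.sub (contDiff_const.add contDiff_nz)).differentiable (n := ∞)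
        (by simp) u).sqrt ?_
      have := ht'.1; exact (by linarith : (0 : ℝ) < _).ne'
    have p3 : √(P.x₃ - Complex.normSq (cw u) - P.x₂) ≠ 0 :=
      (Real.sqrt_pos.2 (by have := ht'.2; linarith)).ne'
    have p2 : √(P.x₂ - (P.x₁ + Complex.normSq (cz u))) ≠ 0 :=
      (Real.sqrt_pos.2 (by have := ht'.1; linarith)).ne'
    refine ⟨_, _, (hz.mul hw).congr P.isOpen_tgt₂ ht' fun v hv => ?_,
      (hw.conj.mul (.ofReal (d3.fun_mul d2) (mul_ne_zero p3 p2))).congr P.isOpen_tgt₂ ht'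
        fun v hv => ?_, fun i => ⟨?_, ?_⟩⟩
    · simp [chart₂, mkChart, hv, bwd₂]
    · simp [chart₂, mkChart, hv, bwd₂]
    · simp only [Corner.T, corner₂]; ring
    · simp only [Corner.Φ, corner₂]; ring

lemma isCornerChart₃ : IsCornerChart P.chart₃ P.corner₃ where
  target := rfl
  fst u hu := by
    have hu' : u ∈ P.tgt₁ := hu
    simp [chart₃, mkChart, hu', bwd₃, Corner.prj, corner₃, sub_eq_add_neg]
  snd u hu := by
    have hu' : u ∈ P.tgt₁ := hu
    simp [chart₃, mkChart, hu', bwd₃, Corner.prj, corner₃, sub_eq_add_neg]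
  angle u hu := by
    obtain ⟨ht, h1, h2⟩ := hu
    have ht' : u ∈ P.tgt₁ := ht
    have hz := hasDArg_cz h1
    have hw := hasDArg_cw h2
    have d3 : DifferentiableAt ℝ (fun u => √(P.x₃ - Complex.normSq (cz u) - P.x₂)) u := by
      refine (((contDiff_const.sub contDiff_nz).sub contDiff_const).differentiable (n := ∞)
        (by simp) u).sqrt ?_
      have := ht'.1; exact (by linarith : (0 : ℝ) < _).ne'
    have d2 : DifferentiableAt ℝ (fun u => √(P.x₂ - Complex.normSq (cw u) - P.x₁)) u := by
      refine (((contDiff_const.sub contDiff_nw).sub contDiff_const).differentiable (n := ∞)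
        (by simp) u).sqrt ?_
      have := ht'.2; exact (by linarith : (0 : ℝ) < _).ne'
    have p3 : √(P.x₃ - Complex.normSq (cz u) - P.x₂) ≠ 0 :=
      (Real.sqrt_pos.2 (by have := ht'.1; linarith)).ne'
    have p2 : √(P.x₂ - Complex.normSq (cw u) - P.x₁) ≠ 0 :=
      (Real.sqrt_pos.2 (by have := ht'.2; linarith)).ne'
    refine ⟨_, _, (hz.conj.mul (.ofReal d2 p2)).congr P.isOpen_tgt₁ ht' fun v hv => ?_,
      ((hz.mul hw).mul (.ofReal d3 p3)).congr P.isOpen_tgt₁ ht' fun v hv => ?_,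
      fun i => ⟨?_, ?_⟩⟩
    · simp [chart₃, mkChart, hv, bwd₃]
    · simp [chart₃, mkChart, hv, bwd₃]
    · simp only [Corner.T, corner₃]; ring
    · simp only [Corner.Φ, corner₃]; ring

lemma exists_isCornerChart {e : OpenPartialHomeomorph P.Space E4} (he : e ∈ atlas E4 P.Space) :
    ∃ K, IsCornerChart e K := by
  rcases he with rfl | rfl | rfl
  · exact ⟨_, isCornerChart₁⟩
  · exact ⟨_, isCornerChart₂⟩
  · exact ⟨_, isCornerChart₃⟩

/-- Every chart of the atlas is the preferred chart at some point. -/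
lemma exists_chartAt {e : OpenPartialHomeomorph P.Space E4} (he : e ∈ atlas E4 P.Space) :
    ∃ p₀ : P.Space, chartAt E4 p₀ = e := by
  have o1 := P.x₁_lt_x₂
  have o2 := P.x₂_lt_x₃
  have t1 : (0 : E4) ∈ P.tgt₁ := by simp [tgt₁, cz, cw, Complex.normSq, o1, o2]
  have t2 : (0 : E4) ∈ P.tgt₂ := by simp [tgt₂, cz, cw, Complex.normSq, o1, o2]
  rcases he with rfl | rfl | rfl
  · exact ⟨⟨P.bwd₁ 0, P.bwd₁_mem t1⟩, if_pos (P.bwd₁_dom t1)⟩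
  · refine ⟨⟨P.bwd₂ 0, P.bwd₂_mem t2⟩, (if_neg ?_).trans (if_pos (P.bwd₂_dom t2))⟩
    simp [dom₁, bwd₂, cz, cw, Complex.normSq]
  · refine ⟨⟨P.bwd₃ 0, P.bwd₃_mem t1⟩, (if_neg ?_).trans (if_neg ?_)⟩
    · simp [dom₁, bwd₃, cz, cw, Complex.normSq]
    · simp [dom₂, bwd₃, cz, cw, Complex.normSq]

lemma IsCornerChart.mem_regular {e : OpenPartialHomeomorph P.Space E4} {K : Corner P}
    (H : IsCornerChart e K) {u : E4} (hu : u ∈ e.target) : e.symm u ∈ P.regular ↔ u ∈ K.reg := by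
  have hx := H.fst u hu
  have hy := H.snd u hu
  have ht : u ∈ K.tgt := by rw [← H.target]; exact hu
  constructor
  · rintro ⟨h1, h2, h3, h4⟩
    rw [hx] at h1 h2
    rw [hy] at h3 h4
    refine ⟨ht, fun h0 => ?_, fun h0 => ?_⟩
    · have := (P.quartic_pos h1 h2).ne'
      rw [K.quartic_fst, h0] at this
      simp at this
    · have := (P.quartic_neg h3 h4).ne
      rw [K.quartic_snd, h0] at this
      simp at this
  · intro h
    obtain ⟨⟨h1, h2⟩, ⟨h3, h4⟩⟩ := K.prj_mem h
    exact ⟨by rw [hx]; exact h1, by rw [hx]; exact h2, by rw [hy]; exact h3, by rw [hy]; exact h4⟩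

lemma dense_regular : Dense P.regular := by
  intro p
  set e := chartAt E4 p with he
  obtain ⟨K, H⟩ := exists_isCornerChart (chart_mem_atlas E4 p)
  have hp : p ∈ e.source := mem_chart_source E4 p
  have ht : e p ∈ e.target := e.map_source hp
  have h1 : e p ∈ closure K.reg := K.dense (by rw [← H.target]; exact ht)
  rw [← e.left_inv hp]
  rw [mem_closure_iff_nhdsWithin_neBot] at h1
  have h2 : Tendsto e.symm (𝓝[K.reg] (e p)) (𝓝 (e.symm (e p))) :=
    (e.continuousAt_symm ht).tendsto.mono_left nhdsWithin_le_nhds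
  refine mem_closure_of_tendsto h2 ?_
  filter_upwards [self_mem_nhdsWithin] with u hu
  exact (H.mem_regular (by rw [H.target]; exact hu.1)).2 hu

end Params

end ChenTeo
end

open Set Filter Topology Manifold Bundle
open scoped ContDiff

noncomputable section

namespace ChenTeo

open Params

lemma isVonNBounded_of_pos (B : E4 →L[ℝ] E4 →L[ℝ] ℝ) (hB : ∀ v, v ≠ 0 → 0 < B v v) :
    Bornology.IsVonNBounded ℝ {v : E4 | B v v < 1} := by
  have hc : Continuous fun v => B v v := B.continuous.clm_apply continuous_id
  obtain ⟨w, hw, hmin⟩ := (isCompact_sphere (0 : E4) 1).exists_isMinOn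
    (NormedSpace.sphere_nonempty.2 zero_le_one) hc.continuousOn
  have hw0 : w ≠ 0 := by
    rintro rfl
    simp at hw
  have hpos := hB w hw0
  rw [NormedSpace.isVonNBounded_iff, isBounded_iff_forall_norm_le]
  refine ⟨√(1 / B w w), fun v hv => Real.le_sqrt_of_sq_le ?_⟩
  by_cases hv0 : v = 0
  · rw [hv0]; simp only [norm_zero, zero_pow two_ne_zero]; positivity
  have hn : 0 < ‖v‖ := norm_pos_iff.2 hv0
  have h1 : ‖v‖⁻¹ • v ∈ Metric.sphere (0 : E4) 1 := by
    simp [norm_smul, hn.ne']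
  have h2 : B w w ≤ B (‖v‖⁻¹ • v) (‖v‖⁻¹ • v) := hmin h1
  simp only [map_smul, smul_apply, smul_eq_mul] at h2
  have h3 : B v v < 1 := hv
  rw [le_div_iff₀ hpos]
  have h4 : ‖v‖ ^ 2 * B w w ≤ ‖v‖ ^ 2 * (‖v‖⁻¹ * (‖v‖⁻¹ * B v v)) := by gcongr
  have h5 : ‖v‖ ^ 2 * (‖v‖⁻¹ * (‖v‖⁻¹ * B v v)) = B v v := by field_simp
  linarith

namespace Params

variable {P : Params}

/-- The forms `dx, dy, dτ, dφ`. -/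
def componentForm (A : Fin 4) (p : P.Space) : TangentSpace (𝓡 4) p →L[ℝ] ℝ :=
  let dA : TangentSpace (𝓡 4) p →L[ℝ] ℝ := Complex.imCLM.comp
    (((ContinuousLinearMap.mul ℝ ℂ).flip (p.1.2.2.1)⁻¹).comp
    (mfderiv (𝓡 4) 𝓘(ℝ, ℂ) (fun q : P.Space => q.1.2.2.1) p : E4 →L[ℝ] ℂ))
  let dB : TangentSpace (𝓡 4) p →L[ℝ] ℝ := Complex.imCLM.comp
    (((ContinuousLinearMap.mul ℝ ℂ).flip (p.1.2.2.2.1)⁻¹).comp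
    (mfderiv (𝓡 4) 𝓘(ℝ, ℂ) (fun q : P.Space => q.1.2.2.2.1) p : E4 →L[ℝ] ℂ))
  ![mfderiv (𝓡 4) 𝓘(ℝ, ℝ) (fun q : P.Space => q.1.1) p,
    mfderiv (𝓡 4) 𝓘(ℝ, ℝ) (fun q : P.Space => q.1.2.1) p,
    P.ℓ₁τ • dA + P.ℓ₀τ • dB, P.ℓ₁φ • dA + P.ℓ₀φ • dB] A

lemma componentForm_apply (A : Fin 4) (p : P.Space) (v : TangentSpace (𝓡 4) p) :
    componentForm A p v = P.components p v A := by
  fin_cases A <;> rfl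

/-- The bilinear form with components `frameForm s` with respect to `dx, dy, dτ, dφ`. -/
def toricForm (s : Mat4) (p : P.Space) :
    TangentSpace (𝓡 4) p →L[ℝ] TangentSpace (𝓡 4) p →L[ℝ] ℝ :=
  ∑ A, ∑ B, (componentForm A p).smulRight
    (P.frameForm s (p.1.1, p.1.2.1) A B • componentForm B p)

lemma toricForm_apply (s : Mat4) (p : P.Space) (v w : TangentSpace (𝓡 4) p) :
    toricForm s p v w = ∑ A, ∑ B,
      P.frameForm s (p.1.1, p.1.2.1) A B * P.components p v A * P.components p w B := by
  simp only [toricForm, sum_apply, ContinuousLinearMap.smulRight_apply, smul_apply, smul_eq_mul,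
    componentForm_apply]
  refine Finset.sum_congr rfl fun A _ => Finset.sum_congr rfl fun B _ => by ring

lemma mem_box_of_regular {p : P.Space} (hp : p ∈ P.regular) : (p.1.1, p.1.2.1) ∈ P.box :=
  ⟨⟨hp.1, hp.2.1⟩, ⟨hp.2.2.1, hp.2.2.2⟩⟩

/-- A chosen corner that describes the chart at a point. -/
def cornerAt (p₀ : P.Space) : Corner P := (exists_isCornerChart (chart_mem_atlas E4 p₀)).choose

lemma isCornerChart_cornerAt (p₀ : P.Space) : IsCornerChart (chartAt E4 p₀) (cornerAt p₀) :=
  (exists_isCornerChart (chart_mem_atlas E4 p₀)).choose_spec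

lemma reg_subset_target (p₀ : P.Space) {u : E4} (hu : u ∈ (cornerAt p₀).reg) :
    u ∈ (chartAt E4 p₀).target := by
  rw [(isCornerChart_cornerAt p₀).target]; exact hu.1

lemma symm_mem_regular (p₀ : P.Space) {u : E4} (hu : u ∈ (cornerAt p₀).reg) :
    (chartAt E4 p₀).symm u ∈ P.regular :=
  ((isCornerChart_cornerAt p₀).mem_regular (reg_subset_target p₀ hu)).2 hu

lemma toricForm_coordVec (s : Mat4) (p₀ : P.Space) {u : E4} (hu : u ∈ (cornerAt p₀).reg)
    (i j : Fin 4) : toricForm s ((chartAt E4 p₀).symm u) (coordVec (chartAt E4 p₀) u i)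
      (coordVec (chartAt E4 p₀) u j) = (((cornerAt p₀).coframe u).transpose *
        P.frameForm s ((cornerAt p₀).prj u) * (cornerAt p₀).coframe u) i j := by
  have H := isCornerChart_cornerAt p₀
  have ht := reg_subset_target p₀ hu
  rw [toricForm_apply, transpose_sandwich_apply]
  simp only [H.components (chart_mem_atlas E4 p₀) hu, H.fst u ht, H.snd u ht, Prod.mk.eta]

lemma exists_toric_bilin (s : Mat4) (h : P.Space → E4 → Mat4)
    (sh : ∀ p₀, SmoothMat (cornerAt p₀).tgt (h p₀))
    (eh : ∀ p₀, ∀ u ∈ (cornerAt p₀).reg, h p₀ u = ((cornerAt p₀).coframe u).transpose *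
      P.frameForm s ((cornerAt p₀).prj u) * (cornerAt p₀).coframe u) :
    ∃ B : ∀ p : P.Space, TangentSpace (𝓡 4) p →L[ℝ] TangentSpace (𝓡 4) p →L[ℝ] ℝ,
      IsSmoothBilin B ∧ (∀ p ∈ P.regular, B p = toricForm s p) ∧
      ∀ p₀, ∀ p ∈ (chartAt E4 p₀).source, ∀ i j,
        B p (frameVec p₀ i p) (frameVec p₀ j p) = h p₀ (chartAt E4 p₀ p) i j := by
  refine exists_bilin dense_regular (toricForm s) h (fun p₀ => ?_) fun p₀ p hp hr i j => ?_
  · rw [(isCornerChart_cornerAt p₀).target]; exact sh p₀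
  · obtain ⟨u, hu, rfl⟩ : ∃ u ∈ (chartAt E4 p₀).target, (chartAt E4 p₀).symm u = p :=
      ⟨chartAt E4 p₀ p, (chartAt E4 p₀).map_source hp, (chartAt E4 p₀).left_inv hp⟩
    have hu' := ((isCornerChart_cornerAt p₀).mem_regular hu).1 hr
    rw [← coordVec_chartAt p₀ hu, ← coordVec_chartAt p₀ hu, toricForm_coordVec s p₀ hu',
      (chartAt E4 p₀).right_inv hu, eh p₀ u hu']

theorem exists_chenTeoMetric : ∃ g : Metric P.Space, P.IsChenTeoMetric g := by
  choose h sh eh using fun p₀ : P.Space => (cornerAt p₀).exists_metric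
  obtain ⟨B, sB, hB, cB⟩ := exists_toric_bilin 1 h sh eh
  have e : ∀ p (v w : TangentSpace (𝓡 4) p), B p v w = ∑ i, ∑ j, coordForm p i p v *
      coordForm p j p w * h p (chartAt E4 p p) i j := by
    intro p v w
    rw [bilin_eq_sum B (mem_chart_source E4 p)]
    simp only [bilinMatrix, cB p p (mem_chart_source E4 p)]
  have pd : ∀ p : P.Space, (h p (chartAt E4 p p)).PosDef := by
    intro p
    refine (cornerAt p).posDef (sh p) (eh p) ?_
    rw [← (isCornerChart_cornerAt p).target]
    exact mem_chart_target E4 p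
  have pos : ∀ p (v : TangentSpace (𝓡 4) p), v ≠ 0 → 0 < B p v v := by
    intro p v hv
    have hv' : (fun i => coordForm p i p v) ≠ 0 := by
      intro h0
      apply hv
      rw [eq_sum_frameVec (mem_chart_source E4 p) v]
      refine Finset.sum_eq_zero fun i _ => ?_
      rw [show coordForm p i p v = 0 from congrFun h0 i, zero_smul]
    have := (pd p).dotProduct_mulVec_pos hv'
    simp only [star_trivial, dotProduct, Matrix.mulVec, Finset.mul_sum] at this
    rw [e]
    exact this.trans_eq (Finset.sum_congr rfl fun i _ => Finset.sum_congr rfl fun j _ => by ring)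
  refine ⟨⟨B, fun p v w => ?_, pos, fun p => isVonNBounded_of_pos (B p) (pos p), sB⟩,
    fun p hp v w => ?_⟩
  · rw [e, e, Finset.sum_comm]
    refine Finset.sum_congr rfl fun i _ => Finset.sum_congr rfl fun j _ => ?_
    have := (pd p).isHermitian.apply i j
    simp only [star_trivial] at this
    rw [← this]; ring
  · have h1 := lineElement_eq (mem_box_of_regular hp) (P.components p v) (P.components p w)
    change B p v w = _
    rw [hB p hp, toricForm_apply]
    exact h1.symm

lemma IsChenTeoMetric.inner_eq {g : Metric P.Space} (hg : P.IsChenTeoMetric g) {p : P.Space}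
    (hp : p ∈ P.regular) (v w : TangentSpace (𝓡 4) p) :
    g.inner p v w = toricForm 1 p v w := by
  rw [hg p hp, toricForm_apply]
  exact lineElement_eq (mem_box_of_regular hp) (P.components p v) (P.components p w)

lemma IsChenTeoMetric.gram_eq {g : Metric P.Space} (hg : P.IsChenTeoMetric g) (p₀ : P.Space)
    {u : E4} (hu : u ∈ (cornerAt p₀).reg) : gram g (chartAt E4 p₀) u =
      (P.frame ((cornerAt p₀).prj u) * (cornerAt p₀).coframe u).transpose *
        (P.frame ((cornerAt p₀).prj u) * (cornerAt p₀).coframe u) := by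
  ext i j
  rw [gram, hg.inner_eq (symm_mem_regular p₀ hu), toricForm_coordVec 1 p₀ hu, frameForm,
    Matrix.transpose_mul]
  simp only [Matrix.mul_one, Matrix.mul_assoc]

lemma IsChenTeoMetric.unique {g g' : Metric P.Space} (hg : P.IsChenTeoMetric g)
    (hg' : P.IsChenTeoMetric g') : g = g' := by
  have key : ∀ p, g.inner p = g'.inner p := by
    intro p
    have hp := mem_chart_source E4 p
    have e : ∀ i j, bilinMatrix g.inner p p i j = bilinMatrix g'.inner p p i j := by
      intro i j
      have oU := (chartAt E4 p).open_source
      refine EqOn.of_subset_closure (s := (chartAt E4 p).source ∩ P.regular)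
        (f := fun q => bilinMatrix g.inner p q i j) (g := fun q => bilinMatrix g'.inner p q i j)
        (t := (chartAt E4 p).source) ?_ ?_ ?_ inter_subset_left
        (dense_regular.open_subset_closure_inter oU) hp
      · intro q hq
        simp only [bilinMatrix]
        rw [hg.inner_eq hq.2, hg'.inner_eq hq.2]
      · exact fun q hq => (contMDiffAt_bilinMatrix (isSmoothBilin_inner g) hq i j).continuousAt.continuousWithinAt
      · exact fun q hq =>
          (contMDiffAt_bilinMatrix (isSmoothBilin_inner g') hq i j).continuousAt.continuousWithinAt
    ext v w
    rw [bilin_eq_sum g.inner hp, bilin_eq_sum g'.inner hp]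
    simp only [e]
  cases g; cases g'
  congr
  exact funext key

theorem existsUnique_chenTeoMetric : ∃! g : Metric P.Space, P.IsChenTeoMetric g := by
  obtain ⟨g, hg⟩ := exists_chenTeoMetric (P := P)
  exact ⟨g, hg, fun g' hg' => hg'.unique hg⟩

theorem components_det_pos {e : OpenPartialHomeomorph P.Space E4} (he : e ∈ atlas E4 P.Space)
    {u : E4} (hu : u ∈ e.target) (hr : e.symm u ∈ P.regular) : 0 < (Matrix.of fun i j =>
      P.components (e.symm u) (coordVec e u j) i : Matrix (Fin 4) (Fin 4) ℝ).det := by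
  obtain ⟨K, H⟩ := exists_isCornerChart he
  have hu' := (H.mem_regular hu).1 hr
  have : (Matrix.of fun i j => P.components (e.symm u) (coordVec e u j) i :
      Matrix (Fin 4) (Fin 4) ℝ) = K.coframe u := by
    ext i j
    exact H.components he hu' j i
  rw [this]
  exact K.toricCoords.det_pos u hu'

end Params

end ChenTeo
end

open Set Filter Topology Manifold Bundle
open scoped ContDiff

noncomputable section

namespace ChenTeo

open Params

section

variable {V : Set E4} {h η : E4 → Mat4}

lemma contDiffOn_riemann (hV : IsOpen V) (sh : SmoothMat V h) (h0 : ∀ v ∈ V, (h v).det ≠ 0)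
    (l k i j : Fin 4) : ContDiffOn ℝ ∞ (fun v => riemann h v l k i j) V := by
  have c : ∀ l i k, ContDiffOn ℝ ∞ (christoffel h l i k) V :=
    fun l i k => smoothMat_gammaM hV sh h0 i l k
  unfold riemann
  exact ((contDiffOn_pd hV i (c _ _ _)).sub (contDiffOn_pd hV j (c _ _ _))).add
    (ContDiffOn.sum fun m _ => ((c _ _ _).mul (c _ _ _)).sub ((c _ _ _).mul (c _ _ _)))

lemma contDiffOn_ricci (hV : IsOpen V) (sh : SmoothMat V h) (h0 : ∀ v ∈ V, (h v).det ≠ 0)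
    (k j : Fin 4) : ContDiffOn ℝ ∞ (fun v => ricci h v k j) V :=
  ContDiffOn.sum fun l _ => contDiffOn_riemann hV sh h0 l k l j

lemma contDiffOn_weyl (hV : IsOpen V) (sh : SmoothMat V h) (h0 : ∀ v ∈ V, (h v).det ≠ 0)
    (l k i j : Fin 4) : ContDiffOn ℝ ∞ (fun v => weyl h v l k i j) V := by
  have r := contDiffOn_ricci hV sh h0
  have s : ContDiffOn ℝ ∞ (fun v => scal h v) V :=
    ContDiffOn.sum fun k _ => ContDiffOn.sum fun j _ => (sh.inv h0 k j).mul (r k j)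
  unfold weyl
  exact ((ContDiffOn.sum fun m _ => (sh l m).mul (contDiffOn_riemann hV sh h0 m k i j)).sub
    (contDiffOn_const.mul (((((sh _ _).mul (r _ _)).sub ((sh _ _).mul (r _ _))).sub
      ((sh _ _).mul (r _ _))).add ((sh _ _).mul (r _ _))))).add
    ((s.div_const 6).mul (((sh _ _).mul (sh _ _)).sub ((sh _ _).mul (sh _ _))))

lemma SmoothMat.raise (sh : SmoothMat V h) (h0 : ∀ v ∈ V, (h v).det ≠ 0) (sη : SmoothMat V η) :
    SmoothMat V fun v => raise h v (η v) :=
  ((sh.inv h0).mul sη).mul (sh.inv h0).transpose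

lemma SmoothMat.hodgeStar (sh : SmoothMat V h) (h0 : ∀ v ∈ V, (h v).det ≠ 0)
    (sη : SmoothMat V η) : SmoothMat V fun v => hodgeStar h v (η v) := fun _ _ =>
  (contDiffOn_const.mul (sh.det.sqrt h0)).mul (ContDiffOn.sum fun k _ => ContDiffOn.sum fun l _ =>
    contDiffOn_const.mul (sh.raise h0 sη k l))

lemma SmoothMat.weylOp (hV : IsOpen V) (sh : SmoothMat V h) (h0 : ∀ v ∈ V, (h v).det ≠ 0)
    (sη : SmoothMat V η) : SmoothMat V fun v => weylOp h v (η v) := fun i j =>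
  contDiffOn_const.mul (ContDiffOn.sum fun k _ => ContDiffOn.sum fun l _ =>
    (contDiffOn_weyl hV sh h0 i j k l).mul (sh.raise h0 sη k l))

lemma SmoothMat.continuousOn (sη : SmoothMat V η) : ContinuousOn η V :=
  continuousOn_pi.2 fun i => continuousOn_pi.2 fun j => (sη i j).continuousOn

lemma SmoothMat.const (n : Mat4) : SmoothMat V fun _ => n := fun _ _ => contDiffOn_const

lemma SmoothMat.const_smul (c : ℝ) (sη : SmoothMat V η) : SmoothMat V fun v => c • η v :=
  fun i j => contDiffOn_const.mul (sη i j)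

end

open scoped MatrixOrder in
lemma exists_transpose_mul_self {A : Mat4} (hA : A.PosDef) :
    ∃ θ : Mat4, 0 < θ.det ∧ A = θ.transpose * θ := by
  obtain ⟨B, hs, -, hB⟩ := CFC.exists_sqrt_of_isSelfAdjoint_of_quasispectrumRestricts
    hA.isHermitian (QuasispectrumRestricts.nnreal_of_nonneg hA.posSemidef.nonneg)
  replace hB : A = B.transpose * B := by
    have : B.transpose = B := by
      rw [← Matrix.conjTranspose_eq_transpose_of_trivial]; exact hs
    rw [this, ← hB]
  have hd : B.det ≠ 0 := by
    intro h0
    have := hA.det_pos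
    rw [hB, det_transpose_mul_self, h0] at this
    norm_num at this
  rcases hd.lt_or_gt with h | h
  · set S : Mat4 := Matrix.diagonal ![-1, 1, 1, 1] with hS
    have hSS : S.transpose * S = 1 := by
      rw [hS, Matrix.diagonal_transpose, Matrix.diagonal_mul_diagonal, ← Matrix.diagonal_one]
      congr 1
      ext i; fin_cases i <;> simp
    have hSd : S.det = -1 := by rw [hS, Matrix.det_diagonal, Fin.prod_univ_four]; simp
    refine ⟨S * B, ?_, ?_⟩
    · rw [Matrix.det_mul, hSd]; linarith
    · rw [Matrix.transpose_mul, Matrix.mul_assoc, ← Matrix.mul_assoc S.transpose, hSS,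
        Matrix.one_mul, hB]
  · exact ⟨B, h, hB⟩

lemma frameStar_sd_add_asd (p q r p' q' r' : ℝ) :
    frameStar (sd p q r + asd p' q' r') = sd p q r - asd p' q' r' := by
  rw [frameStar_eq]
  ext a b; fin_cases a <;> fin_cases b <;> simp [sd, asd] <;> ring

/-- The action of the Weyl tensor on self-dual forms, for a curvature of type `D⁺`. -/
lemma IsFrameCurvature.weylOp_formula {h : E4 → Mat4} {u : E4} {θ : Mat4} {c α β γ : ℝ}
    (H : IsFrameCurvature h u θ (curvModel c α β γ)) {η : Mat4} (hη : η.transpose = -η)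
    (hs : hodgeStar h u η = η) : weylOp h u η = (-c / 2) • η +
      (3 * c / 8 * ∑ i, ∑ j, (θ.transpose * sd 1 0 0 * θ) i j * raise h u η i j) •
        (θ.transpose * sd 1 0 0 * θ) := by
  obtain ⟨n, rfl⟩ := exists_frame_form H.det_pos η
  rw [hodgeStar_frame H.det_pos H.metric] at hs
  have hs' := frame_form_inj H.det_pos hs
  rw [frame_form_transpose, frame_form_neg] at hη
  obtain ⟨p, q, r, rfl⟩ := exists_sd (frame_form_inj H.det_pos hη) hs'
  rw [H.weylOp_frame (curvModel_ricci c α β γ), raise_frame H.det_pos H.metric,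
    sum_sandwich_mul H.mul_inv, sum_sd_sd, frame_form_smul, frame_form_smul, frame_form_add,
    frameOp_curvModel_sd, smul_sd, smul_sd, sd_add]
  congr 3 <;> ring

namespace Corner

variable {P : Params} (K : Corner P) {h : E4 → Mat4}

lemma weylSD_ne {u : E4} (hu : u ∈ K.tgt) : P.weylSD (K.prj u) ≠ 0 := by
  have hN := left_ne_zero_of_mul (K.Nh_ne hu)
  have hD := (K.sub_pos hu).ne'
  have hk := P.k_pos.ne'
  have hν : 1 + P.ν ≠ 0 := by
    have := P.two_ξ_sq_lt
    have : 0 < 1 + P.ν := by unfold ν; linarith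
    exact this.ne'
  exact div_ne_zero (mul_ne_zero (neg_ne_zero.2 hν) (pow_ne_zero _ hD))
    (mul_ne_zero hk (pow_ne_zero _ hN))

lemma continuousOn_weylSD : ContinuousOn (fun u => P.weylSD (K.prj u)) K.tgt := by
  have c := K.smooth_prj.continuous.continuousOn (s := K.tgt)
  have sN := (contDiff_N (P := P)).continuous.comp_continuousOn c
  exact ((continuousOn_const.mul ((c.fst.sub c.snd).pow 3)).div (continuousOn_const.mul (sN.pow 3))
    fun u hu => mul_ne_zero P.k_pos.ne' (pow_ne_zero _ (left_ne_zero_of_mul (K.Nh_ne hu))))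

variable (eh : ∀ u ∈ K.reg, h u = (P.frame (K.prj u) * K.coframe u).transpose *
  (P.frame (K.prj u) * K.coframe u))

include eh in
lemma isFrameCurvature {u : E4} (hu : u ∈ K.reg) :
    IsFrameCurvature h u (P.frame (K.prj u) * K.coframe u) (curvModel (P.weylSD (K.prj u))
      (P.weylα (K.prj u)) (P.weylβ (K.prj u)) (P.weylγ (K.prj u))) :=
  Params.isFrameCurvature K.toricCoords eh hu

include eh in
lemma ricci_eq_zero (sh : SmoothMat K.tgt h) (h0 : ∀ u ∈ K.tgt, (h u).PosDef) {u : E4}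
    (hu : u ∈ K.tgt) (i j : Fin 4) : ricci h u i j = 0 :=
  K.eqOn_of_reg (f := fun u => ricci h u i j) (g := fun _ => 0)
    (contDiffOn_ricci K.isOpen sh (fun v hv => (h0 v hv).det_pos.ne') i j).continuousOn
    continuousOn_const (fun _ hu => (K.isFrameCurvature eh hu).ricci_eq_zero i j) hu

include eh in
lemma ncard_weylEigenvalues_neg {u : E4} (hu : u ∈ K.reg) (hg : K.prj u ∈ P.generic) :
    (weylEigenvalues h u (-1)).ncard = 3 :=
  (K.isFrameCurvature eh hu).ncard_weylEigenvalues (generic_γ hg) (generic_disc hg)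

include eh in
lemma ncard_weylEigenvalues_pos (sh : SmoothMat K.tgt h) (h0 : ∀ u ∈ K.tgt, (h u).PosDef) {u : E4}
    (hu : u ∈ K.tgt) : (weylEigenvalues h u 1).ncard = 2 := by
  have h0' : ∀ v ∈ K.tgt, (h v).det ≠ 0 := fun v hv => (h0 v hv).det_pos.ne'
  obtain ⟨ψ, sψ, eψ'⟩ := K.exists_form
  have eψ : ∀ u ∈ K.reg, ψ u = (P.frame (K.prj u) * K.coframe u).transpose * sd 1 0 0 *
      (P.frame (K.prj u) * K.coframe u) := fun u hu => by
    rw [eψ' u hu, frameForm, Matrix.transpose_mul]; simp only [Matrix.mul_assoc]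
  obtain ⟨θ, hdet, hθ⟩ := exists_transpose_mul_self (h0 u hu)
  refine ncard_weylEigenvalues_of_formula (ψ := ψ u) (c := P.weylSD (K.prj u)) hdet hθ ?_ ?_ ?_
    (K.weylSD_ne hu) fun η hη hs => ?_
  · refine K.eqOn_of_reg (f := fun u => (ψ u).transpose) (g := fun u => -ψ u)
      sψ.transpose.continuousOn sψ.neg.continuousOn (fun u hu => ?_) hu
    rw [eψ u hu, frame_form_transpose, frame_form_neg, sd_skew]
  · refine K.eqOn_of_reg (f := fun u => hodgeStar h u (ψ u)) (sh.hodgeStar h0' sψ).continuousOn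
      sψ.continuousOn (fun u hu => ?_) hu
    have H := K.isFrameCurvature eh hu
    rw [eψ u hu, hodgeStar_frame H.det_pos H.metric, frameStar_sd]
  · refine K.eqOn_of_reg (f := fun u => ∑ i, ∑ j, ψ u i j * raise h u (ψ u) i j)
      (g := fun _ => 4) ?_ continuousOn_const (fun u hu => ?_) hu
    · exact continuousOn_finsetSum _ fun i _ => continuousOn_finsetSum _ fun j _ =>
        ((sψ i j).mul (sh.raise h0' sψ i j)).continuousOn
    · have H := K.isFrameCurvature eh hu
      rw [eψ u hu, raise_frame H.det_pos H.metric, sum_sandwich_mul H.mul_inv, sum_sd_sd]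
      norm_num
  · set n : E4 → Mat4 := fun v => (1 / 2 : ℝ) • (η + hodgeStar h v η) with hn
    have sn : SmoothMat K.tgt n :=
      ((SmoothMat.const η).add (sh.hodgeStar h0' (SmoothMat.const η))).const_smul _
    have nu : n u = η := by
      rw [hn]; beta_reduce; rw [hs, ← two_smul ℝ η, smul_smul]; norm_num
    have key : weylOp h u (n u) = (-P.weylSD (K.prj u) / 2) • n u +
        (3 * P.weylSD (K.prj u) / 8 * ∑ i, ∑ j, ψ u i j * raise h u (n u) i j) • ψ u := by
      refine K.eqOn_of_reg (f := fun u => weylOp h u (n u)) (g := fun u =>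
        (-P.weylSD (K.prj u) / 2) • n u +
        (3 * P.weylSD (K.prj u) / 8 * ∑ i, ∑ j, ψ u i j * raise h u (n u) i j) • ψ u)
        (SmoothMat.weylOp K.isOpen sh h0' sn).continuousOn ?_ (fun u hu => ?_) hu
      · have cw := K.continuousOn_weylSD
        refine ((cw.neg.div_const 2).smul sn.continuousOn).add
          ((((continuousOn_const.mul cw).div_const 8).mul ?_).smul sψ.continuousOn)
        exact continuousOn_finsetSum _ fun i _ => continuousOn_finsetSum _ fun j _ =>
          ((sψ i j).mul (sh.raise h0' sn i j)).continuousOn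
      · have H := K.isFrameCurvature eh hu
        rw [eψ u hu]
        obtain ⟨m, rfl⟩ := exists_frame_form H.det_pos η
        rw [frame_form_transpose, frame_form_neg] at hη
        have hm := frame_form_inj H.det_pos hη
        have hnu : n u = (P.frame (K.prj u) * K.coframe u).transpose *
            ((1 / 2 : ℝ) • (m + frameStar m)) * (P.frame (K.prj u) * K.coframe u) := by
          rw [hn]; beta_reduce
          rw [hodgeStar_frame H.det_pos H.metric, frame_form_add, frame_form_smul]
        rw [skew_eq_sd_add_asd hm, frameStar_sd_add_asd, add_add_sub_cancel, ← two_smul ℝ,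
          smul_smul, show (1 / 2 : ℝ) * 2 = 1 by norm_num, one_smul] at hnu
        refine H.weylOp_formula ?_ ?_
        · rw [hnu, frame_form_transpose, frame_form_neg, sd_skew]
        · rw [hnu, hodgeStar_frame H.det_pos H.metric, frameStar_sd]
    rwa [nu] at key

end Corner

end ChenTeo
end

open Set Filter Topology Manifold Bundle
open scoped ContDiff

noncomputable section

namespace ChenTeo

open Params

namespace Corner

variable {P : Params} (K : Corner P)

/-- The coordinates `(x, y)` define an open map off the axes. -/
lemma map_prj_nhds {u : E4} (hu : u ∈ K.reg) : map K.prj (𝓝 u) = 𝓝 (K.prj u) := by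
  have hd := (K.smooth_prj.contDiffAt (x := u)).hasStrictFDerivAt (by simp)
  refine hd.map_nhds_eq_of_surj (LinearMap.range_eq_top.2 fun w => ?_)
  have hdet : IsUnit (K.coframe u).det := by
    rw [K.det_coframe hu, isUnit_iff_ne_zero]
    have := K.orient.ne'
    contrapose! this
    linarith
  set v : Fin 4 → ℝ := (K.coframe u)⁻¹.mulVec ![w.1, w.2, 0, 0] with hv
  have hv' : (K.coframe u).mulVec v = ![w.1, w.2, 0, 0] := by
    rw [hv, Matrix.mulVec_mulVec, Matrix.mul_nonsing_inv _ hdet, Matrix.one_mulVec]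
  refine ⟨∑ i, v i • (EuclideanSpace.single i (1 : ℝ) : E4), ?_⟩
  have hdiff := K.smooth_prj.differentiable (by simp) u
  have e1 : ∀ i, (fderiv ℝ K.prj u (EuclideanSpace.single i (1 : ℝ))).1 = K.coframe u 0 i := by
    intro i
    have := K.pd_fst u i
    rw [pd, show (fun w => (K.prj w).1) = Prod.fst ∘ K.prj from rfl, fderiv_comp _
      differentiableAt_fst hdiff, fderiv_fst] at this
    exact this
  have e2 : ∀ i, (fderiv ℝ K.prj u (EuclideanSpace.single i (1 : ℝ))).2 = K.coframe u 1 i := by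
    intro i
    have := K.pd_snd u i
    rw [pd, show (fun w => (K.prj w).2) = Prod.snd ∘ K.prj from rfl, fderiv_comp _
      differentiableAt_snd hdiff, fderiv_snd] at this
    exact this
  have f1 := congrFun hv' 0
  have f2 := congrFun hv' 1
  simp only [Matrix.mulVec, dotProduct] at f1 f2
  change fderiv ℝ K.prj u _ = w
  rw [map_sum]
  simp only [map_smul]
  refine Prod.ext ?_ ?_
  · simp only [Prod.fst_sum, Prod.smul_fst, e1, smul_eq_mul]
    exact (Finset.sum_congr rfl fun i _ => mul_comm _ _).trans f1
  · simp only [Prod.snd_sum, Prod.smul_snd, e2, smul_eq_mul]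
    exact (Finset.sum_congr rfl fun i _ => mul_comm _ _).trans f2

end Corner

namespace Params

variable {P : Params}

/-- The set where the anti-self-dual Weyl tensor is algebraically general. -/
def genericSet (P : Params) : Set P.Space := {p | (p.1.1, p.1.2.1) ∈ P.generic}

lemma genericSet_subset : P.genericSet ⊆ P.regular := fun _ hp =>
  ⟨(P.generic_subset hp).1.1, (P.generic_subset hp).1.2, (P.generic_subset hp).2.1,
    (P.generic_subset hp).2.2⟩

lemma isOpen_genericSet : IsOpen P.genericSet :=
  isOpen_generic.preimage (f := fun p : P.Space => (p.1.1, p.1.2.1))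
    ((continuous_fst.comp continuous_subtype_val).prodMk
      (continuous_fst.comp (continuous_snd.comp continuous_subtype_val)))

lemma prj_eq (p₀ : P.Space) {u : E4} (hu : u ∈ (chartAt E4 p₀).target) :
    (cornerAt p₀).prj u = (((chartAt E4 p₀).symm u).1.1, ((chartAt E4 p₀).symm u).1.2.1) :=
  Prod.ext ((isCornerChart_cornerAt p₀).fst u hu).symm ((isCornerChart_cornerAt p₀).snd u hu).symm

lemma dense_genericSet : Dense P.genericSet := by
  refine dense_iff_closure_eq.2 (eq_univ_of_univ_subset ?_)
  rw [← dense_regular.closure_eq]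
  refine closure_minimal (fun p hp => ?_) isClosed_closure
  set e := chartAt E4 p with he
  have hps : p ∈ e.source := mem_chart_source E4 p
  have ht : e p ∈ e.target := e.map_source hps
  have hr : e p ∈ (cornerAt p).reg := by
    rw [← (isCornerChart_cornerAt p).mem_regular ht, e.left_inv hps]; exact hp
  rw [mem_closure_iff_frequently]
  have h1 : ∃ᶠ q in 𝓝 ((cornerAt p).prj (e p)), q ∈ P.generic :=
    mem_closure_iff_frequently.1 (box_subset_closure_generic ((cornerAt p).prj_mem hr))
  rw [← (cornerAt p).map_prj_nhds hr, frequently_map] at h1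
  have h2 : ∃ᶠ u in 𝓝 (e p), e.symm u ∈ P.genericSet := by
    refine (h1.and_eventually (e.open_target.mem_nhds ht)).mono fun u hu => ?_
    rw [prj_eq p hu.2] at hu
    exact hu.1
  have h3 : Tendsto e.symm (𝓝 (e p)) (𝓝 p) := by
    have := e.continuousAt_symm ht
    rwa [ContinuousAt, e.left_inv hps] at this
  exact h3.frequently h2

section

variable {g : Metric P.Space} (hg : P.IsChenTeoMetric g)

lemma smoothMat_gram_cornerAt (p₀ : P.Space) :
    SmoothMat (cornerAt p₀).tgt (gram g (chartAt E4 p₀)) := by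
  rw [← (isCornerChart_cornerAt p₀).target]; exact smoothMat_gram g p₀

lemma gram_posDef_cornerAt (p₀ : P.Space) {u : E4} (hu : u ∈ (cornerAt p₀).tgt) :
    (gram g (chartAt E4 p₀) u).PosDef := by
  rw [← (isCornerChart_cornerAt p₀).target] at hu; exact gram_posDef g p₀ hu

lemma map_mem_tgt (p₀ : P.Space) {p : P.Space} (hp : p ∈ (chartAt E4 p₀).source) :
    chartAt E4 p₀ p ∈ (cornerAt p₀).tgt := by
  rw [← (isCornerChart_cornerAt p₀).target]; exact (chartAt E4 p₀).map_source hp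

lemma map_mem_reg (p₀ : P.Space) {p : P.Space} (hp : p ∈ (chartAt E4 p₀).source)
    (hr : p ∈ P.regular) : chartAt E4 p₀ p ∈ (cornerAt p₀).reg := by
  rw [← (isCornerChart_cornerAt p₀).mem_regular ((chartAt E4 p₀).map_source hp),
    (chartAt E4 p₀).left_inv hp]
  exact hr

include hg

theorem IsChenTeoMetric.isRicciFlat : IsRicciFlat g := by
  intro e he p hp i j
  obtain ⟨p₀, rfl⟩ := exists_chartAt he
  exact (cornerAt p₀).ricci_eq_zero (fun _ hu => hg.gram_eq p₀ hu) (smoothMat_gram_cornerAt p₀)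
    (fun _ hu => gram_posDef_cornerAt p₀ hu) (map_mem_tgt p₀ hp) i j

theorem IsChenTeoMetric.isTypeD (p : P.Space) : IsTypeD g 1 p := by
  intro e he hp
  obtain ⟨p₀, rfl⟩ := exists_chartAt he
  exact (cornerAt p₀).ncard_weylEigenvalues_pos (fun _ hu => hg.gram_eq p₀ hu)
    (smoothMat_gram_cornerAt p₀) (fun _ hu => gram_posDef_cornerAt p₀ hu) (map_mem_tgt p₀ hp)

theorem IsChenTeoMetric.isTypeI {p : P.Space} (h : p ∈ P.genericSet) : IsTypeI g (-1) p := by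
  intro e he hp
  obtain ⟨p₀, rfl⟩ := exists_chartAt he
  refine (cornerAt p₀).ncard_weylEigenvalues_neg (fun _ hu => hg.gram_eq p₀ hu)
    (map_mem_reg p₀ hp (genericSet_subset h)) ?_
  rw [prj_eq p₀ ((chartAt E4 p₀).map_source hp), (chartAt E4 p₀).left_inv hp]
  exact h

end

end Params

end ChenTeo
end

open Set Filter Topology Manifold Bundle
open scoped ContDiff

noncomputable section

namespace ChenTeo

open Params

/-- The Nijenhuis tensor of a matrix-valued function. -/
def nijenhuis (E : E4 → Mat4) (u : E4) (i j k : Fin 4) : ℝ :=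
  ∑ l, (E u l i * pd l (fun v => E v k j) u - E u l j * pd l (fun v => E v k i) u -
    E u k l * (pd i (fun v => E v l j) u - pd j (fun v => E v l i) u))

lemma contDiffOn_nijenhuis {V : Set E4} (hV : IsOpen V) {E : E4 → Mat4} (sE : SmoothMat V E)
    (i j k : Fin 4) : ContDiffOn ℝ ∞ (fun u => nijenhuis E u i j k) V :=
  ContDiffOn.sum fun _ _ => (((sE _ _).mul (contDiffOn_pd hV _ (sE _ _))).sub
    ((sE _ _).mul (contDiffOn_pd hV _ (sE _ _)))).sub
    ((sE _ _).mul ((contDiffOn_pd hV _ (sE _ _)).sub (contDiffOn_pd hV _ (sE _ _))))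

/-- A closed 1-form `η` for which `η ∘ J` is closed too annihilates the Nijenhuis tensor. -/
lemma sum_mul_nijenhuis {V : Set E4} (hV : IsOpen V) {E : E4 → Mat4} (sE : SmoothMat V E)
    {η ζ : Fin 4 → E4 → ℝ} (sη : ∀ i, ContDiffOn ℝ ∞ (η i) V) (sζ : ∀ i, ContDiffOn ℝ ∞ (ζ i) V)
    (cη : ∀ v ∈ V, ∀ i j, pd i (η j) v = pd j (η i) v)
    (cζ : ∀ v ∈ V, ∀ i j, pd i (ζ j) v = pd j (ζ i) v)
    (h1 : ∀ v ∈ V, ∀ j, ζ j v = ∑ k, η k v * E v k j)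
    (h2 : ∀ v ∈ V, ∀ j, η j v = -∑ k, ζ k v * E v k j) {u : E4} (hu : u ∈ V) (i j : Fin 4) :
    ∑ k, η k u * nijenhuis E u i j k = 0 := by
  have d : ∀ {f : E4 → ℝ}, ContDiffOn ℝ ∞ f V → DifferentiableAt ℝ f u :=
    fun hf => diffAt_of_contDiffOn hf hV hu
  have A : ∀ {a : Fin 4 → E4 → ℝ}, (∀ i, ContDiffOn ℝ ∞ (a i) V) → ∀ i j,
      pd i (fun v => ∑ k, a k v * E v k j) u =
        (∑ k, pd i (a k) u * E u k j) + ∑ k, a k u * pd i (fun v => E v k j) u := by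
    intro a ha i j
    rw [pd_sum _ _ fun k _ => (d (ha k)).fun_mul (d (sE k j)), ← Finset.sum_add_distrib]
    exact Finset.sum_congr rfl fun k _ => pd_mul i (d (ha k)) (d (sE k j))
  have A1 : ∀ i j, ∑ k, η k u * pd i (fun v => E v k j) u =
      pd i (ζ j) u - ∑ k, pd i (η k) u * E u k j := by
    intro i j
    rw [pd_congr i (eventually_of_mem (hV.mem_nhds hu) fun v hv => h1 v hv j), A sη]
    ring
  have A2 : ∀ i j, ∑ k, ζ k u * pd i (fun v => E v k j) u =
      -pd i (η j) u - ∑ k, pd i (ζ k) u * E u k j := by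
    intro i j
    have : pd i (η j) u = 0 - pd i (fun v => ∑ k, ζ k v * E v k j) u := by
      rw [← pd_const (u := u) i 0, ← pd_sub i (differentiableAt_const _)
        (DifferentiableAt.fun_sum fun k _ => (d (sζ k)).fun_mul (d (sE k j)))]
      exact pd_congr i (eventually_of_mem (hV.mem_nhds hu) fun v hv => by
        rw [h2 v hv j]; exact (zero_sub _).symm)
    rw [A sζ] at this
    linarith
  have e : ∑ k, η k u * nijenhuis E u i j k =
      (∑ l, E u l i * ∑ k, η k u * pd l (fun v => E v k j) u) -
      (∑ l, E u l j * ∑ k, η k u * pd l (fun v => E v k i) u) -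
      ((∑ l, ζ l u * pd i (fun v => E v l j) u) - ∑ l, ζ l u * pd j (fun v => E v l i) u) := by
    simp only [nijenhuis, h1 u hu, Finset.mul_sum, Finset.sum_mul]
    rw [Finset.sum_comm]
    simp only [← Finset.sum_sub_distrib]
    exact Finset.sum_congr rfl fun l _ => Finset.sum_congr rfl fun k _ => by ring
  rw [e, A2, A2, cη u hu i j]
  simp only [A1, mul_sub, Finset.sum_sub_distrib, Finset.mul_sum]
  have s1 : ∑ l, ∑ k, E u l j * (pd l (η k) u * E u k i) =
      ∑ l, ∑ k, E u l i * (pd l (η k) u * E u k j) := by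
    rw [Finset.sum_comm]
    exact Finset.sum_congr rfl fun l _ => Finset.sum_congr rfl fun k _ => by
      rw [cη u hu k l]; ring
  have s2 : ∀ i j, ∑ k, pd i (ζ k) u * E u k j = ∑ k, E u k j * pd k (ζ i) u := fun i j =>
    Finset.sum_congr rfl fun k _ => by rw [cζ u hu i k, mul_comm]
  rw [s1, s2, s2]
  ring

namespace ToricCoords

variable {V : Set E4} {W : Set (ℝ × ℝ)} {prj : E4 → ℝ × ℝ} {T Φ : Fin 4 → E4 → ℝ} {ξ : E4 → Mat4}

/-- The form `a dx + b dy` is closed if `∂a/∂y = ∂b/∂x`. -/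
lemma closed_dx_dy (H : ToricCoords V W prj T Φ ξ) {a b : ℝ × ℝ → ℝ} (ha : ContDiffOn ℝ ∞ a W)
    (hb : ContDiffOn ℝ ∞ b W) (hab : ∀ p ∈ W, dir 1 a p = dir 0 b p) {v : E4} (hv : v ∈ V)
    (i j : Fin 4) : pd i (fun v => a (prj v) * ξ v 0 j + b (prj v) * ξ v 1 j) v =
      pd j (fun v => a (prj v) * ξ v 0 i + b (prj v) * ξ v 1 i) v := by
  have d : ∀ {f : E4 → ℝ}, ContDiffOn ℝ ∞ f V → DifferentiableAt ℝ f v :=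
    fun hf => diffAt_of_contDiffOn hf H.isOpen hv
  have da := d (H.smooth_comp ha)
  have db := d (H.smooth_comp hb)
  have dξ := fun A i => d (H.smooth_ξ A i)
  have key : ∀ i j, pd i (fun v => a (prj v) * ξ v 0 j + b (prj v) * ξ v 1 j) v =
      (∑ A, ξ v A i * dir A a (prj v)) * ξ v 0 j + a (prj v) * pd i (fun w => ξ w 0 j) v +
      ((∑ A, ξ v A i * dir A b (prj v)) * ξ v 1 j + b (prj v) * pd i (fun w => ξ w 1 j) v) := by
    intro i j
    rw [pd_add i (da.fun_mul (dξ 0 j)) (db.fun_mul (dξ 1 j)), pd_mul i da (dξ 0 j),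
      pd_mul i db (dξ 1 j), H.pd_comp ha hv, H.pd_comp hb hv]
  rw [key, key, H.closed_ξ hv 0 i j, H.closed_ξ hv 1 i j]
  have h2 : ∀ f : ℝ × ℝ → ℝ, dir 2 f (prj v) = 0 := fun f => by simp [dir]
  have h3 : ∀ f : ℝ × ℝ → ℝ, dir 3 f (prj v) = 0 := fun f => by simp [dir]
  simp only [Fin.sum_univ_four, h2, h3, hab _ (H.mapsTo v hv)]
  ring

end ToricCoords

namespace Params

variable {P : Params} {p : ℝ × ℝ}

/-- The coefficients of `dτ ∘ J = a dx + b dy` and `dφ ∘ J = c dx + d dy`. -/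
def coefTx (P : Params) (p : ℝ × ℝ) : ℝ := P.κ * (P.fB p / P.quartic p.1)
def coefTy (P : Params) (p : ℝ × ℝ) : ℝ := P.κ * (-P.fA p / P.quartic p.2)
def coefΦx (P : Params) (p : ℝ × ℝ) : ℝ := P.κ * (-p.1 / P.quartic p.1)
def coefΦy (P : Params) (p : ℝ × ℝ) : ℝ := P.κ * (p.2 / P.quartic p.2)

lemma fBy_fAx (hp : p ∈ P.box) : P.fBy p * P.quartic p.2 + P.fAx p * P.quartic p.1 = 0 := by
  have hD := sub_ne hp
  rw [fBy, fAx, div_mul_eq_mul_div, div_mul_eq_mul_div, ← add_div, div_eq_zero_iff]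
  left
  simp only [numBy, numB, numAx, numA, quartic, a₀_eq]
  ring

lemma contDiffOn_quartic_fst : ContDiffOn ℝ ∞ (fun p : ℝ × ℝ => P.quartic p.1) P.box :=
  (P.contDiff_quartic.comp contDiff_fst).contDiffOn

lemma contDiffOn_quartic_snd : ContDiffOn ℝ ∞ (fun p : ℝ × ℝ => P.quartic p.2) P.box :=
  (P.contDiff_quartic.comp contDiff_snd).contDiffOn

lemma contDiffOn_coefTx : ContDiffOn ℝ ∞ P.coefTx P.box :=
  contDiffOn_const.mul (P.contDiffOn_fB.div contDiffOn_quartic_fst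
    fun _ hp => (box_facts hp).2.2.2.1.ne')

lemma contDiffOn_coefTy : ContDiffOn ℝ ∞ P.coefTy P.box :=
  contDiffOn_const.mul (P.contDiffOn_fA.neg.div contDiffOn_quartic_snd
    fun _ hp => (box_facts hp).2.2.2.2.ne)

lemma contDiffOn_coefΦx : ContDiffOn ℝ ∞ P.coefΦx P.box :=
  contDiffOn_const.mul (contDiff_fst.neg.contDiffOn.div contDiffOn_quartic_fst
    fun _ hp => (box_facts hp).2.2.2.1.ne')

lemma contDiffOn_coefΦy : ContDiffOn ℝ ∞ P.coefΦy P.box :=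
  contDiffOn_const.mul (contDiff_snd.contDiffOn.div contDiffOn_quartic_snd
    fun _ hp => (box_facts hp).2.2.2.2.ne)

lemma dir_coefT (hp : p ∈ P.box) : dir 1 P.coefTx p = dir 0 P.coefTy p := by
  have hX : P.quartic p.1 ≠ 0 := (box_facts hp).2.2.2.1.ne'
  have hY : P.quartic p.2 ≠ 0 := (box_facts hp).2.2.2.2.ne
  have h1 := (HasDir.const P.κ).mul ((hasDir_fB hp).div (P.hasDir_X p) hX)
  have h2 := (HasDir.const P.κ).mul ((hasDir_fA hp).neg.div (P.hasDir_Y p) hY)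
  unfold coefTx coefTy
  rw [h1.dir_one, h2.dir_zero]
  have := fBy_fAx hp
  field_simp
  linear_combination P.κ * P.quartic p.1 * P.quartic p.2 * this

lemma dir_coefΦ (hp : p ∈ P.box) : dir 1 P.coefΦx p = dir 0 P.coefΦy p := by
  have hX : P.quartic p.1 ≠ 0 := (box_facts hp).2.2.2.1.ne'
  have hY : P.quartic p.2 ≠ 0 := (box_facts hp).2.2.2.2.ne
  have h1 := (HasDir.const (p := p) P.κ).mul (HasDir.fst.neg.div (P.hasDir_X p) hX)
  have h2 := (HasDir.const (p := p) P.κ).mul (HasDir.snd.div (P.hasDir_Y p) hY)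
  unfold coefΦx coefΦy
  rw [h1.dir_one, h2.dir_zero]
  simp

/-- The forms `dτ ∘ J` and `dφ ∘ J`. -/
lemma angle_comp (hp : p ∈ P.box) {ξ E : Mat4}
    (hE : P.frame p * ξ * E = -(sd 1 0 0 * (P.frame p * ξ))) (j : Fin 4) :
    (ξ * E) 2 j = P.coefTx p * ξ 0 j + P.coefTy p * ξ 1 j ∧
      (ξ * E) 3 j = P.coefΦx p * ξ 0 j + P.coefΦy p * ξ 1 j := by
  have hs := (fs_pos hp).ne'
  have ht := (ft_pos hp).ne'
  have he := (fe_pos hp).ne'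
  have hD := sub_ne hp
  have hN := N_ne hp
  have hh := h_ne hp
  have hX : P.quartic p.1 ≠ 0 := (box_facts hp).2.2.2.1.ne'
  have hY : P.quartic p.2 ≠ 0 := (box_facts hp).2.2.2.2.ne
  rw [Matrix.mul_assoc] at hE
  set M := ξ * E with hM
  have r2 := congrFun (congrFun hE 2) j
  have r3 := congrFun (congrFun hE 3) j
  simp only [Matrix.mul_apply, Matrix.neg_apply, Fin.sum_univ_four, frame, sd, Matrix.of_apply] at r2 r3
  simp at r2 r3
  have q2 : p.2 * M 2 j + P.fA p * M 3 j =
      P.κ * (P.N p.1 p.2 * P.h p.1 p.2) / ((p.1 - p.2) * P.quartic p.1) * ξ 0 j := by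
    have : p.2 * M 2 j + P.fA p * M 3 j = P.fe p / P.fs p *
        (P.fs p * p.2 / P.fe p * M 2 j + P.fs p * P.fA p / P.fe p * M 3 j) := by
      field_simp
    rw [this, r2, ← fs_sq hp]
    have := fe_sq hp
    field_simp
    linear_combination P.κ * ξ 0 j * this
  have q3 : p.1 * M 2 j + P.fB p * M 3 j =
      P.κ * (P.N p.1 p.2 * P.h p.1 p.2) / ((p.1 - p.2) * P.quartic p.2) * ξ 1 j := by
    have : p.1 * M 2 j + P.fB p * M 3 j = P.fe p / P.ft p *
        (P.ft p * p.1 / P.fe p * M 2 j + P.ft p * P.fB p / P.fe p * M 3 j) := by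
      field_simp
    rw [this, r3, show P.quartic p.2 = -P.ft p ^ 2 by rw [ft_sq hp, neg_neg]]
    have := fe_sq hp
    field_simp
    linear_combination -P.κ * ξ 1 j * this
  have hdet : p.2 * P.fB p - p.1 * P.fA p = P.N p.1 p.2 * P.h p.1 p.2 / (p.1 - p.2) := by
    have := P.numB_sub_numA p.1 p.2
    rw [fA, fB]
    field_simp
    linear_combination this
  have hdet0 : P.N p.1 p.2 * P.h p.1 p.2 / (p.1 - p.2) ≠ 0 := div_ne_zero (mul_ne_zero hN hh) hD
  constructor
  · apply mul_left_cancel₀ hdet0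
    have : P.N p.1 p.2 * P.h p.1 p.2 / (p.1 - p.2) * M 2 j =
        P.fB p * (p.2 * M 2 j + P.fA p * M 3 j) - P.fA p * (p.1 * M 2 j + P.fB p * M 3 j) := by
      rw [← hdet]; ring
    rw [this, q2, q3, coefTx, coefTy]
    field_simp
    ring
  · apply mul_left_cancel₀ hdet0
    have : P.N p.1 p.2 * P.h p.1 p.2 / (p.1 - p.2) * M 3 j =
        p.2 * (p.1 * M 2 j + P.fB p * M 3 j) - p.1 * (p.2 * M 2 j + P.fA p * M 3 j) := by
      rw [← hdet]; ring
    rw [this, q2, q3, coefΦx, coefΦy]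
    field_simp
    ring

end Params

namespace Corner

variable {P : Params} (K : Corner P) {h E : E4 → Mat4}

lemma sd_sq : sd 1 0 0 * sd 1 0 0 = -1 := by
  ext a b
  fin_cases a <;> fin_cases b <;> simp [sd, Matrix.mul_apply, Fin.sum_univ_four]

section

variable (sE : SmoothMat K.tgt E) (hE : ∀ u ∈ K.reg, P.frame (K.prj u) * K.coframe u * E u =
  -(sd 1 0 0 * (P.frame (K.prj u) * K.coframe u)))

include hE in
lemma mul_self_of_reg {u : E4} (hu : u ∈ K.reg) : E u * E u = -1 := by
  have hdet : 0 < (P.frame (K.prj u) * K.coframe u).det := by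
    rw [Matrix.det_mul]
    exact mul_pos (frame_det (K.prj_mem hu)) (K.toricCoords.det_pos u hu)
  have e := hE u hu
  set θ := P.frame (K.prj u) * K.coframe u
  have hu : IsUnit θ.det := isUnit_iff_ne_zero.2 hdet.ne'
  have h1 : θ * (E u * E u) = θ * -1 := by
    rw [← Matrix.mul_assoc, e, Matrix.neg_mul, Matrix.mul_assoc, e, Matrix.mul_neg, neg_neg,
      ← Matrix.mul_assoc, sd_sq, Matrix.neg_mul, Matrix.one_mul, Matrix.mul_neg, Matrix.mul_one]
  have := congrArg (fun A => θ⁻¹ * A) h1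
  simpa only [Matrix.nonsing_inv_mul_cancel_left _ _ hu] using this

include sE hE in
lemma mul_self_eq {u : E4} (hu : u ∈ K.tgt) : E u * E u = -1 :=
  K.eqOn_of_reg (f := fun u => E u * E u) (g := fun _ => -1) (sE.mul sE).continuousOn
    continuousOn_const (fun _ hu => K.mul_self_of_reg hE hu) hu

include sE hE in
lemma orthogonal_eq (sh : SmoothMat K.tgt h)
    (eh : ∀ u ∈ K.reg, h u = (P.frame (K.prj u) * K.coframe u).transpose *
      (P.frame (K.prj u) * K.coframe u)) {u : E4} (hu : u ∈ K.tgt) :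
    (E u).transpose * h u * E u = h u := by
  refine K.eqOn_of_reg (f := fun u => (E u).transpose * h u * E u) (g := h)
    ((sE.transpose.mul sh).mul sE).continuousOn sh.continuousOn (fun u hu => ?_) hu
  have e := hE u hu
  rw [eh u hu]
  generalize P.frame (K.prj u) * K.coframe u = θ at e
  have : (E u).transpose * (θ.transpose * θ) * E u = (θ * E u).transpose * (θ * E u) := by
    rw [Matrix.transpose_mul]; simp only [Matrix.mul_assoc]
  rw [this, e, Matrix.transpose_neg, Matrix.neg_mul, Matrix.mul_neg, neg_neg, Matrix.transpose_mul, sd_skew,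
    Matrix.mul_assoc, ← Matrix.mul_assoc (-sd 1 0 0), Matrix.neg_mul, sd_sq, neg_neg,
    Matrix.one_mul]

include sE hE in
lemma nijenhuis_eq_zero {u : E4} (hu : u ∈ K.tgt) (i j k : Fin 4) : nijenhuis E u i j k = 0 := by
  refine K.eqOn_of_reg (f := fun u => nijenhuis E u i j k) (g := fun _ => 0)
    (contDiffOn_nijenhuis K.isOpen sE i j k).continuousOn continuousOn_const (fun u hu => ?_) hu
  have H := K.toricCoords
  have sE' : SmoothMat K.reg E := fun a b => (sE a b).mono K.reg_subset
  have hζ : ∀ v ∈ K.reg, ∀ j,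
      (∑ k, K.coframe v 2 k * E v k j = P.coefTx (K.prj v) * K.coframe v 0 j +
        P.coefTy (K.prj v) * K.coframe v 1 j) ∧
      ∑ k, K.coframe v 3 k * E v k j = P.coefΦx (K.prj v) * K.coframe v 0 j +
        P.coefΦy (K.prj v) * K.coframe v 1 j := fun v hv j =>
    angle_comp (K.prj_mem hv) (hE v hv) j
  have hE2 : ∀ v ∈ K.reg, ∀ A j, K.coframe v A j =
      -∑ k, (∑ l, K.coframe v A l * E v l k) * E v k j := by
    intro v hv A j
    have : (K.coframe v * E v * E v) A j = -K.coframe v A j := by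
      rw [Matrix.mul_assoc, K.mul_self_of_reg hE hv, Matrix.mul_neg, Matrix.mul_one]; rfl
    rw [Matrix.mul_apply] at this
    rw [← neg_neg (K.coframe v A j), ← this]
    rfl
  have key : ∀ (A : Fin 4) (a b : ℝ × ℝ → ℝ), ContDiffOn ℝ ∞ a P.box → ContDiffOn ℝ ∞ b P.box →
      (∀ p ∈ P.box, dir 1 a p = dir 0 b p) → (∀ v ∈ K.reg, ∀ j, ∑ k, K.coframe v A k * E v k j =
        a (K.prj v) * K.coframe v 0 j + b (K.prj v) * K.coframe v 1 j) →
      ∑ k, K.coframe u A k * nijenhuis E u i j k = 0 ∧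
      a (K.prj u) * (∑ k, K.coframe u 0 k * nijenhuis E u i j k) +
        b (K.prj u) * (∑ k, K.coframe u 1 k * nijenhuis E u i j k) = 0 := by
    intro A a b sa sb hab h1
    have sη : ∀ i, ContDiffOn ℝ ∞ (fun v => K.coframe v A i) K.reg := fun i => H.smooth_ξ A i
    have sζ : ∀ i, ContDiffOn ℝ ∞ (fun v => a (K.prj v) * K.coframe v 0 i +
        b (K.prj v) * K.coframe v 1 i) K.reg := fun i =>
      ((H.smooth_comp sa).mul (H.smooth_ξ 0 i)).add ((H.smooth_comp sb).mul (H.smooth_ξ 1 i))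
    have cη : ∀ v ∈ K.reg, ∀ i j, pd i (fun v => K.coframe v A j) v =
        pd j (fun v => K.coframe v A i) v := fun v hv i j => H.closed_ξ hv A i j
    have cζ := fun v (hv : v ∈ K.reg) i j => H.closed_dx_dy sa sb hab hv i j
    have e1 : ∀ v ∈ K.reg, ∀ j, a (K.prj v) * K.coframe v 0 j + b (K.prj v) * K.coframe v 1 j =
        ∑ k, K.coframe v A k * E v k j := fun v hv j => (h1 v hv j).symm
    have e2 : ∀ v ∈ K.reg, ∀ j, K.coframe v A j = -∑ k, (a (K.prj v) * K.coframe v 0 k +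
        b (K.prj v) * K.coframe v 1 k) * E v k j := fun v hv j => by
      rw [hE2 v hv A j]
      simp only [h1 v hv]
    refine ⟨sum_mul_nijenhuis H.isOpen sE' sη sζ cη cζ e1 e2 hu i j, ?_⟩
    have := sum_mul_nijenhuis (η := fun i v => a (K.prj v) * K.coframe v 0 i +
        b (K.prj v) * K.coframe v 1 i) (ζ := fun i v => -K.coframe v A i) H.isOpen sE' sζ
      (fun i => (sη i).neg) cζ (fun v hv i j => ?_) (fun v hv j => ?_) (fun v hv j => ?_) hu i j
    · rw [← this, Finset.mul_sum, Finset.mul_sum, ← Finset.sum_add_distrib]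
      exact Finset.sum_congr rfl fun k _ => by ring
    · simp only [pd, fderiv_fun_neg, neg_apply]
      exact congrArg _ (cη v hv i j)
    · rw [e2 v hv j, neg_neg]
    · rw [e1 v hv j, ← Finset.sum_neg_distrib]
      exact Finset.sum_congr rfl fun k _ => by ring
  obtain ⟨k1, k2⟩ := key 2 _ _ contDiffOn_coefTx contDiffOn_coefTy (fun _ hp => dir_coefT hp)
    fun v hv j => (hζ v hv j).1
  obtain ⟨k3, k4⟩ := key 3 _ _ contDiffOn_coefΦx contDiffOn_coefΦy (fun _ hp => dir_coefΦ hp)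
    fun v hv j => (hζ v hv j).2
  obtain ⟨hD, hN, hh, hX, hY⟩ := box_facts (K.prj_mem hu)
  have hκ := (κ_pos (P := P)).ne'
  have hdet : P.coefTx (K.prj u) * P.coefΦy (K.prj u) - P.coefTy (K.prj u) * P.coefΦx (K.prj u) ≠
      0 := by
    have := P.numB_sub_numA (K.prj u).1 (K.prj u).2
    have e : P.coefTx (K.prj u) * P.coefΦy (K.prj u) - P.coefTy (K.prj u) * P.coefΦx (K.prj u) =
        P.κ ^ 2 * (P.N (K.prj u).1 (K.prj u).2 * P.h (K.prj u).1 (K.prj u).2) /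
        (((K.prj u).1 - (K.prj u).2) * P.quartic (K.prj u).1 * P.quartic (K.prj u).2) := by
      have := hX.ne'
      have := hY.ne
      have := hD.ne'
      simp only [coefTx, coefTy, coefΦx, coefΦy, fA, fB]
      field_simp
      linear_combination P.numB_sub_numA (K.prj u).1 (K.prj u).2
    rw [e]
    exact div_ne_zero (mul_ne_zero (pow_ne_zero 2 hκ) (mul_ne_zero hN.ne hh.ne))
      (mul_ne_zero (mul_ne_zero hD.ne' hX.ne') hY.ne)
  have k5 : ∑ k, K.coframe u 0 k * nijenhuis E u i j k = 0 := by
    apply mul_left_cancel₀ hdet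
    linear_combination P.coefΦy (K.prj u) * k2 - P.coefTy (K.prj u) * k4
  have k6 : ∑ k, K.coframe u 1 k * nijenhuis E u i j k = 0 := by
    apply mul_left_cancel₀ hdet
    linear_combination P.coefTx (K.prj u) * k4 - P.coefΦx (K.prj u) * k2
  have k7 : (K.coframe u).mulVec (nijenhuis E u i j) = 0 := by
    ext A
    fin_cases A
    exacts [k5, k6, k1, k3]
  exact congrFun (Matrix.eq_zero_of_mulVec_eq_zero (H.det_pos u hu).ne' k7) k

end

end Corner

end ChenTeo
end

open Set Filter Topology Manifold Bundle
open scoped ContDiff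

noncomputable section

namespace ChenTeo

open Params

section

variable {M : Type} [TopologicalSpace M] [ChartedSpace E4 M] [IsManifold (𝓡 4) ∞ M]

lemma end_frameVec (J : EndField M) (p₀ : M) {u : E4} (hu : u ∈ (chartAt E4 p₀).target)
    (j : Fin 4) : J ((chartAt E4 p₀).symm u) (frameVec p₀ j ((chartAt E4 p₀).symm u)) =
      ∑ i, endMatrix J (chartAt E4 p₀) u i j • frameVec p₀ i ((chartAt E4 p₀).symm u) := by
  conv_lhs => rw [eq_sum_frameVec ((chartAt E4 p₀).map_target hu) (J _ _)]
  simp only [endMatrix_apply J p₀ hu]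

/-- `Jᵀ g` is the matrix of `g(J·, ·)`. -/
lemma endMatrix_transpose_mul_gram (g : Metric M) (J : EndField M) (p₀ : M) {u : E4}
    (hu : u ∈ (chartAt E4 p₀).target) (i j : Fin 4) :
    ((endMatrix J (chartAt E4 p₀) u).transpose * gram g (chartAt E4 p₀) u) i j =
      g.inner ((chartAt E4 p₀).symm u) (J ((chartAt E4 p₀).symm u)
        (frameVec p₀ i ((chartAt E4 p₀).symm u))) (frameVec p₀ j ((chartAt E4 p₀).symm u)) := by
  rw [end_frameVec J p₀ hu, Matrix.mul_apply]
  simp only [map_sum, map_smul, sum_apply, smul_apply, smul_eq_mul, Matrix.transpose_apply,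
    gram_eq_bilinMatrix g p₀ hu, bilinMatrix]

lemma end_end_frameVec (J : EndField M) (p₀ : M) {u : E4} (hu : u ∈ (chartAt E4 p₀).target)
    (j : Fin 4) : J ((chartAt E4 p₀).symm u) (J ((chartAt E4 p₀).symm u)
      (frameVec p₀ j ((chartAt E4 p₀).symm u))) =
      ∑ i, (endMatrix J (chartAt E4 p₀) u * endMatrix J (chartAt E4 p₀) u) i j •
        frameVec p₀ i ((chartAt E4 p₀).symm u) := by
  rw [end_frameVec J p₀ hu]
  simp only [map_sum, map_smul, end_frameVec J p₀ hu, Finset.smul_sum, smul_smul,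
    Matrix.mul_apply, Finset.sum_smul]
  rw [Finset.sum_comm]
  exact Finset.sum_congr rfl fun i _ => Finset.sum_congr rfl fun l _ => by rw [mul_comm]

/-- `J² = -1` if this holds in the charts. -/
lemma end_sq (J : EndField M) (p : M) (h : endMatrix J (chartAt E4 p) (chartAt E4 p p) *
    endMatrix J (chartAt E4 p) (chartAt E4 p p) = -1) (v : TangentSpace (𝓡 4) p) :
    J p (J p v) = -v := by
  have hp := mem_chart_source E4 p
  have key : ∀ j, J p (J p (frameVec p j p)) = -frameVec p j p := by
    intro j
    have := end_end_frameVec J p ((chartAt E4 p).map_source hp) j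
    rw [(chartAt E4 p).left_inv hp, h] at this
    rw [this]
    simp [Matrix.one_apply]
  rw [eq_sum_frameVec hp v]
  simp only [map_sum, map_smul, key, smul_neg, Finset.sum_neg_distrib]

/-- `g` is `J`-invariant if this holds in the charts. -/
lemma end_orthogonal (g : Metric M) (J : EndField M) (p : M)
    (h : (endMatrix J (chartAt E4 p) (chartAt E4 p p)).transpose *
      gram g (chartAt E4 p) (chartAt E4 p p) * endMatrix J (chartAt E4 p) (chartAt E4 p p) =
      gram g (chartAt E4 p) (chartAt E4 p p)) (v w : TangentSpace (𝓡 4) p) :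
    g.inner p (J p v) (J p w) = g.inner p v w := by
  have hp := mem_chart_source E4 p
  have ht := (chartAt E4 p).map_source hp
  have key : ∀ i j, g.inner p (J p (frameVec p i p)) (J p (frameVec p j p)) =
      g.inner p (frameVec p i p) (frameVec p j p) := by
    intro i j
    have e1 := congrFun (congrFun h i) j
    have e2 := end_frameVec J p ht j
    rw [Matrix.mul_apply] at e1
    simp only [endMatrix_transpose_mul_gram g J p ht] at e1
    rw [gram_eq_bilinMatrix g p ht, bilinMatrix] at e1
    rw [(chartAt E4 p).left_inv hp] at e1 e2
    rw [← e1, e2]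
    simp only [map_sum, map_smul, smul_eq_mul]
    exact Finset.sum_congr rfl fun k _ => mul_comm _ _
  conv_lhs => rw [eq_sum_frameVec hp v, eq_sum_frameVec hp w]
  conv_rhs => rw [eq_sum_frameVec hp v, eq_sum_frameVec hp w]
  simp only [map_sum, map_smul, sum_apply, smul_apply, key]

end

namespace Params

variable {P : Params} {g : Metric P.Space} (hg : P.IsChenTeoMetric g)

include hg in
lemma IsChenTeoMetric.frame_mul_endMatrix {J : EndField P.Space}
    (hJ : ∀ p ∈ P.regular, ∀ v w, g.inner p (J p v) w = toricForm (sd 1 0 0) p v w) (p₀ : P.Space)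
    {u : E4} (hu : u ∈ (cornerAt p₀).reg) :
    P.frame ((cornerAt p₀).prj u) * (cornerAt p₀).coframe u * endMatrix J (chartAt E4 p₀) u =
      -(sd 1 0 0 * (P.frame ((cornerAt p₀).prj u) * (cornerAt p₀).coframe u)) := by
  have ht := reg_subset_target p₀ hu
  have e : (endMatrix J (chartAt E4 p₀) u).transpose * gram g (chartAt E4 p₀) u =
      (P.frame ((cornerAt p₀).prj u) * (cornerAt p₀).coframe u).transpose * sd 1 0 0 *
        (P.frame ((cornerAt p₀).prj u) * (cornerAt p₀).coframe u) := by
    ext i j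
    rw [endMatrix_transpose_mul_gram g J p₀ ht, hJ _ (symm_mem_regular p₀ hu),
      ← coordVec_chartAt p₀ ht, ← coordVec_chartAt p₀ ht, toricForm_coordVec _ p₀ hu, frameForm,
      Matrix.transpose_mul]
    simp only [Matrix.mul_assoc]
  have hdet := ((cornerAt p₀).isFrameCurvature (fun _ hu => hg.gram_eq p₀ hu) hu).det_pos
  rw [hg.gram_eq p₀ hu] at e
  generalize P.frame ((cornerAt p₀).prj u) * (cornerAt p₀).coframe u = θ at e hdet
  have hu : IsUnit θ.det := isUnit_iff_ne_zero.2 hdet.ne'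
  rw [← Matrix.mul_assoc] at e
  have e2 := congrArg (fun A => A * θ⁻¹) e
  simp only [Matrix.mul_nonsing_inv_cancel_right _ _ hu] at e2
  have e3 := congrArg Matrix.transpose e2
  rw [Matrix.transpose_mul, Matrix.transpose_mul, Matrix.transpose_transpose,
    Matrix.transpose_transpose, sd_skew, Matrix.neg_mul] at e3
  exact e3

include hg in
theorem IsChenTeoMetric.exists_isHermitian : ∃ J : EndField P.Space, IsHermitian g J := by
  choose h sh eh using fun p₀ : P.Space => (cornerAt p₀).exists_form
  obtain ⟨φ, sφ, hφ, -⟩ := exists_toric_bilin (sd 1 0 0) h sh eh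
  obtain ⟨J, sJ, hJ⟩ := exists_end g sφ
  have hE := fun p₀ u (hu : u ∈ (cornerAt p₀).reg) =>
    hg.frame_mul_endMatrix (fun p hp v w => by rw [hJ, hφ p hp]) p₀ hu
  have sE : ∀ p₀, SmoothMat (cornerAt p₀).tgt (endMatrix J (chartAt E4 p₀)) := fun p₀ => by
    rw [← (isCornerChart_cornerAt p₀).target]; exact smoothMat_endMatrix sJ p₀
  refine ⟨J, sJ, fun p v => ?_, fun p v w => ?_, fun e he p hp i j k => ?_⟩
  · exact end_sq J p
      ((cornerAt p).mul_self_eq (sE p) (hE p) (map_mem_tgt p (mem_chart_source E4 p))) v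
  · exact end_orthogonal g J p ((cornerAt p).orthogonal_eq (sE p) (hE p)
      (smoothMat_gram_cornerAt p) (fun _ hu => hg.gram_eq p hu)
      (map_mem_tgt p (mem_chart_source E4 p))) v w
  · obtain ⟨p₀, rfl⟩ := exists_chartAt he
    exact (cornerAt p₀).nijenhuis_eq_zero (sE p₀) (hE p₀) (map_mem_tgt p₀ hp) i j k

end Params

end ChenTeo
end

open Set Filter Topology Manifold Bundle
open scoped ContDiff

noncomputable section

namespace ChenTeo

open Params

/-- The algebra behind the fact that a Hermitian structure with closed fundamental form is
parallel: `B` stands for the covariant derivative of the fundamental form. -/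
lemma eq_zero_of_hermitian_closed {B : Fin 4 → Mat4} {E : Mat4} (hE : E * E = -1)
    (hskew : ∀ i, (B i).transpose = -B i) (hcomm : ∀ i, E.transpose * B i = B i * E)
    (hN : ∀ i j k, (∑ l, E l i * B l j k) + (B i * E) j k = (∑ l, E l j * B l i k) + (B j * E) i k)
    (hc : ∀ i j k, B i j k + B j k i + B k i j = 0) (i : Fin 4) : B i = 0 := by
  have sk : ∀ i j k, B i k j = -B i j k := fun i j k => congrFun (congrFun (hskew i) j) k
  have skE : ∀ i j k, (B i * E) k j = -(B i * E) j k := by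
    intro i j k
    have : (B i * E).transpose = -(B i * E) := by
      rw [Matrix.transpose_mul, hskew, Matrix.mul_neg, hcomm]
    exact congrFun (congrFun this j) k
  have h1 : ∀ i j k, ∑ l, E l i * B l j k = -(B i * E) j k := by
    set S : Fin 4 → Fin 4 → Fin 4 → ℝ := fun i j k => (∑ l, E l i * B l j k) + (B i * E) j k with hS
    have s1 : ∀ i j k, S i j k = S j i k := hN
    have s2 : ∀ i j k, S i k j = -S i j k := by
      intro i j k
      simp only [hS, skE i j k, neg_add, ← Finset.sum_neg_distrib]
      congr 1
      exact Finset.sum_congr rfl fun l _ => by rw [sk l j k]; ring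
    intro i j k
    have : S i j k = 0 := by
      linarith [s1 i j k, s2 j k i, s1 j k i, s2 k i j, s1 k i j, s2 i j k]
    exact eq_neg_of_add_eq_zero_left this
  have r : ∀ i j k, ∑ l, B i j l * E l k = (B i * E) j k := fun i j k => rfl
  have l : ∀ i j k, ∑ m, E m j * B i m k = (B i * E) j k := fun i j k => by
    rw [← hcomm, Matrix.mul_apply]; rfl
  have c1 : ∀ a j k, -(B a * E) j k + (B j * E) k a + (B k * E) a j = 0 := by
    intro a j k
    have : ∑ i, E i a * (B i j k + B j k i + B k i j) = 0 := by simp [hc]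
    rw [← this, ← h1, ← r j k a, ← l k a j, ← Finset.sum_add_distrib, ← Finset.sum_add_distrib]
    exact Finset.sum_congr rfl fun i _ => by ring
  have c2 : ∀ i j c, (B i * E) j c + (B j * E) c i - (B c * E) i j = 0 := by
    intro i j c
    have : ∑ k, E k c * (B i j k + B j k i + B k i j) = 0 := by simp [hc]
    rw [sub_eq_add_neg, ← this, ← h1, ← r i j c, ← l j c i, ← Finset.sum_add_distrib,
      ← Finset.sum_add_distrib]
    exact Finset.sum_congr rfl fun i _ => by ring
  have z : B i * E = 0 := by
    ext c a
    change (B i * E) c a = 0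
    linarith [c1 a i c, c2 a i c]
  have : B i * (E * E) = 0 := by rw [← Matrix.mul_assoc, z, Matrix.zero_mul]
  rw [hE, Matrix.mul_neg, Matrix.mul_one, neg_eq_zero] at this
  exact this

section

variable {V : Set E4} {h E : E4 → Mat4}

lemma christoffel_symm (hV : IsOpen V) (symm : ∀ v ∈ V, (h v).transpose = h v) {u : E4}
    (hu : u ∈ V) (m i j : Fin 4) : christoffel h m i j u = christoffel h m j i u := by
  unfold christoffel
  have : ∀ l, pd l (fun w => h w i j) u = pd l (fun w => h w j i) u := fun l =>
    pd_congr l (eventually_of_mem (hV.mem_nhds hu) fun w hw => congrFun (congrFun (symm w hw) j) i)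
  congr 1
  exact Finset.sum_congr rfl fun l _ => by rw [this l]; ring

/-- The Christoffel symbols are compatible with the metric. -/
lemma pdM_metric (hV : IsOpen V) (symm : ∀ v ∈ V, (h v).transpose = h v)
    (h0 : ∀ v ∈ V, (h v).det ≠ 0) {u : E4} (hu : u ∈ V) (i : Fin 4) :
    pdM i h u = (gammaM h i u).transpose * h u + h u * gammaM h i u := by
  have ps : ∀ l i j, pd l (fun w => h w i j) u = pd l (fun w => h w j i) u := fun l i j =>
    pd_congr l (eventually_of_mem (hV.mem_nhds hu) fun w hw => congrFun (congrFun (symm w hw) j) i)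
  have key : ∀ i j k, (h u * gammaM h i u) k j = (1 / 2) *
      (pd i (fun v => h v j k) u + pd j (fun v => h v i k) u - pd k (fun v => h v i j) u) := by
    intro i j k
    set c : Fin 4 → ℝ := fun l => (1 / 2) *
      (pd i (fun v => h v j l) u + pd j (fun v => h v i l) u - pd l (fun v => h v i j) u) with hc
    have e : ∀ m, gammaM h i u m j = ((h u)⁻¹.mulVec c) m := by
      intro m
      simp only [gammaM, Matrix.of_apply, christoffel, Matrix.mulVec, dotProduct, hc,
        Finset.mul_sum]
      exact Finset.sum_congr rfl fun l _ => by ring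
    have : (h u * gammaM h i u) k j = ((h u).mulVec ((h u)⁻¹.mulVec c)) k := by
      rw [Matrix.mul_apply, Matrix.mulVec, dotProduct]
      exact Finset.sum_congr rfl fun m _ => by rw [e]
    rw [this, Matrix.mulVec_mulVec, Matrix.mul_nonsing_inv _ (isUnit_iff_ne_zero.2 (h0 u hu)),
      Matrix.one_mulVec]
  have t : (gammaM h i u).transpose * h u = (h u * gammaM h i u).transpose := by
    rw [Matrix.transpose_mul, symm u hu]
  rw [t]
  ext j k
  rw [Matrix.add_apply, Matrix.transpose_apply, key, key, ps i k j, ps j i k, ps k i j]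
  simp only [pdM, Matrix.of_apply]
  ring

/-- The covariant derivative of an endomorphism. -/
def covDeriv (h E : E4 → Mat4) (i : Fin 4) (u : E4) : Mat4 :=
  pdM i E u + gammaM h i u * E u - E u * gammaM h i u

lemma covDeriv_anticomm (hV : IsOpen V) (sE : SmoothMat V E) (hE : ∀ v ∈ V, E v * E v = -1) {u : E4}
    (hu : u ∈ V) (i : Fin 4) : covDeriv h E i u * E u = -(E u * covDeriv h E i u) := by
  have h1 : pdM i E u * E u + E u * pdM i E u = 0 := by
    rw [← pdM_mul hV hu i sE sE, pdM_congr (B := fun _ => -1) hV hu i hE]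
    ext a b
    simp [pdM, pd_const]
  have h2 := hE u hu
  rw [← sub_eq_zero, sub_neg_eq_add]
  calc covDeriv h E i u * E u + E u * covDeriv h E i u
      = (pdM i E u * E u + E u * pdM i E u) + gammaM h i u * (E u * E u) -
        (E u * E u) * gammaM h i u := by unfold covDeriv; noncomm_ring
    _ = 0 := by rw [h1, h2]; noncomm_ring

end

end ChenTeo
end

open Set Filter Topology Manifold Bundle
open scoped ContDiff

noncomputable section

namespace ChenTeo

open Params

section

variable {V : Set E4} {h E : E4 → Mat4}

/-- An integrable orthogonal complex structure with closed fundamental form is parallel. -/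
lemma covDeriv_eq_zero (hV : IsOpen V) (sh : SmoothMat V h) (sE : SmoothMat V E)
    (symm : ∀ v ∈ V, (h v).transpose = h v) (h0 : ∀ v ∈ V, (h v).det ≠ 0)
    (hE : ∀ v ∈ V, E v * E v = -1) (orth : ∀ v ∈ V, (E v).transpose * h v * E v = h v) {u : E4}
    (hu : u ∈ V) (hN : ∀ i j k, nijenhuis E u i j k = 0)
    (hc : ∀ i j k, pd i (fun v => ((E v).transpose * h v) j k) u +
      pd j (fun v => ((E v).transpose * h v) k i) u +
      pd k (fun v => ((E v).transpose * h v) i j) u = 0) (i : Fin 4) : covDeriv h E i u = 0 := by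
  have hφ : ∀ v ∈ V, (E v).transpose * h v = -(h v * E v) := by
    intro v hv
    have : (E v).transpose * h v * (E v * E v) = h v * E v := by
      rw [← Matrix.mul_assoc, orth v hv]
    rw [hE v hv, Matrix.mul_neg, Matrix.mul_one] at this
    rw [← this, neg_neg]
  have hφs : ∀ v ∈ V, ((E v).transpose * h v).transpose = -((E v).transpose * h v) := by
    intro v hv
    rw [Matrix.transpose_mul, Matrix.transpose_transpose, symm v hv, hφ v hv, neg_neg]
  set φ : E4 → Mat4 := fun v => (E v).transpose * h v with hφd
  have sφ : SmoothMat V φ := sE.transpose.mul sh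
  set B : Fin 4 → Mat4 := fun i => (covDeriv h E i u).transpose * h u with hB
  have Γs : ∀ i m j, gammaM h i u m j = gammaM h j u m i := fun i m j =>
    christoffel_symm hV symm hu m i j
  have pdT : ∀ i, pdM i (fun v => (E v).transpose) u = (pdM i E u).transpose := fun i => rfl
  have hB' : ∀ i, B i = pdM i φ u - (gammaM h i u).transpose * φ u - φ u * gammaM h i u := by
    intro i
    rw [hφd, pdM_mul hV hu i sE.transpose sh, pdM_metric hV symm h0 hu, pdT]
    simp only [hB, covDeriv, Matrix.transpose_sub, Matrix.transpose_add, Matrix.transpose_mul]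
    noncomm_ring
  have φs := hφs u hu
  have hskew : ∀ i, (B i).transpose = -B i := by
    intro i
    have : (pdM i φ u).transpose = -pdM i φ u := by
      ext a b
      have : pd i (fun v => φ v b a) u = pd i (fun v => -φ v a b) u :=
        pd_congr i (eventually_of_mem (hV.mem_nhds hu) fun v hv =>
          congrFun (congrFun (hφs v hv) a) b)
      refine this.trans ?_
      simp only [pd, fderiv_fun_neg, neg_apply]
      rfl
    have e : ∀ p f Γ : Mat4, p.transpose = -p → f.transpose = -f →
        (p - Γ.transpose * f - f * Γ).transpose = -(p - Γ.transpose * f - f * Γ) := by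
      intro p f Γ hp hf
      simp only [Matrix.transpose_sub, Matrix.transpose_mul, Matrix.transpose_transpose, hp, hf]
      noncomm_ring
    rw [hB']
    exact e _ _ _ this φs
  have anti := covDeriv_anticomm (h := h) hV sE hE hu
  have hBE : ∀ i, B i * E u = -((E u * covDeriv h E i u).transpose * h u) := by
    intro i
    have e : h u * E u = -((E u).transpose * h u) := by rw [hφ u hu, neg_neg]
    rw [hB, Matrix.mul_assoc, e, Matrix.transpose_mul, Matrix.mul_neg, Matrix.mul_assoc]
  have hcomm : ∀ i, (E u).transpose * B i = B i * E u := by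
    intro i
    rw [hBE, ← Matrix.neg_mul, ← Matrix.transpose_neg, ← anti, Matrix.transpose_mul,
      Matrix.mul_assoc]
  have key : B i = 0 := by
    refine eq_zero_of_hermitian_closed (hE u hu) hskew hcomm (fun i j k => ?_) (fun i j k => ?_) i
    · set Q : Fin 4 → Mat4 := fun i => (∑ l, E u l i • covDeriv h E l u) - E u * covDeriv h E i u
        with hQ
      have hS : ∀ i j k, (∑ l, E u l i * B l j k) + (B i * E u) j k =
          ((Q i).transpose * h u) j k := by
        intro i j k
        rw [hBE, hQ]
        simp only [hB, Matrix.transpose_sub, Matrix.sub_mul, Matrix.transpose_sum,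
          Matrix.transpose_smul, Matrix.sum_mul, Matrix.smul_mul, Matrix.sub_apply,
          Matrix.neg_apply, Matrix.sum_apply, Matrix.smul_apply, smul_eq_mul]
        exact (sub_eq_add_neg _ _).symm
      have hQs : ∀ m i j, Q i m j = Q j m i := by
        intro m i j
        have n := hN i j m
        have e : ∀ i j, Q i m j = (∑ l, (E u l i * pd l (fun v => E v m j) u -
            E u m l * pd i (fun v => E v l j) u)) +
            (∑ l, ∑ a, E u l i * gammaM h l u m a * E u a j) -
            (∑ l, ∑ a, E u l i * E u m a * gammaM h l u a j) -
            (∑ l, ∑ a, E u m a * gammaM h i u a l * E u l j) +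
            (E u * E u * gammaM h i u) m j := by
          intro i j
          have e1 : E u * covDeriv h E i u = E u * pdM i E u + E u * (gammaM h i u * E u) -
              E u * E u * gammaM h i u := by
            unfold covDeriv; noncomm_ring
          simp only [hQ, e1, Matrix.sub_apply, Matrix.add_apply, Matrix.sum_apply,
            Matrix.smul_apply, smul_eq_mul]
          simp only [covDeriv, Matrix.sub_apply, Matrix.add_apply, Matrix.mul_apply, mul_add,
            mul_sub, Finset.sum_add_distrib, Finset.sum_sub_distrib, Finset.mul_sum, pdM,
            Matrix.of_apply]
          have t1 : ∑ l, ∑ a, E u m l * (gammaM h i u l a * E u a j) =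
              ∑ l, ∑ a, E u m a * gammaM h i u a l * E u l j := by
            rw [Finset.sum_comm]
            exact Finset.sum_congr rfl fun _ _ => Finset.sum_congr rfl fun _ _ => by ring
          rw [t1]
          have t2 : ∀ f g : Fin 4 → Fin 4 → ℝ, (∀ a b, f a b = g a b) →
              ∑ a, ∑ b, f a b = ∑ a, ∑ b, g a b := fun f g hfg =>
            Finset.sum_congr rfl fun _ _ => Finset.sum_congr rfl fun _ _ => hfg _ _
          rw [t2 (fun l a => E u l i * (gammaM h l u m a * E u a j)) _ fun _ _ =>
            (mul_assoc _ _ _).symm, t2 (fun l a => E u l i * (E u m a * gammaM h l u a j)) _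
            fun _ _ => (mul_assoc _ _ _).symm]
          ring
        have n' : (∑ l, (E u l i * pd l (fun v => E v m j) u -
            E u m l * pd i (fun v => E v l j) u)) = ∑ l, (E u l j * pd l (fun v => E v m i) u -
            E u m l * pd j (fun v => E v l i) u) := by
          rw [← sub_eq_zero, ← Finset.sum_sub_distrib, ← n]
          exact Finset.sum_congr rfl fun l _ => by ring
        have g1 : ∑ l, ∑ a, E u l i * gammaM h l u m a * E u a j =
            ∑ l, ∑ a, E u l j * gammaM h l u m a * E u a i := by
          rw [Finset.sum_comm]
          exact Finset.sum_congr rfl fun a _ => Finset.sum_congr rfl fun l _ => by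
            rw [Γs l m a]; ring
        have g2 : ∀ i j, ∑ l, ∑ a, E u m a * gammaM h i u a l * E u l j =
            ∑ l, ∑ a, E u l j * E u m a * gammaM h l u a i := fun i j =>
          Finset.sum_congr rfl fun l _ => Finset.sum_congr rfl fun a _ => by rw [Γs i a l]; ring
        have g3 : (E u * E u * gammaM h i u) m j = (E u * E u * gammaM h j u) m i := by
          rw [hE u hu, Matrix.neg_mul, Matrix.neg_mul, Matrix.one_mul, Matrix.one_mul,
            Matrix.neg_apply, Matrix.neg_apply, Γs i m j]
        rw [e, e, n', g1, g2, g2, g3]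
        ring
      rw [hS, hS, Matrix.mul_apply, Matrix.mul_apply]
      exact Finset.sum_congr rfl fun m _ => by
        rw [Matrix.transpose_apply, Matrix.transpose_apply, hQs m i j]
    · have sk : ∀ a b, φ u b a = -φ u a b := fun a b => congrFun (congrFun φs a) b
      have e : ∀ i j k, B i j k = pd i (fun v => φ v j k) u -
          (∑ l, gammaM h i u l j * φ u l k) - ∑ l, φ u j l * gammaM h i u l k := by
        intro i j k
        rw [hB']; rfl
      have t : ∀ i j k, ∑ l, φ u j l * gammaM h i u l k = -∑ l, gammaM h k u l i * φ u l j := by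
        intro i j k
        rw [← Finset.sum_neg_distrib]
        exact Finset.sum_congr rfl fun l _ => by rw [Γs i l k, sk l j]; ring
      have c := hc i j k
      have s : ∀ i j k, ∑ l, gammaM h i u l j * φ u l k = ∑ l, gammaM h j u l i * φ u l k :=
        fun i j k => Finset.sum_congr rfl fun l _ => by rw [Γs i l j]
      rw [e, e, e, t, t, t]
      linarith [s i j k, s j k i, s k i j]
  have hu' : IsUnit (h u).det := isUnit_iff_ne_zero.2 (h0 u hu)
  have := congrArg (fun A => A * (h u)⁻¹) key
  simp only [hB, Matrix.mul_nonsing_inv_cancel_right _ _ hu', Matrix.zero_mul] at this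
  rw [← Matrix.transpose_transpose (covDeriv h E i u), this, Matrix.transpose_zero]

/-- A parallel endomorphism commutes with the curvature. -/
lemma riemann_comm_of_covDeriv (hV : IsOpen V) (sh : SmoothMat V h) (sE : SmoothMat V E)
    (h0 : ∀ v ∈ V, (h v).det ≠ 0) (hD : ∀ i, ∀ v ∈ V, covDeriv h E i v = 0) {u : E4} (hu : u ∈ V)
    (i j : Fin 4) : (Matrix.of fun l k => riemann h u l k i j) * E u =
      E u * Matrix.of fun l k => riemann h u l k i j := by
  have sΓ := smoothMat_gammaM hV sh h0
  have e : ∀ i, ∀ v ∈ V, pdM i E v = E v * gammaM h i v - gammaM h i v * E v := by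
    intro i v hv
    have := hD i v hv
    unfold covDeriv at this
    rw [sub_eq_zero] at this
    exact eq_sub_of_add_eq this
  have e2 : ∀ i j, pdM j (pdM i E) u = pdM j E u * gammaM h i u + E u * pdM j (gammaM h i) u -
      (pdM j (gammaM h i) u * E u + gammaM h i u * pdM j E u) := by
    intro i j
    rw [pdM_congr hV hu j (e i), ← pdM_mul hV hu j sE (sΓ i), ← pdM_mul hV hu j (sΓ i) sE]
    ext a b
    exact pd_sub j (diffAt_of_contDiffOn ((sE.mul (sΓ i)) a b) hV hu)
      (diffAt_of_contDiffOn (((sΓ i).mul sE) a b) hV hu)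
  have c := pdM_comm hV hu i j sE
  rw [e2, e2, e i u hu, e j u hu] at c
  rw [riemann_eq_gammaM, ← sub_eq_zero]
  rw [← sub_eq_zero] at c
  rw [← neg_eq_zero, ← c]
  noncomm_ring

end

end ChenTeo
end

open Set Filter Topology Manifold Bundle
open scoped ContDiff

noncomputable section

namespace ChenTeo

open Params

lemma eq_zero_of_sd_add_asd_eq_zero {p q r p' q' r' : ℝ} (h : sd p q r + asd p' q' r' = 0) :
    (p = 0 ∧ q = 0 ∧ r = 0) ∧ p' = 0 ∧ q' = 0 ∧ r' = 0 := by
  have s := fun a b => congrFun (congrFun h a) b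
  have s1 := s 0 1
  have s2 := s 0 2
  have s3 := s 0 3
  have s4 := s 2 3
  have s5 := s 1 3
  have s6 := s 1 2
  simp [sd, asd] at s1 s2 s3 s4 s5 s6
  refine ⟨⟨?_, ?_, ?_⟩, ?_, ?_, ?_⟩ <;> linarith

lemma bracket_sd_add_asd (p q r p' q' r' a b c a' b' c' : ℝ) :
    (sd p q r + asd p' q' r') * (sd a b c + asd a' b' c') -
      (sd a b c + asd a' b' c') * (sd p q r + asd p' q' r') =
    (-2 : ℝ) • sd (q * c - r * b) (r * a - p * c) (p * b - q * a) +
      (2 : ℝ) • asd (q' * c' - r' * b') (r' * a' - p' * c') (p' * b' - q' * a') := by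
  rw [← sd_bracket, ← asd_bracket, Matrix.add_mul, Matrix.mul_add, Matrix.mul_add, Matrix.add_mul,
    Matrix.mul_add, Matrix.mul_add, sd_mul_asd_comm p q r, sd_mul_asd_comm a b c]
  abel

/-- No nonzero skew endomorphism commutes with the curvature of type `D⁺`, unless the
anti-self-dual Weyl tensor vanishes. -/
lemma eq_zero_of_comm_curvModel {c α β γ : ℝ} (hc : c ≠ 0) (h2 : (α - β) * (2 * α + β) ≠ γ ^ 2)
    {n : Mat4} (hn : n.transpose = -n)
    (hcomm : ∀ k l, curvModel c α β γ k l * n = n * curvModel c α β γ k l) : n = 0 := by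
  rw [skew_eq_sd_add_asd hn] at hcomm ⊢
  generalize (n 0 2 - n 1 3) / 2 = p at *
  generalize (n 0 3 + n 1 2) / 2 = q at *
  generalize (n 0 1 + n 2 3) / 2 = r at *
  generalize (n 0 2 + n 1 3) / 2 = p' at *
  generalize (n 0 3 - n 1 2) / 2 = q' at *
  generalize (n 0 1 - n 2 3) / 2 = r' at *
  have key : ∀ k l, (sd (c * sd 1 0 0 k l) (-c / 2 * sd 0 1 0 k l) (-c / 2 * sd 0 0 1 k l) +
      asd (β * asd 1 0 0 k l + γ * asd 0 1 0 k l)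
      (γ * asd 1 0 0 k l + (-α - β) * asd 0 1 0 k l) (α * asd 0 0 1 k l)) *
      (sd p q r + asd p' q' r') - (sd p q r + asd p' q' r') *
      (sd (c * sd 1 0 0 k l) (-c / 2 * sd 0 1 0 k l) (-c / 2 * sd 0 0 1 k l) +
      asd (β * asd 1 0 0 k l + γ * asd 0 1 0 k l)
      (γ * asd 1 0 0 k l + (-α - β) * asd 0 1 0 k l) (α * asd 0 0 1 k l)) = 0 := by
    intro k l
    have h := hcomm k l
    rw [curvModel, Matrix.smul_mul, Matrix.mul_smul] at h
    rw [sub_eq_zero]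
    exact smul_right_injective _ (show (1 / 2 : ℝ) ≠ 0 by norm_num) h
  simp only [bracket_sd_add_asd, smul_sd, smul_asd] at key
  have key' := fun k l => eq_zero_of_sd_add_asd_eq_zero (key k l)
  have k1 := key' 0 2
  have k2 := key' 0 3
  have k3 := key' 0 1
  obtain ⟨⟨-, a1, a2⟩, b1, b2, b3⟩ := k1
  obtain ⟨⟨-, -, a3⟩, b4, b5, b6⟩ := k2
  obtain ⟨-, b7, b8, -⟩ := k3
  simp only [sd, asd, Matrix.of_apply, Matrix.cons_val', Matrix.cons_val_zero, Matrix.cons_val,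
    Matrix.cons_val_one, Matrix.cons_val_fin_one, neg_zero, mul_zero, mul_one, add_zero, zero_add,
    zero_mul, sub_zero, zero_sub] at a1 a2 a3 b1 b2 b3 b4 b5 b6 b7 b8
  have hr : r = 0 := by
    have : c * r = 0 := by linarith
    exact (mul_eq_zero.1 this).resolve_left hc
  have hq : q = 0 := by
    have : c * q = 0 := by linarith
    exact (mul_eq_zero.1 this).resolve_left hc
  have hp : p = 0 := by
    have : c * p = 0 := by linarith
    exact (mul_eq_zero.1 this).resolve_left hc
  have hne : ¬(α = 0 ∧ β = 0 ∧ γ = 0) := by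
    rintro ⟨rfl, rfl, rfl⟩
    simp at h2
  have hr' : r' = 0 := by
    by_contra h0
    have hγ : γ = 0 := (mul_eq_zero.1 (by linarith : γ * r' = 0)).resolve_right h0
    have hβ : β = 0 := (mul_eq_zero.1 (by linarith : β * r' = 0)).resolve_right h0
    have hα : α = 0 := (mul_eq_zero.1 (by rw [hβ] at b4; linarith : α * r' = 0)).resolve_right h0
    exact hne ⟨hα, hβ, hγ⟩
  have hpq : p' = 0 ∧ q' = 0 := by
    by_cases hα : α = 0
    · have hs : β ^ 2 + γ ^ 2 ≠ 0 := by
        intro h0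
        exact hne ⟨hα, by nlinarith [sq_nonneg β, sq_nonneg γ], by nlinarith [sq_nonneg β, sq_nonneg γ]⟩
      rw [hα] at b6
      constructor <;> apply mul_left_cancel₀ hs
      · linear_combination (-γ * b3 + β * b6) / 2
      · linear_combination (β * b3 + γ * b6) / 2
    · exact ⟨(mul_eq_zero.1 (by linarith : α * p' = 0)).resolve_left hα,
        (mul_eq_zero.1 (by linarith : α * q' = 0)).resolve_left hα⟩
  rw [hp, hq, hr, hr', hpq.1, hpq.2, sd_zero, asd_zero, add_zero]

/-- A skew endomorphism that commutes with the curvature in a chart. -/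
lemma IsFrameCurvature.comm_frame {h : E4 → Mat4} {u : E4} {θ : Mat4} {Rm : Fin 4 → Fin 4 → Mat4}
    (H : IsFrameCurvature h u θ Rm) {E : Mat4}
    (hE : ∀ i j, (Matrix.of fun l k => riemann h u l k i j) * E =
      E * Matrix.of fun l k => riemann h u l k i j) (c d : Fin 4) :
    Rm c d * (θ * E * θ⁻¹) = (θ * E * θ⁻¹) * Rm c d := by
  set n := θ * E * θ⁻¹ with hn
  have h1 : ∀ i j, (∑ c, ∑ d, (θ c i * θ d j) • Rm c d) * n =
      n * ∑ c, ∑ d, (θ c i * θ d j) • Rm c d := by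
    intro i j
    have e := hE i j
    rw [H.curv] at e
    generalize ∑ c, ∑ d, (θ c i * θ d j) • Rm c d = S at e ⊢
    have l : S * n = θ * (θ⁻¹ * S * θ * E) * θ⁻¹ := by
      rw [hn]
      calc S * (θ * E * θ⁻¹) = 1 * S * (θ * E * θ⁻¹) := by rw [Matrix.one_mul]
        _ = _ := by rw [← H.mul_inv]; simp only [Matrix.mul_assoc]
    have r : n * S = θ * (E * (θ⁻¹ * S * θ)) * θ⁻¹ := by
      rw [hn]
      calc θ * E * θ⁻¹ * S = θ * E * θ⁻¹ * S * 1 := by rw [Matrix.mul_one]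
        _ = _ := by rw [← H.mul_inv]; simp only [Matrix.mul_assoc]
    rw [l, r, e]
  have hδ : ∀ a b, ∑ i, θ a i * θ⁻¹ i b = if a = b then 1 else 0 := by
    intro a b
    rw [← Matrix.mul_apply, H.mul_inv, Matrix.one_apply]
  have h2 : Rm c d = ∑ i, ∑ j, (θ⁻¹ i c * θ⁻¹ j d) • ∑ a, ∑ b, (θ a i * θ b j) • Rm a b := by
    have : ∀ i j, (θ⁻¹ i c * θ⁻¹ j d) • ∑ a, ∑ b, (θ a i * θ b j) • Rm a b =
        ∑ a, ∑ b, ((θ a i * θ⁻¹ i c) * (θ b j * θ⁻¹ j d)) • Rm a b := by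
      intro i j
      simp only [Finset.smul_sum, smul_smul]
      exact Finset.sum_congr rfl fun a _ => Finset.sum_congr rfl fun b _ => by congr 1; ring
    simp only [this]
    ext p q
    simp only [Matrix.sum_apply, Matrix.smul_apply, smul_eq_mul]
    rw [sum_comm₄ (f := fun i j a b => _)]
    have : ∀ a b, ∑ i, ∑ j, θ a i * θ⁻¹ i c * (θ b j * θ⁻¹ j d) * Rm a b p q =
        (if a = c then 1 else 0) * (if b = d then 1 else 0) * Rm a b p q := by
      intro a b
      rw [← hδ, ← hδ, Finset.sum_mul_sum, Finset.sum_mul]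
      exact Finset.sum_congr rfl fun i _ => by rw [Finset.sum_mul]
    simp [this]
  rw [h2]
  simp only [Finset.sum_mul, Finset.mul_sum, Matrix.smul_mul, Matrix.mul_smul, h1]

namespace Params

variable {P : Params} {g : Metric P.Space}

theorem IsChenTeoMetric.not_isKahler (hg : P.IsChenTeoMetric g) (J : EndField P.Space) :
    ¬IsKahler g J := by
  intro hJ
  have : Nonempty P.Space := ⟨P.base⟩
  obtain ⟨p, hp⟩ := (dense_genericSet (P := P)).nonempty
  set e := chartAt E4 p with he
  have hs : p ∈ e.source := mem_chart_source E4 p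
  have ht : e p ∈ e.target := e.map_source hs
  have hr : e p ∈ (cornerAt p).reg := map_mem_reg p hs (genericSet_subset hp)
  have hgen : (cornerAt p).prj (e p) ∈ P.generic := by
    rw [prj_eq p ht, e.left_inv hs]; exact hp
  have sh := smoothMat_gram g p
  have sE := smoothMat_endMatrix hJ.smooth p
  have pd := fun u (hu : u ∈ e.target) => gram_posDef g p hu
  have h0 : ∀ u ∈ e.target, (gram g e u).det ≠ 0 := fun u hu => (pd u hu).det_pos.ne'
  have symm : ∀ u ∈ e.target, (gram g e u).transpose = gram g e u := fun u hu => by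
    rw [← Matrix.conjTranspose_eq_transpose_of_trivial]; exact (pd u hu).isHermitian
  have hφ : ∀ u ∈ e.target, ∀ i j,
      ((endMatrix J e u).transpose * gram g e u) i j = fundForm g J e u i j := fun u hu i j => by
    rw [endMatrix_transpose_mul_gram g J p hu, fundForm, coordVec_chartAt p hu,
      coordVec_chartAt p hu]
  have hE : ∀ u ∈ e.target, endMatrix J e u * endMatrix J e u = -1 := by
    intro u hu
    ext i j
    have h1 := end_end_frameVec J p hu j
    rw [hJ.sq] at h1
    have h2 := congrArg (coordForm p i (e.symm u)) h1
    rw [coordForm_sum (e.map_target hu), map_neg, coordForm_frameVec (e.map_target hu)] at h2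
    rw [← h2, Matrix.neg_apply, Matrix.one_apply]
  have orth : ∀ u ∈ e.target,
      (endMatrix J e u).transpose * gram g e u * endMatrix J e u = gram g e u := by
    intro u hu
    ext i j
    have h1 := hJ.orthogonal (e.symm u) (frameVec p i (e.symm u)) (frameVec p j (e.symm u))
    rw [end_frameVec J p hu j] at h1
    have h2 : gram g e u i j = g.inner (e.symm u) (frameVec p i (e.symm u))
        (frameVec p j (e.symm u)) := by rw [gram_eq_bilinMatrix g p hu, bilinMatrix]
    rw [Matrix.mul_apply, h2, ← h1]
    simp only [map_sum, map_smul, smul_eq_mul]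
    exact Finset.sum_congr rfl fun k _ => (congrArg (· * _)
      (endMatrix_transpose_mul_gram g J p hu i k)).trans (mul_comm _ _)
  have hD : ∀ i, ∀ u ∈ e.target, covDeriv (gram g e) (endMatrix J e) i u = 0 := by
    intro i u hu
    refine covDeriv_eq_zero e.open_target sh sE symm h0 hE orth hu (fun i j k => ?_)
      (fun i j k => ?_) i
    · have := hJ.integrable e (chart_mem_atlas E4 p) (e.symm u) (e.map_target hu) i j k
      rw [e.right_inv hu] at this
      exact this
    · have := hJ.closed e (chart_mem_atlas E4 p) (e.symm u) (e.map_target hu) i j k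
      rw [e.right_inv hu] at this
      have c : ∀ m i j, ChenTeo.pd m (fun v => ((endMatrix J e v).transpose * gram g e v) i j) u =
          ChenTeo.pd m (fun v => fundForm g J e v i j) u := fun m i j =>
        pd_congr m (eventually_of_mem (e.open_target.mem_nhds hu) fun v hv => hφ v hv i j)
      rw [c, c, c]
      exact this
  have H := (cornerAt p).isFrameCurvature (fun _ hu => hg.gram_eq p hu) hr
  have comm := H.comm_frame
    (riemann_comm_of_covDeriv e.open_target sh sE h0 hD ht)
  have hE' := hE _ ht
  have orth' := orth _ ht
  rw [H.metric] at orth'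
  have m1 := H.mul_inv
  have m2 := H.inv_mul
  generalize P.frame ((cornerAt p).prj (e p)) * (cornerAt p).coframe (e p) = θ at *
  generalize endMatrix J e (e p) = E at *
  have m3 : θ⁻¹.transpose * θ.transpose = 1 := by
    rw [← Matrix.transpose_mul, m1, Matrix.transpose_one]
  have sq : (θ * E * θ⁻¹) * (θ * E * θ⁻¹) = -1 := by
    calc (θ * E * θ⁻¹) * (θ * E * θ⁻¹) = θ * E * (θ⁻¹ * θ) * E * θ⁻¹ := by noncomm_ring
      _ = θ * (E * E) * θ⁻¹ := by rw [m2, Matrix.mul_one]; simp only [Matrix.mul_assoc]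
      _ = -1 := by rw [hE', Matrix.mul_neg, Matrix.mul_one, Matrix.neg_mul, m1]
  have ot : (θ * E * θ⁻¹).transpose * (θ * E * θ⁻¹) = 1 := by
    calc (θ * E * θ⁻¹).transpose * (θ * E * θ⁻¹) =
        θ⁻¹.transpose * (E.transpose * (θ.transpose * θ) * E) * θ⁻¹ := by
          simp only [Matrix.transpose_mul, Matrix.mul_assoc]
      _ = (θ⁻¹.transpose * θ.transpose) * (θ * θ⁻¹) := by rw [orth']; simp only [Matrix.mul_assoc]
      _ = 1 := by rw [m1, m3, Matrix.one_mul]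
  have skew : (θ * E * θ⁻¹).transpose = -(θ * E * θ⁻¹) := by
    generalize θ * E * θ⁻¹ = n at sq ot
    have : n.transpose * (n * n) = n := by rw [← Matrix.mul_assoc, ot, Matrix.one_mul]
    rw [sq, Matrix.mul_neg, Matrix.mul_one] at this
    exact neg_eq_iff_eq_neg.1 this
  have z := eq_zero_of_comm_curvModel ((cornerAt p).weylSD_ne hr.1) (generic_disc hgen) skew comm
  rw [z, Matrix.zero_mul] at sq
  have := congrFun (congrFun sq 0) 0
  simp at this

end Params

end ChenTeo
end

theorem theorem1p2 (P : ChenTeo.Params) :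
    -- the atlas is positively oriented with respect to `dx ∧ dy ∧ dτ ∧ dφ`
    (∀ e ∈ atlas ChenTeo.E4 P.Space, ∀ u ∈ e.target, e.symm u ∈ P.regular →
      0 < (Matrix.of fun i j =>
        P.components (e.symm u) (ChenTeo.coordVec e u j) i : Matrix (Fin 4) (Fin 4) ℝ).det) ∧
    -- the line element extends in exactly one way to a smooth Riemannian metric on the manifold
    (∃! g : ChenTeo.Metric P.Space, P.IsChenTeoMetric g) ∧
    ∀ g : ChenTeo.Metric P.Space, P.IsChenTeoMetric g →
      ChenTeo.IsRicciFlat g ∧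
      -- type `D⁺ I⁻`
      (∀ p : P.Space, ChenTeo.IsTypeD g 1 p) ∧
      (∃ U : Set P.Space, IsOpen U ∧ Dense U ∧ ∀ p ∈ U, ChenTeo.IsTypeI g (-1) p) ∧
      -- Hermitian and not Kähler
      (∃ J : ChenTeo.EndField P.Space, ChenTeo.IsHermitian g J) ∧
      ¬ ∃ J : ChenTeo.EndField P.Space, ChenTeo.IsKahler g J := by
  refine ⟨fun e he u hu hr => ChenTeo.Params.components_det_pos he hu hr,
    ChenTeo.Params.existsUnique_chenTeoMetric, fun g hg => ⟨hg.isRicciFlat, hg.isTypeD,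
    ⟨P.genericSet, ChenTeo.Params.isOpen_genericSet, ChenTeo.Params.dense_genericSet,
      fun p hp => hg.isTypeI hp⟩, hg.exists_isHermitian, ?_⟩⟩
  rintro ⟨J, hJ⟩
  exact hg.not_isKahler J hJ
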